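/- **Setting.** Let $d\ge 3$, $m>0$, $m_0>0$. On $\mathbb R^d$ write $k=(k^0,\mathbf k)$, $x\cdot y=x^0y^0-\mathbf x\cdot\mathbf y$, $k^2=k\cdot k$, $\omega=\omega(\mathbf k)=(|\mathbf k|^2+m^2)^{1/2}$ and $\omega_\mu=(|\mathbf k|^2+\mu^2)^{1/2}$. Let $\mathcal S_n=\mathcal S(\mathbb R^{dn},\mathbb C)$, $\mathcal S_0=\mathbb C$, let $\mathcal S^{\rm ext}_n$ be the Schwartz functions on $\mathbb R^{dn}$ with values in $(\mathbb C^3)^{\otimes n}$, with components $f^{(a_1,\dots,a_n)}$, $a_l\in\{\text{in},\text{loc},\text{out}\}$, and let $\underline{\mathcal S}=\bigoplus_n\mathcal S_n$, $\underline{\mathcal S}^{\rm ext}=\bigoplus_n\mathcal S_n^{\rm ext}$ carry the locally convex direct sum topologies. The Fourier transform is $\mathcal Ff(k)=\hat f(k)=(2\pi)^{-dn/2}\int e^{-i(x_1\cdot k_1+\dots+x_n\cdot k_n)}f(x)\,dx$ on $\mathcal S_n$, with inverse $\bar{\mathcal F}$, and $\hat T(\hat f)=T(f)$ for distributions. Let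 $\delta^\pm_\mu(k)=\theta(\pm k^0)\delta(k^2-\mu^2)$. **Wave operators.** Let $\varphi\in C_0^\infty(\mathbb R,\mathbb R)$ have support in $(-\epsilon,\epsilon)$, $0<\epsilon<m^2$, with $\varphi=1$ on $(-\epsilon/2,\epsilon/2)$, and let $\chi^\pm(k)=\theta(\pm k^0)\varphi(k^2-m^2)$. Put $\chi_t(\text{loc},k)=1$, $\chi_t(\text{in},k)=\chi^+(k)e^{-i(k^0-\omega)t}+\chi^-(k)e^{-i(k^0+\omega)t}$ and $\chi_t(\text{out},k)=\chi^+(k)e^{i(k^0-\omega)t}+\chi^-(k)e^{i(k^0+\omega)t}$. For $t=(t_n^l)_{1\le l\le n}$, $t_n^l\in\mathbb R$, define $\Omega_t:\underline{\mathcal S}^{\rm ext}\to\underline{\mathcal S}$ by $(\Omega_tf)_n=\sum_{a_1,\dots,a_n}\bar{\mathcal F}\big(\prod_{l=1}^n\chi_{t_n^l}(a_l,k_l)\,\mathcal F f_n^{(a_1,\dots,a_n)}\big)$. The limit $t\to\infty$ means that the $t_n^l$ are sent to $+\infty$ one after the other; it exists if these iterated limits exist for every order and do not depend on the order. **Structure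 functional.** Let $\rho\ge0$ be a polynomially bounded, locally integrable function on $[m_0,\infty)$. The functional $G$ on $\underline{\mathcal S}$ is given by $G_0=G_1=0$, $\hat G_2(k_1,k_2)=\big[\delta_m^-(k_1)+\int_{m_0}^\infty\delta^-_\mu(k_1)\rho(\mu)\,d\mu\big]\delta(k_1+k_2)$ and, for $n\ge3$, $$\hat G_n(k_1,\dots,k_n)=\Big\{\sum_{j=1}^n\prod_{l<j}\delta_m^-(k_l)\,\frac1{k_j^2-m^2}\prod_{l>j}\delta_m^+(k_l)\Big\}\,\delta\Big(\sum_{l=1}^nk_l\Big).$$ **The functional $F^G$.** Put $\hat\Delta_m(\text{in},k)=-i\pi(\delta_m^+(k)-\delta_m^-(k))$, $\hat\Delta_m(\text{loc},k)=1/(k^2-m^2)$ (Cauchy principal value) and $\hat\Delta_m(\text{out},k)=i\pi(\delta_m^+(k)-\delta_m^-(k))$. The functional $F^G$ on $\underline{\mathcal S}^{\rm ext}$ is given by $F^G_0=F^G_1=0$, $\hat F_2^{G(\text{loc},\text{loc})}=\hat G_2$, $\hat F_2^{G(a_1,a_2)}(k_1,k_2)=\delta_m^-(k_1)\delta(k_1+k_2)$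 for all other $(a_1,a_2)$ and, for $n\ge3$, $$\hat F_n^{G(a_1,\dots,a_n)}(k_1,\dots,k_n)=\Big\{\sum_{j=1}^n\prod_{l<j}\delta_m^-(k_l)\,\hat\Delta_m(a_j,k_j)\prod_{l>j}\delta_m^+(k_l)\Big\}\,\delta\Big(\sum_{l=1}^nk_l\Big).$$ The products for $n\ge3$ are understood as follows. The remaining factors form the measure $\prod_{l\ne j}d\mathbf k_l/(2\omega(\mathbf k_l))$ on the set of $(k_1,\dots,k_n)$ with $k_l=(\mp\omega(\mathbf k_l),\mathbf k_l)$ (sign $-$ for $l<j$, $+$ for $l>j$) and $k_j=-\sum_{l\neq j}k_l$. The factor $\hat\Delta_m(a_j,k_j)$ is inserted as the limit $\eta\to0+$ of $(k_j^2-m^2)^{-1}1_{\{|k_j^2-m^2|>\eta\}}$ for $a_j=\text{loc}$, and of $\mp i\pi\,\mathrm{sign}(k_j^0)\,(2\eta)^{-1}1_{\{|k_j^2-m^2|<\eta\}}$ for $a_j=\text{in}/\text{out}$, the limit being taken after integration against the test function. **Proposition 4.7.** All these limits $\eta\to0+$ exist, $G$ and $F^G$ are continuous linear functionals on $\underline{\mathcal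 S}$ and $\underline{\mathcal S}^{\rm ext}$, and $F^G$ is the form factor functional associated to $G$, i.e. for every $f\in\underline{\mathcal S}^{\rm ext}$ $$\lim_{t\to\infty}G(\Omega_tf)=F^G(f),$$ in any order of the time limits. Moreover, $F^G$ is invariant under the proper orthochronous Poincaré group, acting by $(\alpha_{\{\Lambda,a\}}f)(x_1,\dots,x_n)=f(\Lambda^{-1}(x_1-a),\dots,\Lambda^{-1}(x_n-a))$ in each component, and $F^G$ is $\gamma$-continuous. Here $\gamma$ is the weakest topology that is stronger than all $\gamma_{K,L}$, $K,L\in\mathbb N_0$, and $\gamma_{K,L}$ is the locally convex direct sum topology on $\underline{\mathcal S}^{\rm ext}$ when each component of $\mathcal S_n^{\rm ext}$ carries the norm $\|f\|_{K,L}=\sup_{x,\,|\beta_1|,\dots,|\beta_n|\le K}\big|\prod_{l=1}^n(1+|x_l|^2)^{L/2}D^{\beta_1\cdots\beta_n}f(x)\big|$. -/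

import Mathlib

open scoped SchwartzMap Topology DirectSum FourierTransform ContDiff

noncomputable section

namespace IndefMetricQFT

/-! ### Minkowski space and test functions

Space-time has dimension `d = s + 1`: coordinate `0` is time, coordinates `i.succ` are space. -/

/-- Minkowski space `ℝ^d`, `d = s + 1` (Euclidean norm as a normed space). -/
abbrev Mink (s : ℕ) : Type := EuclideanSpace ℝ (Fin (s + 1))

/-- `(ℝ^d)^n`, an element being a tuple `(x_1, …, x_n)` of points of Minkowski space. -/
abbrev MinkN (s n : ℕ) : Type := PiLp 2 (fun _ : Fin n => Mink s)

/-- `S_n`, the complex Schwartz functions on `ℝ^{dn}`. -/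
abbrev TestFn (s n : ℕ) : Type := 𝓢(MinkN s n, ℂ)

/-- The three types of fields. -/
inductive Channel : Type
  | inn : Channel
  | loc : Channel
  | out : Channel
  deriving DecidableEq

instance : Fintype Channel where
  elems := {Channel.inn, Channel.loc, Channel.out}
  complete := by intro a; cases a <;> simp

/-- `S_n^ext`: the Schwartz functions on `ℝ^{dn}` with values in `(ℂ³)^{⊗ n}`, by components. -/
abbrev TestFnExt (s n : ℕ) : Type := (Fin n → Channel) → TestFn s n

/-- The vector space of the Borchers algebra `⨁ S_n`. -/
abbrev Borchers (s : ℕ) : Type := ⨁ n, TestFn s n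

/-- The vector space of the extended Borchers algebra `⨁ S_n^ext`. -/
abbrev BorchersExt (s : ℕ) : Type := ⨁ n, TestFnExt s n

/-- The Minkowski inner product `x · y = x⁰ y⁰ - 𝐱 · 𝐲`. -/
def minkInner {s : ℕ} (x y : Mink s) : ℝ := x 0 * y 0 - ∑ i : Fin s, x i.succ * y i.succ

/-- The Minkowski square `k² = k · k`. -/
def minkSq {s : ℕ} (k : Mink s) : ℝ := minkInner k k

/-! ### Topologies -/

/-- The locally convex direct sum topology: the strongest locally convex vector space topology
on `⨁ X n` for which all the inclusions `X n → ⨁ X n` are continuous, where `X n` has the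
topology `τ n`. -/
@[reducible] def directSumTopology (X : ℕ → Type) [∀ n, AddCommGroup (X n)]
    [∀ n, Module ℝ (X n)] (τ : ∀ n, TopologicalSpace (X n)) : TopologicalSpace (⨁ n, X n) :=
  sInf {t : TopologicalSpace (⨁ n, X n) |
    (∀ n, @Continuous (X n) (⨁ n, X n) (τ n) t (DirectSum.of X n)) ∧
    @IsTopologicalAddGroup (⨁ n, X n) t _ ∧
    @ContinuousSMul ℝ (⨁ n, X n) _ _ t ∧
    @LocallyConvexSpace ℝ (⨁ n, X n) _ _ _ _ t}

/-- The topology of the Borchers algebra: direct sum of the Schwartz topologies. -/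
instance borchersTopology (s : ℕ) : TopologicalSpace (Borchers s) :=
  directSumTopology (fun n => TestFn s n) (fun _ => inferInstance)

/-- The topology of the extended Borchers algebra. -/
instance borchersExtTopology (s : ℕ) : TopologicalSpace (BorchersExt s) :=
  directSumTopology (fun n => TestFnExt s n) (fun _ => inferInstance)

/-- A list of coordinate directions `(l, μ)` (meaning `∂/∂x_l^μ`), i.e. a mixed partial derivative
`D^{β_1 ⋯ β_n}`, where each argument `x_l` is differentiated at most `K` times. -/
abbrev Derivs (s n K : ℕ) : Type :=
  {w : Σ r : ℕ, Fin r → Fin n × Fin (s + 1) //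
    ∀ l : Fin n, (Finset.univ.filter fun i => (w.2 i).1 = l).card ≤ K}

/-- The quantity `∏_l (1 + |x_l|²)^{L/2} · |D^{β_1 ⋯ β_n} f(x_1, …, x_n)|`. -/
def weightedDeriv {s n K : ℕ} (L : ℕ) (f : TestFn s n) (w : Derivs s n K) (x : MinkN s n) : ℝ :=
  (∏ l, Real.sqrt (1 + ‖x l‖ ^ 2) ^ L) *
    ‖iteratedFDeriv ℝ w.1.1 f x
      (fun i => PiLp.single 2 (w.1.2 i).1 (EuclideanSpace.single (w.1.2 i).2 (1 : ℝ)))‖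

theorem weightedDeriv_nonneg {s n K : ℕ} (L : ℕ) (f : TestFn s n) (w : Derivs s n K)
    (x : MinkN s n) : 0 ≤ weightedDeriv L f w x := by
  unfold weightedDeriv; positivity

theorem card_le_of_derivs {s n K : ℕ} (w : Derivs s n K) : w.1.1 ≤ n * K := by
  have h := Finset.card_eq_sum_card_fiberwise (s := (Finset.univ : Finset (Fin w.1.1)))
    (t := (Finset.univ : Finset (Fin n))) (f := fun i => (w.1.2 i).1) (by intro i _; simp)
  rw [Finset.card_univ, Fintype.card_fin] at h
  calc w.1.1 = _ := h
    _ ≤ ∑ _l : Fin n, K := Finset.sum_le_sum fun l _ => w.2 l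
    _ = n * K := by simp

theorem weightedDeriv_bdd {s n : ℕ} (K L : ℕ) (f : TestFn s n) :
    BddAbove (Set.range fun p : Derivs s n K × MinkN s n => weightedDeriv L f p.1 p.2) := by
  refine ⟨2 ^ (n * L) * ((Finset.Iic (n * L, n * K)).sup fun m => SchwartzMap.seminorm ℝ m.1 m.2) f,
    ?_⟩
  rintro _ ⟨⟨w, x⟩, rfl⟩
  have h1 := SchwartzMap.one_add_le_sup_seminorm_apply (𝕜 := ℝ) (m := (n * L, n * K))
    (k := n * L) (n := w.1.1) le_rfl (card_le_of_derivs w) f x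
  refine le_trans ?_ h1
  simp only [weightedDeriv]
  have h2 : ∏ l, Real.sqrt (1 + ‖x l‖ ^ 2) ^ L ≤ (1 + ‖x‖) ^ (n * L) := by
    calc ∏ l, Real.sqrt (1 + ‖x l‖ ^ 2) ^ L ≤ ∏ _l : Fin n, (1 + ‖x‖) ^ L := by
          refine Finset.prod_le_prod (fun _ _ => by positivity) fun l _ => ?_
          gcongr
          rw [Real.sqrt_le_left (by positivity)]
          have := PiLp.norm_apply_le x l
          nlinarith [norm_nonneg (x l), norm_nonneg x]
      _ = (1 + ‖x‖) ^ (n * L) := by simp [← pow_mul, mul_comm]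
  have h3 : ‖iteratedFDeriv ℝ w.1.1 f x (fun i =>
      PiLp.single 2 (w.1.2 i).1 (EuclideanSpace.single (w.1.2 i).2 (1 : ℝ)))‖
      ≤ ‖iteratedFDeriv ℝ w.1.1 f x‖ := by
    refine le_trans (ContinuousMultilinearMap.le_opNorm _ _) ?_
    simp
  gcongr

/-- The norm `‖f‖_{K,L}`: the supremum of `∏_l (1 + |x_l|²)^{L/2} |D^{β_1 ⋯ β_n} f(x)|` over all
`x` and all multi-indices with `|β_1|, …, |β_n| ≤ K`. -/
def schwartzNorm (s n K L : ℕ) : Seminorm ℝ (TestFn s n) :=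
  Seminorm.of
    (fun f => ⨆ p : Derivs s n K × MinkN s n, weightedDeriv L f p.1 p.2)
    (fun f g => by
      have : Nonempty (Derivs s n K) := ⟨⟨⟨0, Fin.elim0⟩, by simp⟩⟩
      refine ciSup_le fun p => ?_
      refine le_trans ?_ (add_le_add (le_ciSup (weightedDeriv_bdd K L f) p)
        (le_ciSup (weightedDeriv_bdd K L g) p))
      have hf := (f.smooth p.1.1.1).contDiffAt (x := p.2)
      have hg := (g.smooth p.1.1.1).contDiffAt (x := p.2)
      simp only [weightedDeriv, FunLike.coe_add]
      rw [iteratedFDeriv_add_apply hf hg, add_apply, ← mul_add]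
      gcongr
      exact norm_add_le _ _)
    (fun c f => by
      rw [Real.mul_iSup_of_nonneg (norm_nonneg c)]
      congr 1
      ext p
      have hf := (f.smooth p.1.1.1).contDiffAt (x := p.2)
      simp only [weightedDeriv, FunLike.coe_smul]
      rw [iteratedFDeriv_const_smul_apply hf, smul_apply, norm_smul]
      ring)

/-- The topology of the norm `‖·‖_{K,L}` on `S_n`. -/
@[reducible] def normTopology (s n K L : ℕ) : TopologicalSpace (TestFn s n) :=
  (schwartzNorm s n K L).toSeminormedAddCommGroup.toUniformSpace.toTopologicalSpace

/-- The topology `γ_{K,L}` on the extended Borchers algebra: the direct sum topology, where `S_n^ext`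
has the norm topology of `‖·‖_{K,L}` in each of its components. -/
@[reducible] def gammaKL (s K L : ℕ) : TopologicalSpace (BorchersExt s) :=
  directSumTopology (fun n => TestFnExt s n)
    (fun n => @Pi.topologicalSpace (Fin n → Channel) (fun _ => TestFn s n)
      (fun _ => normTopology s n K L))

/-- The topology `γ`: the weakest topology that is stronger than every `γ_{K,L}`. (In Mathlib's
order on topologies, stronger topologies are smaller.) -/
@[reducible] def gammaTopology (s : ℕ) : TopologicalSpace (BorchersExt s) :=
  ⨅ (K : ℕ) (L : ℕ), gammaKL s K L

/-! ### Poincaré transformations -/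

/-- The proper orthochronous Lorentz group. -/
structure IsRestrictedLorentz {s : ℕ} (Λ : Mink s ≃L[ℝ] Mink s) : Prop where
  inner_eq : ∀ x y : Mink s, minkInner (Λ x) (Λ y) = minkInner x y
  det_eq : LinearMap.det ((Λ : Mink s →L[ℝ] Mink s) : Mink s →ₗ[ℝ] Mink s) = 1
  orthochronous : 0 < Λ (EuclideanSpace.single 0 1) 0

/-- The map `(x_1, …, x_n) ↦ (Λ x_1, …, Λ x_n)`. -/
def diagEquiv {s : ℕ} (n : ℕ) (Λ : Mink s ≃L[ℝ] Mink s) : MinkN s n ≃L[ℝ] MinkN s n :=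
  (PiLp.continuousLinearEquiv 2 ℝ (fun _ : Fin n => Mink s)).trans
    ((ContinuousLinearEquiv.piCongrRight fun _ => Λ).trans
      (PiLp.continuousLinearEquiv 2 ℝ (fun _ : Fin n => Mink s)).symm)

theorem diagEquiv_apply {s n : ℕ} (Λ : Mink s ≃L[ℝ] Mink s) (x : MinkN s n) (l : Fin n) :
    diagEquiv n Λ x l = Λ (x l) := rfl

/-- The representation `(α_{Λ,a} f)(x_1, …, x_n) = f(Λ⁻¹(x_1 - a), …, Λ⁻¹(x_n - a))`. -/
def poincareAct {s : ℕ} (n : ℕ) (Λ : Mink s ≃L[ℝ] Mink s) (a : Mink s) :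
    TestFn s n →L[ℂ] TestFn s n :=
  (SchwartzMap.compSubConstCLM ℂ (WithLp.toLp 2 fun _ : Fin n => a)).comp
    (SchwartzMap.compCLMOfContinuousLinearEquiv ℂ (diagEquiv n Λ.symm))

theorem poincareAct_apply {s n : ℕ} (Λ : Mink s ≃L[ℝ] Mink s) (a : Mink s) (f : TestFn s n)
    (x : MinkN s n) :
    poincareAct n Λ a f x = f (WithLp.toLp 2 fun l => Λ.symm (x l - a)) := rfl

/-- The action on the extended Borchers algebra, in each component. -/
def poincareActExt {s : ℕ} (Λ : Mink s ≃L[ℝ] Mink s) (a : Mink s) :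
    BorchersExt s →ₗ[ℂ] BorchersExt s :=
  DFinsupp.mapRange.linearMap fun n =>
    LinearMap.pi fun c => (poincareAct n Λ a).toLinearMap ∘ₗ LinearMap.proj c

/-- Invariance of a functional under the proper orthochronous Poincaré group. -/
def IsPoincareInvariant {s : ℕ} (F : BorchersExt s → ℂ) : Prop :=
  ∀ (Λ : Mink s ≃L[ℝ] Mink s) (a : Mink s) (f : BorchersExt s),
    IsRestrictedLorentz Λ → F (poincareActExt Λ a f) = F f

/-! ### Fourier transform -/

/-- The time-preserving space reflection `(x⁰, 𝐱) ↦ (x⁰, -𝐱)` as a linear involution. -/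
def spaceReflLin (s : ℕ) : Mink s ≃ₗ[ℝ] Mink s where
  toFun x := WithLp.toLp 2 (Fin.cons (x 0) fun i : Fin s => -x i.succ)
  invFun x := WithLp.toLp 2 (Fin.cons (x 0) fun i : Fin s => -x i.succ)
  map_add' x y := by
    ext i; refine Fin.cases ?_ (fun i => ?_) i <;> simp; ring
  map_smul' c x := by
    ext i; refine Fin.cases ?_ (fun i => ?_) i <;> simp
  left_inv x := by
    ext i; refine Fin.cases ?_ (fun i => ?_) i <;> simp
  right_inv x := by
    ext i; refine Fin.cases ?_ (fun i => ?_) i <;> simp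

/-- The map `(k_1, …, k_n) ↦ (2π)⁻¹ (k_1', …, k_n')` where `k' = (k⁰, -𝐤)`. It turns Mathlib's
character `e^{-2πi⟨x, ·⟩}` into the character `e^{-i x·k}` of the Minkowski inner product. -/
def fourierScale (s n : ℕ) : MinkN s n ≃L[ℝ] MinkN s n :=
  (diagEquiv n (spaceReflLin s).toContinuousLinearEquiv).trans
    (ContinuousLinearEquiv.smulLeft (Units.mk0 (2 * Real.pi)⁻¹ (by positivity)))

/-- `(2π)^{-dn/2}`. -/
def fourierConst (s n : ℕ) : ℂ := (((2 * Real.pi) ^ (-(((s + 1) * n : ℕ) : ℝ) / 2) : ℝ) : ℂ)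

/-- The Fourier transform
`𝓕 f(k) = (2π)^{-dn/2} ∫ e^{-i (x_1·k_1 + ⋯ + x_n·k_n)} f(x) dx` on `S_n`. -/
def minkFourier (s n : ℕ) : TestFn s n →L[ℂ] TestFn s n :=
  fourierConst s n • (SchwartzMap.compCLMOfContinuousLinearEquiv ℂ (fourierScale s n)).comp
    (FourierTransform.fourierCLM ℂ (TestFn s n))

/-- The inverse Fourier transform
`f ↦ (2π)^{-dn/2} ∫ e^{i (x_1·k_1 + ⋯ + x_n·k_n)} f(k) dk` on `S_n`. -/
def minkFourierInv (s n : ℕ) : TestFn s n →L[ℂ] TestFn s n :=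
  fourierConst s n • (SchwartzMap.compCLMOfContinuousLinearEquiv ℂ (fourierScale s n)).comp
    (FourierTransform.fourierInvCLM ℂ (TestFn s n))

theorem inner_fourierScale {s n : ℕ} (x k : MinkN s n) :
    inner ℝ x (fourierScale s n k) = (2 * Real.pi)⁻¹ * ∑ l, minkInner (x l) (k l) := by
  have h : ∀ l, inner ℝ (x l) (fourierScale s n k l)
      = (2 * Real.pi)⁻¹ * minkInner (x l) (k l) := by
    intro l
    have : fourierScale s n k l = (2 * Real.pi)⁻¹ • spaceReflLin s (k l) := rfl
    rw [this, inner_smul_right]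
    congr 1
    simp [PiLp.inner_apply, Fin.sum_univ_succ, spaceReflLin, minkInner, mul_comm,
      Finset.sum_neg_distrib]
    ring
  rw [PiLp.inner_apply, Finset.mul_sum]
  exact Finset.sum_congr rfl fun l _ => h l

/-- The Fourier transform is given by the stated integral. -/
theorem minkFourier_apply {s n : ℕ} (f : TestFn s n) (k : MinkN s n) :
    minkFourier s n f k = fourierConst s n *
      ∫ x : MinkN s n, Complex.exp (-Complex.I * ((∑ l, minkInner (x l) (k l) : ℝ) : ℂ)) * f x := by
  have h : minkFourier s n f k = fourierConst s n * (𝓕 (f : MinkN s n → ℂ)) (fourierScale s n k) :=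
    rfl
  rw [h, Real.fourier_eq']
  congr 2
  ext x
  rw [inner_fourierScale, smul_eq_mul]
  congr 2
  push_cast
  have : (Real.pi : ℂ) ≠ 0 := by exact_mod_cast Real.pi_ne_zero
  field_simp

/-- The inverse Fourier transform is given by the stated integral. -/
theorem minkFourierInv_apply {s n : ℕ} (f : TestFn s n) (x : MinkN s n) :
    minkFourierInv s n f x = fourierConst s n *
      ∫ k : MinkN s n, Complex.exp (Complex.I * ((∑ l, minkInner (k l) (x l) : ℝ) : ℂ)) * f k := by
  have h : minkFourierInv s n f x
      = fourierConst s n * (𝓕⁻ f) (fourierScale s n x) := rfl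
  rw [h, SchwartzMap.fourierInv_coe, Real.fourierInv_eq']
  congr 2
  ext k
  rw [inner_fourierScale, smul_eq_mul]
  congr 2
  push_cast
  have : (Real.pi : ℂ) ≠ 0 := by exact_mod_cast Real.pi_ne_zero
  field_simp

/-! ### Finite time wave operators -/

/-- The spatial part `𝐤` of `k`. -/
def spatial {s : ℕ} (k : Mink s) : EuclideanSpace ℝ (Fin s) := WithLp.toLp 2 fun i => k i.succ

/-- The energy `ω = (|𝐤|² + m²)^{1/2}`. -/
def energy {s : ℕ} (m : ℝ) (p : EuclideanSpace ℝ (Fin s)) : ℝ := Real.sqrt (‖p‖ ^ 2 + m ^ 2)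

/-- `φ ∈ C_0^∞(ℝ, ℝ)` has support in `(-ε, ε)`, `0 < ε < m²`, and equals `1` on
`(-ε/2, ε/2)`. -/
structure IsCutoff (m ε : ℝ) (φ : ℝ → ℝ) : Prop where
  eps_pos : 0 < ε
  eps_lt : ε < m ^ 2
  contDiff : ContDiff ℝ ∞ φ
  tsupport_subset : tsupport φ ⊆ Set.Ioo (-ε) ε
  eq_one : ∀ x, -ε / 2 < x → x < ε / 2 → φ x = 1

/-- `χ^±(k) = θ(± k⁰) φ(k² - m²)`, where the sign is `σ = ± 1`. -/
def chiPM {s : ℕ} (m : ℝ) (φ : ℝ → ℝ) (σ : ℝ) (k : Mink s) : ℝ :=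
  if 0 < σ * k 0 then φ (minkSq k - m ^ 2) else 0

/-- `χ_t(a, k)`. -/
def chi {s : ℕ} (m : ℝ) (φ : ℝ → ℝ) (t : ℝ) (a : Channel) (k : Mink s) : ℂ :=
  match a with
  | Channel.inn =>
      chiPM m φ 1 k * Complex.exp (-Complex.I * ((k 0 - energy m (spatial k)) * t : ℝ))
        + chiPM m φ (-1) k * Complex.exp (-Complex.I * ((k 0 + energy m (spatial k)) * t : ℝ))
  | Channel.loc => 1
  | Channel.out =>
      chiPM m φ 1 k * Complex.exp (Complex.I * ((k 0 - energy m (spatial k)) * t : ℝ))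
        + chiPM m φ (-1) k * Complex.exp (Complex.I * ((k 0 + energy m (spatial k)) * t : ℝ))

/-- `∏_l χ_{t_l}(a_l, k_l)`. -/
def chiProd {s n : ℕ} (m : ℝ) (φ : ℝ → ℝ) (t : Fin n → ℝ) (a : Fin n → Channel)
    (k : MinkN s n) : ℂ := ∏ l, chi m φ (t l) (a l) (k l)

/-! ### The multipliers have temperate growth -/

theorem hasTemperateGrowth_coord {s : ℕ} (μ : Fin (s + 1)) :
    (fun k : Mink s => k μ).HasTemperateGrowth :=
  (EuclideanSpace.proj (𝕜 := ℝ) μ : Mink s →L[ℝ] ℝ).hasTemperateGrowth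

theorem hasTemperateGrowth_minkSq (s : ℕ) : (minkSq : Mink s → ℝ).HasTemperateGrowth := by
  have h : ∀ μ : Fin (s + 1), (fun k : Mink s => k μ * k μ).HasTemperateGrowth := fun μ =>
    (hasTemperateGrowth_coord μ).fun_mul (hasTemperateGrowth_coord μ)
  have := (h 0).fun_sub (Function.HasTemperateGrowth.sum (s := Finset.univ)
    (f := fun (i : Fin s) (k : Mink s) => k i.succ * k i.succ) fun i _ => h i.succ)
  exact this

theorem hasTemperateGrowth_energy (s : ℕ) {m : ℝ} (hm : 0 < m) :
    (fun k : Mink s => energy m (spatial k)).HasTemperateGrowth := by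
  let A : Mink s →ₗ[ℝ] EuclideanSpace ℝ (Fin s) :=
    { toFun := fun k => m⁻¹ • spatial k
      map_add' := fun x y => by ext i; simp [spatial]; ring
      map_smul' := fun c x => by ext i; simp [spatial]; ring }
  have h := ((Function.hasTemperateGrowth_one_add_norm_sq_rpow (EuclideanSpace ℝ (Fin s)) (1 / 2)).comp
    (LinearMap.toContinuousLinearMap A).hasTemperateGrowth)
  have h2 := (Function.HasTemperateGrowth.const (E := Mink s) m).fun_mul h
  refine Eq.mp (congrArg Function.HasTemperateGrowth ?_) h2
  funext k
  symm
  have : (LinearMap.toContinuousLinearMap A) k = m⁻¹ • spatial k := rfl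
  simp only [Function.comp, this, energy]
  rw [← Real.sqrt_eq_rpow, norm_smul, norm_inv, Real.norm_of_nonneg hm.le]
  nth_rewrite 2 [← Real.sqrt_sq hm.le]
  rw [← Real.sqrt_mul (by positivity)]
  congr 1
  field_simp
  ring

theorem hasTemperateGrowth_cexp (c : ℂ) (hc : ‖c‖ = 1) (hre : c.re = 0) :
    (fun x : ℝ => Complex.exp (c * (x : ℂ))).HasTemperateGrowth := by
  refine ⟨(contDiff_const.mul Complex.ofRealCLM.contDiff).cexp, fun n => ⟨0, 1, fun x => ?_⟩⟩
  have h : ∀ n : ℕ, iteratedDeriv n (fun x : ℝ => Complex.exp (c * (x : ℂ)))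
      = fun x : ℝ => c ^ n * Complex.exp (c * (x : ℂ)) := by
    intro n
    induction n with
    | zero => simp
    | succ n ih =>
      rw [iteratedDeriv_succ, ih]
      ext x
      have h1 : HasDerivAt (fun x : ℝ => c * (x : ℂ)) c x := by
        simpa using (Complex.ofRealCLM.hasDerivAt (x := x)).const_mul c
      rw [(h1.cexp.const_mul (c ^ n)).deriv]
      ring
  rw [norm_iteratedFDeriv_eq_norm_iteratedDeriv, h]
  simp [hc, Complex.norm_exp, hre]

theorem hasTemperateGrowth_chiPM {s : ℕ} {m ε : ℝ} {φ : ℝ → ℝ} (hφ : IsCutoff m ε φ)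
    (σ : ℝ) : (chiPM m φ σ : Mink s → ℝ).HasTemperateGrowth := by
  have hcomp : HasCompactSupport φ :=
    HasCompactSupport.of_support_subset_isCompact (isCompact_Icc (a := -ε) (b := ε))
      ((subset_tsupport φ).trans (hφ.tsupport_subset.trans Set.Ioo_subset_Icc_self))
  have hΦ : (fun k : Mink s => φ (minkSq k - m ^ 2)).HasTemperateGrowth :=
    (hcomp.hasTemperateGrowth hφ.contDiff).comp
      ((hasTemperateGrowth_minkSq s).fun_sub (Function.HasTemperateGrowth.const (m ^ 2)))
  have hc0 : Continuous fun k : Mink s => σ * k 0 := by fun_prop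
  have hloc : ∀ x : Mink s, chiPM m φ σ =ᶠ[𝓝 x] (fun k => φ (minkSq k - m ^ 2)) ∨
      chiPM m φ σ =ᶠ[𝓝 x] fun _ => (0 : ℝ) := by
    intro x
    rcases lt_trichotomy (σ * x 0) 0 with h | h | h
    · right
      filter_upwards [hc0.continuousAt.eventually_lt continuousAt_const h] with k hk
      simp [chiPM, not_lt.2 hk.le]
    · right
      by_cases hσ : σ = 0
      · exact Filter.Eventually.of_forall fun k => by simp [chiPM, hσ]
      have hx0 : x 0 = 0 := by simpa [hσ] using h
      have hx : minkSq x - m ^ 2 < -ε := by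
        have h0 : 0 ≤ ∑ i : Fin s, x i.succ * x i.succ :=
          Finset.sum_nonneg fun i _ => mul_self_nonneg _
        have := hφ.eps_lt
        simp only [minkSq, minkInner, hx0]
        linarith
      have hcm : Continuous fun k : Mink s => minkSq k - m ^ 2 :=
        (hasTemperateGrowth_minkSq s).1.continuous.sub continuous_const
      filter_upwards [hcm.continuousAt.eventually_lt continuousAt_const hx] with k hk
      have : φ (minkSq k - m ^ 2) = 0 := by
        by_contra hne
        have := hφ.tsupport_subset (subset_tsupport φ hne)
        exact absurd this.1 (not_lt.2 hk.le)
      simp [chiPM, this]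
    · left
      filter_upwards [continuousAt_const.eventually_lt hc0.continuousAt h] with k hk
      simp [chiPM, hk]
  refine ⟨contDiff_iff_contDiffAt.2 fun x => ?_, fun n => ?_⟩
  · rcases hloc x with h | h
    · exact hΦ.1.contDiffAt.congr_of_eventuallyEq h
    · exact contDiffAt_const.congr_of_eventuallyEq h
  · obtain ⟨k, C, hC⟩ := hΦ.2 n
    refine ⟨k, C, fun x => ?_⟩
    rcases hloc x with h | h
    · rw [(h.iteratedFDeriv (𝕜 := ℝ) n).eq_of_nhds]
      exact hC x
    · rw [(h.iteratedFDeriv (𝕜 := ℝ) n).eq_of_nhds]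
      refine le_trans ?_ ((norm_nonneg _).trans (hC x))
      rcases n with _ | n
      · simp
      · simp [iteratedFDeriv_const_of_ne (𝕜 := ℝ) (Nat.succ_ne_zero n)]

theorem hasTemperateGrowth_chi {s : ℕ} {m ε : ℝ} (hm : 0 < m) {φ : ℝ → ℝ} (hφ : IsCutoff m ε φ)
    (t : ℝ) (a : Channel) : (chi m φ t a : Mink s → ℂ).HasTemperateGrowth := by
  have hpm : ∀ σ, (fun k : Mink s => (chiPM m φ σ k : ℂ)).HasTemperateGrowth := fun σ =>
    Function.HasTemperateGrowth.comp Function.Complex.hasTemperateGrowth_ofReal (hasTemperateGrowth_chiPM hφ σ)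
  have hE := hasTemperateGrowth_energy s hm
  have ha : (fun k : Mink s => (k 0 - energy m (spatial k)) * t).HasTemperateGrowth :=
    ((hasTemperateGrowth_coord 0).fun_sub hE).fun_mul (Function.HasTemperateGrowth.const t)
  have hb : (fun k : Mink s => (k 0 + energy m (spatial k)) * t).HasTemperateGrowth :=
    ((hasTemperateGrowth_coord 0).fun_add hE).fun_mul (Function.HasTemperateGrowth.const t)
  have e1 := hasTemperateGrowth_cexp Complex.I (by simp) (by simp)
  have e2 := hasTemperateGrowth_cexp (-Complex.I) (by simp) (by simp)
  cases a with
  | inn => exact ((hpm 1).fun_mul (e2.comp ha)).fun_add ((hpm (-1)).fun_mul (e2.comp hb))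
  | loc => exact Function.HasTemperateGrowth.const (1 : ℂ)
  | out => exact ((hpm 1).fun_mul (e1.comp ha)).fun_add ((hpm (-1)).fun_mul (e1.comp hb))

/-- The multiplier of `Ω_{n,t}` maps Schwartz functions to Schwartz functions. -/
theorem hasTemperateGrowth_chiProd {s n : ℕ} {m ε : ℝ} (hm : 0 < m) {φ : ℝ → ℝ}
    (hφ : IsCutoff m ε φ) (t : Fin n → ℝ) (a : Fin n → Channel) :
    (chiProd m φ t a : MinkN s n → ℂ).HasTemperateGrowth := by
  have hl : ∀ l : Fin n, (fun k : MinkN s n => chi m φ (t l) (a l) (k l)).HasTemperateGrowth :=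
    fun l => (hasTemperateGrowth_chi hm hφ (t l) (a l)).comp
      (PiLp.proj (𝕜 := ℝ) 2 (fun _ : Fin n => Mink s) l).hasTemperateGrowth
  unfold chiProd
  induction (Finset.univ : Finset (Fin n)) using Finset.induction_on with
  | empty => simp
  | insert i S hi ih =>
    simp only [Finset.prod_insert hi]
    exact (hl i).fun_mul ih

/-- `Ω_{n,t} = Ω_{t_1} ⊗ ⋯ ⊗ Ω_{t_n}` on `S_n^ext`: in the component `a` this is multiplication by
`∏_l χ_{t_l}(a_l, k_l)` in momentum space. -/
def omegaN {s : ℕ} (m : ℝ) (φ : ℝ → ℝ) (n : ℕ) (t : Fin n → ℝ) :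
    TestFnExt s n →L[ℂ] TestFnExt s n :=
  ContinuousLinearMap.pi fun a =>
    ((minkFourierInv s n).comp
      ((SchwartzMap.smulLeftCLM ℂ (chiProd m φ t a)).comp (minkFourier s n))).comp
        (ContinuousLinearMap.proj a)

/-- `J^{⊗ n} : S_n^ext → S_n`, the sum of all components. -/
def projN (s n : ℕ) : TestFnExt s n →ₗ[ℂ] TestFn s n := ∑ a, LinearMap.proj a

/-- A multi-parameter `t = (t_1, t_2, …)`, `t_n = (t_n^1, …, t_n^n)`, `t_n^l ∈ ℝ`. -/
abbrev TimeParam : Type := (Σ n : ℕ, Fin n) → ℝ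

/-- The finite times wave operator `Ω_t = J ∘ ⨁ Ω_{n,t_n}`. -/
def waveOp {s : ℕ} (m : ℝ) (φ : ℝ → ℝ) (t : TimeParam) : BorchersExt s →ₗ[ℂ] Borchers s :=
  DFinsupp.mapRange.linearMap fun n =>
    projN s n ∘ₗ (omegaN m φ n fun l => t ⟨n, l⟩).toLinearMap

/-- `IteratedLim [i₁, i₂, …] Φ c`: the iterated limit of `Φ(t)`, where first `t_{i₁} → +∞` with the
other parameters fixed, then `t_{i₂} → +∞` etc., exists at every stage, and the result is `c`
(in particular it does not depend on the remaining parameters). -/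
def IteratedLim {ι : Type} [DecidableEq ι] : List ι → ((ι → ℝ) → ℂ) → ℂ → Prop
  | [], Φ, c => ∀ t, Φ t = c
  | i :: is, Φ, c => ∃ Ψ : (ι → ℝ) → ℂ,
      (∀ t, Filter.Tendsto (fun τ : ℝ => Φ (Function.update t i τ)) Filter.atTop (𝓝 (Ψ t))) ∧
      IteratedLim is Ψ c

/-- Elements of the topological dual space: continuous linear functionals. -/
def IsContinuousFunctional {X : Type} [AddCommGroup X] [Module ℂ X] [TopologicalSpace X]
    (F : X → ℂ) : Prop := IsLinearMap ℂ F ∧ Continuous F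

open Classical in
/-- `F` is the form factor functional associated to `W`: both are continuous functionals, and
`F = lim_{t → +∞} W ∘ Ω_t` (pointwise) for every order in which the time parameters can be sent to
infinity one after the other. For a given `f = (f_0, f_1, …, f_N, 0, …)` the order is given by a list
of parameters without repetitions which contains all those on which `Ω_t f` can depend. -/
def IsFormFactorFunctional {s : ℕ} (m : ℝ) (φ : ℝ → ℝ) (W : Borchers s → ℂ)
    (F : BorchersExt s → ℂ) : Prop :=
  IsContinuousFunctional W ∧ IsContinuousFunctional F ∧
  ∀ (f : BorchersExt s) (order : List (Σ n : ℕ, Fin n)), order.Nodup →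
    (∀ n ∈ DFinsupp.support f, ∀ l : Fin n, (⟨n, l⟩ : Σ n : ℕ, Fin n) ∈ order) →
    IteratedLim order (fun t : TimeParam => W (waveOp m φ t f)) (F f)

/-! ### The structure functional and the functional `F^G` -/

/-- The point `(σ ω, 𝐩)` of the mass shell of mass `m`, with `σ = ± 1`. -/
def shellPoint {s : ℕ} (m σ : ℝ) (p : EuclideanSpace ℝ (Fin s)) : Mink s :=
  WithLp.toLp 2 (Fin.cons (σ * energy m p) fun i : Fin s => p i)

/-- The tuple `(k_1, …, k_n)` where `k_l` is the point with spatial part `𝐩_l` on the backward mass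
shell for `l < j` and on the forward mass shell for `l > j`, and where `k_j = - ∑_{l ≠ j} k_l`. -/
def shellConfig {s n : ℕ} (m : ℝ) (j : Fin n) (p : {l : Fin n // l ≠ j} → EuclideanSpace ℝ (Fin s)) :
    MinkN s n :=
  WithLp.toLp 2 fun l =>
    if h : l = j then
      -∑ i : {l : Fin n // l ≠ j}, shellPoint m (if i.1 < j then -1 else 1) (p i)
    else shellPoint m (if l < j then -1 else 1) (p ⟨l, h⟩)

/-- Regularization of `Δ̂_m(a, k)`, which is recovered as `η → 0+`. For `a = loc` it is
`1/(k² - m²)` cut off to `|k² - m²| > η`, which gives the Cauchy principal value. For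
`a = in/out` it is `∓ iπ (θ(k⁰) - θ(-k⁰)) (2η)⁻¹ 1_{|k² - m²| < η}`, which gives
`∓ iπ (δ_m^+ - δ_m^-)`, since `δ_m^±(k) = θ(± k⁰) δ(k² - m²)`. -/
def deltaReg {s : ℕ} (m : ℝ) (a : Channel) (η : ℝ) (k : Mink s) : ℂ :=
  match a with
  | Channel.inn =>
      if |minkSq k - m ^ 2| < η then
        -(Complex.I * Real.pi * (SignType.sign (k 0) : ℝ) * ((2 * η)⁻¹ : ℝ)) else 0
  | Channel.loc => if η < |minkSq k - m ^ 2| then ((minkSq k - m ^ 2)⁻¹ : ℝ) else 0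
  | Channel.out =>
      if |minkSq k - m ^ 2| < η then
        Complex.I * Real.pi * (SignType.sign (k 0) : ℝ) * ((2 * η)⁻¹ : ℝ) else 0

/-- `∏_{l<j} δ_m^-(k_l) · Δ̂_m(a, k_j) · ∏_{l>j} δ_m^+(k_l) · δ(∑ k_l)` with regularized `Δ̂_m`, applied
to `f`. Here `δ_m^±(k) dk = d𝐤/(2ω)` on the mass shell, and `δ(∑ k_l)` removes the integration over
`k_j`. -/
def regTerm {s n : ℕ} (m : ℝ) (j : Fin n) (a : Channel) (f : TestFn s n) (η : ℝ) : ℂ :=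
  ∫ p : {l : Fin n // l ≠ j} → EuclideanSpace ℝ (Fin s),
    ((∏ l, (2 * energy m (p l))⁻¹ : ℝ) : ℂ) *
      deltaReg m a η (shellConfig m j p j) * f (shellConfig m j p)

/-- `∏_{l<j} δ_m^-(k_l) · Δ̂_m(a, k_j) · ∏_{l>j} δ_m^+(k_l) · δ(∑ k_l)`, applied to `f`. -/
def shellTerm {s n : ℕ} (m : ℝ) (j : Fin n) (a : Channel) (f : TestFn s n) : ℂ :=
  Filter.limUnder (𝓝[>] (0 : ℝ)) (regTerm m j a f)

/-- `δ_μ^-(k_1) δ(k_1 + k_2)` applied to `f`. -/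
def twoPoint {s : ℕ} (μ : ℝ) (f : TestFn s 2) : ℂ :=
  ∫ p : EuclideanSpace ℝ (Fin s), (((2 * energy μ p)⁻¹ : ℝ) : ℂ) *
    f (WithLp.toLp 2 ![shellPoint μ (-1) p, -shellPoint μ (-1) p])

/-- A positive, polynomially bounded, locally integrable density on `[m₀, ∞)`. -/
structure IsSpectralDensity (m₀ : ℝ) (ρ : ℝ → ℝ) : Prop where
  nonneg : ∀ μ, m₀ ≤ μ → 0 ≤ ρ μ
  locallyIntegrable : MeasureTheory.LocallyIntegrableOn ρ (Set.Ici m₀)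
  polynomially_bounded : ∃ (C : ℝ) (N : ℕ), ∀ μ, m₀ ≤ μ → ρ μ ≤ C * (1 + μ) ^ N

/-- `Ĝ_n` in momentum space. For `n = 2` it is
`[δ_m^-(k_1) + ∫_{m₀}^∞ δ_μ^-(k_1) ρ(μ) dμ] δ(k_1 + k_2)`. -/
def structHat {s : ℕ} (m m₀ : ℝ) (ρ : ℝ → ℝ) : (n : ℕ) → TestFn s n → ℂ
  | 0, _ => 0
  | 1, _ => 0
  | 2, f => twoPoint m f + ∫ μ in Set.Ioi m₀, (ρ μ : ℂ) * twoPoint μ f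
  | n + 3, f => ∑ j : Fin (n + 3), shellTerm m j Channel.loc f

/-- `F̂_n^{G(a_1, …, a_n)}` in momentum space. -/
def formFactorHat {s : ℕ} (m m₀ : ℝ) (ρ : ℝ → ℝ) :
    (n : ℕ) → (Fin n → Channel) → TestFn s n → ℂ
  | 0, _, _ => 0
  | 1, _, _ => 0
  | 2, a, f =>
      if a 0 = Channel.loc ∧ a 1 = Channel.loc then structHat m m₀ ρ 2 f else twoPoint m f
  | n + 3, a, f => ∑ j : Fin (n + 3), shellTerm m j (a j) f

open Classical in
/-- The structure functional `G`. The Fourier transform of a distribution is defined by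
`T̂(f̂) = T(f)`. -/
def structFunctional {s : ℕ} (m m₀ : ℝ) (ρ : ℝ → ℝ) (f : Borchers s) : ℂ :=
  ∑ n ∈ DFinsupp.support f, structHat m m₀ ρ n (minkFourier s n (f n))

open Classical in
/-- The functional `F^G`. -/
def formFactor {s : ℕ} (m m₀ : ℝ) (ρ : ℝ → ℝ) (f : BorchersExt s) : ℂ :=
  ∑ n ∈ DFinsupp.support f,
    ∑ a : Fin n → Channel, formFactorHat m m₀ ρ n a (minkFourier s n (f n a))

end IndefMetricQFT

/-!
In momentum space the finite time wave operators multiply by `χ_t(a, k)`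
(`minkFourier_omegaN`), and `χ_t(a, k) = 1` on the mass shell (`chi_shellPoint`). In the `j`-th term
of `Ĝ_n`, `n ≥ 3`, all particles except the `j`-th are on the mass shell, so that only the propagator
`1/(k_j² - m²)` is affected by the wave operators, and the time limit of `χ_t(a, k)/(k² - m²)` has
to be computed. As a distribution in `k⁰` at fixed spatial momentum this is the Dirichlet integral
together with the Riemann-Lebesgue lemma, and the limit is `Δ̂_m(a, k)`. The difficulty is that the
integral over the configurations `k_1 + ⋯ + k_n = 0` is singular, and that limits in `η` and `t` have to
be taken in it, with bounds that are uniform in both parameters.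

*Transition to the time variable.* A test function is `f = 𝓕 g`. Powers of the operators `m² - Δ_l`
in the spatial variables turn `f(k)` into a product of negative powers of the `ω(𝐤_l)` and a
superposition, with an integrable weight `F(x)`, of the plane waves `e^{-i ∑ x_l·k_l}`
(`minkFourier_eq_integral`); the weight is bounded by `‖g‖_{K,L}` with `K`, `L` independent
of `n` (`exists_integral_ellipticOps_le`). For fixed `x` the integral over the particles on the shell is
a product of free waves `ω^{-M} e^{-i k·x}`, and the propagator, as a function of the total energy, enters
only through its Fourier transform in the energy, which is integrated against the product of
the free waves at time `t` (`hasSpectralRep_multiWave`, `HasSpectralRep.exists_timeFunctional`). The Fourier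
transforms of the regularized propagators `χ_t(a, k)/(k² - m²)` are bounded uniformly in `η` and `t`
and converge pointwise (`isTimeLimit_nearLimit`, `isTimeLimit_deltaLimit`). Hence all
limits follow by dominated convergence if the product of free waves is absolutely integrable in time
(`exists_kernelTerm_limits`).

*Decay of products of free waves.* It suffices to treat three waves, since further integrable
factors only shift the kernel (`HasSpectralRep.addParticle`). The `L²` norm in `𝐤` of the convolution of
three amplitudes is an integral over a product of three autocorrelations (`autocorr_conv`). In the
autocorrelation at distance `r` the phase is `t (ω(q + r) - ω(q))`, whose derivative in the direction `r`
is bounded below by convexity of `ω`, and a single integration by parts gives a factor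
`(1 + 1/|r|)/(1 + |t|)` (`norm_integral_phase_le`, `norm_autocorr_wave_le`). Three such factors give the
integrable bound `(1 + |t|)^{-3/2}` for the `L²` norm (`lintegral_threeWave_le`); the singularities at
`r = 0` are integrable in space dimension `s ≥ 2`. For `n = 3` there are only two particles on the shell,
but then the remaining momentum stays away from the mass shell (`sq_le_abs_of_three`) and there is
no singularity.

*The two-point function.* Only the masses `μ` above `m₀` carry a phase, `e^{i(ω_μ - ω_m) T}` with `T` a
difference of times, and this part vanishes as `T → ±∞` by the Riemann-Lebesgue lemma in `μ`
(`tendsto_spectralPart`).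

*Invariance and continuity.* The measure `d𝐩/(2ω)` on the mass shell is Lorentz invariant, since in
hyperbolic polar coordinates it is a factor of Lebesgue measure on the light cone
(`lintegral_coneFun`). The regularized terms are then invariant already for `η < m²`. Linear
functionals on a direct sum are continuous if their restrictions to the summands are, and the
bounds by `‖·‖_{K,L}` hold with the same `K`, `L` in each degree (`exists_norm_formFactorHat_le`), which
gives continuity for `γ`. Each term depends on the time parameters through one combination of
them, so that the first limit that changes it already gives the final value
(`iteratedLim_of_single`).
-/


namespace IndefMetricQFT

open MeasureTheory Filter Set
open scoped InnerProductSpace ComplexConjugate ENNReal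

/-! ### The relativistic energy -/

/-- The space of spatial momenta. -/
abbrev Momentum (s : ℕ) : Type := EuclideanSpace ℝ (Fin s)

section Energy

variable {s : ℕ} {m : ℝ}

theorem energy_sq (m : ℝ) (p : Momentum s) : energy m p ^ 2 = ‖p‖ ^ 2 + m ^ 2 :=
  Real.sq_sqrt (by positivity)

theorem energy_nonneg (m : ℝ) (p : Momentum s) : 0 ≤ energy m p := Real.sqrt_nonneg _

theorem le_energy (m : ℝ) (p : Momentum s) : m ≤ energy m p :=
  Real.le_sqrt_of_sq_le (by nlinarith [sq_nonneg ‖p‖])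

theorem energy_pos (hm : 0 < m) (p : Momentum s) : 0 < energy m p :=
  hm.trans_le (le_energy m p)

theorem norm_le_energy (m : ℝ) (p : Momentum s) : ‖p‖ ≤ energy m p :=
  Real.le_sqrt_of_sq_le (by nlinarith [sq_nonneg m])

theorem energy_neg (m : ℝ) (p : Momentum s) : energy m (-p) = energy m p := by
  simp [energy]

theorem continuous_energy (m : ℝ) : Continuous (energy m : Momentum s → ℝ) := by
  unfold energy; fun_prop

theorem abs_energy_sub_le (hm : 0 < m) (p q : Momentum s) :
    |energy m p - energy m q| ≤ ‖p - q‖ := by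
  have hp := energy_pos hm p
  have hq := energy_pos hm q
  have h1 : (energy m p - energy m q) * (energy m p + energy m q)
      = (‖p‖ - ‖q‖) * (‖p‖ + ‖q‖) := by
    nlinarith [energy_sq m p, energy_sq m q]
  have h2 : |energy m p - energy m q| * (energy m p + energy m q)
      = |‖p‖ - ‖q‖| * (‖p‖ + ‖q‖) := by
    have := congrArg abs h1
    rwa [abs_mul, abs_mul, abs_of_pos (by positivity : 0 < energy m p + energy m q),
      abs_of_nonneg (by positivity : 0 ≤ ‖p‖ + ‖q‖)] at this
  have h3 : |‖p‖ - ‖q‖| * (‖p‖ + ‖q‖) ≤ ‖p - q‖ * (energy m p + energy m q) :=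
    mul_le_mul (abs_norm_sub_norm_le p q) (add_le_add (norm_le_energy m p) (norm_le_energy m q))
      (by positivity) (by positivity)
  exact le_of_mul_le_mul_right (h2 ▸ h3) (by positivity)

/-- The reversed Cauchy-Schwarz inequality on the mass shell. -/
theorem sq_add_norm_mul_le_energy_mul (m : ℝ) (p q : Momentum s) :
    m ^ 2 + ‖p‖ * ‖q‖ ≤ energy m p * energy m q := by
  refine abs_le_of_sq_le_sq' ?_ (by have := energy_nonneg m p; have := energy_nonneg m q; positivity)
    |>.2
  rw [mul_pow, energy_sq, energy_sq]
  nlinarith [sq_nonneg (m * (‖p‖ - ‖q‖))]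

/-- The derivative of the energy difference `ω(q + r) - ω(q)` in direction `r` is, with
`p = q + r`, the number `⟪p - q, p / ω(p) - q / ω(q)⟫`. -/
def velocityGap (m : ℝ) (p q : Momentum s) : ℝ :=
  ⟪p - q, p⟫_ℝ / energy m p - ⟪p - q, q⟫_ℝ / energy m q

/-- Quantitative convexity of the energy. -/
theorem velocityGap_ge (hm : 0 < m) (p q : Momentum s) :
    2 * m ^ 2 * ‖p - q‖ ^ 2 / (energy m p * energy m q * (energy m p + energy m q))
      ≤ velocityGap m p q := by
  have hp := energy_pos hm p
  have hq := energy_pos hm q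
  have sp := energy_sq m p
  have sq := energy_sq m q
  set a := energy m p
  set b := energy m q
  have hr : ‖p - q‖ ^ 2 = ‖p‖ ^ 2 - 2 * ⟪p, q⟫_ℝ + ‖q‖ ^ 2 := norm_sub_sq_real p q
  have hgap : velocityGap m p q
      = (a + b) * (‖p - q‖ ^ 2 - (a - b) ^ 2) / (2 * (a * b)) := by
    unfold velocityGap
    rw [inner_sub_left, inner_sub_left, real_inner_self_eq_norm_sq, real_inner_self_eq_norm_sq,
      real_inner_comm p q]
    change (‖p‖ ^ 2 - ⟪p, q⟫_ℝ) / a - (⟪p, q⟫_ℝ - ‖q‖ ^ 2) / b = _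
    rw [div_sub_div _ _ hp.ne' hq.ne', div_eq_div_iff (by positivity) (by positivity), hr]
    have e1 : ‖p‖ ^ 2 = a ^ 2 - m ^ 2 := by linarith
    have e2 : ‖q‖ ^ 2 = b ^ 2 - m ^ 2 := by linarith
    rw [e1, e2]; ring
  have key : 4 * m ^ 2 * ‖p - q‖ ^ 2 ≤ (‖p - q‖ ^ 2 - (a - b) ^ 2) * (a + b) ^ 2 := by
    have h1 : ((a - b) * (a + b)) ^ 2 ≤ ‖p - q‖ ^ 2 * (‖p‖ + ‖q‖) ^ 2 := by
      have : (a - b) * (a + b) = (‖p‖ - ‖q‖) * (‖p‖ + ‖q‖) := by nlinarith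
      rw [this, mul_pow]
      refine mul_le_mul_of_nonneg_right (sq_le_sq.2 ?_) (by positivity)
      rw [abs_of_nonneg (norm_nonneg (p - q))]
      exact abs_norm_sub_norm_le p q
    have h2 : 4 * m ^ 2 + (‖p‖ + ‖q‖) ^ 2 ≤ (a + b) ^ 2 := by
      nlinarith [sq_add_norm_mul_le_energy_mul m p q]
    nlinarith [sq_nonneg ‖p - q‖]
  rw [hgap, div_le_div_iff₀ (by positivity) (by positivity)]
  nlinarith [mul_le_mul_of_nonneg_right key (by positivity : 0 ≤ a * b)]

theorem velocityGap_pos (hm : 0 < m) {p q : Momentum s} (h : p ≠ q) : 0 < velocityGap m p q := by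
  refine lt_of_lt_of_le ?_ (velocityGap_ge hm p q)
  have hp := energy_pos hm p
  have hq := energy_pos hm q
  have : 0 < ‖p - q‖ := norm_pos_iff.2 (sub_ne_zero.2 h)
  positivity

theorem abs_inv_energy_sub_le (hm : 0 < m) (p q : Momentum s) :
    |(energy m p)⁻¹ - (energy m q)⁻¹| ≤ ‖p - q‖ / (energy m p * energy m q) := by
  have hp := energy_pos hm p
  have hq := energy_pos hm q
  rw [inv_sub_inv hp.ne' hq.ne', abs_div, abs_of_pos (mul_pos hp hq), abs_sub_comm]
  gcongr
  exact abs_energy_sub_le hm p q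

theorem abs_velocityGap_le (hm : 0 < m) (p q : Momentum s) :
    |velocityGap m p q| ≤ 2 * ‖p - q‖ ^ 2 / m := by
  have hp := energy_pos hm p
  have hq := energy_pos hm q
  have e : velocityGap m p q = ‖p - q‖ ^ 2 * (energy m p)⁻¹
      + ⟪p - q, q⟫_ℝ * ((energy m p)⁻¹ - (energy m q)⁻¹) := by
    unfold velocityGap
    rw [← real_inner_self_eq_norm_sq (p - q), inner_sub_right (p - q) p q]
    ring
  have h1 : |‖p - q‖ ^ 2 * (energy m p)⁻¹| ≤ ‖p - q‖ ^ 2 / m := by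
    rw [abs_of_nonneg (by positivity), div_eq_mul_inv]
    gcongr
    exact le_energy m p
  have h2 : |⟪p - q, q⟫_ℝ * ((energy m p)⁻¹ - (energy m q)⁻¹)| ≤ ‖p - q‖ ^ 2 / m := by
    rw [abs_mul]
    calc _ ≤ (‖p - q‖ * energy m q) * (‖p - q‖ / (energy m p * energy m q)) := by
          gcongr
          · exact (abs_real_inner_le_norm _ _).trans
              (mul_le_mul_of_nonneg_left (norm_le_energy m q) (norm_nonneg _))
          · exact abs_inv_energy_sub_le hm p q
      _ = ‖p - q‖ ^ 2 / energy m p := by field_simp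
      _ ≤ ‖p - q‖ ^ 2 / m := by gcongr; exact le_energy m p
  rw [e]
  calc _ ≤ _ := abs_add_le _ _
    _ ≤ ‖p - q‖ ^ 2 / m + ‖p - q‖ ^ 2 / m := add_le_add h1 h2
    _ = _ := by ring

theorem hasFDerivAt_energy (hm : 0 < m) (p : Momentum s) :
    HasFDerivAt (energy m : Momentum s → ℝ) ((energy m p)⁻¹ • innerSL ℝ p) p := by
  have h : HasFDerivAt (fun p : Momentum s => ‖p‖ ^ 2 + m ^ 2) (2 • innerSL ℝ p) p :=
    (hasStrictFDerivAt_norm_sq p).hasFDerivAt.add_const _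
  have h2 := h.sqrt (by positivity)
  refine h2.congr_fderiv ?_
  ext v
  change (1 / (2 * energy m p)) * ((2 : ℕ) • ⟪p, v⟫_ℝ) = (energy m p)⁻¹ * ⟪p, v⟫_ℝ
  have := energy_pos hm p
  rw [nsmul_eq_mul]; field_simp; simp

/-- The derivative in direction `r` of the component `⟪r, q⟫ / ω(q)` of the velocity. -/
def velocityDeriv (m : ℝ) (r q : Momentum s) : ℝ :=
  ‖r‖ ^ 2 * (energy m q)⁻¹ - ⟪r, q⟫_ℝ ^ 2 * ((energy m q)⁻¹) ^ 3

theorem abs_velocityDeriv_sub_le (hm : 0 < m) (p q : Momentum s) :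
    |velocityDeriv m (p - q) p - velocityDeriv m (p - q) q| ≤ 6 * ‖p - q‖ ^ 3 / m ^ 2 := by
  have hp := energy_pos hm p
  have hq := energy_pos hm q
  set r := p - q with hr
  have hg : ∀ k : Momentum s, |⟪r, k⟫_ℝ / energy m k| ≤ ‖r‖ := fun k => by
    have hk := energy_pos hm k
    rw [abs_div, abs_of_pos hk, div_le_iff₀ hk]
    exact (abs_real_inner_le_norm _ _).trans
      (mul_le_mul_of_nonneg_left (norm_le_energy m k) (norm_nonneg _))
  have hinv : |(energy m p)⁻¹ - (energy m q)⁻¹| ≤ ‖r‖ / m ^ 2 := by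
    refine (abs_inv_energy_sub_le hm p q).trans ?_
    gcongr
    nlinarith [le_energy m p, le_energy m q]
  set gp := ⟪r, p⟫_ℝ / energy m p with hgp
  set gq := ⟪r, q⟫_ℝ / energy m q with hgq
  have hgap : |gp - gq| ≤ 2 * ‖r‖ ^ 2 / m := abs_velocityGap_le hm p q
  have e : velocityDeriv m r p - velocityDeriv m r q
      = (‖r‖ ^ 2 - gp ^ 2) * ((energy m p)⁻¹ - (energy m q)⁻¹)
        - (gp + gq) * (gp - gq) * (energy m q)⁻¹ := by
    simp only [velocityDeriv, hgp, hgq]; ring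
  have h1 : |(‖r‖ ^ 2 - gp ^ 2) * ((energy m p)⁻¹ - (energy m q)⁻¹)| ≤ ‖r‖ ^ 2 * (‖r‖ / m ^ 2) := by
    rw [abs_mul]
    gcongr
    rw [abs_le]
    constructor <;> nlinarith [hg p, abs_nonneg gp, sq_abs gp, norm_nonneg r, sq_nonneg gp]
  have h2 : |(gp + gq) * (gp - gq) * (energy m q)⁻¹| ≤ (2 * ‖r‖) * (2 * ‖r‖ ^ 2 / m) * m⁻¹ := by
    rw [abs_mul, abs_mul, abs_of_pos (inv_pos.2 hq)]
    gcongr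
    · exact (abs_add_le _ _).trans (by linarith [hg p, hg q])
    · exact le_energy m q
  rw [e]
  calc _ ≤ _ := abs_sub _ _
    _ ≤ _ := add_le_add h1 h2
    _ = 5 * (‖r‖ ^ 3 / m ^ 2) := by field_simp; ring
    _ ≤ 6 * (‖r‖ ^ 3 / m ^ 2) := by gcongr; norm_num
    _ = _ := by ring

theorem hasFDerivAt_velocity (hm : 0 < m) (r q : Momentum s) :
    HasFDerivAt (fun q : Momentum s => ⟪r, q⟫_ℝ / energy m q)
      ((energy m q)⁻¹ • innerSL ℝ r
        - (⟪r, q⟫_ℝ * ((energy m q)⁻¹) ^ 3) • innerSL ℝ q) q := by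
  have hq := energy_pos hm q
  have h1 : HasFDerivAt (fun q : Momentum s => ⟪r, q⟫_ℝ) (innerSL ℝ r) q :=
    (innerSL ℝ r).hasFDerivAt
  have h2 : HasFDerivAt (fun q : Momentum s => ⟪r, q⟫_ℝ / energy m q) _ q :=
    h1.fun_mul ((hasDerivAt_inv hq.ne').comp_hasFDerivAt q (hasFDerivAt_energy hm q))
  refine h2.congr_fderiv ?_
  ext v
  simp
  field_simp
  ring

end Energy

/-! ### Decay of the autocorrelation of a free wave -/

section Oscillatory

variable {s : ℕ} {m : ℝ}

theorem one_add_norm_le_energy (hm : 0 < m) (p : Momentum s) :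
    1 + ‖p‖ ≤ (m⁻¹ + 1) * energy m p := by
  have h1 : 1 ≤ m⁻¹ * energy m p := by
    rw [inv_mul_eq_div, le_div_iff₀ hm, one_mul]; exact le_energy m p
  linarith [norm_le_energy m p]

theorem integrable_inv_energy_pow (hm : 0 < m) {k : ℕ} (hk : s + 1 ≤ k) :
    Integrable (fun q : Momentum s => (energy m q ^ k)⁻¹) := by
  have hr : ((Module.finrank ℝ (Momentum s) : ℕ) : ℝ) < (k : ℝ) := by
    rw [finrank_euclideanSpace_fin]; exact_mod_cast hk
  refine ((integrable_one_add_norm (μ := volume) hr).const_mul ((m⁻¹ + 1) ^ k)).mono'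
    (Continuous.aestronglyMeasurable ?_) (Eventually.of_forall fun q => ?_)
  · exact ((continuous_energy m).pow k).inv₀ fun q => (pow_pos (energy_pos hm q) k).ne'
  · have hq := energy_pos hm q
    rw [Real.norm_of_nonneg (by positivity), Real.rpow_neg (by positivity), Real.rpow_natCast,
      ← div_eq_mul_inv, inv_eq_one_div, div_le_div_iff₀ (by positivity) (by positivity), one_mul,
      ← mul_pow]
    exact pow_le_pow_left₀ (by positivity) (one_add_norm_le_energy hm q) k

theorem inv_energy_mul_le (hm : 0 < m) (q r : Momentum s) :
    (energy m (q + r) * energy m q)⁻¹ ≤ (m⁻¹ ^ 2 + 2 * m⁻¹) * (1 + ‖r‖)⁻¹ := by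
  have hp := energy_pos hm (q + r)
  have hq := energy_pos hm q
  have h1 := le_energy m (q + r)
  have h2 := le_energy m q
  have hr : ‖r‖ ≤ energy m (q + r) + energy m q := by
    calc ‖r‖ = ‖(q + r) - q‖ := by simp
      _ ≤ ‖q + r‖ + ‖q‖ := norm_sub_le _ _
      _ ≤ _ := add_le_add (norm_le_energy m _) (norm_le_energy m _)
  set a := energy m (q + r)
  set b := energy m q
  rw [inv_eq_one_div, ← div_eq_mul_inv, div_le_div_iff₀ (by positivity) (by positivity), one_mul]
  have e1 : 1 ≤ m⁻¹ ^ 2 * (a * b) := by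
    rw [inv_pow, inv_mul_eq_div, le_div_iff₀ (by positivity)]; nlinarith
  have e2 : a ≤ m⁻¹ * (a * b) := by
    rw [inv_mul_eq_div, le_div_iff₀ hm]; nlinarith
  have e3 : b ≤ m⁻¹ * (a * b) := by
    rw [inv_mul_eq_div, le_div_iff₀ hm]; nlinarith
  linarith

theorem hasLineDerivAt_energy (hm : 0 < m) (q r : Momentum s) :
    HasLineDerivAt ℝ (energy m) (⟪q, r⟫_ℝ / energy m q) q r := by
  have := (hasFDerivAt_energy hm q).hasLineDerivAt r
  simpa [div_eq_inv_mul] using this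

theorem hasLineDerivAt_energy_add (hm : 0 < m) (q r : Momentum s) :
    HasLineDerivAt ℝ (fun q => energy m (q + r)) (⟪q + r, r⟫_ℝ / energy m (q + r)) q r := by
  have h := hasLineDerivAt_energy hm (q + r) r
  unfold HasLineDerivAt at h ⊢
  refine h.congr_of_eventuallyEq (Eventually.of_forall fun t => ?_)
  simp only [add_right_comm]

theorem hasLineDerivAt_velocity (hm : 0 < m) (r q : Momentum s) :
    HasLineDerivAt ℝ (fun q : Momentum s => ⟪r, q⟫_ℝ / energy m q) (velocityDeriv m r q) q r := by
  have := (hasFDerivAt_velocity hm r q).hasLineDerivAt r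
  refine this.congr_deriv ?_
  simp [velocityDeriv, real_inner_comm]
  ring

theorem hasLineDerivAt_velocityGap (hm : 0 < m) (q r : Momentum s) :
    HasLineDerivAt ℝ (fun q => velocityGap m (q + r) q)
      (velocityDeriv m r (q + r) - velocityDeriv m r q) q r := by
  have h1 := hasLineDerivAt_velocity hm r (q + r)
  have h2 := hasLineDerivAt_velocity hm r q
  unfold HasLineDerivAt at h1 h2 ⊢
  refine (h1.sub h2).congr_of_eventuallyEq (Eventually.of_forall fun t => ?_)
  simp [velocityGap, add_right_comm]

/-- The product of the weights `ω^{-M}` at `q + r` and at `q`. -/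
def pairWeight (m : ℝ) (M : ℕ) (r q : Momentum s) : ℝ :=
  ((energy m (q + r) * energy m q)⁻¹) ^ M

theorem hasLineDerivAt_pairWeight (hm : 0 < m) (M : ℕ) (q r : Momentum s) :
    HasLineDerivAt ℝ (pairWeight m M r)
      (pairWeight m M r q * (-M * (⟪q + r, r⟫_ℝ / energy m (q + r) ^ 2
        + ⟪q, r⟫_ℝ / energy m q ^ 2))) q r := by
  have hp := energy_pos hm (q + r)
  have hq := energy_pos hm q
  have h1 := hasLineDerivAt_energy_add hm q r
  have h2 := hasLineDerivAt_energy hm q r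
  unfold HasLineDerivAt at h1 h2 ⊢
  have h3 := ((h1.fun_mul h2).fun_inv (by simp; exact ⟨hp.ne', hq.ne'⟩)).fun_pow M
  refine h3.congr_deriv ?_
  rcases M with _ | M
  · simp
  · simp only [zero_smul, add_zero, pairWeight, Nat.add_sub_cancel, pow_succ]
    push_cast
    field_simp

variable (s) in
theorem pairWeight_le (hm : 0 < m) {M : ℕ} (hM : 2 * s + 2 ≤ M) : ∃ C : ℝ, 0 < C ∧
    ∀ r q : Momentum s, pairWeight m M r q ≤ C * ((1 + ‖r‖) ^ (s + 1))⁻¹ * (energy m q ^ (s + 1))⁻¹ := by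
  obtain ⟨k, rfl⟩ := Nat.exists_eq_add_of_le hM
  refine ⟨(m⁻¹ ^ 2) ^ k * (m⁻¹ ^ 2 + 2 * m⁻¹) ^ (s + 1) * m⁻¹ ^ (s + 1), by positivity,
    fun r q => ?_⟩
  have hp := energy_pos hm (q + r)
  have hq := energy_pos hm q
  have e1 : (energy m (q + r) * energy m q)⁻¹ ≤ m⁻¹ ^ 2 := by
    rw [mul_inv, sq]
    gcongr <;> exact le_energy m _
  have e2 := inv_energy_mul_le hm q r
  have e3 : (energy m (q + r) * energy m q)⁻¹ ≤ m⁻¹ * (energy m q)⁻¹ := by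
    rw [mul_inv]
    gcongr; exact le_energy m _
  unfold pairWeight
  set x := (energy m (q + r) * energy m q)⁻¹ with hx
  have hx0 : 0 ≤ x := by positivity
  calc x ^ (2 * s + 2 + k) = x ^ k * x ^ (s + 1) * x ^ (s + 1) := by
        rw [← pow_add, ← pow_add]; congr 1; ring
    _ ≤ (m⁻¹ ^ 2) ^ k * ((m⁻¹ ^ 2 + 2 * m⁻¹) * (1 + ‖r‖)⁻¹) ^ (s + 1)
          * (m⁻¹ * (energy m q)⁻¹) ^ (s + 1) := by gcongr
    _ = _ := by
      rw [mul_pow (_ + _), mul_pow m⁻¹ (energy m q)⁻¹, inv_pow (1 + ‖r‖), inv_pow (energy m q)]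
      ring

theorem continuous_pairWeight (hm : 0 < m) (M : ℕ) (r : Momentum s) :
    Continuous (pairWeight m M r) := by
  unfold pairWeight
  refine Continuous.pow (Continuous.inv₀ ?_ fun q =>
    (mul_pos (energy_pos hm _) (energy_pos hm _)).ne') M
  exact ((continuous_energy m).comp (by fun_prop)).mul (continuous_energy m)

theorem pairWeight_nonneg (hm : 0 < m) (M : ℕ) (r q : Momentum s) : 0 ≤ pairWeight m M r q := by
  have := energy_pos hm (q + r); have := energy_pos hm q
  unfold pairWeight; positivity

theorem pairWeight_mul_sq (hm : 0 < m) (M : ℕ) (r q : Momentum s) :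
    pairWeight m (M + 2) r q * (energy m (q + r) * energy m q) ^ 2 = pairWeight m M r q := by
  have hp := energy_pos hm (q + r)
  have hq := energy_pos hm q
  unfold pairWeight
  rw [pow_add]; field_simp

theorem pairWeight_succ_le (hm : 0 < m) (M k : ℕ) (r q : Momentum s) :
    pairWeight m (M + k) r q ≤ (m⁻¹ ^ 2) ^ k * pairWeight m M r q := by
  have hp := energy_pos hm (q + r)
  have hq := energy_pos hm q
  have e1 : (energy m (q + r) * energy m q)⁻¹ ≤ m⁻¹ ^ 2 := by
    rw [mul_inv, sq]
    gcongr <;> exact le_energy m _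
  unfold pairWeight
  rw [pow_add, mul_comm]
  gcongr

theorem inv_velocityGap_le (hm : 0 < m) {q r : Momentum s} (hr : r ≠ 0) :
    (velocityGap m (q + r) q)⁻¹
      ≤ m⁻¹ ^ 3 * (‖r‖ ^ 2)⁻¹ * (energy m (q + r) * energy m q) ^ 2 := by
  have hp := energy_pos hm (q + r)
  have hq := energy_pos hm q
  have h1 := le_energy m (q + r)
  have h2 := le_energy m q
  have h := velocityGap_ge hm (q + r) q
  rw [add_sub_cancel_left] at h
  have hr' : 0 < ‖r‖ := norm_pos_iff.2 hr
  refine (inv_anti₀ (by positivity) h).trans ?_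
  set a := energy m (q + r)
  set b := energy m q
  rw [inv_div, div_le_iff₀ (by positivity)]
  have : m⁻¹ ^ 3 * (‖r‖ ^ 2)⁻¹ * (a * b) ^ 2 * (2 * m ^ 2 * ‖r‖ ^ 2)
      = a * b * (2 * m⁻¹ * (a * b)) := by field_simp
  rw [this]
  have e2 : a ≤ m⁻¹ * (a * b) := by
    rw [inv_mul_eq_div, le_div_iff₀ hm]; nlinarith
  have e3 : b ≤ m⁻¹ * (a * b) := by
    rw [inv_mul_eq_div, le_div_iff₀ hm]; nlinarith
  gcongr
  linarith

/-- Integration by parts along `r`: the phase `ω(q + r) - ω(q)` has derivative at least of order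
`|r|²` in direction `r`, while each derivative of the amplitude in direction `r` gains a factor of
order `|r|`. -/
theorem norm_integral_phase_le (s : ℕ) {m : ℝ} (hm : 0 < m) {M : ℕ} (hM : 2 * s + 6 ≤ M) :
    ∃ C : ℝ, 0 < C ∧ ∀ (τ : ℝ) (r : Momentum s), r ≠ 0 →
      |τ| * ‖∫ q : Momentum s, Complex.exp (-(Complex.I * (τ * (energy m (q + r) - energy m q) : ℝ)))
          * (pairWeight m M r q : ℂ)‖
        ≤ C * ‖r‖⁻¹ * ((1 + ‖r‖) ^ (s + 1))⁻¹ := by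
  obtain ⟨k, rfl⟩ := Nat.exists_eq_add_of_le hM
  obtain ⟨C, hC, hW⟩ := pairWeight_le s hm (M := 2 * s + 2 + k) (by omega)
  have hMk : 2 * s + 6 + k = 2 * s + 2 + k + 2 + 2 := by ring
  set K := 2 * s + 2 + k with hK
  have hintE : Integrable (fun q : Momentum s => (energy m q ^ (s + 1))⁻¹) :=
    integrable_inv_energy_pow hm le_rfl
  set J := ∫ q : Momentum s, (energy m q ^ (s + 1))⁻¹ with hJ
  have hJ0 : 0 ≤ J := integral_nonneg fun q => inv_nonneg.2 (pow_nonneg (energy_nonneg m q) _)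
  rw [hMk]
  set D : ℝ := m⁻¹ ^ 3 * (2 * (K + 4) * m⁻¹) * (m⁻¹ ^ 2) ^ 2 + 6 * m⁻¹ ^ 2 * (m⁻¹ ^ 3) ^ 2 with hD
  have hD0 : 0 < D := by positivity
  refine ⟨D * C * (J + 1), by positivity, fun τ r hr => ?_⟩
  have hr' : 0 < ‖r‖ := norm_pos_iff.2 hr
  -- phase, amplitude and their derivatives in direction `r`
  set P : Momentum s → ℝ := fun q => velocityGap m (q + r) q with hP
  set P' : Momentum s → ℝ := fun q => velocityDeriv m r (q + r) - velocityDeriv m r q with hP'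
  set W : Momentum s → ℝ := pairWeight m (K + 2 + 2) r with hWdef
  set w' : Momentum s → ℝ := fun q => -((K + 2 + 2 : ℕ) : ℝ) * (⟪q + r, r⟫_ℝ / energy m (q + r) ^ 2
        + ⟪q, r⟫_ℝ / energy m q ^ 2) with hw'
  have hPpos : ∀ q, 0 < P q := fun q => velocityGap_pos hm (by simpa using hr)
  set G : Momentum s → ℝ := fun q => W q / P q with hG
  set G' : Momentum s → ℝ := fun q => (W q * w' q * P q - W q * P' q) / P q ^ 2 with hG'
  set f : Momentum s → ℂ := fun q =>
    Complex.exp (-(Complex.I * (τ * (energy m (q + r) - energy m q) : ℝ))) with hf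
  have hfn : ∀ q, ‖f q‖ = 1 := fun q => by
    rw [hf]; simp only [Complex.norm_exp]; simp
  have hGd : ∀ q, HasLineDerivAt ℝ (fun q => (G q : ℂ)) (G' q : ℂ) q r := fun q => by
    have h1 := hasLineDerivAt_pairWeight hm (K + 2 + 2) q r
    have h2 := hasLineDerivAt_velocityGap hm q r
    unfold HasLineDerivAt at h1 h2 ⊢
    have h3 := (h1.div h2 (by simpa using (hPpos q).ne')).ofReal_comp
    refine h3.congr_deriv ?_
    simp [hG', hP, hP', hw', hWdef]
  have hfd : ∀ q, HasLineDerivAt ℝ f (f q * (-(Complex.I * (τ * P q : ℝ)))) q r := fun q => by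
    have h1 := hasLineDerivAt_energy_add hm q r
    have h2 := hasLineDerivAt_energy hm q r
    unfold HasLineDerivAt at h1 h2 ⊢
    have h3 := ((((h1.sub h2).const_mul τ).ofReal_comp.const_mul Complex.I).fun_neg).cexp
    refine h3.congr_deriv ?_
    simp [hf, hP, velocityGap, real_inner_comm]
  -- bounds
  have hW0 : ∀ q, 0 ≤ W q := fun q => pairWeight_nonneg hm _ r q
  have hPinv : ∀ q, (P q)⁻¹ ≤ m⁻¹ ^ 3 * (‖r‖ ^ 2)⁻¹ * (energy m (q + r) * energy m q) ^ 2 :=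
    fun q => inv_velocityGap_le hm hr
  have hWP : ∀ q, W q * (P q)⁻¹ ≤ m⁻¹ ^ 3 * (‖r‖ ^ 2)⁻¹ * pairWeight m (K + 2) r q := fun q => by
    calc W q * (P q)⁻¹ ≤ W q * (m⁻¹ ^ 3 * (‖r‖ ^ 2)⁻¹ * (energy m (q + r) * energy m q) ^ 2) :=
          mul_le_mul_of_nonneg_left (hPinv q) (hW0 q)
      _ = m⁻¹ ^ 3 * (‖r‖ ^ 2)⁻¹ * (W q * (energy m (q + r) * energy m q) ^ 2) := by ring
      _ = _ := by rw [hWdef, pairWeight_mul_sq hm]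
  have hWPP : ∀ q, W q * (P q)⁻¹ ^ 2 ≤ (m⁻¹ ^ 3 * (‖r‖ ^ 2)⁻¹) ^ 2 * pairWeight m K r q := fun q => by
    have hi : 0 ≤ (P q)⁻¹ := inv_nonneg.2 (hPpos q).le
    calc W q * (P q)⁻¹ ^ 2 = W q * (P q)⁻¹ * (P q)⁻¹ := by ring
      _ ≤ (m⁻¹ ^ 3 * (‖r‖ ^ 2)⁻¹ * pairWeight m (K + 2) r q)
          * (m⁻¹ ^ 3 * (‖r‖ ^ 2)⁻¹ * (energy m (q + r) * energy m q) ^ 2) := by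
          have := pairWeight_nonneg hm (K + 2) r q
          exact mul_le_mul (hWP q) (hPinv q) hi (by positivity)
      _ = (m⁻¹ ^ 3 * (‖r‖ ^ 2)⁻¹) ^ 2
          * (pairWeight m (K + 2) r q * (energy m (q + r) * energy m q) ^ 2) := by ring
      _ = _ := by rw [pairWeight_mul_sq hm]
  have hw'b : ∀ q, |w' q| ≤ 2 * (K + 4) * m⁻¹ * ‖r‖ := fun q => by
    have hv : ∀ p : Momentum s, |⟪p, r⟫_ℝ / energy m p ^ 2| ≤ m⁻¹ * ‖r‖ := fun p => by
      have hp := energy_pos hm p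
      rw [abs_div, abs_of_pos (by positivity : 0 < energy m p ^ 2), div_le_iff₀ (by positivity)]
      calc |⟪p, r⟫_ℝ| ≤ ‖p‖ * ‖r‖ := abs_real_inner_le_norm _ _
        _ ≤ energy m p * ‖r‖ := by gcongr; exact norm_le_energy m p
        _ = m⁻¹ * ‖r‖ * (m * energy m p) := by field_simp
        _ ≤ _ := by
          rw [sq]; gcongr; exact le_energy m p
    rw [hw']
    simp only [abs_mul, abs_neg, Nat.abs_cast]
    calc _ ≤ ((K + 2 + 2 : ℕ) : ℝ) * (m⁻¹ * ‖r‖ + m⁻¹ * ‖r‖) := by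
          gcongr
          exact (abs_add_le _ _).trans (add_le_add (hv _) (hv _))
      _ = _ := by push_cast; ring
  have hP'b : ∀ q, |P' q| ≤ 6 * m⁻¹ ^ 2 * ‖r‖ ^ 3 := fun q => by
    have := abs_velocityDeriv_sub_le hm (q + r) q
    rw [add_sub_cancel_left] at this
    refine this.trans (le_of_eq ?_)
    field_simp
  have hG'b : ∀ q, |G' q| ≤ D * C * (‖r‖⁻¹ * ((1 + ‖r‖) ^ (s + 1))⁻¹) * (energy m q ^ (s + 1))⁻¹ :=
    fun q => by
    have hne := (hPpos q).ne'
    have hK0 := pairWeight_nonneg hm K r q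
    have e : G' q = W q * (P q)⁻¹ * w' q - W q * (P q)⁻¹ ^ 2 * P' q := by
      rw [hG']; field_simp
    have hi : 0 ≤ (P q)⁻¹ := inv_nonneg.2 (hPpos q).le
    have b1 : |W q * (P q)⁻¹ * w' q| ≤ (m⁻¹ ^ 3 * (‖r‖ ^ 2)⁻¹ * ((m⁻¹ ^ 2) ^ 2 * pairWeight m K r q))
        * (2 * (K + 4) * m⁻¹ * ‖r‖) := by
      rw [abs_mul, abs_of_nonneg (mul_nonneg (hW0 q) hi)]
      refine mul_le_mul ((hWP q).trans ?_) (hw'b q) (abs_nonneg _) (by positivity)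
      gcongr
      exact pairWeight_succ_le hm K 2 r q
    have b2 : |W q * (P q)⁻¹ ^ 2 * P' q| ≤ ((m⁻¹ ^ 3 * (‖r‖ ^ 2)⁻¹) ^ 2 * pairWeight m K r q)
        * (6 * m⁻¹ ^ 2 * ‖r‖ ^ 3) := by
      rw [abs_mul, abs_of_nonneg (mul_nonneg (hW0 q) (by positivity))]
      exact mul_le_mul (hWPP q) (hP'b q) (abs_nonneg _) (by positivity)
    rw [e]
    calc _ ≤ _ := abs_sub _ _
      _ ≤ _ := add_le_add b1 b2
      _ = D * ‖r‖⁻¹ * pairWeight m K r q := by rw [hD]; field_simp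
      _ ≤ D * ‖r‖⁻¹ * (C * ((1 + ‖r‖) ^ (s + 1))⁻¹ * (energy m q ^ (s + 1))⁻¹) := by
        gcongr; exact hW r q
      _ = _ := by ring
  have hcf : Continuous f := by
    have := continuous_energy (s := s) m
    rw [hf]; fun_prop
  have hcW : Continuous W := continuous_pairWeight hm _ r
  have hce : Continuous fun q : Momentum s => energy m (q + r) :=
    (continuous_energy m).comp (by fun_prop)
  have hcP : Continuous P := by
    rw [hP]; unfold velocityGap
    have := continuous_energy (s := s) m
    refine Continuous.sub (Continuous.div (by fun_prop) hce fun q => (energy_pos hm _).ne')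
      (Continuous.div (by fun_prop) this fun q => (energy_pos hm _).ne')
  have hcG : Continuous G := hcW.div hcP fun q => (hPpos q).ne'
  have hcvd : Continuous (velocityDeriv m r : Momentum s → ℝ) := by
    unfold velocityDeriv
    have := (continuous_energy (s := s) m).inv₀ fun q => (energy_pos hm q).ne'
    exact (continuous_const.mul this).sub
      (((innerSL ℝ r).continuous.pow 2).mul (this.pow 3))
  have hcP' : Continuous P' := by
    rw [hP']; exact (hcvd.comp (by fun_prop)).sub hcvd
  have hcw' : Continuous w' := by
    rw [hw']
    have := continuous_energy (s := s) m
    refine continuous_const.mul (Continuous.add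
      (Continuous.div (by fun_prop) (hce.pow 2) fun q => (pow_pos (energy_pos hm _) 2).ne')
      (Continuous.div (by fun_prop) (this.pow 2) fun q => (pow_pos (energy_pos hm _) 2).ne'))
  have hcG' : Continuous G' := by
    rw [hG']
    exact (((hcW.mul hcw').mul hcP).sub (hcW.mul hcP')).div (hcP.pow 2)
      fun q => (pow_pos (hPpos q) 2).ne'
  have hiW : ∀ L, 2 * s + 2 ≤ L → Integrable (fun q => pairWeight m L r q) := fun L hL => by
    obtain ⟨C', _, h'⟩ := pairWeight_le s hm hL
    refine (hintE.const_mul (C' * ((1 + ‖r‖) ^ (s + 1))⁻¹)).mono'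
      (continuous_pairWeight hm L r).aestronglyMeasurable (Eventually.of_forall fun q => ?_)
    rw [Real.norm_of_nonneg (pairWeight_nonneg hm L r q)]
    exact h' r q
  have hiG : Integrable G := by
    refine ((hiW (K + 2) (by omega)).const_mul (m⁻¹ ^ 3 * (‖r‖ ^ 2)⁻¹)).mono'
      hcG.aestronglyMeasurable (Eventually.of_forall fun q => ?_)
    rw [Real.norm_of_nonneg (div_nonneg (hW0 q) (hPpos q).le)]
    exact hWP q
  have hiG' : Integrable G' := by
    refine (hintE.const_mul (D * C * (‖r‖⁻¹ * ((1 + ‖r‖) ^ (s + 1))⁻¹))).mono'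
      hcG'.aestronglyMeasurable (Eventually.of_forall fun q => ?_)
    exact hG'b q
  have hunit : ∀ g : Momentum s → ℝ, Integrable g → Integrable fun q => f q * (g q : ℂ) :=
    fun g hg => hg.ofReal.bdd_mul (c := 1) hcf.aestronglyMeasurable
      (Eventually.of_forall fun q => (hfn q).le)
  have hfW : ∀ q, f q * (-(Complex.I * (τ * P q : ℝ))) * (G q : ℂ)
      = -(Complex.I * τ) * (f q * (W q : ℂ)) := fun q => by
    have hne : (P q : ℂ) ≠ 0 := by exact_mod_cast (hPpos q).ne'
    rw [hG]; push_cast; field_simp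
  have ibp := integral_bilinear_hasLineDerivAt_right_eq_neg_left_of_integrable (μ := volume)
    (B := ContinuousLinearMap.mul ℝ ℂ) (f := f) (f' := fun q => f q * (-(Complex.I * (τ * P q : ℝ))))
    (g := fun q => (G q : ℂ)) (g' := fun q => (G' q : ℂ)) (v := r)
    (by
      simp only [ContinuousLinearMap.mul_apply']
      simp only [hfW]
      exact (hunit W (hiW _ (by omega))).const_mul _)
    (hunit G' hiG') (hunit G hiG) (fun q _ => hfd q) (fun q _ => hGd q)
  simp only [ContinuousLinearMap.mul_apply', hfW] at ibp
  rw [integral_const_mul] at ibp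
  have hnorm : |τ| * ‖∫ q, f q * (W q : ℂ)‖ = ‖∫ q, f q * (G' q : ℂ)‖ := by
    rw [ibp]; simp
  rw [hnorm]
  calc ‖∫ q, f q * (G' q : ℂ)‖ ≤ ∫ q, D * C * (‖r‖⁻¹ * ((1 + ‖r‖) ^ (s + 1))⁻¹)
        * (energy m q ^ (s + 1))⁻¹ := by
        refine norm_integral_le_of_norm_le (hintE.const_mul _) (Eventually.of_forall fun q => ?_)
        rw [norm_mul, hfn, one_mul, Complex.norm_real]
        exact hG'b q
    _ = D * C * J * ‖r‖⁻¹ * ((1 + ‖r‖) ^ (s + 1))⁻¹ := by rw [integral_const_mul]; ring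
    _ ≤ _ := by gcongr; linarith

end Oscillatory

/-! ### Convolutions and autocorrelations -/

section Convolution

variable {s : ℕ}

/-- The convolution `(b * g)(k) = ∫ b(p) g(k - p) dp`. -/
def conv (b g : Momentum s → ℂ) (k : Momentum s) : ℂ := ∫ p, b p * g (k - p)

/-- The autocorrelation `r ↦ ∫ b(q + r) conj(b(q)) dq`. -/
def autocorr (b : Momentum s → ℂ) (r : Momentum s) : ℂ := ∫ q, b (q + r) * conj (b q)

theorem measurable_conv {b g : Momentum s → ℂ} (hb : Measurable b) (hg : Measurable g) :
    Measurable (conv b g) := by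
  have : StronglyMeasurable (Function.uncurry fun k p : Momentum s => b p * g (k - p)) :=
    Measurable.stronglyMeasurable (by unfold Function.uncurry; fun_prop)
  exact this.integral_prod_right.measurable

theorem norm_conv_le {b g : Momentum s → ℂ} (hb : Integrable b) {C : ℝ} (hg : ∀ k, ‖g k‖ ≤ C)
    (k : Momentum s) : ‖conv b g k‖ ≤ C * ∫ p, ‖b p‖ := by
  rw [← integral_const_mul]
  refine norm_integral_le_of_norm_le (hb.norm.const_mul C) (Eventually.of_forall fun p => ?_)
  rw [norm_mul, mul_comm]
  gcongr
  exact hg _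

theorem integrable_conv_integrand {b g : Momentum s → ℂ} (hb : Integrable b) (hg : Integrable g)
    (hbm : Measurable b) (hgm : Measurable g) :
    Integrable (fun x : Momentum s × Momentum s => b x.2 * g (x.1 - x.2)) := by
  have hm : AEStronglyMeasurable (fun x : Momentum s × Momentum s => b x.2 * g (x.1 - x.2))
      (volume.prod volume) := Measurable.aestronglyMeasurable (by fun_prop)
  refine (integrable_prod_iff' hm).2 ⟨Eventually.of_forall fun p => ?_, ?_⟩
  · exact (hg.comp_sub_right p).const_mul (b p)
  · simp only [norm_mul, integral_const_mul]
    simp only [integral_sub_right_eq_self (fun y => ‖g y‖)]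
    exact hb.norm.mul_const _

theorem integrable_conv {b g : Momentum s → ℂ} (hb : Integrable b) (hg : Integrable g)
    (hbm : Measurable b) (hgm : Measurable g) : Integrable (conv b g) :=
  (integrable_conv_integrand hb hg hbm hgm).integral_prod_left

/-- The autocorrelation of a convolution is the convolution of the autocorrelations. -/
theorem autocorr_conv {b g : Momentum s → ℂ} (hb : Integrable b) (hg : Integrable g)
    (hbm : Measurable b) (hgm : Measurable g) {C : ℝ} (hgC : ∀ k, ‖g k‖ ≤ C) (r : Momentum s) :
    autocorr (conv b g) r = conv (autocorr b) (autocorr g) r := by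
  have hconj : Measurable (fun z : ℂ => conj z) := Complex.continuous_conj.measurable
  -- the four-fold integrand, as a function of `(k, (p, q))`
  let H : Momentum s × (Momentum s × Momentum s) → ℂ := fun x =>
    (b x.2.1 * g (x.1 + r - x.2.1)) * (conj (b x.2.2) * conj (g (x.1 - x.2.2)))
  have hHm : AEStronglyMeasurable H (volume.prod (volume.prod volume)) :=
    Measurable.aestronglyMeasurable (by
      have h1 : Measurable fun x : Momentum s × (Momentum s × Momentum s) => conj (b x.2.2) :=
        hconj.comp (by fun_prop)
      have h2 : Measurable fun x : Momentum s × (Momentum s × Momentum s) =>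
        conj (g (x.1 - x.2.2)) := hconj.comp (by fun_prop)
      have h3 : Measurable fun x : Momentum s × (Momentum s × Momentum s) =>
        b x.2.1 * g (x.1 + r - x.2.1) := by fun_prop
      exact h3.mul (h1.mul h2))
  have hHnorm : ∀ k p q, ‖H (k, (p, q))‖ ≤ (‖b p‖ * ‖b q‖ * C) * ‖g (k - q)‖ := fun k p q => by
    simp only [H, norm_mul, RCLike.norm_conj]
    have := mul_le_mul_of_nonneg_left (hgC (k + r - p)) (by positivity :
      0 ≤ ‖b p‖ * ‖b q‖ * ‖g (k - q)‖)
    nlinarith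
  have hHs : ∀ p q, Integrable fun k => H (k, (p, q)) := fun p q => by
    refine ((hg.comp_sub_right q).norm.const_mul (‖b p‖ * ‖b q‖ * C)).mono' ?_
      (Eventually.of_forall fun k => hHnorm k p q)
    refine Measurable.aestronglyMeasurable ?_
    have h2 : Measurable fun k : Momentum s => conj (g (k - q)) := hconj.comp (by fun_prop)
    simp only [H]
    fun_prop
  have hH : Integrable H (volume.prod (volume.prod volume)) := by
    refine (integrable_prod_iff' hHm).2 ⟨Eventually.of_forall fun x => hHs x.1 x.2, ?_⟩
    refine ((hb.norm.mul_prod hb.norm).mul_const (C * ∫ y, ‖g y‖)).mono'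
      hHm.norm.prod_swap.integral_prod_right' (Eventually.of_forall fun x => ?_)
    rw [Real.norm_of_nonneg (integral_nonneg fun k => norm_nonneg _)]
    calc ∫ k, ‖H (k, x)‖ ≤ ∫ k, (‖b x.1‖ * ‖b x.2‖ * C) * ‖g (k - x.2)‖ :=
          integral_mono (hHs x.1 x.2).norm ((hg.comp_sub_right x.2).norm.const_mul _)
            fun k => hHnorm k x.1 x.2
      _ = _ := by
          rw [integral_const_mul, integral_sub_right_eq_self (fun y => ‖g y‖)]; ring
  have e1 : autocorr (conv b g) r = ∫ k, ∫ x : Momentum s × Momentum s, H (k, x) := by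
    unfold autocorr conv
    refine integral_congr_ae (Eventually.of_forall fun k => ?_)
    simp only [H]
    rw [← integral_conj, ← integral_prod_mul]
    simp [map_mul]
    rfl
  have e2 : ∀ p q, ∫ k, H (k, (p, q)) = b p * conj (b q) * autocorr g (r - (p - q)) := fun p q => by
    have : ∀ k, H (k, (p, q))
        = (fun k => b p * conj (b q) * (g (k + (r - (p - q))) * conj (g k))) (k - q) := fun k => by
      simp only [H]
      have : k - q + (r - (p - q)) = k + r - p := by abel
      rw [this]; ring
    simp only [this]
    rw [integral_sub_right_eq_self (fun k => b p * conj (b q) * (g (k + (r - (p - q))) * conj (g k))),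
      integral_const_mul]
    rfl
  have hH2 : Integrable (fun x : Momentum s × Momentum s =>
      b x.1 * conj (b x.2) * autocorr g (r - (x.1 - x.2))) (volume.prod volume) := by
    have := hH.integral_prod_right
    refine this.congr (Eventually.of_forall fun x => e2 x.1 x.2)
  have hH3 : Integrable (fun x : Momentum s × Momentum s =>
      b (x.1 + x.2) * conj (b x.2) * autocorr g (r - x.1)) (volume.prod volume) := by
    have hp := measurePreserving_add_prod (volume : Measure (Momentum s))
      (volume : Measure (Momentum s))
    refine (hp.integrable_comp_of_integrable hH2).congr (Eventually.of_forall fun x => ?_)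
    simp [Function.comp]
  rw [e1, integral_integral_swap hH]
  simp only [e2]
  rw [Measure.volume_eq_prod, integral_prod_symm _ hH2]
  have e3 : ∀ q, ∫ p, b p * conj (b q) * autocorr g (r - (p - q))
      = ∫ p, b (p + q) * conj (b q) * autocorr g (r - p) := fun q => by
    rw [← integral_add_right_eq_self _ q]
    simp
  simp only [e3]
  rw [integral_integral_swap (f := fun q p : Momentum s =>
    b (p + q) * conj (b q) * autocorr g (r - p)) hH3.swap]
  unfold conv
  refine integral_congr_ae (Eventually.of_forall fun p => ?_)
  simp only [integral_mul_const]
  simp only [autocorr, add_comm]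

theorem autocorr_zero (b : Momentum s → ℂ) : autocorr b 0 = ((∫ q, ‖b q‖ ^ 2 : ℝ) : ℂ) := by
  unfold autocorr
  rw [← integral_complex_ofReal]
  refine integral_congr_ae (Eventually.of_forall fun q => ?_)
  simp [Complex.mul_conj, Complex.normSq_eq_norm_sq]

end Convolution

/-! ### Square-integrated decay of products of three free waves -/

section ThreeWaves

variable {s : ℕ} {m : ℝ}

/-- The profile `(1 + |r|⁻¹) (1 + |r|)^{-(s+1)}` of the autocorrelation bound. -/
def corrProfile (r : Momentum s) : ℝ := (1 + ‖r‖⁻¹) * ((1 + ‖r‖) ^ (s + 1))⁻¹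

theorem corrProfile_nonneg (r : Momentum s) : 0 ≤ corrProfile r := by
  unfold corrProfile; positivity

theorem measurable_corrProfile : Measurable (corrProfile : Momentum s → ℝ) := by
  unfold corrProfile; fun_prop

/-- In dimension at least two, the power `3/2` of the profile is integrable. -/
theorem lintegral_corrProfile_lt_top (hs : 2 ≤ s) :
    ∫⁻ r : Momentum s, ENNReal.ofReal (√(corrProfile r) ^ 3) < ⊤ := by
  have : Nontrivial (Momentum s) := by
    have : Nonempty (Fin s) := ⟨⟨0, by omega⟩⟩
    infer_instance
  have hint : Integrable (fun r : Momentum s => √(corrProfile r) ^ 3) := by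
    have h := (integrable_fun_norm_addHaar (volume : Measure (Momentum s))
      (f := fun y : ℝ => √((1 + y⁻¹) * ((1 + y) ^ (s + 1))⁻¹) ^ 3)).2 ?_
    · exact h
    simp only [finrank_euclideanSpace_fin, smul_eq_mul]
    have hmeas : AEStronglyMeasurable (fun y : ℝ =>
        y ^ (s - 1) * √((1 + y⁻¹) * ((1 + y) ^ (s + 1))⁻¹) ^ 3) :=
      Measurable.aestronglyMeasurable (by fun_prop)
    rw [← Ioc_union_Ioi_eq_Ioi zero_le_one]
    refine IntegrableOn.union ?_ ?_
    · -- near the origin the integrand is at most of order `y ^ (-1/2)`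
      have hb : IntegrableOn (fun y : ℝ => 4 * y ^ (-(1 / 2 : ℝ))) (Ioc 0 1) :=
        (((intervalIntegral.intervalIntegrable_rpow' (by norm_num) (a := 0) (b := 1)).1).const_mul 4)
      refine hb.mono' hmeas.restrict ((ae_restrict_iff' measurableSet_Ioc).2
        (Eventually.of_forall fun y hy => ?_))
      have hy0 : 0 < y := hy.1
      have hz : √((1 + y⁻¹) * ((1 + y) ^ (s + 1))⁻¹) ≤ √(2 * y⁻¹) := by
        refine Real.sqrt_le_sqrt ?_
        have h1 : 1 ≤ y⁻¹ := (one_le_inv₀ hy0).2 hy.2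
        have h2 : ((1 + y) ^ (s + 1))⁻¹ ≤ 1 := inv_le_one_of_one_le₀ (one_le_pow₀ (by linarith))
        calc _ ≤ (1 + y⁻¹) * 1 := by gcongr
          _ ≤ _ := by linarith
      have h3 : √(2 * y⁻¹) ^ 3 = (2 * y⁻¹) * √(2 * y⁻¹) := by
        rw [pow_succ, Real.sq_sqrt (by positivity)]
      have h4 : √(2 * y⁻¹) ≤ 2 * y ^ (-(1 / 2 : ℝ)) := by
        rw [Real.sqrt_mul (by norm_num), Real.sqrt_inv, Real.rpow_neg hy0.le, ← Real.sqrt_eq_rpow]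
        gcongr
        rw [Real.sqrt_le_left (by norm_num)]; norm_num
      rw [Real.norm_of_nonneg (by positivity)]
      calc y ^ (s - 1) * √((1 + y⁻¹) * ((1 + y) ^ (s + 1))⁻¹) ^ 3
          ≤ y ^ 1 * √(2 * y⁻¹) ^ 3 := by
            gcongr ?_ * ?_ ^ 3
            exact pow_le_pow_of_le_one hy0.le hy.2 (by omega)
        _ = 2 * √(2 * y⁻¹) := by rw [h3]; field_simp
        _ ≤ 2 * (2 * y ^ (-(1 / 2 : ℝ))) := by gcongr
        _ = _ := by ring
    · -- at infinity the integrand decays at least like `y ^ (-3/2)`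
      have hb : IntegrableOn (fun y : ℝ => 4 * y ^ (-(3 / 2) : ℝ)) (Ioi 1) :=
        (integrableOn_Ioi_rpow_of_lt (by norm_num) zero_lt_one).const_mul 4
      refine hb.mono' hmeas.restrict ((ae_restrict_iff' measurableSet_Ioi).2
        (Eventually.of_forall fun y hy => ?_))
      have hy1 : 1 < y := hy
      have hy0 : 0 < y := by linarith
      have hz : √((1 + y⁻¹) * ((1 + y) ^ (s + 1))⁻¹) ≤ √(2 * (y ^ (s + 1))⁻¹) := by
        refine Real.sqrt_le_sqrt ?_
        have h1 : y⁻¹ ≤ 1 := inv_le_one_of_one_le₀ hy1.le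
        gcongr
        · linarith
        · linarith
      have h3 : √(2 * (y ^ (s + 1))⁻¹) ^ 3 = (2 * (y ^ (s + 1))⁻¹) * √(2 * (y ^ (s + 1))⁻¹) := by
        rw [pow_succ, Real.sq_sqrt (by positivity)]
      have h4 : √(2 * (y ^ (s + 1))⁻¹) ≤ 2 := by
        rw [Real.sqrt_le_left (by norm_num)]
        have : (y ^ (s + 1))⁻¹ ≤ 1 := inv_le_one_of_one_le₀ (one_le_pow₀ hy1.le)
        linarith
      rw [Real.norm_of_nonneg (by positivity)]
      have h5 : y ^ (s - 1) * (y ^ (s + 1))⁻¹ = y⁻¹ ^ 2 := by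
        have : y ^ (s + 1) = y ^ (s - 1) * y ^ 2 := by rw [← pow_add]; congr 1; omega
        rw [this]; field_simp
      calc y ^ (s - 1) * √((1 + y⁻¹) * ((1 + y) ^ (s + 1))⁻¹) ^ 3
          ≤ y ^ (s - 1) * √(2 * (y ^ (s + 1))⁻¹) ^ 3 := by gcongr
        _ = (y ^ (s - 1) * (y ^ (s + 1))⁻¹) * 2 * √(2 * (y ^ (s + 1))⁻¹) := by rw [h3]; ring
        _ ≤ (y ^ (s - 1) * (y ^ (s + 1))⁻¹) * 2 * 2 := by gcongr
        _ = 4 * y⁻¹ ^ 2 := by rw [h5]; ring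
        _ = 4 * y ^ (-2 : ℝ) := by rw [Real.rpow_neg hy0.le, inv_pow]; norm_cast
        _ ≤ _ := by
          gcongr
          · exact hy1.le
          · norm_num
  exact hint.lintegral_lt_top

theorem mul_mul_le_sqrt_cube {x y z : ℝ} (hx : 0 ≤ x) (hy : 0 ≤ y) (hz : 0 ≤ z) :
    x * y * z ≤ √x ^ 3 * √y ^ 3 + √y ^ 3 * √z ^ 3 + √x ^ 3 * √z ^ 3 := by
  obtain ⟨a, ha, rfl⟩ : ∃ a, 0 ≤ a ∧ a ^ 2 = x := ⟨√x, Real.sqrt_nonneg x, Real.sq_sqrt hx⟩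
  obtain ⟨b, hb, rfl⟩ : ∃ a, 0 ≤ a ∧ a ^ 2 = y := ⟨√y, Real.sqrt_nonneg y, Real.sq_sqrt hy⟩
  obtain ⟨c, hc, rfl⟩ : ∃ a, 0 ≤ a ∧ a ^ 2 = z := ⟨√z, Real.sqrt_nonneg z, Real.sq_sqrt hz⟩
  rw [Real.sqrt_sq ha, Real.sqrt_sq hb, Real.sqrt_sq hc]
  have h1 := mul_nonneg ha hb
  have h2 := mul_nonneg hb hc
  have h3 := mul_nonneg ha hc
  have key : ∀ u v w : ℝ, 0 ≤ u → 0 ≤ v → 0 ≤ w → u * v * w ≤ u ^ 3 + v ^ 3 + w ^ 3 := by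
    intro u v w hu hv hw
    nlinarith [mul_nonneg (add_nonneg (add_nonneg hu hv) hw) (sq_nonneg (u - v)),
      mul_nonneg (add_nonneg (add_nonneg hu hv) hw) (sq_nonneg (v - w)),
      mul_nonneg (add_nonneg (add_nonneg hu hv) hw) (sq_nonneg (u - w)),
      mul_nonneg (mul_nonneg hu hv) hw]
  have := key (a * b) (b * c) (a * c) h1 h2 h3
  nlinarith

theorem lintegral_corrProfile_mul_lt_top (hs : 2 ≤ s) :
    ∫⁻ p : Momentum s, ∫⁻ q : Momentum s,
      ENNReal.ofReal (corrProfile p * corrProfile q * corrProfile (-p - q)) < ⊤ := by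
  set ψ : Momentum s → ENNReal := fun r => ENNReal.ofReal (√(corrProfile r) ^ 3) with hψ
  have hψm : Measurable ψ := by
    have := measurable_corrProfile (s := s)
    fun_prop
  have hI := lintegral_corrProfile_lt_top hs
  have hneg : ∀ f : Momentum s → ENNReal, ∀ p, ∫⁻ q, f (-p - q) = ∫⁻ q, f q := fun f p => by
    exact lintegral_sub_left_eq_self f (-p)
  calc _ ≤ ∫⁻ p, ∫⁻ q, (ψ p * ψ q + ψ q * ψ (-p - q) + ψ p * ψ (-p - q)) := by
        gcongr with p q
        have h := mul_mul_le_sqrt_cube (corrProfile_nonneg p) (corrProfile_nonneg q)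
          (corrProfile_nonneg (-p - q))
        refine (ENNReal.ofReal_le_ofReal h).trans (le_of_eq ?_)
        rw [ENNReal.ofReal_add (by positivity) (by positivity),
          ENNReal.ofReal_add (by positivity) (by positivity), ENNReal.ofReal_mul (by positivity),
          ENNReal.ofReal_mul (by positivity), ENNReal.ofReal_mul (by positivity)]
    _ = (∫⁻ p, ψ p) * (∫⁻ q, ψ q) + (∫⁻ p, ψ p) * (∫⁻ q, ψ q) + (∫⁻ p, ψ p) * (∫⁻ q, ψ q) := by
        have e1 : ∀ p, ∫⁻ q, (ψ p * ψ q + ψ q * ψ (-p - q) + ψ p * ψ (-p - q))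
            = ψ p * (∫⁻ q, ψ q) + (∫⁻ q, ψ q * ψ (-p - q)) + ψ p * (∫⁻ q, ψ q) := fun p => by
          rw [lintegral_add_right _ (by fun_prop), lintegral_add_right _ (by fun_prop),
            lintegral_const_mul _ hψm, lintegral_const_mul _ (by fun_prop), hneg]
        simp only [e1]
        have m1 : Measurable fun p => ∫⁻ q, ψ q * ψ (-p - q) := by
          refine Measurable.lintegral_prod_right' (f := fun x : Momentum s × Momentum s =>
            ψ x.2 * ψ (-x.1 - x.2)) (by fun_prop)
        rw [lintegral_add_right _ (by fun_prop), lintegral_add_left (by fun_prop),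
          lintegral_mul_const _ hψm]
        congr 2
        rw [lintegral_lintegral_swap (by fun_prop)]
        have e2 : ∀ q, ∫⁻ p, ψ q * ψ (-p - q) = ψ q * ∫⁻ p, ψ p := fun q => by
          rw [lintegral_const_mul _ (by fun_prop)]
          congr 1
          rw [← hneg ψ q]
          congr 1; ext p; congr 1; abel
        simp only [e2]
        rw [lintegral_mul_const _ hψm]
    _ < ⊤ := by
        have := ENNReal.mul_lt_top hI hI
        simp only [ENNReal.add_lt_top]
        exact ⟨⟨this, this⟩, this⟩

/-- Bounds on the autocorrelations of three functions by the profile bound the `L²`-norm of their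
convolution. -/
theorem integral_norm_sq_conv_conv_le (hs : 2 ≤ s) : ∃ C : ℝ, 0 < C ∧
    ∀ (b₁ b₂ b₃ : Momentum s → ℂ) (B l₁ l₂ l₃ : ℝ), Integrable b₁ → Integrable b₂ → Integrable b₃ →
      Measurable b₁ → Measurable b₂ → Measurable b₃ → (∀ p, ‖b₃ p‖ ≤ B) →
      0 ≤ l₁ → 0 ≤ l₂ → 0 ≤ l₃ →
      (∀ r, r ≠ 0 → ‖autocorr b₁ r‖ ≤ l₁ * corrProfile r) →
      (∀ r, r ≠ 0 → ‖autocorr b₂ r‖ ≤ l₂ * corrProfile r) →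
      (∀ r, r ≠ 0 → ‖autocorr b₃ r‖ ≤ l₃ * corrProfile r) →
      ∫ k, ‖conv b₁ (conv b₂ b₃) k‖ ^ 2 ≤ C * (l₁ * l₂ * l₃) := by
  set I := ∫⁻ p : Momentum s, ∫⁻ q : Momentum s,
      ENNReal.ofReal (corrProfile p * corrProfile q * corrProfile (-p - q)) with hI
  have hIt : I < ⊤ := lintegral_corrProfile_mul_lt_top hs
  refine ⟨I.toReal + 1, by positivity, fun b₁ b₂ b₃ B l₁ l₂ l₃ i1 i2 i3 m1 m2 m3 hB h1 h2 h3
    a1 a2 a3 => ?_⟩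
  have : Nonempty (Fin s) := ⟨⟨0, by omega⟩⟩
  have hkey : autocorr (conv b₁ (conv b₂ b₃)) 0
      = ∫ p, autocorr b₁ p * ∫ q, autocorr b₂ q * autocorr b₃ (-p - q) := by
    rw [autocorr_conv i1 (integrable_conv i2 i3 m2 m3) m1 (measurable_conv m2 m3)
      (fun k => norm_conv_le i2 hB k)]
    unfold conv
    congr 1; ext p
    congr 1
    rw [zero_sub]
    have := autocorr_conv i2 i3 m2 m3 hB (-p)
    unfold conv at this
    exact this
  have hne : ∀ c : Momentum s, ∀ᵐ q : Momentum s, q ≠ c := fun c => by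
    simp [ae_iff, measure_singleton]
  have hle : ‖autocorr (conv b₁ (conv b₂ b₃)) 0‖ₑ ≤ ENNReal.ofReal (l₁ * l₂ * l₃) * I := by
    rw [hkey, hI, ← lintegral_const_mul' _ _ ENNReal.ofReal_ne_top]
    refine (enorm_integral_le_lintegral_enorm _).trans (lintegral_mono_ae ?_)
    filter_upwards [hne 0] with p hp
    rw [enorm_mul, ← lintegral_const_mul' _ _ ENNReal.ofReal_ne_top]
    refine (mul_le_mul_right (enorm_integral_le_lintegral_enorm _) _).trans ?_
    rw [← lintegral_const_mul' _ _ enorm_ne_top]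
    refine lintegral_mono_ae ?_
    filter_upwards [hne 0, hne (-p)] with q hq hq'
    have hpq : -p - q ≠ 0 := fun h => hq' (sub_eq_zero.1 h).symm
    rw [← enorm_mul, ← ENNReal.ofReal_mul (by positivity), ← ofReal_norm]
    refine ENNReal.ofReal_le_ofReal ?_
    rw [norm_mul, norm_mul]
    have c1 := corrProfile_nonneg p
    have c2 := corrProfile_nonneg q
    calc _ ≤ (l₁ * corrProfile p) * ((l₂ * corrProfile q) * (l₃ * corrProfile (-p - q))) := by
          gcongr
          · exact a1 p hp
          · exact a2 q hq
          · exact a3 _ hpq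
      _ = _ := by ring
  rw [autocorr_zero] at hle
  have hnn : 0 ≤ ∫ k, ‖conv b₁ (conv b₂ b₃) k‖ ^ 2 := integral_nonneg fun k => by positivity
  rw [← ofReal_norm, Complex.norm_real, Real.norm_of_nonneg hnn, ← ENNReal.ofReal_toReal hIt.ne,
    ← ENNReal.ofReal_mul (by positivity)] at hle
  have := (ENNReal.ofReal_le_ofReal_iff (by positivity)).1 hle
  nlinarith [mul_nonneg (mul_nonneg h1 h2) h3]

end ThreeWaves

/-! ### Densities of push-forwards with integrable characteristic function -/

section Density

variable {Y : Type*} [MeasurableSpace Y] {μ : Measure Y}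

/-- The Fourier transform `∫ R(e) e^{i e t} de` with the sign and normalization used for time. -/
def timeFourier (R : ℝ → ℂ) (t : ℝ) : ℂ := ∫ e, R e * Complex.exp (Complex.I * (e * t : ℝ))

theorem norm_exp_I_mul (x : ℝ) : ‖Complex.exp (Complex.I * (x : ℂ))‖ = 1 := by
  rw [mul_comm, Complex.norm_exp_ofReal_mul_I]

theorem norm_timeFourier_le (R : ℝ → ℂ) (t : ℝ) : ‖timeFourier R t‖ ≤ ∫ e, ‖R e‖ := by
  refine (norm_integral_le_integral_norm _).trans (le_of_eq ?_)
  simp only [norm_mul, norm_exp_I_mul, mul_one]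

theorem integral_comp_eq_of_contDiff [SFinite μ] {A : Y → ℂ} (hA : Integrable A μ) {E : Y → ℝ}
    (hE : Measurable E) {R : ℝ → ℂ} (hR : ContDiff ℝ ∞ R) (hRc : HasCompactSupport R) :
    ∫ y, A y * R (E y) ∂μ = (2 * Real.pi)⁻¹ *
      ∫ t, (∫ y, A y * Complex.exp (-(Complex.I * (E y * t : ℝ))) ∂μ) * timeFourier R t := by
  set S : 𝓢(ℝ, ℂ) := hRc.toSchwartzMap hR with hS
  have hSR : ∀ e, S e = R e := fun e => rfl
  have hFT : ∀ t, (𝓕 S) (-(2 * Real.pi)⁻¹ * t) = timeFourier R t := fun t => by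
    rw [SchwartzMap.fourier_coe, Real.fourier_eq']
    unfold timeFourier
    congr 1; ext v
    rw [smul_eq_mul, mul_comm, hSR]
    congr 2
    simp only [RCLike.inner_apply, conj_trivial]
    push_cast
    have : (Real.pi : ℂ) ≠ 0 := by exact_mod_cast Real.pi_ne_zero
    field_simp
  have hinv : ∀ e, R e = ∫ t : ℝ, (2 * Real.pi)⁻¹ *
      (timeFourier R t * Complex.exp (-(Complex.I * (e * t : ℝ)))) := fun e => by
    have h1 : R e = (𝓕⁻ (𝓕 S)) e := by rw [FourierTransform.fourierInv_fourier_eq, hSR]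
    rw [h1, SchwartzMap.fourierInv_coe, Real.fourierInv_eq']
    have h2 := (Measure.integral_comp_mul_left (fun ξ : ℝ =>
      Complex.exp ((2 * Real.pi * inner ℝ ξ e : ℝ) * Complex.I) • (𝓕 S) ξ) (-(2 * Real.pi)⁻¹))
    have h3 : |((-(2 * Real.pi)⁻¹)⁻¹ : ℝ)| = 2 * Real.pi := by
      rw [inv_neg, abs_neg, inv_inv, abs_of_pos (by positivity)]
    rw [h3] at h2
    have h4 : (∫ ξ : ℝ, Complex.exp ((2 * Real.pi * inner ℝ ξ e : ℝ) * Complex.I) • (𝓕 S) ξ)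
      = (2 * Real.pi)⁻¹ • ∫ t : ℝ, Complex.exp ((2 * Real.pi * inner ℝ (-(2 * Real.pi)⁻¹ * t) e : ℝ)
        * Complex.I) • (𝓕 S) (-(2 * Real.pi)⁻¹ * t) := by
      rw [h2, smul_smul, inv_mul_cancel₀ (by positivity), one_smul]
    rw [h4, ← integral_smul]
    congr 1; ext t
    rw [hFT, smul_eq_mul, Complex.real_smul]
    push_cast
    rw [mul_comm (Complex.exp _)]
    congr 3
    simp only [RCLike.inner_apply, conj_trivial]
    push_cast
    have : (Real.pi : ℂ) ≠ 0 := by exact_mod_cast Real.pi_ne_zero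
    field_simp
  have hint : Integrable (timeFourier R) := by
    have h1 : Integrable (fun t : ℝ => (𝓕 S) (-(2 * Real.pi)⁻¹ * t)) :=
      (𝓕 S).integrable.comp_mul_left' (by simp [Real.pi_ne_zero])
    exact h1.congr (Eventually.of_forall hFT)
  have hF : Integrable (fun x : Y × ℝ => A x.1 * timeFourier R x.2
      * Complex.exp (-(Complex.I * (E x.1 * x.2 : ℝ)))) (μ.prod volume) := by
    refine (hA.mul_prod hint).mul_bdd (c := 1) ?_ (Eventually.of_forall fun x => ?_)
    · exact Measurable.aestronglyMeasurable (by fun_prop)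
    · rw [← mul_neg, ← Complex.ofReal_neg, norm_exp_I_mul]
  calc ∫ y, A y * R (E y) ∂μ
      = ∫ y, ((2 * Real.pi)⁻¹ * ∫ t : ℝ, A y * timeFourier R t
          * Complex.exp (-(Complex.I * (E y * t : ℝ)))) ∂μ := by
        congr 1; ext y
        rw [hinv (E y), integral_const_mul, mul_left_comm, ← integral_const_mul]
        push_cast
        simp only [mul_assoc]
    _ = (2 * Real.pi)⁻¹ * ∫ t : ℝ, ∫ y, A y * timeFourier R t
          * Complex.exp (-(Complex.I * (E y * t : ℝ))) ∂μ := by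
        rw [integral_const_mul, integral_integral_swap hF]
    _ = _ := by
        congr 2; ext t
        rw [← integral_mul_const]
        congr 1; ext y; ring

/-- If the push-forward of the complex measure `A μ` under `E` has an integrable Fourier transform,
then it has a density, the inverse Fourier transform. -/
theorem integral_comp_eq_timeFourier [SFinite μ] {A : Y → ℂ} (hA : Integrable A μ) {E : Y → ℝ}
    (hE : Measurable E)
    (hN : Integrable fun t : ℝ => ∫ y, A y * Complex.exp (-(Complex.I * (E y * t : ℝ))) ∂μ)
    {R : ℝ → ℂ} (hRm : Measurable R) {B : ℝ} (hRB : ∀ e, ‖R e‖ ≤ B) (hRi : Integrable R) :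
    ∫ y, A y * R (E y) ∂μ = (2 * Real.pi)⁻¹ *
      ∫ t, (∫ y, A y * Complex.exp (-(Complex.I * (E y * t : ℝ))) ∂μ) * timeFourier R t := by
  set N : ℝ → ℂ := fun t => ∫ y, A y * Complex.exp (-(Complex.I * (E y * t : ℝ))) ∂μ with hNdef
  -- approximation of `R` in `L¹` of the sum of Lebesgue measure and the push-forward of `|A| μ`
  set ν : Measure ℝ := (μ.withDensity fun y => ‖A y‖ₑ).map E with hν
  have hνf : IsFiniteMeasure ν := by
    have : IsFiniteMeasure (μ.withDensity fun y => ‖A y‖ₑ) :=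
      isFiniteMeasure_withDensity hA.2.ne
    exact Measure.isFiniteMeasure_map _ _
  have hRν : Integrable R (ν + volume) := by
    refine Integrable.add_measure ?_ hRi
    exact (integrable_const B).mono' hRm.aestronglyMeasurable (Eventually.of_forall hRB)
  have : IsFiniteMeasureOnCompacts (ν + volume) := ⟨fun K hK => by
    rw [Measure.add_apply]
    exact ENNReal.add_lt_top.2 ⟨measure_lt_top _ _, hK.measure_lt_top⟩⟩
  set c : ℝ := ∫ t, ‖N t‖ with hc
  have hc0 : 0 ≤ c := integral_nonneg fun t => norm_nonneg _
  have hlin : ∀ g : ℝ → ℂ, Measurable g →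
      ENNReal.ofReal ‖∫ y, A y * g (E y) ∂μ‖ ≤ ∫⁻ e, ‖g e‖ₑ ∂ν := fun g hg => by
    rw [ofReal_norm, hν, lintegral_map hg.enorm hE]
    refine (enorm_integral_le_lintegral_enorm _).trans ?_
    rw [lintegral_withDensity_eq_lintegral_mul₀ hA.1.enorm (by fun_prop)]
    simp only [enorm_mul, Pi.mul_apply, le_refl]
  refine eq_of_forall_dist_le fun ε hε => ?_
  obtain ⟨g, hgc, hgs, hg⟩ := (memLp_one_iff_integrable.2 hRν).exist_eLpNorm_sub_le
    ENNReal.one_ne_top le_rfl (ε := ε / (1 + (2 * Real.pi)⁻¹ * c)) (by positivity)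
  set δ := ε / (1 + (2 * Real.pi)⁻¹ * c) with hδ
  have hδ0 : 0 < δ := by positivity
  have hgcont : Continuous g := hgs.continuous
  obtain ⟨B', hB'⟩ := hgc.exists_bound_of_continuous hgcont
  have hgi : Integrable g := hgcont.integrable_of_hasCompactSupport hgc
  have key := integral_comp_eq_of_contDiff hA hE hgs hgc
  rw [eLpNorm_one_eq_lintegral_enorm, lintegral_add_measure] at hg
  have hAR : ∀ f : ℝ → ℂ, Measurable f → (∃ B', ∀ e, ‖f e‖ ≤ B') →
      Integrable (fun y => A y * f (E y)) μ := fun f hf ⟨B', hB⟩ =>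
    hA.mul_bdd (c := B') (hf.comp hE).aestronglyMeasurable (Eventually.of_forall fun y => hB _)
  have hd1 : ‖(∫ y, A y * R (E y) ∂μ) - ∫ y, A y * g (E y) ∂μ‖ ≤ δ := by
    rw [← integral_sub (hAR R hRm ⟨B, hRB⟩) (hAR g hgcont.measurable ⟨B', hB'⟩)]
    have := (hlin (fun e => R e - g e) (hRm.sub hgcont.measurable)).trans
      ((le_self_add).trans hg)
    rw [ENNReal.ofReal_le_ofReal_iff hδ0.le] at this
    simpa only [mul_sub] using this
  have hvol : ∫ e, ‖R e - g e‖ ≤ δ := by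
    change ∫ e, ‖(R - g) e‖ ≤ δ
    rw [integral_norm_eq_lintegral_enorm (hRi.1.sub hgi.1)]
    refine ENNReal.toReal_le_of_le_ofReal hδ0.le ?_
    exact (le_add_self).trans hg
  have hTF : ∀ t, ‖timeFourier R t - timeFourier g t‖ ≤ δ := fun t => by
    have hexp : ∀ f : ℝ → ℂ, Integrable f →
        Integrable fun e : ℝ => f e * Complex.exp (Complex.I * (e * t : ℝ)) := fun f hf =>
      hf.mul_bdd (c := 1) (Continuous.aestronglyMeasurable (by fun_prop))
        (Eventually.of_forall fun e => (norm_exp_I_mul _).le)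
    have : timeFourier R t - timeFourier g t = timeFourier (fun e => R e - g e) t := by
      unfold timeFourier
      rw [← integral_sub (hexp R hRi) (hexp g hgi)]
      simp only [sub_mul]
    rw [this]
    exact (norm_timeFourier_le _ t).trans hvol
  have hTFm : ∀ f : ℝ → ℂ, Measurable f → AEStronglyMeasurable (timeFourier f) := fun f hf => by
    refine (StronglyMeasurable.integral_prod_right (f := fun t e : ℝ =>
      f e * Complex.exp (Complex.I * (e * t : ℝ)))
      (Measurable.stronglyMeasurable ?_)).aestronglyMeasurable
    unfold Function.uncurry; fun_prop
  have hNT : ∀ f : ℝ → ℂ, Measurable f → Integrable fun t => N t * timeFourier f t := fun f hf =>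
    hN.mul_bdd (c := ∫ e, ‖f e‖) (hTFm f hf) (Eventually.of_forall (norm_timeFourier_le f))
  have hd2 : ‖(2 * Real.pi)⁻¹ * (∫ t, N t * timeFourier R t)
      - (2 * Real.pi)⁻¹ * ∫ t, N t * timeFourier g t‖ ≤ (2 * Real.pi)⁻¹ * c * δ := by
    rw [← mul_sub, ← integral_sub (hNT R hRm) (hNT g hgcont.measurable), norm_mul]
    have h1 : ‖∫ t, (N t * timeFourier R t - N t * timeFourier g t)‖ ≤ c * δ := by
      rw [hc, ← integral_mul_const]
      refine norm_integral_le_of_norm_le (hN.norm.mul_const δ) (Eventually.of_forall fun t => ?_)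
      rw [← mul_sub, norm_mul]
      exact mul_le_mul_of_nonneg_left (hTF t) (norm_nonneg _)
    rw [Complex.norm_real, Real.norm_of_nonneg (by positivity), mul_assoc]
    gcongr
  rw [dist_eq_norm]
  calc _ = ‖((∫ y, A y * R (E y) ∂μ) - ∫ y, A y * g (E y) ∂μ)
        - ((2 * Real.pi)⁻¹ * (∫ t, N t * timeFourier R t)
      - (2 * Real.pi)⁻¹ * ∫ t, N t * timeFourier g t)‖ := by rw [key]; congr 1; ring
    _ ≤ δ + (2 * Real.pi)⁻¹ * c * δ := (norm_sub_le _ _).trans (add_le_add hd1 hd2)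
    _ = ε := by rw [hδ]; field_simp

end Density

/-! ### Free waves -/

section Waves

variable {s : ℕ} {m : ℝ}

/-- The momentum-space amplitude at time `t` of the free wave on the mass shell of sign `σ` which
is centred at the point `-x`, with weight `ω^{-M}`. For `t = 0` it is `ω^{-M} e^{-i k·x}` with
`k = (σ ω, p)`. -/
def wave (m : ℝ) (M : ℕ) (σ : ℝ) (x : Mink s) (t : ℝ) (p : Momentum s) : ℂ :=
  ((energy m p ^ M)⁻¹ : ℝ) *
    Complex.exp (Complex.I * (⟪p, spatial x⟫_ℝ - σ * (x 0 + t) * energy m p : ℝ))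

theorem norm_wave (hm : 0 < m) (M : ℕ) (σ : ℝ) (x : Mink s) (t : ℝ) (p : Momentum s) :
    ‖wave m M σ x t p‖ = (energy m p ^ M)⁻¹ := by
  have := energy_pos hm p
  rw [wave, norm_mul, norm_exp_I_mul, mul_one, Complex.norm_real, Real.norm_of_nonneg (by positivity)]

theorem continuous_inv_energy_pow (hm : 0 < m) (M : ℕ) :
    Continuous fun p : Momentum s => (energy m p ^ M)⁻¹ :=
  ((continuous_energy m).pow M).inv₀ fun q => (pow_pos (energy_pos hm q) M).ne'

theorem continuous_wave (hm : 0 < m) (M : ℕ) (σ : ℝ) (x : Mink s) :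
    Continuous fun z : ℝ × Momentum s => wave m M σ x z.1 z.2 := by
  unfold wave
  have h1 := (continuous_inv_energy_pow (s := s) hm M).comp (continuous_snd (X := ℝ))
  have h2 := (continuous_energy (s := s) m).comp (continuous_snd (X := ℝ))
  simp only [Function.comp_def] at h1 h2
  fun_prop

theorem continuous_wave_right (hm : 0 < m) (M : ℕ) (σ : ℝ) (x : Mink s) (t : ℝ) :
    Continuous (wave m M σ x t) := by
  have h1 := continuous_inv_energy_pow (s := s) hm M
  have h2 := continuous_energy (s := s) m
  unfold wave
  fun_prop

theorem integrable_wave (hm : 0 < m) {M : ℕ} (hM : s + 1 ≤ M) (σ : ℝ) (x : Mink s) (t : ℝ) :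
    Integrable (wave m M σ x t) :=
  (integrable_inv_energy_pow hm hM).mono' (continuous_wave_right hm M σ x t).aestronglyMeasurable
    (Eventually.of_forall fun p => (norm_wave hm M σ x t p).le)

theorem norm_wave_le (hm : 0 < m) (M : ℕ) (σ : ℝ) (x : Mink s) (t : ℝ) (p : Momentum s) :
    ‖wave m M σ x t p‖ ≤ (m ^ M)⁻¹ := by
  rw [norm_wave hm]
  have := le_energy m p
  gcongr

theorem wave_eq_wave_zero_mul (m : ℝ) (M : ℕ) (σ : ℝ) (x : Mink s) (t : ℝ) (p : Momentum s) :
    wave m M σ x t p = wave m M σ x 0 p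
      * Complex.exp (-(Complex.I * (σ * energy m p * t : ℝ))) := by
  unfold wave
  rw [mul_assoc (((energy m p ^ M)⁻¹ : ℝ) : ℂ), ← Complex.exp_add]
  congr 2
  push_cast; ring

theorem autocorr_wave (hm : 0 < m) (M : ℕ) (σ : ℝ) (x : Mink s) (t : ℝ) (r : Momentum s) :
    autocorr (wave m M σ x t) r = Complex.exp (Complex.I * (⟪r, spatial x⟫_ℝ : ℝ)) *
      ∫ q : Momentum s, Complex.exp (-(Complex.I * (σ * (x 0 + t)
          * (energy m (q + r) - energy m q) : ℝ))) * (pairWeight m M r q : ℂ) := by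
  unfold autocorr
  rw [← integral_const_mul]
  congr 1; ext q
  have hp := energy_pos hm (q + r)
  have hq := energy_pos hm q
  unfold wave pairWeight
  simp only [map_mul, Complex.conj_ofReal, ← Complex.exp_conj, Complex.conj_I]
  rw [mul_mul_mul_comm, ← Complex.exp_add, ← mul_assoc, ← Complex.exp_add, mul_comm]
  congr 1
  · congr 1
    rw [inner_add_left]; push_cast; ring
  · rw [mul_inv, mul_pow, inv_pow, inv_pow]; push_cast; ring

/-- The autocorrelation of a free wave decays like the inverse of the time. -/
theorem norm_autocorr_wave_le (s : ℕ) {m : ℝ} (hm : 0 < m) {M : ℕ} (hM : 2 * s + 6 ≤ M) :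
    ∃ C : ℝ, 0 < C ∧ ∀ (σ : ℝ) (x : Mink s) (t : ℝ) (r : Momentum s), |σ| = 1 → r ≠ 0 →
      ‖autocorr (wave m M σ x t) r‖ ≤ C / (1 + |t + x 0|) * corrProfile r := by
  obtain ⟨C₁, hC₁, h₁⟩ := norm_integral_phase_le s hm hM
  obtain ⟨C₂, hC₂, h₂⟩ := pairWeight_le s hm (M := M) (by omega)
  have hint : Integrable (fun q : Momentum s => (energy m q ^ (s + 1))⁻¹) :=
    integrable_inv_energy_pow hm le_rfl
  set J := ∫ q : Momentum s, (energy m q ^ (s + 1))⁻¹ with hJ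
  have hJ0 : 0 ≤ J := integral_nonneg fun q => inv_nonneg.2 (pow_nonneg (energy_nonneg m q) _)
  refine ⟨C₁ + C₂ * J, by positivity, fun σ x t r hσ hr => ?_⟩
  rw [autocorr_wave hm, norm_mul, norm_exp_I_mul, one_mul, div_mul_eq_mul_div,
    le_div_iff₀ (by positivity), mul_comm, add_mul, one_mul]
  have hτ : |t + x 0| = |σ * (x 0 + t)| := by rw [abs_mul, hσ, one_mul, add_comm]
  have hr' : 0 < ‖r‖ := norm_pos_iff.2 hr
  have b1 := h₁ (σ * (x 0 + t)) r hr
  have b2 : ‖∫ q : Momentum s, Complex.exp (-(Complex.I * (σ * (x 0 + t)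
      * (energy m (q + r) - energy m q) : ℝ))) * (pairWeight m M r q : ℂ)‖
      ≤ C₂ * ((1 + ‖r‖) ^ (s + 1))⁻¹ * J := by
    rw [hJ, ← integral_const_mul]
    refine norm_integral_le_of_norm_le (hint.const_mul _) (Eventually.of_forall fun q => ?_)
    rw [norm_mul, ← mul_neg, ← Complex.ofReal_neg, norm_exp_I_mul, one_mul, Complex.norm_real,
      Real.norm_of_nonneg (pairWeight_nonneg hm M r q)]
    exact h₂ r q
  rw [hτ]
  refine (add_le_add b2 b1).trans ?_
  unfold corrProfile
  have hw : 0 ≤ ((1 + ‖r‖) ^ (s + 1))⁻¹ := by positivity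
  have hi : 0 ≤ ‖r‖⁻¹ := by positivity
  set w := ((1 + ‖r‖) ^ (s + 1))⁻¹
  set i := ‖r‖⁻¹
  nlinarith [mul_nonneg hC₁.le hw, mul_nonneg (mul_nonneg (mul_nonneg hC₂.le hJ0) hw) hi]

/-- The product of three free waves at time `t`, in momentum space. -/
def threeWave (m : ℝ) (M : ℕ) (σ : Fin 3 → ℝ) (x : Fin 3 → Mink s) (t : ℝ) (k : Momentum s) : ℂ :=
  conv (wave m M (σ 0) (x 0) t) (conv (wave m M (σ 1) (x 1) t) (wave m M (σ 2) (x 2) t)) k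

theorem lintegral_sqrt_inv_cube_lt_top :
    ∫⁻ t : ℝ, ENNReal.ofReal (√((1 + |t|)⁻¹) ^ 3) < ⊤ := by
  have h := integrable_one_add_norm (E := ℝ) (μ := volume) (r := 3 / 2) (by simp; norm_num)
  refine (Integrable.lintegral_lt_top (h.congr (Eventually.of_forall fun t => ?_)))
  have ht : (0 : ℝ) ≤ 1 + |t| := by positivity
  simp only [Real.norm_eq_abs]
  rw [Real.sqrt_eq_rpow, ← Real.rpow_natCast, ← Real.rpow_mul (by positivity), Real.inv_rpow ht,
    Real.rpow_neg ht]
  norm_num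

theorem stronglyMeasurable_threeWave (hm : 0 < m) (M : ℕ) (σ : Fin 3 → ℝ) (x : Fin 3 → Mink s) :
    StronglyMeasurable fun z : Momentum s × ℝ => threeWave m M σ x z.2 z.1 := by
  have h : ∀ i, Continuous fun z : ℝ × Momentum s => wave m M (σ i) (x i) z.1 z.2 :=
    fun i => continuous_wave hm M _ _
  unfold threeWave conv
  refine StronglyMeasurable.integral_prod_right' (f := fun z : (Momentum s × ℝ) × Momentum s =>
    wave m M (σ 0) (x 0) z.1.2 z.2 * ∫ q, wave m M (σ 1) (x 1) z.1.2 q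
      * wave m M (σ 2) (x 2) z.1.2 (z.1.1 - z.2 - q)) (StronglyMeasurable.mul ?_ ?_)
  · exact ((h 0).comp (by fun_prop : Continuous fun z : (Momentum s × ℝ) × Momentum s =>
      (z.1.2, z.2))).stronglyMeasurable
  · refine StronglyMeasurable.integral_prod_right'
      (f := fun z : ((Momentum s × ℝ) × Momentum s) × Momentum s =>
        wave m M (σ 1) (x 1) z.1.1.2 z.2 * wave m M (σ 2) (x 2) z.1.1.2 (z.1.1.1 - z.1.2 - z.2))
      (StronglyMeasurable.mul ?_ ?_)
    · exact ((h 1).comp (by fun_prop : Continuous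
        fun z : ((Momentum s × ℝ) × Momentum s) × Momentum s =>
        (z.1.1.2, z.2))).stronglyMeasurable
    · exact ((h 2).comp (by fun_prop : Continuous
        fun z : ((Momentum s × ℝ) × Momentum s) × Momentum s =>
        (z.1.1.2, (z.1.1.1 - z.1.2 - z.2)))).stronglyMeasurable

/-- Products of three free waves are absolutely integrable in time, uniformly in their centres. -/
theorem lintegral_threeWave_le (hs : 2 ≤ s) (hm : 0 < m) {M L : ℕ} (hM : 2 * s + 6 ≤ M)
    (hL : s + 1 ≤ L) : ∃ C : ℝ, 0 < C ∧ ∀ (σ : Fin 3 → ℝ) (x : Fin 3 → Mink s) (Q : Momentum s),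
      (∀ i, |σ i| = 1) →
      ∫⁻ t : ℝ, ∫⁻ k : Momentum s,
        ENNReal.ofReal (‖threeWave m M σ x t k‖ * (energy m (k + Q) ^ L)⁻¹) ≤ ENNReal.ofReal C := by
  obtain ⟨C₁, hC₁, h₁⟩ := integral_norm_sq_conv_conv_le hs
  obtain ⟨C₂, hC₂, h₂⟩ := norm_autocorr_wave_le s hm hM
  have hint : Integrable (fun q : Momentum s => ((energy m q ^ L)⁻¹) ^ 2) := by
    simp only [inv_pow, ← pow_mul]
    exact integrable_inv_energy_pow hm (by omega)
  set J := ∫ q : Momentum s, ((energy m q ^ L)⁻¹) ^ 2 with hJ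
  have hJ0 : 0 ≤ J := integral_nonneg fun q => by positivity
  set I := ∫⁻ t : ℝ, ENNReal.ofReal (√((1 + |t|)⁻¹) ^ 3) with hI
  have hIt : I < ⊤ := lintegral_sqrt_inv_cube_lt_top
  set D : ℝ := (C₁ + J) * √C₂ ^ 3 with hD
  have hD0 : 0 ≤ D := by positivity
  refine ⟨D * (3 * I.toReal) + 1, by positivity, fun σ x Q hσ => ?_⟩
  -- `l i` bounds the autocorrelation of the `i`-th wave at time `t`
  set l : Fin 3 → ℝ → ℝ := fun i t => C₂ / (1 + |t + x i 0|) with hl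
  have hlpos : ∀ i t, 0 < l i t := fun i t => by positivity
  have hinner : ∀ t, ∫⁻ k : Momentum s,
      ENNReal.ofReal (‖threeWave m M σ x t k‖ * (energy m (k + Q) ^ L)⁻¹)
      ≤ ENNReal.ofReal ((C₁ + J) * √(l 0 t * l 1 t * l 2 t)) := fun t => by
    have hΛ : 0 < l 0 t * l 1 t * l 2 t := mul_pos (mul_pos (hlpos 0 t) (hlpos 1 t)) (hlpos 2 t)
    set Λ := l 0 t * l 1 t * l 2 t with hΛdef
    have hδ : 0 < √Λ := Real.sqrt_pos.2 hΛ
    have iw : ∀ i, Integrable (wave m M (σ i) (x i) t) := fun i =>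
      integrable_wave hm (by omega) _ _ _
    have mw : ∀ i, Measurable (wave m M (σ i) (x i) t) := fun i =>
      (continuous_wave_right hm M _ _ t).measurable
    have hsq : ∫ k, ‖threeWave m M σ x t k‖ ^ 2 ≤ C₁ * Λ :=
      h₁ _ _ _ ((m ^ M)⁻¹) (l 0 t) (l 1 t) (l 2 t) (iw 0) (iw 1) (iw 2) (mw 0) (mw 1) (mw 2)
        (norm_wave_le hm M _ _ t) (hlpos 0 t).le (hlpos 1 t).le (hlpos 2 t).le
        (fun r hr => h₂ _ _ _ r (hσ 0) hr) (fun r hr => h₂ _ _ _ r (hσ 1) hr)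
        (fun r hr => h₂ _ _ _ r (hσ 2) hr)
    have hNi : Integrable (threeWave m M σ x t) :=
      integrable_conv (iw 0) (integrable_conv (iw 1) (iw 2) (mw 1) (mw 2)) (mw 0)
        (measurable_conv (mw 1) (mw 2))
    have hNb := norm_conv_le (iw 0) (norm_conv_le (iw 1) (norm_wave_le hm M (σ 2) (x 2) t))
    have hNsq : Integrable (fun k => ‖threeWave m M σ x t k‖ ^ 2) := by
      simp only [sq]
      exact hNi.norm.mul_bdd (c := _) hNi.norm.1 (Eventually.of_forall fun k => by
        rw [norm_norm]; exact hNb k)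
    have hcQ : Integrable (fun k : Momentum s => ((energy m (k + Q) ^ L)⁻¹) ^ 2) :=
      hint.comp_add_right Q
    have hdom : Integrable (fun k => (√Λ)⁻¹ * ‖threeWave m M σ x t k‖ ^ 2
        + √Λ * ((energy m (k + Q) ^ L)⁻¹) ^ 2) := (hNsq.const_mul _).add (hcQ.const_mul _)
    calc _ ≤ ∫⁻ k : Momentum s, ENNReal.ofReal ((√Λ)⁻¹ * ‖threeWave m M σ x t k‖ ^ 2
        + √Λ * ((energy m (k + Q) ^ L)⁻¹) ^ 2) := by
          refine lintegral_mono fun k => ENNReal.ofReal_le_ofReal ?_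
          have hE := energy_pos hm (k + Q)
          set u := ‖threeWave m M σ x t k‖
          set v := (energy m (k + Q) ^ L)⁻¹
          have hu : 0 ≤ u := norm_nonneg _
          have hv : 0 ≤ v := by positivity
          have e : (√Λ)⁻¹ * u ^ 2 + √Λ * v ^ 2 - 2 * (u * v) = (√Λ)⁻¹ * (u - √Λ * v) ^ 2 := by
            field_simp; ring
          have : 0 ≤ (√Λ)⁻¹ * (u - √Λ * v) ^ 2 := by positivity
          nlinarith [mul_nonneg hu hv]
      _ = ENNReal.ofReal (∫ k, ((√Λ)⁻¹ * ‖threeWave m M σ x t k‖ ^ 2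
        + √Λ * ((energy m (k + Q) ^ L)⁻¹) ^ 2)) := by
          rw [ofReal_integral_eq_lintegral_ofReal hdom (Eventually.of_forall fun k => by positivity)]
      _ ≤ _ := by
          refine ENNReal.ofReal_le_ofReal ?_
          rw [integral_add (hNsq.const_mul _) (hcQ.const_mul _), integral_const_mul,
            integral_const_mul, integral_add_right_eq_self (fun k : Momentum s =>
              ((energy m k ^ L)⁻¹) ^ 2) Q, ← hJ]
          have : (√Λ)⁻¹ * (C₁ * Λ) = C₁ * √Λ := by
            nth_rewrite 2 [← Real.sq_sqrt hΛ.le]; field_simp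
          nlinarith [mul_le_mul_of_nonneg_left hsq (inv_nonneg.2 hδ.le)]
  have hpt : ∀ t, (C₁ + J) * √(l 0 t * l 1 t * l 2 t)
      ≤ D * (∑ i, √((1 + |t + x i 0|)⁻¹) ^ 3) := fun t => by
    have hle : ∀ i, √(l i t) = √C₂ * √((1 + |t + x i 0|)⁻¹) := fun i => by
      simp only [hl]
      rw [div_eq_mul_inv, Real.sqrt_mul hC₂.le]
    rw [Real.sqrt_mul (mul_pos (hlpos 0 t) (hlpos 1 t)).le, Real.sqrt_mul (hlpos 0 t).le, hle, hle,
      hle, Fin.sum_univ_three]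
    have key : ∀ u v w : ℝ, 0 ≤ u → 0 ≤ v → 0 ≤ w → u * v * w ≤ u ^ 3 + v ^ 3 + w ^ 3 := by
      intro u v w hu hv hw
      nlinarith [mul_nonneg (add_nonneg (add_nonneg hu hv) hw) (sq_nonneg (u - v)),
        mul_nonneg (add_nonneg (add_nonneg hu hv) hw) (sq_nonneg (v - w)),
        mul_nonneg (add_nonneg (add_nonneg hu hv) hw) (sq_nonneg (u - w)),
        mul_nonneg (mul_nonneg hu hv) hw]
    have := key (√((1 + |t + x 0 0|)⁻¹)) (√((1 + |t + x 1 0|)⁻¹)) (√((1 + |t + x 2 0|)⁻¹))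
      (Real.sqrt_nonneg _) (Real.sqrt_nonneg _) (Real.sqrt_nonneg _)
    refine le_trans (le_of_eq ?_) (mul_le_mul_of_nonneg_left this hD0)
    rw [hD]; ring
  have hmeas : Measurable fun t : ℝ => ENNReal.ofReal (√((1 + |t|)⁻¹) ^ 3) := by fun_prop
  calc _ ≤ ∫⁻ t : ℝ, ENNReal.ofReal D * ∑ i, ENNReal.ofReal (√((1 + |t + x i 0|)⁻¹) ^ 3) := by
        refine lintegral_mono fun t => (hinner t).trans ?_
        rw [← ENNReal.ofReal_sum_of_nonneg (fun i _ => by positivity), ← ENNReal.ofReal_mul hD0]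
        exact ENNReal.ofReal_le_ofReal (hpt t)
    _ = ENNReal.ofReal D * (3 * I) := by
        rw [lintegral_const_mul _ (by fun_prop), lintegral_finsetSum _ (fun i _ => by fun_prop)]
        have : ∀ i, ∫⁻ t : ℝ, ENNReal.ofReal (√((1 + |t + x i 0|)⁻¹) ^ 3) = I := fun i =>
          lintegral_add_right_eq_self (fun t : ℝ => ENNReal.ofReal (√((1 + |t|)⁻¹) ^ 3)) (x i 0)
        rw [Finset.sum_congr rfl fun i _ => this i]
        simp
    _ ≤ _ := by
        rw [← ENNReal.ofReal_toReal hIt.ne]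
        have : (3 : ENNReal) = ENNReal.ofReal 3 := by norm_num
        rw [this, ← ENNReal.ofReal_mul (by norm_num), ← ENNReal.ofReal_mul hD0]
        refine ENNReal.ofReal_le_ofReal ?_
        rw [ENNReal.toReal_ofReal ENNReal.toReal_nonneg]
        linarith

end Waves

/-! ### Time representation of products of free waves -/

section SpectralRep

variable {s : ℕ} {m : ℝ}

/-- The functions `R(k, e)` of the total momentum and the total energy that are integrated against a
product of free waves. -/
structure IsKernel (R : Momentum s → ℝ → ℂ) : Prop where
  measurable : Measurable (Function.uncurry R)
  bounded : ∃ B, ∀ k e, ‖R k e‖ ≤ B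
  integrable : ∀ k, Integrable (R k)

theorem IsKernel.measurable_right {R : Momentum s → ℝ → ℂ} (hR : IsKernel R) (k : Momentum s) :
    Measurable (R k) :=
  hR.measurable.comp measurable_prodMk_left

theorem IsKernel.measurable_timeFourier {R : Momentum s → ℝ → ℂ} (hR : IsKernel R) :
    Measurable fun z : Momentum s × ℝ => timeFourier (R z.1) z.2 := by
  unfold timeFourier
  refine (StronglyMeasurable.integral_prod_right' (f := fun z : (Momentum s × ℝ) × ℝ =>
    R z.1.1 z.2 * Complex.exp (Complex.I * (z.2 * z.1.2 : ℝ)))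
    (Measurable.stronglyMeasurable ?_)).measurable
  have h1 : Measurable fun z : (Momentum s × ℝ) × ℝ => R z.1.1 z.2 :=
    hR.measurable.comp (by fun_prop : Measurable fun z : (Momentum s × ℝ) × ℝ => (z.1.1, z.2))
  exact h1.mul (by fun_prop)

/-- The translate of `R` by the momentum `p` and the energy `e₀`. -/
def shiftKernel (p : Momentum s) (e₀ : ℝ) (R : Momentum s → ℝ → ℂ) (k : Momentum s) (e : ℝ) : ℂ :=
  R (k + p) (e + e₀)

theorem IsKernel.shift {R : Momentum s → ℝ → ℂ} (hR : IsKernel R) (p : Momentum s) (e₀ : ℝ) :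
    IsKernel (shiftKernel p e₀ R) where
  measurable := hR.measurable.comp
    (by fun_prop : Measurable fun z : Momentum s × ℝ => (z.1 + p, z.2 + e₀))
  bounded := by obtain ⟨B, hB⟩ := hR.bounded; exact ⟨B, fun k e => hB _ _⟩
  integrable k := (hR.integrable (k + p)).comp_add_right e₀

theorem timeFourier_shiftKernel (R : Momentum s → ℝ → ℂ) (p : Momentum s) (e₀ t : ℝ)
    (k : Momentum s) :
    timeFourier (shiftKernel p e₀ R k) t
      = Complex.exp (-(Complex.I * (e₀ * t : ℝ))) * timeFourier (R (k + p)) t := by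
  unfold timeFourier
  rw [← integral_const_mul,
    ← integral_add_right_eq_self (fun e : ℝ => Complex.exp (-(Complex.I * (e₀ * t : ℝ)))
      * (R (k + p) e * Complex.exp (Complex.I * (e * t : ℝ)))) e₀]
  congr 1; ext e
  rw [mul_left_comm, ← Complex.exp_add, shiftKernel]
  congr 2
  push_cast; ring

theorem norm_exp_neg_I_mul (x : ℝ) : ‖Complex.exp (-(Complex.I * (x : ℂ)))‖ = 1 := by
  rw [← mul_neg, ← Complex.ofReal_neg, norm_exp_I_mul]

/-- The functional `T` on kernels depends on a kernel `R` only through its Fourier transform in the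
energy, and is given by integrating this Fourier transform over times and momenta with a complex
density `n`. Integrals of `n` with weight `ω^{-L}`, centred at any point, are bounded by `C`. -/
def HasSpectralRep (m : ℝ) (L : ℕ) (C : ℝ) (T : (Momentum s → ℝ → ℂ) → ℂ) : Prop :=
  ∃ (Z : Type) (_ : MeasurableSpace Z) (ν : Measure Z) (_ : SFinite ν) (n : Z → ℂ)
    (κ : Z → Momentum s) (τ : Z → ℝ), AEStronglyMeasurable n ν ∧ Measurable κ ∧ Measurable τ ∧
    (∀ Q, Integrable (fun z => ‖n z‖ * (energy m (κ z + Q) ^ L)⁻¹) ν ∧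
      ∫ z, ‖n z‖ * (energy m (κ z + Q) ^ L)⁻¹ ∂ν ≤ C) ∧
    ∀ R, IsKernel R → (∃ B Q, ∀ k t, ‖timeFourier (R k) t‖ ≤ B * (energy m (k + Q) ^ L)⁻¹) →
      T R = ∫ z, n z * timeFourier (R (κ z)) (τ z) ∂ν

/-- Adding one more particle with an integrable amplitude to a functional with a time
representation. -/
theorem HasSpectralRep.addParticle (hm : 0 < m) {L : ℕ} {C : ℝ} {T : (Momentum s → ℝ → ℂ) → ℂ}
    (hT : HasSpectralRep m L C T) {a : Momentum s → ℂ} (ha : Integrable a) {e₀ : Momentum s → ℝ}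
    (he : Measurable e₀) :
    HasSpectralRep m L (C * ∫ p, ‖a p‖) fun R => ∫ p, a p * T (shiftKernel p (e₀ p) R) := by
  obtain ⟨Z, mZ, ν, hν, n, κ, τ, hn, hκ, hτ, hb, hrep⟩ := hT
  have hcE : Continuous fun p : Momentum s => (energy m p ^ L)⁻¹ := continuous_inv_energy_pow hm L
  have hmeas0 : AEStronglyMeasurable (fun z : Momentum s × Z =>
      a z.1 * n z.2 * Complex.exp (-(Complex.I * (e₀ z.1 * τ z.2 : ℝ)))) (volume.prod ν) := by
    refine (ha.1.comp_fst.mul hn.comp_snd).mul (Measurable.aestronglyMeasurable ?_)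
    have h1 : Measurable fun z : Momentum s × Z => e₀ z.1 := he.comp measurable_fst
    have h2 : Measurable fun z : Momentum s × Z => τ z.2 := hτ.comp measurable_snd
    fun_prop
  have hκ' : Measurable fun z : Momentum s × Z => κ z.2 + z.1 :=
    (hκ.comp measurable_snd).add measurable_fst
  have hnorm : ∀ z : Momentum s × Z,
      ‖a z.1 * n z.2 * Complex.exp (-(Complex.I * (e₀ z.1 * τ z.2 : ℝ)))‖ = ‖a z.1‖ * ‖n z.2‖ :=
    fun z => by rw [norm_mul, norm_exp_neg_I_mul, mul_one, norm_mul]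
  have hint : ∀ Q, Integrable (fun z : Momentum s × Z => ‖a z.1‖ * ‖n z.2‖
      * (energy m (κ z.2 + z.1 + Q) ^ L)⁻¹) (volume.prod ν) ∧
      ∫ z : Momentum s × Z, ‖a z.1‖ * ‖n z.2‖
      * (energy m (κ z.2 + z.1 + Q) ^ L)⁻¹ ∂(volume.prod ν) ≤ C * ∫ p, ‖a p‖ := fun Q => by
    have hm1 : AEStronglyMeasurable (fun z : Momentum s × Z => ‖a z.1‖ * ‖n z.2‖
      * (energy m (κ z.2 + z.1 + Q) ^ L)⁻¹) (volume.prod ν) := by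
      refine (ha.1.comp_fst.norm.mul hn.comp_snd.norm).mul ?_
      exact (hcE.measurable.comp (hκ'.add_const Q)).aestronglyMeasurable
    have hre : ∀ p z, ‖a p‖ * ‖n z‖ * (energy m (κ z + p + Q) ^ L)⁻¹
        = ‖a p‖ * (‖n z‖ * (energy m (κ z + (p + Q)) ^ L)⁻¹) := fun p z => by
      rw [mul_assoc, add_assoc]
    have hnn : ∀ p z, 0 ≤ ‖a p‖ * ‖n z‖ * (energy m (κ z + p + Q) ^ L)⁻¹ := fun p z => by
      have := energy_nonneg m (κ z + p + Q); positivity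
    have hin : Integrable (fun p => ∫ z, ‖‖a p‖ * ‖n z‖ * (energy m (κ z + p + Q) ^ L)⁻¹‖ ∂ν) := by
      refine (ha.norm.mul_const C).mono' hm1.norm.integral_prod_right'
        (Eventually.of_forall fun p => ?_)
      rw [Real.norm_of_nonneg (integral_nonneg fun z => norm_nonneg _)]
      simp only [Real.norm_of_nonneg (hnn _ _)]
      simp only [hre, integral_const_mul]
      exact mul_le_mul_of_nonneg_left (hb _).2 (norm_nonneg _)
    have hI : Integrable (fun z : Momentum s × Z => ‖a z.1‖ * ‖n z.2‖
      * (energy m (κ z.2 + z.1 + Q) ^ L)⁻¹) (volume.prod ν) := by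
      refine (integrable_prod_iff hm1).2 ⟨Eventually.of_forall fun p => ?_, hin⟩
      simp only [hre]
      exact (hb (p + Q)).1.const_mul _
    refine ⟨hI, ?_⟩
    rw [integral_prod _ hI, ← integral_const_mul]
    refine integral_mono_of_nonneg (Eventually.of_forall fun p => integral_nonneg fun z => hnn p z)
      (ha.norm.const_mul C) (Eventually.of_forall fun p => ?_)
    simp only [hre, integral_const_mul]
    rw [mul_comm C]
    exact mul_le_mul_of_nonneg_left (hb _).2 (norm_nonneg _)
  refine ⟨Momentum s × Z, inferInstance, volume.prod ν, inferInstance,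
    fun z => a z.1 * n z.2 * Complex.exp (-(Complex.I * (e₀ z.1 * τ z.2 : ℝ))),
    fun z => κ z.2 + z.1, fun z => τ z.2, hmeas0, hκ', hτ.comp measurable_snd, fun Q => ?_,
    fun R hR hRb => ?_⟩
  · simp only [hnorm]
    exact hint Q
  · obtain ⟨B, Q, hB⟩ := hRb
    have hE : ∀ p, T (shiftKernel p (e₀ p) R)
        = ∫ z, n z * (Complex.exp (-(Complex.I * (e₀ p * τ z : ℝ)))
          * timeFourier (R (κ z + p)) (τ z)) ∂ν := fun p => by
      rw [hrep _ (hR.shift p (e₀ p)) ⟨B, p + Q, fun k t => ?_⟩]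
      · simp only [timeFourier_shiftKernel]
      · rw [timeFourier_shiftKernel, norm_mul, norm_exp_neg_I_mul, one_mul, ← add_assoc]
        exact hB _ _
    have hI : Integrable (fun z : Momentum s × Z => a z.1 * n z.2
        * Complex.exp (-(Complex.I * (e₀ z.1 * τ z.2 : ℝ)))
        * timeFourier (R (κ z.2 + z.1)) (τ z.2)) (volume.prod ν) := by
      refine ((hint Q).1.mul_const B).mono' (hmeas0.mul ?_) (Eventually.of_forall fun z => ?_)
      · exact (hR.measurable_timeFourier.comp
          (hκ'.prodMk (hτ.comp measurable_snd))).aestronglyMeasurable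
      · rw [norm_mul, hnorm, mul_assoc (‖a z.1‖ * ‖n z.2‖), mul_comm _ B]
        exact mul_le_mul_of_nonneg_left (hB _ _) (by positivity)
    rw [integral_prod _ hI]
    refine integral_congr_ae (Eventually.of_forall fun p => ?_)
    simp only
    rw [hE, ← integral_const_mul]
    refine integral_congr_ae (Eventually.of_forall fun z => ?_)
    simp only
    ring

/-- The time representation of a product of three free waves. -/
theorem hasSpectralRep_threeWave (hs : 2 ≤ s) (hm : 0 < m) {M L : ℕ} (hM : 2 * s + 6 ≤ M)
    (hL : s + 1 ≤ L) : ∃ C : ℝ, 0 < C ∧ ∀ (σ : Fin 3 → ℝ) (x : Fin 3 → Mink s), (∀ i, |σ i| = 1) →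
      HasSpectralRep m L C fun R => ∫ p, wave m M (σ 0) (x 0) 0 p * ∫ q, wave m M (σ 1) (x 1) 0 q
        * ∫ r, wave m M (σ 2) (x 2) 0 r
          * R (r + q + p) (σ 2 * energy m r + σ 1 * energy m q + σ 0 * energy m p) := by
  obtain ⟨C, hC, hbd⟩ := lintegral_threeWave_le hs hm hM hL
  refine ⟨C, hC, fun σ x hσ => ?_⟩
  have hc := continuous_inv_energy_pow (s := s) hm L
  have hNm := stronglyMeasurable_threeWave hm M σ x
  have hπ : (0 : ℝ) ≤ (2 * Real.pi)⁻¹ := by positivity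
  have hπ1 : (2 * Real.pi)⁻¹ ≤ 1 := inv_le_one_of_one_le₀ (by linarith [Real.pi_gt_three])
  have hint : ∀ Q, Integrable (fun z : Momentum s × ℝ => ‖threeWave m M σ x z.2 z.1‖
        * (energy m (z.1 + Q) ^ L)⁻¹) ∧
      ∫ z : Momentum s × ℝ, ‖threeWave m M σ x z.2 z.1‖ * (energy m (z.1 + Q) ^ L)⁻¹ ≤ C := fun Q => by
    have hm1 : Measurable (fun z : Momentum s × ℝ => ‖threeWave m M σ x z.2 z.1‖
        * (energy m (z.1 + Q) ^ L)⁻¹) :=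
      hNm.norm.measurable.mul (hc.comp (by fun_prop)).measurable
    have hnn : ∀ z : Momentum s × ℝ, 0 ≤ ‖threeWave m M σ x z.2 z.1‖
        * (energy m (z.1 + Q) ^ L)⁻¹ := fun z => by
      have := energy_nonneg m (z.1 + Q); positivity
    have hlin : ∫⁻ z : Momentum s × ℝ, ENNReal.ofReal (‖threeWave m M σ x z.2 z.1‖
        * (energy m (z.1 + Q) ^ L)⁻¹) ≤ ENNReal.ofReal C := by
      rw [Measure.volume_eq_prod, lintegral_prod_symm' _ hm1.ennreal_ofReal]
      exact hbd σ x Q hσ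
    have hI : Integrable (fun z : Momentum s × ℝ => ‖threeWave m M σ x z.2 z.1‖
        * (energy m (z.1 + Q) ^ L)⁻¹) := by
      refine ⟨hm1.aestronglyMeasurable, ?_⟩
      rw [hasFiniteIntegral_iff_ofReal (Eventually.of_forall hnn)]
      exact hlin.trans_lt ENNReal.ofReal_lt_top
    refine ⟨hI, ?_⟩
    rw [integral_eq_lintegral_of_nonneg_ae (Eventually.of_forall hnn) hI.1]
    exact ENNReal.toReal_le_of_le_ofReal hC.le hlin
  refine ⟨Momentum s × ℝ, inferInstance, volume, inferInstance,
    fun z => (2 * Real.pi)⁻¹ * threeWave m M σ x z.2 z.1, Prod.fst, Prod.snd,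
    (hNm.const_mul _).aestronglyMeasurable, measurable_fst, measurable_snd, fun Q => ?_,
    fun R hR hRb => ?_⟩
  · have e : ∀ z : Momentum s × ℝ, ‖((2 * Real.pi)⁻¹ : ℝ) * threeWave m M σ x z.2 z.1‖
        * (energy m (z.1 + Q) ^ L)⁻¹ = (2 * Real.pi)⁻¹ * (‖threeWave m M σ x z.2 z.1‖
        * (energy m (z.1 + Q) ^ L)⁻¹) := fun z => by
      rw [norm_mul, Complex.norm_real, Real.norm_of_nonneg hπ, mul_assoc]
    simp only [e, integral_const_mul]
    refine ⟨(hint Q).1.const_mul _, ?_⟩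
    have h0 : 0 ≤ ∫ z : Momentum s × ℝ, ‖threeWave m M σ x z.2 z.1‖ * (energy m (z.1 + Q) ^ L)⁻¹ :=
      integral_nonneg fun z => by have := energy_nonneg m (z.1 + Q); positivity
    nlinarith [(hint Q).2]
  · obtain ⟨B, Q, hB⟩ := hRb
    obtain ⟨B₀, hB₀⟩ := hR.bounded
    set w : Fin 3 → ℝ → Momentum s → ℂ := fun i t => wave m M (σ i) (x i) t with hw
    have iw : ∀ i t, Integrable (w i t) := fun i t => integrable_wave hm (by omega) _ _ _
    have cw : ∀ i t, Continuous (w i t) := fun i t => continuous_wave_right hm M _ _ t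
    have mE := (continuous_energy (s := s) m).measurable
    -- amplitude and total energy at total momentum `k`, as functions of the first two momenta
    set A : Momentum s → Momentum s × Momentum s → ℂ := fun k y =>
      w 0 0 y.1 * (w 1 0 y.2 * w 2 0 (k - y.1 - y.2)) with hA
    set E : Momentum s → Momentum s × Momentum s → ℝ := fun k y =>
      σ 2 * energy m (k - y.1 - y.2) + σ 1 * energy m y.2 + σ 0 * energy m y.1 with hE
    have mE' : ∀ k, Measurable (E k) := fun k => by simp only [hE]; fun_prop
    have hA12 : Integrable (fun y : Momentum s × Momentum s => w 0 0 y.1 * w 1 0 y.2)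
        (volume.prod volume) := (iw 0 0).mul_prod (iw 1 0)
    have hAi : ∀ k, Integrable (A k) (volume.prod volume) := fun k => by
      have : A k = fun y => w 0 0 y.1 * w 1 0 y.2 * w 2 0 (k - y.1 - y.2) := by
        ext y; simp only [hA]; ring
      rw [this]
      refine hA12.mul_bdd (c := (m ^ M)⁻¹) ?_ (Eventually.of_forall fun y => norm_wave_le hm M _ _ _ _)
      exact ((cw 2 0).comp (by fun_prop)).aestronglyMeasurable
    have hNeq : ∀ k t, ∫ y, A k y * Complex.exp (-(Complex.I * (E k y * t : ℝ))) ∂(volume.prod volume)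
        = threeWave m M σ x t k := fun k t => by
      have hfac : ∀ y, A k y * Complex.exp (-(Complex.I * (E k y * t : ℝ)))
          = w 0 t y.1 * (w 1 t y.2 * w 2 t (k - y.1 - y.2)) := fun y => by
        simp only [hA, hE, hw]
        rw [wave_eq_wave_zero_mul m M (σ 0) (x 0) t, wave_eq_wave_zero_mul m M (σ 1) (x 1) t,
          wave_eq_wave_zero_mul m M (σ 2) (x 2) t]
        have : Complex.exp (-(Complex.I * (((σ 2 * energy m (k - y.1 - y.2) + σ 1 * energy m y.2
            + σ 0 * energy m y.1) * t : ℝ) : ℂ)))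
            = Complex.exp (-(Complex.I * (σ 0 * energy m y.1 * t : ℝ)))
            * Complex.exp (-(Complex.I * (σ 1 * energy m y.2 * t : ℝ)))
            * Complex.exp (-(Complex.I * (σ 2 * energy m (k - y.1 - y.2) * t : ℝ))) := by
          rw [← Complex.exp_add, ← Complex.exp_add]; congr 1; push_cast; ring
        rw [this]; ring
      have hi : Integrable (fun y => A k y * Complex.exp (-(Complex.I * (E k y * t : ℝ))))
          (volume.prod volume) := by
        refine (hAi k).mul_bdd (c := 1) (Measurable.aestronglyMeasurable ?_)
          (Eventually.of_forall fun y => (norm_exp_neg_I_mul _).le)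
        have := mE' k
        fun_prop
      rw [integral_prod _ hi]
      simp only [hfac]
      unfold threeWave conv
      congr 1; ext p
      rw [← integral_const_mul]
    have hAE : ∀ᵐ k : Momentum s, Integrable fun t => threeWave m M σ x t k := by
      have h1 := ((integrable_prod_iff (hint Q).1.1).1 (hint Q).1).1
      filter_upwards [h1] with k hk
      have hE := energy_pos hm (k + Q)
      have h2 := hk.mul_const (energy m (k + Q) ^ L)
      have h3 : Integrable fun t => ‖threeWave m M σ x t k‖ := by
        refine h2.congr (Eventually.of_forall fun t => ?_)
        simp only
        field_simp
      refine (integrable_norm_iff ?_).1 h3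
      exact (hNm.comp_measurable (measurable_prodMk_left (x := k))).aestronglyMeasurable
    -- the four-fold integrand as function of `(y, k)`
    have hFi : Integrable (fun z : (Momentum s × Momentum s) × Momentum s =>
        A z.2 z.1 * R z.2 (E z.2 z.1)) ((volume.prod volume).prod volume) := by
      have hmeas : Measurable (fun z : (Momentum s × Momentum s) × Momentum s =>
        A z.2 z.1 * R z.2 (E z.2 z.1)) := by
        refine Measurable.mul ?_ (hR.measurable.comp (measurable_snd.prodMk ?_))
        · have h0 := (cw 0 0).measurable
          have h1 := (cw 1 0).measurable
          have h2 := (cw 2 0).measurable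
          simp only [hA]; fun_prop
        · fun_prop
      have hAk : ∀ y, Integrable fun k => A k y := fun y =>
        ((((iw 2 0).comp_sub_right y.2).comp_sub_right y.1).const_mul _).const_mul _
      refine (integrable_prod_iff hmeas.aestronglyMeasurable).2 ⟨Eventually.of_forall fun y => ?_, ?_⟩
      · exact (hAk y).mul_bdd (c := B₀) (hR.measurable.comp (measurable_id.prodMk
          (by simp only; fun_prop))).aestronglyMeasurable (Eventually.of_forall fun k => hB₀ _ _)
      · refine (hA12.norm.mul_const ((∫ r, ‖w 2 0 r‖) * B₀)).mono'
          hmeas.norm.stronglyMeasurable.integral_prod_right'.aestronglyMeasurable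
          (Eventually.of_forall fun y => ?_)
        rw [Real.norm_of_nonneg (integral_nonneg fun k => norm_nonneg _)]
        calc ∫ k, ‖A k y * R k (E k y)‖ ≤ ∫ k, ‖w 0 0 y.1 * w 1 0 y.2‖ * (‖w 2 0 (k - y.1 - y.2)‖ * B₀) := by
              refine integral_mono_of_nonneg (Eventually.of_forall fun k => norm_nonneg _)
                (((((iw 2 0).comp_sub_right y.2).comp_sub_right y.1).norm.mul_const _).const_mul _)
                (Eventually.of_forall fun k => ?_)
              simp only [hA, norm_mul]
              rw [mul_assoc, mul_assoc, mul_assoc]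
              gcongr
              exact hB₀ _ _
          _ = _ := by
              rw [integral_const_mul, integral_mul_const,
                integral_sub_right_eq_self (fun k => ‖w 2 0 (k - y.2)‖),
                integral_sub_right_eq_self (fun k => ‖w 2 0 k‖)]
    have hleft : (∫ p, w 0 0 p * ∫ q, w 1 0 q * ∫ r, w 2 0 r
          * R (r + q + p) (σ 2 * energy m r + σ 1 * energy m q + σ 0 * energy m p))
        = ∫ y : Momentum s × Momentum s, ∫ k, A k y * R k (E k y) ∂volume ∂(volume.prod volume) := by
      rw [integral_prod _ hFi.integral_prod_left]
      congr 1; ext p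
      rw [← integral_const_mul]
      congr 1; ext q
      have h1 : ∫ r, w 2 0 r * R (r + q + p) (σ 2 * energy m r + σ 1 * energy m q + σ 0 * energy m p)
          = ∫ k, w 2 0 (k - p - q) * R k (E k (p, q)) := by
        rw [← integral_sub_right_eq_self _ q, ← integral_sub_right_eq_self _ p]
        congr 1; ext k
        simp only [hE]
        congr 2; abel
      rw [h1, ← integral_const_mul, ← integral_const_mul]
      congr 1; ext k
      simp only [hA]; ring
    have hIr : Integrable (fun z : Momentum s × ℝ => ((2 * Real.pi)⁻¹ : ℝ)
        * threeWave m M σ x z.2 z.1 * timeFourier (R z.1) z.2) (volume.prod volume) := by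
      refine ((hint Q).1.const_mul ((2 * Real.pi)⁻¹ * B)).mono'
        ((hNm.const_mul _).aestronglyMeasurable.mul
          hR.measurable_timeFourier.aestronglyMeasurable) (Eventually.of_forall fun z => ?_)
      rw [norm_mul, norm_mul, Complex.norm_real, Real.norm_of_nonneg hπ]
      have := mul_le_mul_of_nonneg_left (hB z.1 z.2)
        (mul_nonneg hπ (norm_nonneg (threeWave m M σ x z.2 z.1)))
      nlinarith
    change (∫ p, w 0 0 p * ∫ q, w 1 0 q * ∫ r, w 2 0 r
          * R (r + q + p) (σ 2 * energy m r + σ 1 * energy m q + σ 0 * energy m p)) = _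
    rw [hleft, integral_integral_swap (f := fun y k => A k y * R k (E k y)) hFi,
      Measure.volume_eq_prod (Momentum s) ℝ, integral_prod _ hIr]
    refine integral_congr_ae ?_
    filter_upwards [hAE] with k hk
    have h1 := integral_comp_eq_timeFourier (hAi k) (mE' k) (by simpa only [hNeq] using hk)
      (hR.measurable_right k) (hB₀ k) (hR.integrable k)
    simp only [hNeq] at h1
    rw [h1, ← integral_const_mul]
    congr 1; ext t; ring

end SpectralRep

section MultiWave

variable {s : ℕ} {m : ℝ}

theorem HasSpectralRep.congr {L : ℕ} {C : ℝ} {T T' : (Momentum s → ℝ → ℂ) → ℂ}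
    (h : HasSpectralRep m L C T) (hT : ∀ R, IsKernel R → T' R = T R) : HasSpectralRep m L C T' := by
  obtain ⟨Z, mZ, ν, hν, n, κ, τ, hn, hκ, hτ, hb, hrep⟩ := h
  exact ⟨Z, mZ, ν, hν, n, κ, τ, hn, hκ, hτ, hb, fun R hR hB => (hT R hR).trans (hrep R hR hB)⟩

/-- The product of the free waves `ω(p_i)^{-M} e^{-i k_i · x_i}`, with `k_i = (σ_i ω(p_i), p_i)`,
integrated against a function of the total momentum and the total energy. -/
def multiWave {ι : Type} [Fintype ι] (m : ℝ) (M : ℕ) (σ : ι → ℝ) (x : ι → Mink s)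
    (R : Momentum s → ℝ → ℂ) : ℂ :=
  ∫ p : ι → Momentum s, (∏ i, wave m M (σ i) (x i) 0 (p i)) *
    R (∑ i, p i) (∑ i, σ i * energy m (p i))

theorem integrable_prod_wave (hm : 0 < m) {M : ℕ} (hM : s + 1 ≤ M) {ι : Type} [Fintype ι]
    (σ : ι → ℝ) (x : ι → Mink s) :
    Integrable fun p : ι → Momentum s => ∏ i, wave m M (σ i) (x i) 0 (p i) :=
  Integrable.fintype_prod fun i => integrable_wave hm hM (σ i) (x i) 0

theorem IsKernel.integrable_multiWave (hm : 0 < m) {M : ℕ} (hM : s + 1 ≤ M) {ι : Type} [Fintype ι]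
    (σ : ι → ℝ) (x : ι → Mink s) {R : Momentum s → ℝ → ℂ} (hR : IsKernel R) :
    Integrable fun p : ι → Momentum s => (∏ i, wave m M (σ i) (x i) 0 (p i)) *
      R (∑ i, p i) (∑ i, σ i * energy m (p i)) := by
  obtain ⟨B, hB⟩ := hR.bounded
  refine (integrable_prod_wave hm hM σ x).mul_bdd (c := B) ?_ (Eventually.of_forall fun p => hB _ _)
  have hE := (continuous_energy (s := s) m).measurable
  exact (hR.measurable.comp (by fun_prop : Measurable fun p : ι → Momentum s =>
    (∑ i, p i, ∑ i, σ i * energy m (p i)))).aestronglyMeasurable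

theorem multiWave_zero (M : ℕ) (σ : Fin 0 → ℝ) (x : Fin 0 → Mink s) (R : Momentum s → ℝ → ℂ) :
    multiWave m M σ x R = R 0 0 := by
  simp [multiWave, Measure.volume_pi_eq_dirac 0]

theorem multiWave_succ (hm : 0 < m) {M : ℕ} (hM : s + 1 ≤ M) {k : ℕ} (σ : Fin (k + 1) → ℝ)
    (x : Fin (k + 1) → Mink s) {R : Momentum s → ℝ → ℂ} (hR : IsKernel R) :
    multiWave m M σ x R = ∫ p, wave m M (σ 0) (x 0) 0 p *
      multiWave m M (fun i : Fin k => σ i.succ) (fun i : Fin k => x i.succ)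
        (shiftKernel p (σ 0 * energy m p) R) := by
  have hmp := (volume_preserving_piFinSuccAbove (fun _ : Fin (k + 1) => Momentum s) 0).symm
  have hi := hR.integrable_multiWave hm hM σ x
  rw [← hmp.integrable_comp_emb (MeasurableEquiv.measurableEmbedding _)] at hi
  simp only [Function.comp_def] at hi
  unfold multiWave
  rw [← hmp.integral_comp (MeasurableEquiv.measurableEmbedding _), Measure.volume_eq_prod,
    integral_prod _ hi]
  refine integral_congr_ae (Eventually.of_forall fun p => ?_)
  simp only
  rw [← integral_const_mul]
  refine integral_congr_ae (Eventually.of_forall fun q => ?_)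
  simp only [MeasurableEquiv.piFinSuccAbove_symm_apply, Fin.insertNthEquiv_apply, Fin.insertNth_zero,
    Fin.prod_univ_succ, Fin.sum_univ_succ, shiftKernel, Fin.cons_zero, Fin.cons_succ, cast_eq]
  rw [mul_assoc, add_comm p, add_comm (σ 0 * energy m p)]

theorem multiWave_reindex {ι κ : Type} [Fintype ι] [Fintype κ] (e : ι ≃ κ) (M : ℕ) (σ : κ → ℝ)
    (x : κ → Mink s) (R : Momentum s → ℝ → ℂ) :
    multiWave m M σ x R = multiWave m M (σ ∘ e) (x ∘ e) R := by
  have hmp := volume_measurePreserving_piCongrLeft (fun _ : κ => Momentum s) e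
  unfold multiWave
  rw [← hmp.integral_comp (MeasurableEquiv.measurableEmbedding _)]
  refine integral_congr_ae (Eventually.of_forall fun p => ?_)
  have h : ∀ i, MeasurableEquiv.piCongrLeft (fun _ : κ => Momentum s) e p (e i) = p i := fun i => by
    exact Equiv.piCongrLeft_apply_apply (fun _ : κ => Momentum s) e p i
  simp only [Function.comp]
  rw [← e.prod_comp, ← e.sum_comp, ← e.sum_comp]
  simp only [h]

theorem hasSpectralRep_multiWave_fin (hs : 2 ≤ s) (hm : 0 < m) {M L : ℕ} (hM : 2 * s + 6 ≤ M)
    (hL : s + 1 ≤ L) (k : ℕ) : ∃ C : ℝ, 0 ≤ C ∧ ∀ (σ : Fin (k + 3) → ℝ) (x : Fin (k + 3) → Mink s),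
      (∀ i, |σ i| = 1) → HasSpectralRep m L C (multiWave m M σ x) := by
  have hM' : s + 1 ≤ M := by omega
  induction k with
  | zero =>
    obtain ⟨C, hC, h⟩ := hasSpectralRep_threeWave hs hm hM hL
    refine ⟨C, hC.le, fun σ x hσ => (h σ x hσ).congr fun R hR => ?_⟩
    rw [multiWave_succ hm hM' σ x hR]
    refine integral_congr_ae (Eventually.of_forall fun p => ?_)
    simp only
    rw [multiWave_succ hm hM' _ _ (hR.shift _ _)]
    congr 1
    refine integral_congr_ae (Eventually.of_forall fun q => ?_)
    simp only
    rw [multiWave_succ hm hM' _ _ ((hR.shift _ _).shift _ _)]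
    congr 1
    refine integral_congr_ae (Eventually.of_forall fun r => ?_)
    simp only
    rw [multiWave_zero]
    simp [shiftKernel]
  | succ k ih =>
    obtain ⟨C, hC, h⟩ := ih
    refine ⟨C * ∫ p : Momentum s, (energy m p ^ M)⁻¹,
      mul_nonneg hC (integral_nonneg fun p => by have := energy_nonneg m p; positivity),
      fun σ x hσ => ?_⟩
    have h1 := (h (fun i => σ i.succ) (fun i => x i.succ) fun i => hσ _).addParticle hm
      (integrable_wave hm hM' (σ 0) (x 0) 0)
      (((continuous_energy (s := s) m).measurable).const_mul (σ 0))
    simp only [norm_wave hm] at h1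
    exact h1.congr fun R hR => multiWave_succ hm hM' σ x hR

/-- Products of at least three free waves have a time representation, with a constant that does not
depend on the points `x_i` at which the waves are centred. -/
theorem hasSpectralRep_multiWave (hs : 2 ≤ s) (hm : 0 < m) {M L : ℕ} (hM : 2 * s + 6 ≤ M)
    (hL : s + 1 ≤ L) {ι : Type} [Fintype ι] (hι : 3 ≤ Fintype.card ι) :
    ∃ C : ℝ, 0 ≤ C ∧ ∀ (σ : ι → ℝ) (x : ι → Mink s),
      (∀ i, |σ i| = 1) → HasSpectralRep m L C (multiWave m M σ x) := by
  obtain ⟨k, hk⟩ : ∃ k, Fintype.card ι = k + 3 := ⟨_, (Nat.sub_add_cancel hι).symm⟩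
  obtain ⟨C, hC, h⟩ := hasSpectralRep_multiWave_fin hs hm hM hL k
  refine ⟨C, hC, fun σ x hσ => ?_⟩
  set e := (Fintype.equivFinOfCardEq hk).symm
  exact (h (σ ∘ e) (x ∘ e) fun i => hσ _).congr fun R _ => multiWave_reindex e M σ x R

end MultiWave

/-! ### The sine integral -/

section SineIntegral

/-- The sine integral `Si(x) = ∫₀ˣ sin u / u du`. -/
def sineIntegral (x : ℝ) : ℝ := ∫ u in (0 : ℝ)..x, Real.sinc u

theorem sineIntegral_neg (x : ℝ) : sineIntegral (-x) = -sineIntegral x := by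
  unfold sineIntegral
  have h := intervalIntegral.integral_comp_neg (a := 0) (b := x) Real.sinc
  simp only [Real.sinc_neg, neg_zero] at h
  rw [h, intervalIntegral.integral_symm (0 : ℝ) (-x), neg_neg]

theorem abs_sineIntegral_le (x : ℝ) : |sineIntegral x| ≤ |x| := by
  have := intervalIntegral.norm_integral_le_of_norm_le_const (a := 0) (b := x) (C := 1)
    (f := Real.sinc) fun u _ => Real.abs_sinc_le_one u
  simpa [sineIntegral] using this

theorem integral_sin_mul_exp (v X : ℝ) : ∫ u in (0 : ℝ)..X, Real.sin u * Real.exp (-u * v)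
    = (1 - Real.exp (-X * v) * (v * Real.sin X + Real.cos X)) * (1 + v ^ 2)⁻¹ := by
  have hv : 1 + v ^ 2 ≠ 0 := by positivity
  have hd : ∀ u : ℝ, HasDerivAt
      (fun u => -(Real.exp (-u * v) * (v * Real.sin u + Real.cos u)) * (1 + v ^ 2)⁻¹)
      (Real.sin u * Real.exp (-u * v)) u := fun u => by
    have h1 : HasDerivAt (fun u : ℝ => Real.exp (-u * v)) (Real.exp (-u * v) * (-1 * v)) u :=
      (((hasDerivAt_id u).neg).mul_const v).exp
    have h2 : HasDerivAt (fun u : ℝ => v * Real.sin u + Real.cos u)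
        (v * Real.cos u + -Real.sin u) u :=
      ((Real.hasDerivAt_sin u).const_mul v).add (Real.hasDerivAt_cos u)
    have h3 := ((h1.mul h2).neg).mul_const (1 + v ^ 2)⁻¹
    refine h3.congr_deriv ?_
    field_simp
    ring
  rw [intervalIntegral.integral_eq_sub_of_hasDerivAt (fun u _ => hd u)
    ((by fun_prop : Continuous fun u : ℝ => Real.sin u * Real.exp (-u * v)).intervalIntegrable _ _)]
  simp
  ring

theorem abs_sineIntegral_sub_le {X : ℝ} (hX : 0 < X) : |sineIntegral X - Real.pi / 2| ≤ X⁻¹ := by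
  -- `sin u / u = ∫₀^∞ sin u e^{-uv} dv`, and the integrals over `u` and `v` are interchanged
  have hexp : ∀ u : ℝ, 0 < u → IntegrableOn (fun v => Real.exp (-u * v)) (Ioi 0) := fun u hu =>
    integrableOn_exp_mul_Ioi (neg_lt_zero.2 hu) 0
  have hexpi : ∀ u : ℝ, 0 < u → ∫ v in Ioi (0 : ℝ), Real.exp (-u * v) = u⁻¹ := fun u hu => by
    rw [integral_exp_mul_Ioi (neg_lt_zero.2 hu)]
    simp [neg_div_neg_eq]
  have hmeas : Measurable fun z : ℝ × ℝ => Real.sin z.1 * Real.exp (-z.1 * z.2) := by fun_prop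
  have hint : Integrable (fun z : ℝ × ℝ => Real.sin z.1 * Real.exp (-z.1 * z.2))
      ((volume.restrict (Ioc 0 X)).prod (volume.restrict (Ioi 0))) := by
    refine (integrable_prod_iff hmeas.aestronglyMeasurable).2 ⟨?_, ?_⟩
    · filter_upwards [ae_restrict_mem measurableSet_Ioc] with u hu
      exact (hexp u hu.1).const_mul _
    · refine Integrable.mono' (g := fun _ => (1 : ℝ)) (integrable_const 1)
        hmeas.norm.stronglyMeasurable.integral_prod_right'.aestronglyMeasurable ?_
      filter_upwards [ae_restrict_mem measurableSet_Ioc] with u hu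
      rw [Real.norm_of_nonneg (integral_nonneg fun v => norm_nonneg _)]
      simp only [norm_mul, Real.norm_eq_abs, Real.abs_exp]
      rw [integral_const_mul, hexpi u hu.1]
      have := Real.abs_sinc_le_one u
      rwa [Real.sinc_of_ne_zero hu.1.ne', abs_div, abs_of_pos hu.1, div_eq_mul_inv] at this
  have h1 : sineIntegral X = ∫ v in Ioi (0 : ℝ),
      (1 - Real.exp (-X * v) * (v * Real.sin X + Real.cos X)) * (1 + v ^ 2)⁻¹ := by
    calc sineIntegral X = ∫ u in Ioc 0 X, ∫ v in Ioi (0 : ℝ), Real.sin u * Real.exp (-u * v) := by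
          rw [sineIntegral, intervalIntegral.integral_of_le hX.le]
          refine setIntegral_congr_fun measurableSet_Ioc fun u hu => ?_
          rw [integral_const_mul, hexpi u hu.1, Real.sinc_of_ne_zero hu.1.ne', div_eq_mul_inv]
      _ = ∫ v in Ioi (0 : ℝ), ∫ u in Ioc 0 X, Real.sin u * Real.exp (-u * v) :=
          integral_integral_swap hint
      _ = _ := by
          refine setIntegral_congr_fun measurableSet_Ioi fun v _ => ?_
          rw [← intervalIntegral.integral_of_le hX.le, integral_sin_mul_exp]
  have hb : ∀ v : ℝ, ‖Real.exp (-X * v) * (v * Real.sin X + Real.cos X) * (1 + v ^ 2)⁻¹‖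
      ≤ Real.exp (-X * v) := fun v => by
    have hq : |v * Real.sin X + Real.cos X| ≤ 1 + v ^ 2 := by
      have h2 : (v * Real.sin X + Real.cos X) ^ 2 ≤ 1 + v ^ 2 := by
        nlinarith [sq_nonneg (v * Real.cos X - Real.sin X), Real.sin_sq_add_cos_sq X]
      have h3 : (1 + v ^ 2) ≤ (1 + v ^ 2) ^ 2 := by nlinarith [sq_nonneg v, sq_nonneg (v ^ 2)]
      exact abs_le_of_sq_le_sq (h2.trans h3) (by positivity)
    rw [norm_mul, norm_mul, Real.norm_eq_abs, Real.norm_eq_abs, Real.norm_eq_abs, Real.abs_exp,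
      abs_of_pos (by positivity : 0 < (1 + v ^ 2)⁻¹), mul_assoc]
    refine mul_le_of_le_one_right (Real.exp_pos _).le ?_
    rw [← div_eq_mul_inv]
    exact div_le_one_of_le₀ hq (by positivity)
  have hi2 : IntegrableOn (fun v => Real.exp (-X * v) * (v * Real.sin X + Real.cos X)
      * (1 + v ^ 2)⁻¹) (Ioi 0) := by
    refine (hexp X hX).mono' (Continuous.aestronglyMeasurable ?_) (Eventually.of_forall hb)
    have : ∀ v : ℝ, 1 + v ^ 2 ≠ 0 := fun v => by positivity
    fun_prop (disch := assumption)
  have h2 : sineIntegral X - Real.pi / 2 = -∫ v in Ioi (0 : ℝ),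
      Real.exp (-X * v) * (v * Real.sin X + Real.cos X) * (1 + v ^ 2)⁻¹ := by
    have h3 : ∫ v in Ioi (0 : ℝ), (1 + v ^ 2)⁻¹ = Real.pi / 2 := by
      rw [integral_Ioi_inv_one_add_sq]; simp
    rw [h1]
    simp only [sub_mul, one_mul]
    rw [integral_sub integrable_inv_one_add_sq.integrableOn hi2, h3]
    ring
  rw [h2, abs_neg, ← hexpi X hX]
  exact norm_integral_le_of_norm_le (hexp X hX) (Eventually.of_forall hb)

/-- The Dirichlet integral. -/
theorem tendsto_sineIntegral : Tendsto sineIntegral atTop (𝓝 (Real.pi / 2)) := by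
  rw [tendsto_iff_norm_sub_tendsto_zero]
  refine squeeze_zero' (Eventually.of_forall fun _ => norm_nonneg _) ?_ tendsto_inv_atTop_zero
  filter_upwards [eventually_gt_atTop 0] with X hX using abs_sineIntegral_sub_le hX

theorem tendsto_sineIntegral_atBot : Tendsto sineIntegral atBot (𝓝 (-(Real.pi / 2))) := by
  have h := (tendsto_sineIntegral.comp tendsto_neg_atBot_atTop).neg
  refine h.congr fun x => ?_
  simp [sineIntegral_neg]

theorem abs_sineIntegral_le_three (x : ℝ) : |sineIntegral x| ≤ 3 := by
  have key : ∀ x : ℝ, 0 ≤ x → |sineIntegral x| ≤ 3 := fun x hx => by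
    rcases le_or_gt x 1 with h | h
    · exact (abs_sineIntegral_le x).trans (by rw [abs_of_nonneg hx]; linarith)
    · have h1 := abs_sineIntegral_sub_le (zero_lt_one.trans h)
      have h2 : x⁻¹ ≤ 1 := inv_le_one_of_one_le₀ h.le
      have h3 := Real.pi_lt_four
      have h4 := Real.pi_pos
      rw [abs_le] at h1 ⊢
      constructor <;> linarith [h1.1, h1.2]
  rcases le_total 0 x with h | h
  · exact key x h
  · have := key (-x) (by linarith)
    rwa [sineIntegral_neg, abs_neg] at this

theorem integral_sin_mul_div {b η : ℝ} (hη : 0 < η) (hb : η ≤ b) (r : ℝ) :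
    ∫ u in η..b, Real.sin (r * u) / u = sineIntegral (r * b) - sineIntegral (r * η) := by
  have hc := Real.continuous_sinc
  have h1 : ∫ u in η..b, Real.sin (r * u) / u = ∫ u in η..b, r * Real.sinc (r * u) := by
    refine intervalIntegral.integral_congr fun u hu => ?_
    rw [uIcc_of_le hb] at hu
    have hu0 : u ≠ 0 := (hη.trans_le hu.1).ne'
    rcases eq_or_ne r 0 with rfl | hr
    · simp
    · rw [Real.sinc_of_ne_zero (mul_ne_zero hr hu0)]
      field_simp
  rw [h1, intervalIntegral.integral_const_mul, ← smul_eq_mul (a := r),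
    intervalIntegral.smul_integral_comp_mul_left]
  unfold sineIntegral
  rw [intervalIntegral.integral_interval_sub_left (hc.intervalIntegrable _ _)
    (hc.intervalIntegrable _ _)]

theorem continuous_sineIntegral : Continuous sineIntegral :=
  intervalIntegral.continuous_primitive
    (fun a b => Real.continuous_sinc.intervalIntegrable a b) 0

end SineIntegral

/-! ### Time limits of the regularized propagators -/

section PropagatorLimits

variable {m ε : ℝ} {φ : ℝ → ℝ}

theorem IsCutoff.eq_zero (hφ : IsCutoff m ε φ) {x : ℝ} (hx : ε ≤ |x|) : φ x = 0 := by
  by_contra hne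
  have h := hφ.tsupport_subset (subset_tsupport φ hne)
  exact absurd (abs_lt.2 h) (not_lt.2 hx)

theorem IsCutoff.exists_bound (hφ : IsCutoff m ε φ) : ∃ Φ : ℝ, 0 ≤ Φ ∧ ∀ x, |φ x| ≤ Φ := by
  have hcomp : HasCompactSupport φ :=
    HasCompactSupport.of_support_subset_isCompact (isCompact_Icc (a := -ε) (b := ε))
      ((subset_tsupport φ).trans (hφ.tsupport_subset.trans Set.Ioo_subset_Icc_self))
  obtain ⟨C, hC⟩ := hcomp.exists_bound_of_continuous hφ.contDiff.continuous
  exact ⟨C, (norm_nonneg _).trans (hC 0), hC⟩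

/-- The Riemann-Lebesgue lemma for the kernel `e^{iμu}`. -/
theorem tendsto_integral_mul_exp (g : ℝ → ℂ) :
    Tendsto (fun μ : ℝ => ∫ u, g u * Complex.exp (Complex.I * (μ * u : ℝ))) (cocompact ℝ) (𝓝 0) := by
  have hne : -(2 * Real.pi)⁻¹ ≠ 0 := by simp [Real.pi_ne_zero]
  have h1 : Tendsto (fun μ : ℝ => -(2 * Real.pi)⁻¹ * μ) (cocompact ℝ) (cocompact ℝ) :=
    (Homeomorph.mulLeft₀ _ hne).isClosedEmbedding.tendsto_cocompact
  refine ((Real.tendsto_integral_exp_smul_cocompact g).comp h1).congr fun μ => ?_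
  refine integral_congr_ae (Eventually.of_forall fun u => ?_)
  simp only
  rw [Circle.smul_def, Real.fourierChar_apply, smul_eq_mul, mul_comm]
  congr 2
  push_cast
  have : (Real.pi : ℂ) ≠ 0 := by exact_mod_cast Real.pi_ne_zero
  field_simp

/-- With `h = u + c u²`, the part of the propagator `φ(h)/h` that remains after the singularity
`1/u` has been subtracted on `|u| ≤ b`. -/
def regularPart (φ : ℝ → ℝ) (b c u : ℝ) : ℝ :=
  ((if -(1 / 2) < c * u then φ (u + c * u ^ 2) * (1 + c * u)⁻¹ else 0)
    - if |u| ≤ b then 1 else 0) * u⁻¹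

theorem measurable_regularPart (hφ : IsCutoff m ε φ) (b c : ℝ) :
    Measurable (regularPart φ b c) := by
  have h1 := hφ.contDiff.continuous.measurable
  unfold regularPart
  refine Measurable.mul (Measurable.sub (Measurable.ite ?_ (by fun_prop) measurable_const)
    (Measurable.ite ?_ measurable_const measurable_const)) (by fun_prop)
  · exact measurableSet_lt measurable_const (by fun_prop)
  · exact measurableSet_le (by fun_prop) measurable_const

theorem abs_regularPart_le (hφ : IsCutoff m ε φ) {Φ : ℝ} (hΦ : ∀ x, |φ x| ≤ Φ) {c : ℝ} (hc : 0 ≤ c)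
    (hcε : c * ε ≤ 1 / 4) (u : ℝ) :
    |regularPart φ (ε / 4) c u| ≤ (Icc (-(2 * ε)) (2 * ε)).indicator
      (fun _ => 2 * c + 8 * Φ * ε⁻¹) u := by
  have hε := hφ.eps_pos
  have hΦ0 : 0 ≤ Φ := (abs_nonneg _).trans (hΦ 0)
  rcases le_or_gt |u| (ε / 4) with hu | hu
  · have hmem : u ∈ Icc (-(2 * ε)) (2 * ε) := by
      rw [abs_le] at hu; constructor <;> linarith
    rw [indicator_of_mem hmem]
    rcases eq_or_ne u 0 with rfl | hu0
    · simp only [regularPart, inv_zero, mul_zero, abs_zero]; positivity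
    have hcu : |c * u| ≤ 1 / 16 := by
      rw [abs_mul, abs_of_nonneg hc]
      calc c * |u| ≤ c * (ε / 4) := by gcongr
        _ ≤ 1 / 16 := by linarith
    have hcu' := abs_le.1 hcu
    have h1 : φ (u + c * u ^ 2) = 1 := by
      have : |u + c * u ^ 2| ≤ 17 / 16 * (ε / 4) := by
        rw [show u + c * u ^ 2 = (1 + c * u) * u by ring, abs_mul]
        gcongr
        rw [abs_le]; constructor <;> linarith
      have h2 := abs_le.1 this
      exact hφ.eq_one _ (by linarith) (by linarith)
    have hpos : 0 < 1 + c * u := by linarith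
    have h2 : regularPart φ (ε / 4) c u = -(c * (1 + c * u)⁻¹) := by
      rw [regularPart, if_pos (by linarith), if_pos hu, h1]
      field_simp
      ring
    rw [h2, abs_neg, abs_of_nonneg (by positivity)]
    have h3 : (1 + c * u)⁻¹ ≤ 2 := by
      rw [inv_le_comm₀ hpos (by norm_num)]; linarith
    have : 0 ≤ 8 * Φ * ε⁻¹ := by positivity
    nlinarith
  · rw [regularPart, if_neg (not_le.2 hu), sub_zero, abs_mul]
    split_ifs with hcu
    swap
    · rw [abs_zero, zero_mul]
      exact indicator_nonneg (fun _ _ => by positivity) _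
    have hpos : 0 < 1 + c * u := by linarith
    by_cases hmem : u ∈ Icc (-(2 * ε)) (2 * ε)
    · rw [indicator_of_mem hmem, abs_mul, abs_inv, abs_inv, abs_of_pos hpos]
      have h3 : (1 + c * u)⁻¹ ≤ 2 := by
        rw [inv_le_comm₀ hpos (by norm_num)]; linarith
      have h4 : |u|⁻¹ ≤ 4 * ε⁻¹ := by
        rw [inv_le_comm₀ (by linarith) (by positivity), mul_inv, inv_inv]; linarith
      calc |φ (u + c * u ^ 2)| * (1 + c * u)⁻¹ * |u|⁻¹ ≤ Φ * 2 * (4 * ε⁻¹) := by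
            gcongr; exact hΦ _
        _ ≤ _ := by nlinarith
    · rw [indicator_of_notMem hmem, hφ.eq_zero]
      · simp
      · rw [show u + c * u ^ 2 = (1 + c * u) * u by ring, abs_mul, abs_of_pos hpos]
        have : 2 * ε ≤ |u| := by
          by_contra h
          have := abs_lt.1 (not_le.1 h)
          exact hmem ⟨this.1.le, this.2.le⟩
        nlinarith

theorem integrable_regularPart (hφ : IsCutoff m ε φ) {Φ : ℝ} (hΦ : ∀ x, |φ x| ≤ Φ) {c : ℝ}
    (hc : 0 ≤ c) (hcε : c * ε ≤ 1 / 4) : Integrable (regularPart φ (ε / 4) c) ∧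
      ∫ u, |regularPart φ (ε / 4) c u| ≤ 4 * ε * (2 * c + 8 * Φ * ε⁻¹) := by
  have hε := hφ.eps_pos
  have hi : Integrable ((Icc (-(2 * ε)) (2 * ε)).indicator
      (fun _ => 2 * c + 8 * Φ * ε⁻¹) : ℝ → ℝ) :=
    (integrable_indicator_iff measurableSet_Icc).2 (integrableOn_const (by simp))
  refine ⟨hi.mono' (measurable_regularPart hφ _ _).aestronglyMeasurable
    (Eventually.of_forall (abs_regularPart_le hφ hΦ hc hcε)), ?_⟩
  refine (integral_mono_of_nonneg (Eventually.of_forall fun _ => abs_nonneg _) hi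
    (Eventually.of_forall (abs_regularPart_le hφ hΦ hc hcε))).trans ?_
  rw [integral_indicator_const _ measurableSet_Icc]
  simp only [measureReal_def, Real.volume_Icc, smul_eq_mul]
  rw [ENNReal.toReal_ofReal (by linarith)]
  apply le_of_eq; ring

/-- The singular part of the propagator, with the singularity cut off symmetrically in `u`. -/
theorem integral_symmetric_cut {b η : ℝ} (hη : 0 < η) (hb : η ≤ b) (r : ℝ) :
    ∫ u : ℝ, (if |u| ≤ b ∧ η < |u| then (u⁻¹ : ℂ) else 0) * Complex.exp (Complex.I * (r * u : ℝ))
      = 2 * Complex.I * ((sineIntegral (r * b) - sineIntegral (r * η) : ℝ) : ℂ) := by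
  set f : ℝ → ℂ := fun u =>
    (if |u| ≤ b ∧ η < |u| then (u⁻¹ : ℂ) else 0) * Complex.exp (Complex.I * (r * u : ℝ)) with hf
  have hc : ContinuousOn (fun u : ℝ => (u⁻¹ : ℂ) * Complex.exp (Complex.I * (r * u : ℝ)))
      (Icc η b) := by
    refine ContinuousOn.mul (ContinuousOn.inv₀ (by fun_prop) fun u hu => ?_) (by fun_prop)
    exact_mod_cast (hη.trans_le hu.1).ne'
  have hc' : ContinuousOn (fun u : ℝ => (u⁻¹ : ℂ) * Complex.exp (Complex.I * (r * u : ℝ)))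
      (Icc (-b) (-η)) := by
    refine ContinuousOn.mul (ContinuousOn.inv₀ (by fun_prop) fun u hu => ?_) (by fun_prop)
    have : u < 0 := by linarith [hu.2]
    exact_mod_cast this.ne
  have hfe : f = (Ioc η b).indicator (fun u : ℝ => (u⁻¹ : ℂ) * Complex.exp (Complex.I * (r * u : ℝ)))
      + (Ico (-b) (-η)).indicator (fun u : ℝ => (u⁻¹ : ℂ) * Complex.exp (Complex.I * (r * u : ℝ))) := by
    ext u
    simp only [hf, Pi.add_apply, indicator_apply, mem_Ioc, mem_Ico]
    rcases le_or_gt 0 u with h | h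
    · rw [abs_of_nonneg h, if_neg (fun h' : -b ≤ u ∧ u < -η => by linarith [h'.2]), add_zero]
      by_cases h2 : u ≤ b ∧ η < u
      · rw [if_pos h2, if_pos h2.symm]
      · rw [if_neg h2, if_neg (fun h' => h2 h'.symm), zero_mul]
    · rw [abs_of_neg h, if_neg (fun h' : η < u ∧ u ≤ b => by linarith [h'.1]), zero_add]
      by_cases h2 : -u ≤ b ∧ η < -u
      · rw [if_pos h2, if_pos ⟨by linarith [h2.1], by linarith [h2.2]⟩]
      · rw [if_neg h2, if_neg (fun h' => h2 ⟨by linarith [h'.1], by linarith [h'.2]⟩), zero_mul]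
  have i1 := (hc.integrableOn_Icc (μ := volume)).mono_set Ioc_subset_Icc_self
  have i2 := (hc'.integrableOn_Icc (μ := volume)).mono_set Ico_subset_Icc_self
  rw [hfe, integral_add' ((integrable_indicator_iff measurableSet_Ioc).2 i1)
    ((integrable_indicator_iff measurableSet_Ico).2 i2), integral_indicator measurableSet_Ioc,
    integral_indicator measurableSet_Ico, integral_Ico_eq_integral_Ioc,
    ← intervalIntegral.integral_of_le hb, ← intervalIntegral.integral_of_le (by linarith),
    ← intervalIntegral.integral_comp_neg, ← integral_sin_mul_div hη hb,
    ← intervalIntegral.integral_ofReal, ← intervalIntegral.integral_add]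
  · rw [← intervalIntegral.integral_const_mul]
    refine intervalIntegral.integral_congr fun u _ => ?_
    have h2 : Complex.exp (Complex.I * (r * u : ℝ)) - Complex.exp (Complex.I * (r * -u : ℝ))
        = 2 * Complex.I * (Real.sin (r * u) : ℂ) := by
      rw [Complex.ofReal_sin, Complex.sin]
      have : Complex.exp (Complex.I * (r * -u : ℝ)) = Complex.exp (-((r * u : ℝ) : ℂ) * Complex.I) := by
        congr 1; push_cast; ring
      rw [this, mul_comm Complex.I]
      linear_combination (-Complex.exp (-((r * u : ℝ) : ℂ) * Complex.I)
        + Complex.exp (((r * u : ℝ) : ℂ) * Complex.I)) * Complex.I_sq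
    rw [Complex.ofReal_div, mul_div_assoc', ← h2]
    push_cast
    rw [inv_neg]
    ring
  · rw [intervalIntegrable_iff_integrableOn_Ioc_of_le hb]; exact i1
  · have h3 : ContinuousOn (fun u : ℝ => ((-u : ℝ) : ℂ)⁻¹ * Complex.exp (Complex.I * (r * -u : ℝ)))
        (Icc η b) := by
      refine ContinuousOn.mul (ContinuousOn.inv₀ (by fun_prop) fun u hu => ?_) (by fun_prop)
      have := (hη.trans_le hu.1).ne'
      exact_mod_cast neg_ne_zero.2 this
    rw [intervalIntegrable_iff_integrableOn_Ioc_of_le hb]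
    exact h3.integrableOn_Icc.mono_set Ioc_subset_Icc_self

/-- The cutoffs `|u + c u²| > η` and `|u| > η` differ by a set of measure `O(η²)` on which
`1/u = O(1/η)`. -/
theorem abs_cut_sub_cut_le {b c η : ℝ} (hη : 0 < η) (hc : 0 ≤ c) (hcb : c * b ≤ 1 / 16) {u : ℝ}
    (hu : |u| ≤ b) :
    |(if η < |u + c * u ^ 2| then u⁻¹ else 0) - (if η < |u| then u⁻¹ else 0)|
      ≤ (Icc (η - 4 * c * η ^ 2) (η + 4 * c * η ^ 2)).indicator (fun _ => 2 * η⁻¹) u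
        + (Icc (-η - 4 * c * η ^ 2) (-η + 4 * c * η ^ 2)).indicator (fun _ => 2 * η⁻¹) u := by
  have hnn : ∀ S : Set ℝ, 0 ≤ S.indicator (fun _ => 2 * η⁻¹) u := fun S =>
    indicator_nonneg (fun _ _ => by positivity) _
  have hcu : |c * u| ≤ 1 / 16 := by
    rw [abs_mul, abs_of_nonneg hc]
    exact (mul_le_mul_of_nonneg_left hu hc).trans hcb
  have hcu' := abs_le.1 hcu
  have hh : |u + c * u ^ 2| = |u| * (1 + c * u) := by
    rw [show u + c * u ^ 2 = u * (1 + c * u) by ring, abs_mul,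
      abs_of_pos (show 0 < 1 + c * u by linarith)]
  have hkey : |u| ≤ 2 * η → η ≤ 2 * |u| → |(|u| - η)| ≤ 4 * c * η ^ 2 → |u⁻¹| ≤
      (Icc (η - 4 * c * η ^ 2) (η + 4 * c * η ^ 2)).indicator (fun _ => 2 * η⁻¹) u
        + (Icc (-η - 4 * c * η ^ 2) (-η + 4 * c * η ^ 2)).indicator (fun _ => 2 * η⁻¹) u := by
    intro _ h2 h3
    have h4 : |u⁻¹| ≤ 2 * η⁻¹ := by
      rw [abs_inv, inv_le_comm₀ (by linarith) (by positivity), mul_inv, inv_inv]; linarith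
    have h5 := abs_le.1 h3
    rcases le_total 0 u with h | h
    · rw [abs_of_nonneg h] at h5
      have := hnn (Icc (-η - 4 * c * η ^ 2) (-η + 4 * c * η ^ 2))
      rw [indicator_of_mem (show u ∈ Icc (η - 4 * c * η ^ 2) (η + 4 * c * η ^ 2) from
        ⟨by linarith, by linarith⟩)]
      linarith
    · rw [abs_of_nonpos h] at h5
      have := hnn (Icc (η - 4 * c * η ^ 2) (η + 4 * c * η ^ 2))
      rw [indicator_of_mem (show u ∈ Icc (-η - 4 * c * η ^ 2) (-η + 4 * c * η ^ 2) from
        ⟨by linarith, by linarith⟩)]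
      linarith
  have hdiff : |(|u| * (1 + c * u) - |u|)| = c * |u| ^ 2 := by
    rw [show |u| * (1 + c * u) - |u| = c * |u| * u by ring, abs_mul, abs_mul, abs_abs,
      abs_of_nonneg hc]; ring
  have hd := abs_le.1 hdiff.le
  rw [hh]
  have ha := abs_nonneg u
  split_ifs with h1 h2 h2
  · simp only [sub_self, abs_zero]; exact add_nonneg (hnn _) (hnn _)
  · rw [sub_zero]
    have h6 : η ≤ 2 * |u| := by nlinarith
    refine hkey (by linarith) h6 ?_
    have : |u| ^ 2 ≤ η ^ 2 := by nlinarith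
    rw [abs_le]; constructor <;> nlinarith [mul_nonneg hc (sq_nonneg η)]
  · rw [zero_sub, abs_neg]
    have h6 : |u| ≤ 2 * η := by nlinarith
    refine hkey h6 (by linarith) ?_
    have : |u| ^ 2 ≤ 4 * η ^ 2 := by nlinarith
    rw [abs_le]; constructor <;> nlinarith [mul_nonneg hc (sq_nonneg η)]
  · simp only [sub_self, abs_zero]; exact add_nonneg (hnn _) (hnn _)

theorem measurable_cut (b c η : ℝ) :
    Measurable fun u : ℝ => if |u| ≤ b then (if η < |u + c * u ^ 2| then u⁻¹ else 0) else 0 := by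
  refine Measurable.ite (measurableSet_le (by fun_prop) measurable_const)
    (Measurable.ite (measurableSet_lt measurable_const (by fun_prop)) (by fun_prop)
      measurable_const) measurable_const

theorem integrable_cut {b c η : ℝ} (hη : 0 < η) (hc : 0 ≤ c) (hcb : c * b ≤ 1 / 16) :
    Integrable fun u : ℝ => if |u| ≤ b then (if η < |u + c * u ^ 2| then u⁻¹ else 0) else 0 := by
  have hi : Integrable ((Icc (-b) b).indicator (fun _ => 2 * η⁻¹) : ℝ → ℝ) :=
    (integrable_indicator_iff measurableSet_Icc).2 (integrableOn_const (by simp))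
  refine hi.mono' (measurable_cut b c η).aestronglyMeasurable (Eventually.of_forall fun u => ?_)
  split_ifs with h1 h2
  · rw [indicator_of_mem (show u ∈ Icc (-b) b from abs_le.1 h1), Real.norm_eq_abs, abs_inv]
    have h0 : 0 < |u| := by
      rw [abs_pos]; rintro rfl; simp at h2; linarith
    have hcu : |c * u| ≤ 1 / 16 := by
      rw [abs_mul, abs_of_nonneg hc]
      exact (mul_le_mul_of_nonneg_left h1 hc).trans hcb
    have hcu' := abs_le.1 hcu
    rw [show u + c * u ^ 2 = u * (1 + c * u) by ring, abs_mul,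
      abs_of_pos (show 0 < 1 + c * u by linarith)] at h2
    rw [inv_le_comm₀ h0 (by positivity), mul_inv, inv_inv]
    nlinarith
  all_goals rw [norm_zero]; exact indicator_nonneg (fun _ _ => by positivity) _

/-- Cutting off `1/u` at `|u + c u²| > η` instead of `|u| > η` changes the integral by `O(η)`. -/
theorem norm_integral_cut_sub_le {b c η : ℝ} (hη : 0 < η) (hb : η ≤ b) (hc : 0 ≤ c)
    (hcb : c * b ≤ 1 / 16) (r : ℝ) :
    ‖(∫ u : ℝ, ((if |u| ≤ b then (if η < |u + c * u ^ 2| then u⁻¹ else 0) else 0 : ℝ) : ℂ)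
        * Complex.exp (Complex.I * (r * u : ℝ)))
      - 2 * Complex.I * ((sineIntegral (r * b) - sineIntegral (r * η) : ℝ) : ℂ)‖
      ≤ 32 * c * η := by
  have i1 : Integrable fun u : ℝ =>
      ((if |u| ≤ b then (if η < |u + c * u ^ 2| then u⁻¹ else 0) else 0 : ℝ) : ℂ)
        * Complex.exp (Complex.I * (r * u : ℝ)) :=
    (integrable_cut hη hc hcb).ofReal.mul_bdd (c := 1)
      (Continuous.aestronglyMeasurable (by fun_prop))
      (Eventually.of_forall fun u => (norm_exp_I_mul _).le)
  have i0 : Integrable fun u : ℝ => if |u| ≤ b then (if η < |u| then u⁻¹ else 0) else 0 := by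
    simpa using integrable_cut (b := b) hη le_rfl (by simp)
  have i2 : Integrable fun u : ℝ => ((if |u| ≤ b then (if η < |u| then u⁻¹ else 0) else 0 : ℝ) : ℂ)
        * Complex.exp (Complex.I * (r * u : ℝ)) :=
    i0.ofReal.mul_bdd (c := 1)
      (Continuous.aestronglyMeasurable (by fun_prop))
      (Eventually.of_forall fun u => (norm_exp_I_mul _).le)
  rw [← integral_symmetric_cut hη hb r]
  have e2 : (fun u : ℝ => (if |u| ≤ b ∧ η < |u| then (u⁻¹ : ℂ) else 0)
      * Complex.exp (Complex.I * (r * u : ℝ)))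
      = fun u : ℝ => ((if |u| ≤ b then (if η < |u| then u⁻¹ else 0) else 0 : ℝ) : ℂ)
        * Complex.exp (Complex.I * (r * u : ℝ)) := by
    ext u
    by_cases h1 : |u| ≤ b <;> by_cases h2 : η < |u| <;> simp [h1, h2]
  rw [e2, ← integral_sub i1 i2]
  have hI : ∀ x : ℝ, Integrable ((Icc (x - 4 * c * η ^ 2) (x + 4 * c * η ^ 2)).indicator
      (fun _ => 2 * η⁻¹) : ℝ → ℝ) := fun x =>
    (integrable_indicator_iff measurableSet_Icc).2 (integrableOn_const (by simp))
  have hIv : ∀ x : ℝ, ∫ u, (Icc (x - 4 * c * η ^ 2) (x + 4 * c * η ^ 2)).indicator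
      (fun _ => 2 * η⁻¹) u = 16 * c * η := fun x => by
    rw [integral_indicator_const _ measurableSet_Icc]
    have h0 := mul_nonneg hc (sq_nonneg η)
    simp only [measureReal_def, Real.volume_Icc, smul_eq_mul]
    rw [ENNReal.toReal_ofReal (by nlinarith)]
    field_simp
    ring
  refine (norm_integral_le_of_norm_le ((hI η).add (hI (-η))) (Eventually.of_forall fun u => ?_)).trans
    (le_of_eq ?_)
  · rw [← sub_mul, norm_mul, norm_exp_I_mul, mul_one, ← Complex.ofReal_sub, Complex.norm_real,
      Real.norm_eq_abs]
    by_cases h : |u| ≤ b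
    · simp only [if_pos h]
      exact abs_cut_sub_cut_le hη hc hcb h
    · simp only [if_neg h, sub_self, abs_zero, Pi.add_apply]
      exact add_nonneg (indicator_nonneg (fun _ _ => by positivity) _)
        (indicator_nonneg (fun _ _ => by positivity) _)
  · simp only [Pi.add_apply]
    rw [integral_add (hI η) (hI (-η)), hIv, hIv]
    ring

end PropagatorLimits

section ShellIntegral

variable {m ε : ℝ} {φ : ℝ → ℝ}

/-- The regularized propagator `φ(h)/h`, cut off to `|h| > η`. -/
def propCut (φ : ℝ → ℝ) (η h : ℝ) : ℝ := if η < |h| then h⁻¹ * φ h else 0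

theorem measurable_propCut (hφ : IsCutoff m ε φ) (η : ℝ) : Measurable (propCut φ η) := by
  have h1 := hφ.contDiff.continuous.measurable
  exact Measurable.ite (measurableSet_lt measurable_const (by fun_prop)) (by fun_prop)
    measurable_const

theorem abs_propCut_le {Φ : ℝ} (hΦ : ∀ x, |φ x| ≤ Φ) {η : ℝ} (hη : 0 < η) (h : ℝ) :
    |propCut φ η h| ≤ η⁻¹ * Φ := by
  have hΦ0 : 0 ≤ Φ := (abs_nonneg _).trans (hΦ 0)
  unfold propCut
  split_ifs with h1
  · rw [abs_mul, abs_inv]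
    gcongr
    exact hΦ h
  · rw [abs_zero]; positivity

theorem IsCutoff.propCut_eq_zero (hφ : IsCutoff m ε φ) (η : ℝ) {h : ℝ} (hh : ε ≤ |h|) :
    propCut φ η h = 0 := by
  simp [propCut, hφ.eq_zero hh]

theorem propCut_eq_regularPart_add {b c η : ℝ} (hη : 0 < η) (u : ℝ) :
    (if -(1 / 2) < c * u then propCut φ η (u + c * u ^ 2) else 0)
      = (if η < |u + c * u ^ 2| then regularPart φ b c u else 0)
        + (if |u| ≤ b then (if η < |u + c * u ^ 2| then u⁻¹ else 0) else 0) := by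
  by_cases h1 : η < |u + c * u ^ 2|
  · have h0 : u + c * u ^ 2 ≠ 0 := by
      intro h; rw [h, abs_zero] at h1; linarith
    have hu : u ≠ 0 := by rintro rfl; simp at h0
    have hc : 1 + c * u ≠ 0 := by
      intro h; apply h0; rw [show u + c * u ^ 2 = (1 + c * u) * u by ring, h, zero_mul]
    have h2 : (u + c * u ^ 2)⁻¹ = (1 + c * u)⁻¹ * u⁻¹ := by
      rw [← mul_inv]; congr 1; ring
    simp only [h1, if_true, regularPart, propCut]
    split_ifs <;> (try rw [h2]) <;> ring
  · simp [propCut, h1]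

/-- The Fourier transform of the regularized propagator in the variable `u`. -/
def cutTransform (φ : ℝ → ℝ) (η c μ : ℝ) : ℂ :=
  ∫ u : ℝ, ((if -(1 / 2) < c * u then propCut φ η (u + c * u ^ 2) else 0 : ℝ) : ℂ)
    * Complex.exp (Complex.I * (μ * u : ℝ))

/-- The Fourier transform of the Cauchy principal value of the propagator in the variable `u`. -/
def principalTransform (φ : ℝ → ℝ) (b c μ : ℝ) : ℂ :=
  (∫ u : ℝ, (regularPart φ b c u : ℂ) * Complex.exp (Complex.I * (μ * u : ℝ)))
    + 2 * Complex.I * (sineIntegral (μ * b) : ℂ)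

theorem integrable_cut_regularPart (hφ : IsCutoff m ε φ) {Φ : ℝ} (hΦ : ∀ x, |φ x| ≤ Φ) {c : ℝ}
    (hc : 0 ≤ c) (hcε : c * ε ≤ 1 / 4) (η μ : ℝ) :
    Integrable fun u : ℝ => ((if η < |u + c * u ^ 2| then regularPart φ (ε / 4) c u else 0 : ℝ) : ℂ)
      * Complex.exp (Complex.I * (μ * u : ℝ)) := by
  have hi := (integrable_regularPart hφ hΦ hc hcε).1
  have h1 : Integrable fun u : ℝ =>
      if η < |u + c * u ^ 2| then regularPart φ (ε / 4) c u else 0 := by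
    refine hi.norm.mono' (Measurable.ite (measurableSet_lt measurable_const (by fun_prop))
      (measurable_regularPart hφ _ _) measurable_const).aestronglyMeasurable
      (Eventually.of_forall fun u => ?_)
    split_ifs
    · exact le_rfl
    · rw [norm_zero]; exact norm_nonneg _
  exact h1.ofReal.mul_bdd (c := 1) (Continuous.aestronglyMeasurable (by fun_prop))
    (Eventually.of_forall fun u => (norm_exp_I_mul _).le)

theorem cutTransform_eq (hφ : IsCutoff m ε φ) {Φ : ℝ} (hΦ : ∀ x, |φ x| ≤ Φ) {c : ℝ}
    (hc : 0 ≤ c) (hcε : c * ε ≤ 1 / 4) {η : ℝ} (hη : 0 < η) (μ : ℝ) :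
    cutTransform φ η c μ =
      (∫ u : ℝ, ((if η < |u + c * u ^ 2| then regularPart φ (ε / 4) c u else 0 : ℝ) : ℂ)
        * Complex.exp (Complex.I * (μ * u : ℝ)))
      + ∫ u : ℝ, ((if |u| ≤ ε / 4 then (if η < |u + c * u ^ 2| then u⁻¹ else 0) else 0 : ℝ) : ℂ)
        * Complex.exp (Complex.I * (μ * u : ℝ)) := by
  have hcb : c * (ε / 4) ≤ 1 / 16 := by linarith
  rw [← integral_add (integrable_cut_regularPart hφ hΦ hc hcε η μ)]
  · unfold cutTransform
    refine integral_congr_ae (Eventually.of_forall fun u => ?_)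
    simp only
    rw [propCut_eq_regularPart_add (b := ε / 4) hη, ← add_mul]
    push_cast
    rfl
  · exact (integrable_cut hη hc hcb).ofReal.mul_bdd (c := 1)
      (Continuous.aestronglyMeasurable (by fun_prop))
      (Eventually.of_forall fun u => (norm_exp_I_mul _).le)

theorem norm_cutTransform_le (hφ : IsCutoff m ε φ) {Φ : ℝ} (hΦ : ∀ x, |φ x| ≤ Φ) {c : ℝ}
    (hc : 0 ≤ c) (hcε : c * ε ≤ 1 / 4) {η : ℝ} (hη : 0 < η) (hηε : η ≤ ε / 4) (μ : ℝ) :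
    ‖cutTransform φ η c μ‖ ≤ 16 + 32 * Φ := by
  have hε := hφ.eps_pos
  have hcb : c * (ε / 4) ≤ 1 / 16 := by linarith
  obtain ⟨hi, hib⟩ := integrable_regularPart hφ hΦ hc hcε
  rw [cutTransform_eq hφ hΦ hc hcε hη]
  have h1 : ‖∫ u : ℝ, ((if η < |u + c * u ^ 2| then regularPart φ (ε / 4) c u else 0 : ℝ) : ℂ)
        * Complex.exp (Complex.I * (μ * u : ℝ))‖ ≤ 2 + 32 * Φ := by
    refine (norm_integral_le_of_norm_le hi.abs (Eventually.of_forall fun u => ?_)).trans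
      (hib.trans ?_)
    · rw [norm_mul, norm_exp_I_mul, mul_one, Complex.norm_real, Real.norm_eq_abs]
      split_ifs
      · exact le_rfl
      · rw [abs_zero]; exact abs_nonneg _
    · have e : 4 * ε * (2 * c + 8 * Φ * ε⁻¹) = 8 * (c * ε) + 32 * Φ := by field_simp; ring
      linarith
  have h2 := norm_integral_cut_sub_le hη hηε hc hcb μ
  have h3 : ‖2 * Complex.I * ((sineIntegral (μ * (ε / 4)) - sineIntegral (μ * η) : ℝ) : ℂ)‖ ≤ 12 := by
    rw [norm_mul, norm_mul, Complex.norm_I, Complex.norm_real, Real.norm_eq_abs]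
    have := abs_sub (sineIntegral (μ * (ε / 4))) (sineIntegral (μ * η))
    have := abs_sineIntegral_le_three (μ * (ε / 4))
    have := abs_sineIntegral_le_three (μ * η)
    norm_num
    linarith
  have h4 : 32 * c * η ≤ 2 := by
    have : c * η ≤ c * (ε / 4) := by gcongr
    linarith
  refine (norm_add_le _ _).trans ?_
  have h5 := norm_le_norm_sub_add (∫ u : ℝ, ((if |u| ≤ ε / 4 then (if η < |u + c * u ^ 2| then u⁻¹ else 0) else 0 : ℝ) : ℂ)
        * Complex.exp (Complex.I * (μ * u : ℝ))) (2 * Complex.I * ((sineIntegral (μ * (ε / 4)) - sineIntegral (μ * η) : ℝ) : ℂ))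
  linarith

theorem tendsto_cutTransform (hφ : IsCutoff m ε φ) {Φ : ℝ} (hΦ : ∀ x, |φ x| ≤ Φ) {c : ℝ}
    (hc : 0 ≤ c) (hcε : c * ε ≤ 1 / 4) (μ : ℝ) :
    Tendsto (fun η => cutTransform φ η c μ) (𝓝[>] 0) (𝓝 (principalTransform φ (ε / 4) c μ)) := by
  have hε := hφ.eps_pos
  have hcb : c * (ε / 4) ≤ 1 / 16 := by linarith
  have hi := (integrable_regularPart hφ hΦ hc hcε).1
  have h1 : Tendsto (fun η : ℝ => ∫ u : ℝ,
      ((if η < |u + c * u ^ 2| then regularPart φ (ε / 4) c u else 0 : ℝ) : ℂ)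
        * Complex.exp (Complex.I * (μ * u : ℝ))) (𝓝[>] 0)
      (𝓝 (∫ u : ℝ, (regularPart φ (ε / 4) c u : ℂ) * Complex.exp (Complex.I * (μ * u : ℝ)))) := by
    refine tendsto_integral_filter_of_dominated_convergence (fun u => |regularPart φ (ε / 4) c u|)
      (Eventually.of_forall fun η => (integrable_cut_regularPart hφ hΦ hc hcε η μ).1)
      (Eventually.of_forall fun η => Eventually.of_forall fun u => ?_) hi.abs
      (Eventually.of_forall fun u => ?_)
    · rw [norm_mul, norm_exp_I_mul, mul_one, Complex.norm_real, Real.norm_eq_abs]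
      split_ifs
      · exact le_rfl
      · rw [abs_zero]; exact abs_nonneg _
    · by_cases hr : regularPart φ (ε / 4) c u = 0
      · simp [hr]
      have h0 : 0 < |u + c * u ^ 2| := by
        rw [abs_pos]
        intro h
        have hu : u ≠ 0 := by rintro rfl; simp [regularPart] at hr
        have hcu : c * u = -1 := by
          have : (1 + c * u) * u = 0 := by linarith
          rcases mul_eq_zero.1 this with h' | h'
          · linarith
          · exact absurd h' hu
        apply hr
        rw [regularPart, if_neg (by rw [hcu]; norm_num), if_neg]
        · simp
        · intro hle
          have := abs_le.1 hle
          nlinarith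
      refine tendsto_const_nhds.congr' ?_
      filter_upwards [nhdsWithin_le_nhds (eventually_lt_nhds h0)] with η hη
      rw [if_pos hη]
  have h2 : Tendsto (fun η : ℝ => ∫ u : ℝ,
      ((if |u| ≤ ε / 4 then (if η < |u + c * u ^ 2| then u⁻¹ else 0) else 0 : ℝ) : ℂ)
        * Complex.exp (Complex.I * (μ * u : ℝ))) (𝓝[>] 0)
      (𝓝 (2 * Complex.I * (sineIntegral (μ * (ε / 4)) : ℂ))) := by
    have h3 : Tendsto (fun η : ℝ => 2 * Complex.I *
        ((sineIntegral (μ * (ε / 4)) - sineIntegral (μ * η) : ℝ) : ℂ)) (𝓝[>] 0)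
        (𝓝 (2 * Complex.I * (sineIntegral (μ * (ε / 4)) : ℂ))) := by
      have hcs := continuous_sineIntegral
      have : Continuous fun η : ℝ => 2 * Complex.I *
        ((sineIntegral (μ * (ε / 4)) - sineIntegral (μ * η) : ℝ) : ℂ) := by fun_prop
      have h4 := this.tendsto 0
      simp only [mul_zero] at h4
      have h5 : sineIntegral 0 = 0 := by simp [sineIntegral]
      rw [h5, sub_zero] at h4
      exact h4.mono_left nhdsWithin_le_nhds
    refine (tendsto_iff_of_dist ?_).2 h3
    have h6 : Tendsto (fun η : ℝ => 32 * c * η) (𝓝[>] 0) (𝓝 0) := by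
      have : Tendsto (fun η : ℝ => 32 * c * η) (𝓝 0) (𝓝 (32 * c * 0)) :=
        (by fun_prop : Continuous fun η : ℝ => 32 * c * η).tendsto 0
      rw [mul_zero] at this
      exact this.mono_left nhdsWithin_le_nhds
    refine squeeze_zero' (Eventually.of_forall fun _ => dist_nonneg) ?_ h6
    filter_upwards [self_mem_nhdsWithin, nhdsWithin_le_nhds (eventually_le_nhds
      (show (0 : ℝ) < ε / 4 by linarith))] with η hη hηε
    rw [dist_eq_norm]
    exact norm_integral_cut_sub_le hη hηε hc hcb μ
  refine (h1.add h2).congr' ?_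
  filter_upwards [self_mem_nhdsWithin] with η hη
  exact (cutTransform_eq hφ hΦ hc hcε hη μ).symm

theorem tendsto_principalTransform_atTop (hb : 0 < ε) (c : ℝ) :
    Tendsto (principalTransform φ (ε / 4) c) atTop (𝓝 (Complex.I * Real.pi)) := by
  have h1 := (tendsto_integral_mul_exp fun u => (regularPart φ (ε / 4) c u : ℂ)).mono_left
    atTop_le_cocompact
  have h2 : Tendsto (fun μ : ℝ => 2 * Complex.I * (sineIntegral (μ * (ε / 4)) : ℂ)) atTop
      (𝓝 (2 * Complex.I * ((Real.pi / 2 : ℝ) : ℂ))) :=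
    (Complex.continuous_ofReal.tendsto _ |>.comp (tendsto_sineIntegral.comp
      (tendsto_id.atTop_mul_const (by linarith)))).const_mul _
  have h3 := h1.add h2
  rw [zero_add, show 2 * Complex.I * ((Real.pi / 2 : ℝ) : ℂ) = Complex.I * Real.pi by push_cast; ring] at h3
  exact h3

theorem tendsto_principalTransform_atBot (hb : 0 < ε) (c : ℝ) :
    Tendsto (principalTransform φ (ε / 4) c) atBot (𝓝 (-(Complex.I * Real.pi))) := by
  have h1 := (tendsto_integral_mul_exp fun u => (regularPart φ (ε / 4) c u : ℂ)).mono_left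
    atBot_le_cocompact
  have h2 : Tendsto (fun μ : ℝ => 2 * Complex.I * (sineIntegral (μ * (ε / 4)) : ℂ)) atBot
      (𝓝 (2 * Complex.I * ((-(Real.pi / 2) : ℝ) : ℂ))) :=
    (Complex.continuous_ofReal.tendsto _ |>.comp (tendsto_sineIntegral_atBot.comp
      (tendsto_id.atBot_mul_const (by linarith)))).const_mul _
  have h3 := h1.add h2
  rw [zero_add, show 2 * Complex.I * ((-(Real.pi / 2) : ℝ) : ℂ) = -(Complex.I * Real.pi) by push_cast; ring] at h3
  exact h3

/-- The contribution of the positive energies to the time dependence of the regularized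
propagator. -/
def shellIntegral (φ : ℝ → ℝ) (η a t : ℝ) : ℂ :=
  ∫ e in Ioi (0 : ℝ), (propCut φ η (e ^ 2 - a ^ 2) : ℂ)
    * Complex.exp (Complex.I * ((e - a) * t : ℝ))

theorem shellIntegral_eq {η a : ℝ} (ha : 0 < a) (t : ℝ) :
    shellIntegral φ η a t
      = ((2 * a)⁻¹ : ℝ) * cutTransform φ η ((4 * a ^ 2)⁻¹) (t * (2 * a)⁻¹) := by
  have h1 : shellIntegral φ η a t = ∫ w : ℝ, ((if -a < w then propCut φ η (w ^ 2 + 2 * a * w) else 0 : ℝ) : ℂ)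
      * Complex.exp (Complex.I * (w * t : ℝ)) := by
    unfold shellIntegral
    rw [← integral_indicator measurableSet_Ioi, ← integral_add_right_eq_self _ a]
    refine integral_congr_ae (Eventually.of_forall fun w => ?_)
    simp only [indicator_apply, mem_Ioi]
    have e1 : (w + a) ^ 2 - a ^ 2 = w ^ 2 + 2 * a * w := by ring
    rw [e1, add_sub_cancel_right]
    by_cases h : -a < w
    · rw [if_pos (by linarith), if_pos h]
    · rw [if_neg (by linarith), if_neg h]; simp
  have h2 := Measure.integral_comp_div (fun w : ℝ => ((if -a < w then propCut φ η (w ^ 2 + 2 * a * w) else 0 : ℝ) : ℂ)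
      * Complex.exp (Complex.I * (w * t : ℝ))) (2 * a)
  rw [h1]
  have h3 : cutTransform φ η ((4 * a ^ 2)⁻¹) (t * (2 * a)⁻¹) = |2 * a| •
      ∫ w : ℝ, ((if -a < w then propCut φ η (w ^ 2 + 2 * a * w) else 0 : ℝ) : ℂ)
      * Complex.exp (Complex.I * (w * t : ℝ)) := by
    rw [← h2]
    unfold cutTransform
    refine integral_congr_ae (Eventually.of_forall fun u => ?_)
    simp only
    have e1 : (u / (2 * a)) ^ 2 + 2 * a * (u / (2 * a)) = u + (4 * a ^ 2)⁻¹ * u ^ 2 := by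
      field_simp; ring
    have e2 : (-a < u / (2 * a)) ↔ (-(1 / 2) < (4 * a ^ 2)⁻¹ * u) := by
      rw [lt_div_iff₀ (by positivity), inv_mul_eq_div, lt_div_iff₀ (by positivity)]
      constructor <;> intro h <;> nlinarith
    have e3 : t * (2 * a)⁻¹ * u = u / (2 * a) * t := by ring
    rw [e1, e3]
    simp only [e2]
  rw [h3, abs_of_pos (by positivity), Complex.real_smul, ← mul_assoc, ← Complex.ofReal_mul,
    inv_mul_cancel₀ (by positivity), Complex.ofReal_one, one_mul]

end ShellIntegral

section EnergyKernels

variable {m ε : ℝ} {φ : ℝ → ℝ}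

/-- Functions `κ(ω, e)` of the energy `e = -k⁰` on momenta with `ω(𝐤) = ω`, whose Fourier transforms
in `e` are bounded by `B`. -/
structure IsEnergyKernel (m B : ℝ) (κ : ℝ → ℝ → ℂ) : Prop where
  measurable : Measurable (Function.uncurry κ)
  bounded : ∃ D, ∀ a e, ‖κ a e‖ ≤ D
  integrable : ∀ a, Integrable (κ a)
  bound : ∀ a t, m ≤ a → ‖timeFourier (κ a) t‖ ≤ B

theorem integrable_of_bounded_support {f : ℝ → ℂ} (hf : Measurable f) {D A : ℝ}
    (hD : ∀ e, ‖f e‖ ≤ D) (hA : ∀ e, A < |e| → f e = 0) : Integrable f := by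
  have hi : Integrable ((Icc (-A) A).indicator (fun _ => D) : ℝ → ℝ) :=
    (integrable_indicator_iff measurableSet_Icc).2 (integrableOn_const (by simp))
  refine hi.mono' hf.aestronglyMeasurable (Eventually.of_forall fun e => ?_)
  by_cases h : |e| ≤ A
  · rw [indicator_of_mem (show e ∈ Icc (-A) A from abs_le.1 h)]; exact hD e
  · rw [hA e (not_le.1 h), norm_zero]
    exact indicator_nonneg (fun _ _ => (norm_nonneg _).trans (hD 0)) _

/-- Splitting a Fourier integral into positive and negative energies. -/
theorem timeFourier_eq_add {f : ℝ → ℂ} (hf : Integrable f) (t : ℝ) :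
    timeFourier f t = (∫ e in Ioi (0 : ℝ), f e * Complex.exp (Complex.I * (e * t : ℝ)))
      + ∫ e in Ioi (0 : ℝ), f (-e) * Complex.exp (Complex.I * (-e * t : ℝ)) := by
  have hi : Integrable fun e => f e * Complex.exp (Complex.I * (e * t : ℝ)) :=
    hf.mul_bdd (c := 1) (Continuous.aestronglyMeasurable (by fun_prop))
      (Eventually.of_forall fun e => (norm_exp_I_mul _).le)
  have h2 := integral_comp_neg_Ioi (0 : ℝ) fun e => f e * Complex.exp (Complex.I * (e * t : ℝ))
  rw [neg_zero] at h2
  rw [h2, timeFourier, ← integral_add_compl measurableSet_Ioi hi, compl_Ioi]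

/-- The propagator near the mass shell, multiplied by the time dependent phase `χ_r(in, k)`, as a
function of `ω(𝐤) = a` and `e = -k⁰`. -/
def nearKernel (φ : ℝ → ℝ) (η r a e : ℝ) : ℂ :=
  (propCut φ η (e ^ 2 - a ^ 2) : ℂ)
    * Complex.exp (Complex.I * ((if 0 < e then e - a else e + a) * r : ℝ))

/-- The time dependence of the principal value propagator. -/
def nearLimit (φ : ℝ → ℝ) (ε r a t : ℝ) : ℂ :=
  Complex.exp (Complex.I * (a * t : ℝ)) * (((2 * a)⁻¹ : ℝ) *
      principalTransform φ (ε / 4) ((4 * a ^ 2)⁻¹) ((t + r) * (2 * a)⁻¹))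
    + Complex.exp (Complex.I * (-a * t : ℝ)) * (((2 * a)⁻¹ : ℝ) *
      principalTransform φ (ε / 4) ((4 * a ^ 2)⁻¹) (-(t + r) * (2 * a)⁻¹))

/-- The regularization of `δ_m^+ - δ_m^-`, as a function of `ω(𝐤) = a` and `e = -k⁰`. -/
def deltaKernel (η a e : ℝ) : ℂ :=
  if |e ^ 2 - a ^ 2| < η then -((SignType.sign e : ℝ) * (2 * η)⁻¹ : ℝ) else 0

/-- The time dependence of `δ_m^+ - δ_m^-`. -/
def deltaLimit (a t : ℝ) : ℂ :=
  -(((2 * a)⁻¹ : ℝ) * (Complex.exp (Complex.I * (a * t : ℝ))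
    - Complex.exp (Complex.I * (-a * t : ℝ))))

theorem measurable_nearKernel (hφ : IsCutoff m ε φ) (η r : ℝ) :
    Measurable (Function.uncurry (nearKernel φ η r)) := by
  have h1 : Measurable fun z : ℝ × ℝ => propCut φ η (z.2 ^ 2 - z.1 ^ 2) :=
    (measurable_propCut hφ η).comp (by fun_prop)
  have h2 : Measurable fun z : ℝ × ℝ => (if 0 < z.2 then z.2 - z.1 else z.2 + z.1) :=
    Measurable.ite (measurableSet_lt measurable_const (by fun_prop)) (by fun_prop) (by fun_prop)
  change Measurable fun z : ℝ × ℝ => (propCut φ η (z.2 ^ 2 - z.1 ^ 2) : ℂ)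
    * Complex.exp (Complex.I * ((if 0 < z.2 then z.2 - z.1 else z.2 + z.1) * r : ℝ))
  fun_prop

theorem norm_nearKernel_le {Φ : ℝ} (hΦ : ∀ x, |φ x| ≤ Φ) {η : ℝ} (hη : 0 < η) (r a e : ℝ) :
    ‖nearKernel φ η r a e‖ ≤ η⁻¹ * Φ := by
  rw [nearKernel, norm_mul, norm_exp_I_mul, mul_one, Complex.norm_real]
  exact abs_propCut_le hΦ hη _

theorem nearKernel_eq_zero (hφ : IsCutoff m ε φ) (η r : ℝ) {a e : ℝ} (he : |a| + ε + 1 < |e|) :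
    nearKernel φ η r a e = 0 := by
  have hε := hφ.eps_pos
  have ha := abs_nonneg a
  have h3 : (ε + 1) * 1 ≤ (|e| - |a|) * (|e| + |a|) :=
    mul_le_mul (by linarith) (by linarith) zero_le_one (by linarith)
  have h1 : ε ≤ |e ^ 2 - a ^ 2| := by
    refine le_trans ?_ (le_abs_self _)
    rw [← sq_abs e, ← sq_abs a]
    linarith
  rw [nearKernel, hφ.propCut_eq_zero η h1, Complex.ofReal_zero, zero_mul]

theorem measurable_nearKernel_right (hφ : IsCutoff m ε φ) (η r a : ℝ) :
    Measurable (nearKernel φ η r a) := by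
  have h := (measurable_nearKernel hφ η r).comp (measurable_prodMk_left (x := a))
  exact h

theorem integrable_nearKernel (hφ : IsCutoff m ε φ) {η : ℝ} (hη : 0 < η) (r a : ℝ) :
    Integrable (nearKernel φ η r a) := by
  obtain ⟨Φ, hΦ⟩ : ∃ Φ : ℝ, ∀ x, |φ x| ≤ Φ := hφ.exists_bound.imp fun _ h => h.2
  refine integrable_of_bounded_support (measurable_nearKernel_right hφ η r a) (D := η⁻¹ * Φ)
    (A := |a| + ε + 1) ?_ ?_
  · intro e
    exact norm_nearKernel_le hΦ hη r a e
  · intro e he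
    exact nearKernel_eq_zero hφ η r he

theorem timeFourier_nearKernel (hφ : IsCutoff m ε φ) {η : ℝ} (hη : 0 < η) (r a t : ℝ) :
    timeFourier (nearKernel φ η r a) t
      = Complex.exp (Complex.I * (a * t : ℝ)) * shellIntegral φ η a (t + r)
        + Complex.exp (Complex.I * (-a * t : ℝ)) * shellIntegral φ η a (-(t + r)) := by
  rw [timeFourier_eq_add (integrable_nearKernel hφ hη r a)]
  unfold shellIntegral
  rw [← integral_const_mul, ← integral_const_mul]
  congr 1
  · refine setIntegral_congr_fun measurableSet_Ioi fun e he => ?_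
    simp only [nearKernel]
    rw [if_pos (mem_Ioi.1 he), mul_assoc, ← Complex.exp_add, mul_left_comm, ← Complex.exp_add]
    congr 2
    push_cast; ring
  · refine setIntegral_congr_fun measurableSet_Ioi fun e he => ?_
    have he' : 0 < e := he
    simp only [nearKernel]
    rw [if_neg (by linarith), mul_assoc, ← Complex.exp_add, mul_left_comm, ← Complex.exp_add, neg_sq]
    congr 2
    push_cast; ring

theorem four_inv_sq_mul_le (hm : 0 < m) (hφ : IsCutoff m ε φ) {a : ℝ} (ha : m ≤ a) :
    (4 * a ^ 2)⁻¹ * ε ≤ 1 / 4 := by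
  have h := hφ.eps_lt
  have ha0 : 0 < a := hm.trans_le ha
  rw [inv_mul_le_iff₀ (by positivity)]
  nlinarith

theorem isEnergyKernel_nearKernel (hm : 0 < m) (hφ : IsCutoff m ε φ) {Φ : ℝ}
    (hΦ : ∀ x, |φ x| ≤ Φ) {η : ℝ} (hη : 0 < η) (hηε : η ≤ ε / 4) (r : ℝ) :
    IsEnergyKernel m ((16 + 32 * Φ) * m⁻¹) (nearKernel φ η r) where
  measurable := measurable_nearKernel hφ η r
  bounded := ⟨_, norm_nearKernel_le hΦ hη r⟩
  integrable := integrable_nearKernel hφ hη r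
  bound a t ha := by
    have ha0 : 0 < a := hm.trans_le ha
    have hΦ0 : 0 ≤ Φ := (abs_nonneg _).trans (hΦ 0)
    have h1 : ∀ τ, ‖shellIntegral φ η a τ‖ ≤ (2 * m)⁻¹ * (16 + 32 * Φ) := fun τ => by
      rw [shellIntegral_eq ha0, norm_mul, Complex.norm_real, Real.norm_of_nonneg (by positivity)]
      gcongr
      exact norm_cutTransform_le hφ hΦ (by positivity) (four_inv_sq_mul_le hm hφ ha) hη hηε _
    rw [timeFourier_nearKernel hφ hη]
    refine (norm_add_le _ _).trans ?_
    rw [norm_mul, norm_mul, norm_exp_I_mul, norm_exp_I_mul, one_mul, one_mul]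
    have e : (16 + 32 * Φ) * m⁻¹ = (2 * m)⁻¹ * (16 + 32 * Φ) + (2 * m)⁻¹ * (16 + 32 * Φ) := by
      rw [mul_inv]; ring
    rw [e]
    exact add_le_add (h1 _) (h1 _)

theorem tendsto_timeFourier_nearKernel (hm : 0 < m) (hφ : IsCutoff m ε φ) (r : ℝ) {a : ℝ}
    (ha : m ≤ a) (t : ℝ) :
    Tendsto (fun η => timeFourier (nearKernel φ η r a) t) (𝓝[>] 0) (𝓝 (nearLimit φ ε r a t)) := by
  obtain ⟨Φ, -, hΦ⟩ := hφ.exists_bound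
  have ha0 : 0 < a := hm.trans_le ha
  have h := tendsto_cutTransform hφ hΦ (c := (4 * a ^ 2)⁻¹) (by positivity)
    (four_inv_sq_mul_le hm hφ ha)
  refine ((((h ((t + r) * (2 * a)⁻¹)).const_mul (((2 * a)⁻¹ : ℝ) : ℂ)).const_mul
    (Complex.exp (Complex.I * (a * t : ℝ)))).add
    (((h (-(t + r) * (2 * a)⁻¹)).const_mul (((2 * a)⁻¹ : ℝ) : ℂ)).const_mul
    (Complex.exp (Complex.I * (-a * t : ℝ))))).congr' ?_
  filter_upwards [self_mem_nhdsWithin] with η hη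
  rw [timeFourier_nearKernel hφ hη, shellIntegral_eq ha0, shellIntegral_eq ha0]

theorem tendsto_nearLimit_atTop (hφ : IsCutoff m ε φ) {a : ℝ} (ha : 0 < a) (t : ℝ) :
    Tendsto (fun r => nearLimit φ ε r a t) atTop
      (𝓝 (-(Complex.I * Real.pi) * deltaLimit a t)) := by
  have h1 := tendsto_principalTransform_atTop (φ := φ) hφ.eps_pos ((4 * a ^ 2)⁻¹)
  have h2 := tendsto_principalTransform_atBot (φ := φ) hφ.eps_pos ((4 * a ^ 2)⁻¹)
  have t1 : Tendsto (fun r : ℝ => (t + r) * (2 * a)⁻¹) atTop atTop :=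
    (tendsto_atTop_add_const_left _ _ tendsto_id).atTop_mul_const (by positivity)
  have t2 : Tendsto (fun r : ℝ => -(t + r) * (2 * a)⁻¹) atTop atBot :=
    (tendsto_neg_atTop_atBot.comp (tendsto_atTop_add_const_left _ _ tendsto_id)).atBot_mul_const
      (by positivity)
  have h3 := (((h1.comp t1).const_mul (((2 * a)⁻¹ : ℝ) : ℂ)).const_mul
    (Complex.exp (Complex.I * (a * t : ℝ)))).add (((h2.comp t2).const_mul
    (((2 * a)⁻¹ : ℝ) : ℂ)).const_mul (Complex.exp (Complex.I * (-a * t : ℝ))))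
  refine h3.trans (le_of_eq ?_)
  congr 1
  rw [deltaLimit]; ring

theorem tendsto_nearLimit_atBot (hφ : IsCutoff m ε φ) {a : ℝ} (ha : 0 < a) (t : ℝ) :
    Tendsto (fun r => nearLimit φ ε r a t) atBot
      (𝓝 (Complex.I * Real.pi * deltaLimit a t)) := by
  have h1 := tendsto_principalTransform_atTop (φ := φ) hφ.eps_pos ((4 * a ^ 2)⁻¹)
  have h2 := tendsto_principalTransform_atBot (φ := φ) hφ.eps_pos ((4 * a ^ 2)⁻¹)
  have t1 : Tendsto (fun r : ℝ => (t + r) * (2 * a)⁻¹) atBot atBot :=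
    (tendsto_atBot_add_const_left _ _ tendsto_id).atBot_mul_const (by positivity)
  have t2 : Tendsto (fun r : ℝ => -(t + r) * (2 * a)⁻¹) atBot atTop :=
    (tendsto_neg_atBot_atTop.comp (tendsto_atBot_add_const_left _ _ tendsto_id)).atTop_mul_const
      (by positivity)
  have h3 := (((h2.comp t1).const_mul (((2 * a)⁻¹ : ℝ) : ℂ)).const_mul
    (Complex.exp (Complex.I * (a * t : ℝ)))).add (((h1.comp t2).const_mul
    (((2 * a)⁻¹ : ℝ) : ℂ)).const_mul (Complex.exp (Complex.I * (-a * t : ℝ))))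
  refine h3.trans (le_of_eq ?_)
  congr 1
  rw [deltaLimit]; ring

theorem measurable_deltaKernel (η : ℝ) : Measurable (Function.uncurry (deltaKernel η)) := by
  have h1 : Measurable fun z : ℝ × ℝ => (SignType.sign z.2 : ℝ) := by
    have : (fun z : ℝ × ℝ => (SignType.sign z.2 : ℝ))
        = fun z => if 0 < z.2 then 1 else if z.2 < 0 then -1 else 0 := by
      ext z; rw [sign_apply]; split_ifs <;> simp
    rw [this]
    exact Measurable.ite (measurableSet_lt measurable_const (by fun_prop)) measurable_const
      (Measurable.ite (measurableSet_lt (by fun_prop) measurable_const) measurable_const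
        measurable_const)
  change Measurable fun z : ℝ × ℝ => if |z.2 ^ 2 - z.1 ^ 2| < η then
    -((((SignType.sign z.2 : ℝ) * (2 * η)⁻¹ : ℝ)) : ℂ) else 0
  exact Measurable.ite (measurableSet_lt (by fun_prop) measurable_const) (by fun_prop)
    measurable_const

theorem norm_deltaKernel_le {η : ℝ} (hη : 0 < η) (a e : ℝ) : ‖deltaKernel η a e‖ ≤ (2 * η)⁻¹ := by
  unfold deltaKernel
  split_ifs
  · rw [norm_neg, Complex.norm_real, norm_mul, Real.norm_of_nonneg (by positivity : 0 ≤ (2 * η)⁻¹)]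
    refine mul_le_of_le_one_left (by positivity) ?_
    rcases lt_trichotomy e 0 with h | h | h <;> simp [h]
  · rw [norm_zero]; positivity

theorem integrable_deltaKernel {η : ℝ} (hη : 0 < η) (a : ℝ) : Integrable (deltaKernel η a) := by
  refine integrable_of_bounded_support ((measurable_deltaKernel η).comp measurable_prodMk_left)
    (A := |a| + η + 1) (norm_deltaKernel_le hη a) fun e he => ?_
  rw [deltaKernel, if_neg]
  rw [not_lt]
  have h2 : e ^ 2 - a ^ 2 = |e| ^ 2 - |a| ^ 2 := by rw [sq_abs, sq_abs]
  refine le_trans ?_ (le_abs_self _)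
  have ha := abs_nonneg a
  have h3 : (η + 1) * 1 ≤ (|e| - |a|) * (|e| + |a|) :=
    mul_le_mul (by linarith) (by linarith) zero_le_one (by linarith)
  rw [h2]
  linarith

/-- The Fourier transform of the energy interval `{e > 0 : |e² - a²| < η}`. -/
theorem setIntegral_deltaKernel (η a t : ℝ) :
    ∫ e in Ioi (0 : ℝ), (if |e ^ 2 - a ^ 2| < η then (1 : ℂ) else 0)
        * Complex.exp (Complex.I * (e * t : ℝ))
      = ∫ e in Ioo √(a ^ 2 - η) √(a ^ 2 + η), Complex.exp (Complex.I * (e * t : ℝ)) := by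
  rw [← integral_indicator measurableSet_Ioi, ← integral_indicator measurableSet_Ioo]
  congr 1
  ext e
  simp only [indicator_apply, mem_Ioi, mem_Ioo]
  by_cases he : 0 < e
  · rw [if_pos he]
    have : (|e ^ 2 - a ^ 2| < η) ↔ (√(a ^ 2 - η) < e ∧ e < √(a ^ 2 + η)) := by
      rw [abs_lt, Real.sqrt_lt' he, Real.lt_sqrt he.le]
      constructor <;> rintro ⟨h1, h2⟩ <;> constructor <;> linarith
    simp only [this]
    split_ifs <;> simp
  · rw [if_neg he, if_neg]
    rintro ⟨h1, -⟩
    exact he ((Real.sqrt_nonneg _).trans_lt h1)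

theorem timeFourier_deltaKernel {η : ℝ} (hη : 0 < η) (a t : ℝ) :
    timeFourier (deltaKernel η a) t = -(((2 * η)⁻¹ : ℝ) *
      ((∫ e in Ioo √(a ^ 2 - η) √(a ^ 2 + η), Complex.exp (Complex.I * (e * t : ℝ)))
        - ∫ e in Ioo √(a ^ 2 - η) √(a ^ 2 + η), Complex.exp (Complex.I * (e * -t : ℝ)))) := by
  rw [timeFourier_eq_add (integrable_deltaKernel hη a), ← setIntegral_deltaKernel,
    ← setIntegral_deltaKernel, mul_sub, neg_sub, sub_eq_neg_add, ← integral_const_mul,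
    ← integral_const_mul, ← integral_neg]
  congr 1
  · refine setIntegral_congr_fun measurableSet_Ioi fun e he => ?_
    simp only [deltaKernel, sign_pos (mem_Ioi.1 he)]
    split_ifs <;> simp
  · refine setIntegral_congr_fun measurableSet_Ioi fun e he => ?_
    have he' : -e < 0 := neg_lt_zero.2 he
    simp only [deltaKernel, sign_neg he', neg_sq]
    split_ifs <;> simp

theorem norm_setIntegral_exp_le {η a : ℝ} (hη : 0 < η) (ha : 0 < a) (t : ℝ) :
    ‖∫ e in Ioo √(a ^ 2 - η) √(a ^ 2 + η), Complex.exp (Complex.I * (e * t : ℝ))‖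
      ≤ 2 * η * a⁻¹ := by
  refine (norm_setIntegral_le_of_norm_le_const (C := 1) (by simp)
    fun e _ => (norm_exp_I_mul _).le).trans ?_
  have h1 : a ≤ √(a ^ 2 + η) := Real.le_sqrt_of_sq_le (by linarith)
  have h2 : √(a ^ 2 + η) ^ 2 = a ^ 2 + η := Real.sq_sqrt (by positivity)
  have h3 := Real.sqrt_nonneg (a ^ 2 - η)
  have h4 : √(a ^ 2 - η) ≤ √(a ^ 2 + η) := Real.sqrt_le_sqrt (by linarith)
  have h5 : a ^ 2 - η ≤ √(a ^ 2 - η) ^ 2 := by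
    rcases le_total 0 (a ^ 2 - η) with h | h
    · rw [Real.sq_sqrt h]
    · exact h.trans (sq_nonneg _)
  rw [measureReal_def, Real.volume_Ioo, ENNReal.toReal_ofReal (by linarith), one_mul,
    ← div_eq_mul_inv, le_div_iff₀ ha]
  nlinarith

theorem isEnergyKernel_deltaKernel (hm : 0 < m) {η : ℝ} (hη : 0 < η) :
    IsEnergyKernel m (2 * m⁻¹) (deltaKernel η) where
  measurable := measurable_deltaKernel η
  bounded := ⟨_, norm_deltaKernel_le hη⟩
  integrable := integrable_deltaKernel hη
  bound a t ha := by
    have ha0 : 0 < a := hm.trans_le ha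
    rw [timeFourier_deltaKernel hη, norm_neg, norm_mul, Complex.norm_real,
      Real.norm_of_nonneg (by positivity)]
    calc _ ≤ (2 * η)⁻¹ * (2 * η * a⁻¹ + 2 * η * a⁻¹) := by
          gcongr
          exact (norm_sub_le _ _).trans (add_le_add (norm_setIntegral_exp_le hη ha0 _)
            (norm_setIntegral_exp_le hη ha0 _))
      _ = 2 * a⁻¹ := by field_simp; ring
      _ ≤ _ := by gcongr

theorem tendsto_setIntegral_exp {a : ℝ} (ha : 0 < a) (t : ℝ) :
    Tendsto (fun η : ℝ => (((2 * η)⁻¹ : ℝ) : ℂ) *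
      ∫ e in Ioo √(a ^ 2 - η) √(a ^ 2 + η), Complex.exp (Complex.I * (e * t : ℝ)))
      (𝓝[>] 0) (𝓝 (((2 * a)⁻¹ : ℝ) * Complex.exp (Complex.I * (a * t : ℝ)))) := by
  set P : ℝ → ℂ := fun x => ∫ e in (0 : ℝ)..x, Complex.exp (Complex.I * (e * t : ℝ)) with hP
  have hc : Continuous fun e : ℝ => Complex.exp (Complex.I * (e * t : ℝ)) := by fun_prop
  have hsa : √(a ^ 2) = a := Real.sqrt_sq ha.le
  have hPd : HasDerivAt P (Complex.exp (Complex.I * (a * t : ℝ))) a :=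
    intervalIntegral.integral_hasDerivAt_right (hc.intervalIntegrable _ _)
      (hc.stronglyMeasurableAtFilter _ _) hc.continuousAt
  -- `q(η) = P(√(a² + η))`, and the integral is `q(η) - q(-η)`
  have hsq : ∀ σ : ℝ, HasDerivAt (fun η : ℝ => √(a ^ 2 + σ * η)) (σ * (2 * a)⁻¹) 0 := fun σ => by
    have h1 : HasDerivAt (fun η : ℝ => a ^ 2 + σ * η) σ 0 := by
      simpa using ((hasDerivAt_id (0 : ℝ)).const_mul σ).const_add (a ^ 2)
    have h2 := h1.sqrt (by simp [ha.ne'])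
    simp only [mul_zero, add_zero, hsa] at h2
    exact h2
  have hq : ∀ σ : ℝ, HasDerivAt (fun η : ℝ => P √(a ^ 2 + σ * η))
      ((σ * (2 * a)⁻¹) • Complex.exp (Complex.I * (a * t : ℝ))) 0 := fun σ => by
    have hPd' : HasDerivAt P (Complex.exp (Complex.I * (a * t : ℝ))) √(a ^ 2 + σ * 0) := by
      rw [mul_zero, add_zero, hsa]; exact hPd
    exact hPd'.scomp (0 : ℝ) (hsq σ)
  have h1 := ((hq 1).sub (hq (-1))).tendsto_slope_zero_right
  have h2 := h1.const_mul (2 : ℂ)⁻¹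
  have e2 : (2 : ℂ)⁻¹ * ((1 * (2 * a)⁻¹) • Complex.exp (Complex.I * (a * t : ℝ))
      - (-1 * (2 * a)⁻¹) • Complex.exp (Complex.I * (a * t : ℝ)))
      = ((2 * a)⁻¹ : ℝ) * Complex.exp (Complex.I * (a * t : ℝ)) := by
    rw [Complex.real_smul, Complex.real_smul]; push_cast; ring
  rw [e2] at h2
  refine h2.congr' ?_
  filter_upwards [self_mem_nhdsWithin] with η hη
  have hη' : 0 < η := hη
  rw [← integral_Ioc_eq_integral_Ioo, ← intervalIntegral.integral_of_le
    (Real.sqrt_le_sqrt (by linarith))]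
  have e3 : ∫ e in √(a ^ 2 - η)..√(a ^ 2 + η), Complex.exp (Complex.I * (e * t : ℝ))
      = P √(a ^ 2 + η) - P √(a ^ 2 - η) :=
    (intervalIntegral.integral_interval_sub_left (hc.intervalIntegrable _ _)
      (hc.intervalIntegrable _ _)).symm
  rw [e3]
  simp only [Pi.sub_apply, zero_add, one_mul, add_zero, sub_self, sub_zero,
    Complex.real_smul, neg_mul, ← sub_eq_add_neg]
  push_cast
  rw [mul_inv]
  ring

theorem tendsto_timeFourier_deltaKernel {a : ℝ} (ha : 0 < a) (t : ℝ) :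
    Tendsto (fun η => timeFourier (deltaKernel η a) t) (𝓝[>] 0) (𝓝 (deltaLimit a t)) := by
  have h1 := tendsto_setIntegral_exp ha t
  have h2 := tendsto_setIntegral_exp ha (-t)
  have h3 := (h1.sub h2).neg
  have e : deltaLimit a t = -((((2 * a)⁻¹ : ℝ) : ℂ) * Complex.exp (Complex.I * (a * t : ℝ))
      - (((2 * a)⁻¹ : ℝ) : ℂ) * Complex.exp (Complex.I * (a * -t : ℝ))) := by
    rw [deltaLimit, mul_sub, mul_neg a t, neg_mul]
  rw [e]
  refine h3.congr' ?_
  have hpos : 0 < a ^ 2 := by positivity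
  filter_upwards [self_mem_nhdsWithin, nhdsWithin_le_nhds (eventually_lt_nhds hpos)] with η hη hη2
  rw [timeFourier_deltaKernel hη, mul_sub]

end EnergyKernels

/-! ### Limits of propagators inside products of free waves -/

section Engine

variable {s : ℕ} {m : ℝ}

/-- Pointwise limits of Fourier transforms of energy kernels with the common bound `B`. -/
def IsTimeLimit (m B : ℝ) (v : ℝ → ℝ → ℂ) : Prop :=
  ∃ κ : ℕ → ℝ → ℝ → ℂ, (∀ i, IsEnergyKernel m B (κ i)) ∧
    ∀ a t, m ≤ a → Tendsto (fun i => timeFourier (κ i a) t) atTop (𝓝 (v a t))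

theorem IsEnergyKernel.isTimeLimit {B : ℝ} {κ : ℝ → ℝ → ℂ} (hκ : IsEnergyKernel m B κ) :
    IsTimeLimit m B fun a t => timeFourier (κ a) t :=
  ⟨fun _ => κ, fun _ => hκ, fun _ _ _ => tendsto_const_nhds⟩

theorem IsTimeLimit.norm_le {B : ℝ} {v : ℝ → ℝ → ℂ} (hv : IsTimeLimit m B v) {a t : ℝ}
    (ha : m ≤ a) : ‖v a t‖ ≤ B := by
  obtain ⟨κ, hκ, h⟩ := hv
  exact le_of_tendsto (h a t ha).norm (Eventually.of_forall fun i => (hκ i).bound a t ha)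

theorem IsEnergyKernel.measurable_timeFourier {B : ℝ} {κ : ℝ → ℝ → ℂ}
    (hκ : IsEnergyKernel m B κ) : Measurable fun z : ℝ × ℝ => timeFourier (κ z.1) z.2 := by
  unfold timeFourier
  refine (StronglyMeasurable.integral_prod_right' (f := fun z : (ℝ × ℝ) × ℝ =>
    κ z.1.1 z.2 * Complex.exp (Complex.I * (z.2 * z.1.2 : ℝ)))
    (Measurable.stronglyMeasurable ?_)).measurable
  have h1 : Measurable fun z : (ℝ × ℝ) × ℝ => κ z.1.1 z.2 :=
    hκ.measurable.comp (by fun_prop : Measurable fun z : (ℝ × ℝ) × ℝ => (z.1.1, z.2))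
  exact h1.mul (by fun_prop)

theorem IsTimeLimit.measurable {B : ℝ} {v : ℝ → ℝ → ℂ} (hv : IsTimeLimit m B v) :
    Measurable fun z : ℝ × ℝ => v (max m z.1) z.2 := by
  obtain ⟨κ, hκ, h⟩ := hv
  refine measurable_of_tendsto_metrizable
    (f := fun i (z : ℝ × ℝ) => timeFourier (κ i (max m z.1)) z.2) (fun i => ?_)
    (tendsto_pi_nhds.2 fun z => h _ _ (le_max_left _ _))
  exact (hκ i).measurable_timeFourier.comp
    (by fun_prop : Measurable fun z : ℝ × ℝ => (max m z.1, z.2))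

/-- The function of the total momentum `k` and the total energy `e` by which the free waves are
multiplied: the propagator at `-(e, k)`, a weight, and the phase of the point `y`. -/
def vertexKernel (m : ℝ) (L : ℕ) (κ : ℝ → ℝ → ℂ) (y : Mink s) (k : Momentum s) (e : ℝ) : ℂ :=
  (((energy m k ^ L)⁻¹ : ℝ) : ℂ) * κ (energy m k) e
    * Complex.exp (Complex.I * (e * y 0 - ⟪k, spatial y⟫_ℝ : ℝ))

theorem timeFourier_vertexKernel (L : ℕ) (κ : ℝ → ℝ → ℂ) (y : Mink s) (k : Momentum s) (t : ℝ) :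
    timeFourier (vertexKernel m L κ y k) t = (((energy m k ^ L)⁻¹ : ℝ) : ℂ)
      * Complex.exp (-(Complex.I * (⟪k, spatial y⟫_ℝ : ℝ)))
      * timeFourier (κ (energy m k)) (t + y 0) := by
  unfold timeFourier vertexKernel
  rw [← integral_const_mul]
  refine integral_congr_ae (Eventually.of_forall fun e => ?_)
  simp only
  have : Complex.exp (Complex.I * ((e * y 0 - ⟪k, spatial y⟫_ℝ : ℝ) : ℂ))
      * Complex.exp (Complex.I * (e * t : ℝ))
      = Complex.exp (-(Complex.I * (⟪k, spatial y⟫_ℝ : ℝ)))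
        * Complex.exp (Complex.I * (e * (t + y 0) : ℝ)) := by
    rw [← Complex.exp_add, ← Complex.exp_add]; congr 1; push_cast; ring
  linear_combination (((energy m k ^ L)⁻¹ : ℝ) : ℂ) * κ (energy m k) e * this

theorem norm_timeFourier_vertexKernel (L : ℕ) (κ : ℝ → ℝ → ℂ) (y : Mink s)
    (k : Momentum s) (t : ℝ) : ‖timeFourier (vertexKernel m L κ y k) t‖
      = (energy m k ^ L)⁻¹ * ‖timeFourier (κ (energy m k)) (t + y 0)‖ := by
  have := energy_nonneg m k
  rw [timeFourier_vertexKernel, norm_mul, norm_mul, norm_exp_neg_I_mul, mul_one,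
    Complex.norm_real, Real.norm_of_nonneg (by positivity)]

theorem continuous_spatial : Continuous (spatial : Mink s → Momentum s) := by
  unfold spatial
  fun_prop

theorem measurable_vertexKernel (hm : 0 < m) (L : ℕ) {κ : ℝ → ℝ → ℂ}
    (hκ : Measurable (Function.uncurry κ)) {X : Type} [MeasurableSpace X] {y : X → Mink s}
    (hy : Measurable y) {k : X → Momentum s} (hk : Measurable k) {e : X → ℝ} (he : Measurable e) :
    Measurable fun z => vertexKernel m L κ (y z) (k z) (e z) := by
  have hE := (continuous_energy (s := s) m).measurable
  have hE' := (continuous_inv_energy_pow (s := s) hm L).measurable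
  have h1 : Measurable fun z => κ (energy m (k z)) (e z) :=
    hκ.comp ((hE.comp hk).prodMk he)
  have h2 : Measurable fun z => spatial (y z) := continuous_spatial.measurable.comp hy
  have h3 : Measurable fun z => (energy m (k z) ^ L)⁻¹ := hE'.comp hk
  have h4 : Measurable fun z => y z 0 := by fun_prop
  have h5 : Measurable fun z => ⟪k z, spatial (y z)⟫_ℝ := hk.inner h2
  unfold vertexKernel
  fun_prop

theorem norm_vertexKernel_le (hm : 0 < m) (L : ℕ) {κ : ℝ → ℝ → ℂ} {D : ℝ}
    (hD : ∀ a e, ‖κ a e‖ ≤ D) (y : Mink s) (k : Momentum s) (e : ℝ) :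
    ‖vertexKernel m L κ y k e‖ ≤ (m ^ L)⁻¹ * D := by
  have hE := energy_pos hm k
  rw [vertexKernel, norm_mul, norm_mul, norm_exp_I_mul, mul_one, Complex.norm_real,
    Real.norm_of_nonneg (by positivity)]
  gcongr
  · exact le_energy m k
  · exact hD _ _

theorem IsEnergyKernel.isKernel_vertexKernel (hm : 0 < m) {B : ℝ} {κ : ℝ → ℝ → ℂ}
    (hκ : IsEnergyKernel m B κ) (L : ℕ) (y : Mink s) : IsKernel (vertexKernel m L κ y) where
  measurable := measurable_vertexKernel hm L hκ.measurable measurable_const measurable_fst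
    measurable_snd
  bounded := by
    obtain ⟨D, hD⟩ := hκ.bounded
    exact ⟨_, norm_vertexKernel_le hm L hD y⟩
  integrable k := by
    have h1 : Integrable fun e => (((energy m k ^ L)⁻¹ : ℝ) : ℂ) * κ (energy m k) e :=
      (hκ.integrable _).const_mul _
    exact h1.mul_bdd (c := 1) (Continuous.aestronglyMeasurable (by fun_prop))
      (Eventually.of_forall fun e => (norm_exp_I_mul _).le)

/-- A functional with a time representation, evaluated on vertex kernels, is given by an
integral over the Fourier transforms of the energy kernels, and hence is continuous along bounded
pointwise limits. -/
theorem HasSpectralRep.exists_timeFunctional (hm : 0 < m) {L : ℕ} {C : ℝ}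
    {T : (Momentum s → ℝ → ℂ) → ℂ} (hT : HasSpectralRep m L C T) (y : Mink s) :
    ∃ Λ : (ℝ → ℝ → ℂ) → ℂ,
      (∀ B κ, IsEnergyKernel m B κ →
        T (vertexKernel m L κ y) = Λ fun a t => timeFourier (κ a) t) ∧
      (∀ B v, IsTimeLimit m B v → ‖Λ v‖ ≤ C * B) ∧
      (∀ (c : ℂ) v, (Λ fun a t => c * v a t) = c * Λ v) ∧
      ∀ (B : ℝ) (J : Type) (l : Filter J) (v : J → ℝ → ℝ → ℂ) (v₀ : ℝ → ℝ → ℂ),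
        l.IsCountablyGenerated → (∀ᶠ i in l, IsTimeLimit m B (v i)) →
        (∀ a t, m ≤ a → Tendsto (fun i => v i a t) l (𝓝 (v₀ a t))) →
        Tendsto (fun i => Λ (v i)) l (𝓝 (Λ v₀)) := by
  obtain ⟨Z, mZ, ν, hν, n, κ, τ, hn, hκ, hτ, hb, hrep⟩ := hT
  have hcE := continuous_inv_energy_pow (s := s) hm L
  have hE := (continuous_energy (s := s) m).measurable
  set g : (ℝ → ℝ → ℂ) → Z → ℂ := fun v z => n z * ((((energy m (κ z) ^ L)⁻¹ : ℝ) : ℂ)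
    * Complex.exp (-(Complex.I * (⟪κ z, spatial y⟫_ℝ : ℝ))) * v (energy m (κ z)) (τ z + y 0))
    with hg
  have hb0 : Integrable (fun z => ‖n z‖ * (energy m (κ z) ^ L)⁻¹) ν ∧
      ∫ z, ‖n z‖ * (energy m (κ z) ^ L)⁻¹ ∂ν ≤ C := by simpa only [add_zero] using hb 0
  have hmeas : ∀ B v, IsTimeLimit m B v → AEStronglyMeasurable (g v) ν := fun B v hv => by
    refine hn.mul (Measurable.aestronglyMeasurable ?_)
    have h1 : Measurable fun z => v (energy m (κ z)) (τ z + y 0) := by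
      have := hv.measurable.comp ((hE.comp hκ).prodMk (hτ.add_const (y 0)))
      simpa only [Function.comp_def, max_eq_right (le_energy m _)] using this
    have h2 : Measurable fun z => (energy m (κ z) ^ L)⁻¹ := hcE.measurable.comp hκ
    have h3 : Measurable fun z => ⟪κ z, spatial y⟫_ℝ := hκ.inner measurable_const
    exact Measurable.mul (by fun_prop) h1
  have hbd : ∀ B v, IsTimeLimit m B v → ∀ z, ‖g v z‖ ≤ ‖n z‖ * (energy m (κ z) ^ L)⁻¹ * B :=
    fun B v hv z => by
      have hEp := energy_pos hm (κ z)
      simp only [hg, norm_mul, norm_exp_neg_I_mul, mul_one, Complex.norm_real]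
      rw [Real.norm_of_nonneg (by positivity), mul_assoc]
      gcongr
      exact hv.norm_le (le_energy m _)
  refine ⟨fun v => ∫ z, g v z ∂ν, fun B χ hχ => ?_, fun B v hv => ?_, fun c v => ?_,
    fun B J l v v₀ hl hv hlim => ?_⟩
  · rw [hrep _ (hχ.isKernel_vertexKernel hm L y) ⟨B, 0, fun k t => ?_⟩]
    · refine integral_congr_ae (Eventually.of_forall fun z => ?_)
      simp only [hg]
      rw [timeFourier_vertexKernel]
    · rw [norm_timeFourier_vertexKernel, add_zero, mul_comm]
      have hEp := energy_pos hm k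
      gcongr
      exact hχ.bound _ _ (le_energy m _)
  · refine (norm_integral_le_of_norm_le (hb0.1.mul_const B)
      (Eventually.of_forall (hbd B v hv))).trans ?_
    rw [integral_mul_const]
    have hB : 0 ≤ B := (norm_nonneg _).trans (hv.norm_le (a := m) (t := 0) le_rfl)
    exact mul_le_mul_of_nonneg_right hb0.2 hB
  · rw [← integral_const_mul]
    refine integral_congr_ae (Eventually.of_forall fun z => ?_)
    simp only [hg]
    ring
  · refine tendsto_integral_filter_of_dominated_convergence _
      (hv.mono fun i hi => hmeas B _ hi) (hv.mono fun i hi => Eventually.of_forall (hbd B _ hi))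
      (hb0.1.mul_const B) (Eventually.of_forall fun z => ?_)
    exact ((hlim _ _ (le_energy m _)).const_mul _).const_mul _

/-- The same for a superposition with an integrable function `F(x)` of functionals that depend on a
parameter `x`. -/
theorem exists_timeFunctional (hm : 0 < m) {L : ℕ} {C : ℝ} {X : Type} [MeasurableSpace X]
    {ν : Measure X} {T : X → (Momentum s → ℝ → ℂ) → ℂ} {y : X → Mink s}
    (hT : ∀ x, HasSpectralRep m L C (T x))
    (hTm : ∀ B κ, IsEnergyKernel m B κ → Measurable fun x => T x (vertexKernel m L κ (y x)))
    {F : X → ℂ} (hF : Integrable F ν) :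
    ∃ Λ : (ℝ → ℝ → ℂ) → ℂ,
      (∀ B κ, IsEnergyKernel m B κ →
        ∫ x, F x * T x (vertexKernel m L κ (y x)) ∂ν = Λ fun a t => timeFourier (κ a) t) ∧
      (∀ B v, IsTimeLimit m B v → ‖Λ v‖ ≤ C * B * ∫ x, ‖F x‖ ∂ν) ∧
      (∀ (c : ℂ) v, (Λ fun a t => c * v a t) = c * Λ v) ∧
      ∀ (B : ℝ) (J : Type) (l : Filter J) (v : J → ℝ → ℝ → ℂ) (v₀ : ℝ → ℝ → ℂ),
        l.IsCountablyGenerated → (∀ᶠ i in l, IsTimeLimit m B (v i)) →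
        (∀ a t, m ≤ a → Tendsto (fun i => v i a t) l (𝓝 (v₀ a t))) →
        Tendsto (fun i => Λ (v i)) l (𝓝 (Λ v₀)) := by
  choose Λ h1 h2 h4 h3 using fun x => (hT x).exists_timeFunctional hm (y x)
  have hmeas : ∀ B v, IsTimeLimit m B v → Measurable fun x => Λ x v := fun B v hv => by
    obtain ⟨κ, hκ, hlim⟩ := hv
    refine measurable_of_tendsto_metrizable
      (f := fun i x => T x (vertexKernel m L (κ i) (y x))) (fun i => hTm B _ (hκ i))
      (tendsto_pi_nhds.2 fun x => ?_)
    simp only [h1 x B _ (hκ _)]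
    exact h3 x B ℕ atTop _ v inferInstance (Eventually.of_forall fun i => (hκ i).isTimeLimit) hlim
  refine ⟨fun v => ∫ x, F x * Λ x v ∂ν, fun B κ hκ => ?_, fun B v hv => ?_, fun c v => ?_,
    fun B J l v v₀ hl hv hlim => ?_⟩
  · simp only [h1 _ B κ hκ]
  · refine (norm_integral_le_of_norm_le (hF.norm.mul_const (C * B))
      (Eventually.of_forall fun x => ?_)).trans (le_of_eq ?_)
    · rw [norm_mul]
      exact mul_le_mul_of_nonneg_left (h2 x B v hv) (norm_nonneg _)
    · rw [integral_mul_const, mul_comm]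
  · rw [← integral_const_mul]
    refine integral_congr_ae (Eventually.of_forall fun x => ?_)
    simp only [h4]
    ring
  · refine tendsto_integral_filter_of_dominated_convergence (fun x => ‖F x‖ * (C * B))
      (hv.mono fun i hi => hF.1.mul (hmeas B _ hi).aestronglyMeasurable)
      (hv.mono fun i hi => Eventually.of_forall fun x => ?_) (hF.norm.mul_const _)
      (Eventually.of_forall fun x => ?_)
    · rw [norm_mul]
      exact mul_le_mul_of_nonneg_left (h2 x B _ hi) (norm_nonneg _)
    · exact (h3 x B J l v v₀ hl hv hlim).const_mul _

theorem measurable_multiWave (hm : 0 < m) {M L : ℕ} {ι : Type} [Fintype ι] (σ : ι → ℝ) {X : Type}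
    [MeasurableSpace X] {x : X → ι → Mink s} (hx : ∀ i, Measurable fun z => x z i)
    {y : X → Mink s} (hy : Measurable y) {κ : ℝ → ℝ → ℂ} (hκ : Measurable (Function.uncurry κ)) :
    Measurable fun z => multiWave m M σ (x z) (vertexKernel m L κ (y z)) := by
  unfold multiWave
  refine (StronglyMeasurable.integral_prod_right' (f := fun w : X × (ι → Momentum s) =>
    (∏ i, wave m M (σ i) (x w.1 i) 0 (w.2 i)) *
      vertexKernel m L κ (y w.1) (∑ i, w.2 i) (∑ i, σ i * energy m (w.2 i)))
    (Measurable.stronglyMeasurable ?_)).measurable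
  have hE := (continuous_energy (s := s) m).measurable
  have hE' := (continuous_inv_energy_pow (s := s) hm M).measurable
  refine Measurable.mul (Finset.measurable_prod _ fun i _ => ?_) (measurable_vertexKernel hm L hκ
    (hy.comp measurable_fst) (by fun_prop) (by fun_prop))
  have h1 : Measurable fun w : X × (ι → Momentum s) => x w.1 i := (hx i).comp measurable_fst
  have h2 : Measurable fun w : X × (ι → Momentum s) => w.2 i := by fun_prop
  have h3 : Measurable fun w : X × (ι → Momentum s) => spatial (x w.1 i) :=
    continuous_spatial.measurable.comp h1
  have h4 : Measurable fun w : X × (ι → Momentum s) => ⟪w.2 i, spatial (x w.1 i)⟫_ℝ := h2.inner h3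
  have h5 : Measurable fun w : X × (ι → Momentum s) => (energy m (w.2 i) ^ M)⁻¹ := hE'.comp h2
  have h6 : Measurable fun w : X × (ι → Momentum s) => x w.1 i 0 := by fun_prop
  unfold wave
  fun_prop

end Engine

/-! ### Elliptic operators on test functions and the norms `‖·‖_{K,L}` -/

section EllipticOp

open scoped LineDeriv

variable {s n : ℕ}

/-- The unit vector of the coordinate `x_l^μ`. -/
def coordDir (l : Fin n) (μ : Fin (s + 1)) : MinkN s n :=
  PiLp.single 2 l (EuclideanSpace.single μ (1 : ℝ))

/-- The operator `c - ∑_{μ ∈ S} (∂/∂x_l^μ)²`. -/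
def ellipticOp (c : ℝ) (S : Finset (Fin (s + 1))) (l : Fin n) (g : TestFn s n) : TestFn s n :=
  c • g - ∑ μ ∈ S, ∂_{coordDir l μ} (∂_{coordDir l μ} g)

/-- The operators `c - ∑_{μ ∈ S} (∂/∂x_l^μ)²` in all the arguments `x_l`, `l ∈ ls`, each applied `N`
times. -/
def ellipticOps (c : ℝ) (S : Finset (Fin (s + 1))) (N : ℕ) (ls : List (Fin n)) (g : TestFn s n) :
    TestFn s n :=
  ls.foldr (fun l G => (ellipticOp c S l)^[N] G) g

/-- The symbol of `ellipticOp`. -/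
def ellipticSymbol (c : ℝ) (S : Finset (Fin (s + 1))) (k : Mink s) : ℝ := c + ∑ μ ∈ S, k μ ^ 2

theorem minkFourier_lineDeriv (v : MinkN s n) (g : TestFn s n) (k : MinkN s n) :
    minkFourier s n (∂_{v} g) k
      = Complex.I * ((∑ l, minkInner (v l) (k l) : ℝ) : ℂ) * minkFourier s n g k := by
  have h : ∀ f : TestFn s n,
      minkFourier s n f k = fourierConst s n * (𝓕 f) (fourierScale s n k) := fun f => rfl
  have hg : Function.HasTemperateGrowth fun x : MinkN s n => (inner ℝ x v : ℝ) := by fun_prop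
  rw [h, h, SchwartzMap.fourier_lineDerivOp_eq, FunLike.coe_smul, Pi.smul_apply,
    SchwartzMap.smulLeftCLM_apply_apply hg, real_inner_comm, inner_fourierScale, Complex.real_smul,
    smul_eq_mul]
  push_cast
  have : (Real.pi : ℂ) ≠ 0 := by exact_mod_cast Real.pi_ne_zero
  field_simp

theorem sum_minkInner_coordDir_sq (l : Fin n) (μ : Fin (s + 1)) (k : MinkN s n) :
    (∑ i, minkInner (coordDir l μ i) (k i)) ^ 2 = k l μ ^ 2 := by
  rw [Finset.sum_eq_single l]
  · refine Fin.cases ?_ (fun i => ?_) μ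
    · simp [coordDir, minkInner]
    · simp [coordDir, minkInner]
  · intro i _ hi
    simp [coordDir, minkInner, hi]
  · simp

theorem minkFourier_ellipticOp (c : ℝ) (S : Finset (Fin (s + 1))) (l : Fin n) (g : TestFn s n)
    (k : MinkN s n) : minkFourier s n (ellipticOp c S l g) k
      = (ellipticSymbol c S (k l) : ℂ) * minkFourier s n g k := by
  have h2 : ∀ μ : Fin (s + 1), minkFourier s n (∂_{coordDir l μ} (∂_{coordDir l μ} g)) k
      = -((k l μ ^ 2 : ℝ) : ℂ) * minkFourier s n g k := fun μ => by
    rw [minkFourier_lineDeriv, minkFourier_lineDeriv, ← sum_minkInner_coordDir_sq]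
    push_cast
    linear_combination (∑ i, (minkInner (coordDir l μ i) (k i) : ℂ)) ^ 2 * minkFourier s n g k
      * Complex.I_sq
  have h1 : minkFourier s n (c • g) = c • minkFourier s n g := by
    rw [← Complex.coe_smul, map_smul, Complex.coe_smul]
  rw [ellipticOp, map_sub, map_sum, h1, FunLike.coe_sub, Pi.sub_apply, sum_apply,
    FunLike.coe_smul, Pi.smul_apply]
  simp only [h2]
  rw [← Finset.sum_mul, Complex.real_smul, ellipticSymbol]
  push_cast
  rw [Finset.sum_neg_distrib]
  ring

theorem minkFourier_ellipticOps (c : ℝ) (S : Finset (Fin (s + 1))) (N : ℕ) (ls : List (Fin n))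
    (g : TestFn s n) (k : MinkN s n) : minkFourier s n (ellipticOps c S N ls g) k
      = (((ls.map fun l => ellipticSymbol c S (k l) ^ N).prod : ℝ) : ℂ) * minkFourier s n g k := by
  have h1 : ∀ (l : Fin n) (N : ℕ) (g : TestFn s n),
      minkFourier s n ((ellipticOp c S l)^[N] g) k
        = ((ellipticSymbol c S (k l) ^ N : ℝ) : ℂ) * minkFourier s n g k := by
    intro l N g
    induction N with
    | zero => simp
    | succ N ih =>
      rw [Function.iterate_succ_apply', minkFourier_ellipticOp, ih]
      push_cast; ring
  induction ls with
  | nil => simp [ellipticOps]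
  | cons l ls ih =>
    rw [ellipticOps, List.foldr_cons, h1, ← ellipticOps, ih, List.map_cons, List.prod_cons]
    push_cast; ring

/-- Weighted bounds for all derivatives of `g` with at most `u_l` derivatives in the argument
`x_l`. -/
def DerivBound (L : ℕ) (u : Fin n → ℕ) (B : ℝ) (g : TestFn s n) : Prop :=
  ∀ (r : ℕ) (w : Fin r → Fin n × Fin (s + 1)),
    (∀ l, (Finset.univ.filter fun i => (w i).1 = l).card ≤ u l) → ∀ x : MinkN s n,
      (∏ l, Real.sqrt (1 + ‖x l‖ ^ 2) ^ L) * ‖(∂^{fun i => coordDir (w i).1 (w i).2} g) x‖ ≤ B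

theorem derivBound_schwartzNorm (K L : ℕ) (g : TestFn s n) :
    DerivBound L (fun _ => K) (schwartzNorm s n K L g) g := by
  intro r w hw x
  rw [SchwartzMap.iteratedLineDerivOp_eq_iteratedFDeriv]
  exact le_ciSup (weightedDeriv_bdd K L g) (⟨⟨r, w⟩, hw⟩, x)

theorem DerivBound.lineDeriv {L : ℕ} {u : Fin n → ℕ} {B : ℝ} {g : TestFn s n} {l : Fin n}
    (h : DerivBound L (fun i => u i + if i = l then 1 else 0) B g) (μ : Fin (s + 1)) :
    DerivBound L u B (∂_{coordDir l μ} g) := by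
  intro r w hw x
  have h1 := h (r + 1) (Fin.snoc w (l, μ)) (fun i => ?_) x
  · rw [LineDeriv.iteratedLineDerivOp_succ_right] at h1
    have e1 : Fin.init (fun i => coordDir ((Fin.snoc w (l, μ) : Fin (r + 1) → Fin n × Fin (s + 1)) i).1
        ((Fin.snoc w (l, μ) : Fin (r + 1) → Fin n × Fin (s + 1)) i).2)
        = fun i => coordDir (w i).1 (w i).2 := by
      ext i : 1
      simp only [Fin.init, Fin.snoc_castSucc]
    simpa only [e1, Fin.snoc_last] using h1
  · have h2 := hw i
    rw [Finset.card_filter] at h2 ⊢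
    rw [Fin.sum_univ_castSucc]
    simp only [Fin.snoc_castSucc, Fin.snoc_last]
    simp only [eq_comm (a := l)]
    omega

theorem DerivBound.mono {L : ℕ} {u v : Fin n → ℕ} {B : ℝ} {g : TestFn s n}
    (h : DerivBound L v B g) (huv : ∀ l, u l ≤ v l) : DerivBound L u B g :=
  fun r w hw => h r w fun l => (hw l).trans (huv l)

theorem DerivBound.ellipticOp {L : ℕ} {u : Fin n → ℕ} {B c : ℝ} {g : TestFn s n} {l : Fin n}
    (hc : 0 ≤ c) (S : Finset (Fin (s + 1)))
    (h : DerivBound L (fun i => u i + if i = l then 2 else 0) B g) :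
    DerivBound L u ((c + S.card) * B) (ellipticOp c S l g) := by
  have h0 : DerivBound L u B g := h.mono fun i => Nat.le_add_right _ _
  have h2 : ∀ μ, DerivBound L u B (∂_{coordDir l μ} (∂_{coordDir l μ} g)) := fun μ => by
    refine (DerivBound.lineDeriv (u := fun i => u i + if i = l then 1 else 0)
      (h.mono fun i => ?_) μ).lineDeriv μ
    split_ifs <;> omega
  intro r w hw x
  have e : (∂^{fun i => coordDir (w i).1 (w i).2} (IndefMetricQFT.ellipticOp c S l g)) x
      = c • (∂^{fun i => coordDir (w i).1 (w i).2} g) x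
        - ∑ μ ∈ S, (∂^{fun i => coordDir (w i).1 (w i).2}
          (∂_{coordDir l μ} (∂_{coordDir l μ} g))) x := by
    rw [IndefMetricQFT.ellipticOp, sub_eq_add_neg, LineDeriv.iteratedLineDerivOp_add,
      LineDeriv.iteratedLineDerivOp_neg, LineDeriv.iteratedLineDerivOp_smul,
      LineDeriv.iteratedLineDerivOp_sum, ← sub_eq_add_neg, FunLike.coe_sub, Pi.sub_apply,
      sum_apply, FunLike.coe_smul, Pi.smul_apply]
  rw [e]
  set W := ∏ l, Real.sqrt (1 + ‖x l‖ ^ 2) ^ L with hW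
  have hW0 : 0 ≤ W := by positivity
  calc _ ≤ W * (c * ‖(∂^{fun i => coordDir (w i).1 (w i).2} g) x‖
        + ∑ μ ∈ S, ‖(∂^{fun i => coordDir (w i).1 (w i).2}
          (∂_{coordDir l μ} (∂_{coordDir l μ} g))) x‖) := by
        gcongr
        refine (norm_sub_le _ _).trans (add_le_add ?_ (norm_sum_le _ _))
        rw [norm_smul, Real.norm_of_nonneg hc]
    _ = c * (W * ‖(∂^{fun i => coordDir (w i).1 (w i).2} g) x‖)
        + ∑ μ ∈ S, W * ‖(∂^{fun i => coordDir (w i).1 (w i).2}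
          (∂_{coordDir l μ} (∂_{coordDir l μ} g))) x‖ := by
        rw [mul_add, Finset.mul_sum]; ring
    _ ≤ c * B + ∑ _μ ∈ S, B := by
        gcongr with μ _
        · exact h0 r w hw x
        · exact h2 μ r w hw x
    _ = _ := by rw [Finset.sum_const, nsmul_eq_mul]; ring

theorem DerivBound.ellipticOps {L : ℕ} {B c : ℝ} {g : TestFn s n} (hc : 0 ≤ c)
    (S : Finset (Fin (s + 1))) (N : ℕ) (ls : List (Fin n)) {u : Fin n → ℕ}
    (h : DerivBound L (fun i => u i + 2 * N * ls.count i) B g) :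
    DerivBound L u ((c + S.card) ^ (N * ls.length) * B) (ellipticOps c S N ls g) := by
  have h1 : ∀ (l : Fin n) (N : ℕ) (u : Fin n → ℕ) (B : ℝ) (g : TestFn s n),
      DerivBound L (fun i => u i + if i = l then 2 * N else 0) B g →
      DerivBound L u ((c + S.card) ^ N * B) ((IndefMetricQFT.ellipticOp c S l)^[N] g) := by
    intro l N
    induction N with
    | zero => intro u B g h; simpa using h
    | succ N ih =>
      intro u B g h
      rw [Function.iterate_succ_apply', pow_succ', mul_assoc]
      refine DerivBound.ellipticOp hc S (ih _ _ _ (h.mono fun i => ?_))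
      split_ifs <;> omega
  induction ls generalizing u with
  | nil => simpa [IndefMetricQFT.ellipticOps] using h
  | cons l ls ih =>
    rw [IndefMetricQFT.ellipticOps, List.foldr_cons, ← IndefMetricQFT.ellipticOps]
    have e : (c + S.card) ^ (N * (l :: ls).length) * B
        = (c + S.card) ^ N * ((c + S.card) ^ (N * ls.length) * B) := by
      rw [List.length_cons, mul_add, mul_one, pow_add]; ring
    rw [e]
    refine h1 l N u _ _ (ih (h.mono fun i => ?_))
    rw [List.count_cons]
    by_cases hi : i = l
    · subst hi; simp; ring_nf; omega
    · simp [hi, Ne.symm hi]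

theorem count_finRange (l : Fin n) : (List.finRange n).count l = 1 :=
  List.count_eq_one_of_mem (List.nodup_finRange n) (List.mem_finRange l)

/-- The function `∏_l (1 + |x_l|²)^{-L/2}` is integrable for large `L`. -/
theorem integrable_prod_weight (s n : ℕ) {L : ℕ} (hL : s + 2 ≤ L) :
    Integrable fun x : MinkN s n => (∏ l, Real.sqrt (1 + ‖x l‖ ^ 2) ^ L)⁻¹ := by
  have h1 : Integrable fun y : Mink s => (Real.sqrt (1 + ‖y‖ ^ 2) ^ L)⁻¹ := by
    have h2 := integrable_one_add_norm (E := Mink s) (μ := volume) (r := (L : ℝ)) (by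
      rw [finrank_euclideanSpace, Fintype.card_fin]
      exact_mod_cast (by omega : s + 1 < L))
    refine (h2.const_mul (2 ^ L)).mono' (Continuous.aestronglyMeasurable ?_)
      (Eventually.of_forall fun y => ?_)
    · refine Continuous.inv₀ (by fun_prop) fun y => ?_
      have : 0 < Real.sqrt (1 + ‖y‖ ^ 2) := Real.sqrt_pos.2 (by positivity)
      positivity
    · have h3 : 0 < Real.sqrt (1 + ‖y‖ ^ 2) := Real.sqrt_pos.2 (by positivity)
      have h4 : 1 + ‖y‖ ≤ 2 * Real.sqrt (1 + ‖y‖ ^ 2) := by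
        have : (1 + ‖y‖) / 2 ≤ Real.sqrt (1 + ‖y‖ ^ 2) := by
          refine Real.le_sqrt_of_sq_le ?_
          nlinarith [norm_nonneg y, sq_nonneg (‖y‖ - 1)]
        linarith
      rw [Real.norm_of_nonneg (by positivity), Real.rpow_neg (by positivity), Real.rpow_natCast,
        ← div_eq_mul_inv, le_div_iff₀ (by positivity), inv_mul_le_iff₀ (by positivity), ← mul_pow,
        mul_comm _ (2 : ℝ)]
      exact pow_le_pow_left₀ (by positivity) h4 L
  have h2 : Integrable (fun x : Fin n → Mink s => ∏ l, (Real.sqrt (1 + ‖x l‖ ^ 2) ^ L)⁻¹) :=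
    Integrable.fintype_prod fun _ => h1
  -- the two Haar measures on the product are proportional
  set e : MinkN s n ≃L[ℝ] (Fin n → Mink s) :=
    PiLp.continuousLinearEquiv 2 ℝ (fun _ : Fin n => Mink s) with he
  have h3 : (Measure.map e (volume : Measure (MinkN s n))).IsAddHaarMeasure :=
    ContinuousLinearEquiv.isAddHaarMeasure_map e volume
  have h4 := Measure.isAddLeftInvariant_eq_smul (Measure.map e (volume : Measure (MinkN s n))) volume
  have h5 : Integrable (fun x : Fin n → Mink s => ∏ l, (Real.sqrt (1 + ‖x l‖ ^ 2) ^ L)⁻¹)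
      (Measure.map e (volume : Measure (MinkN s n))) := by
    rw [h4]
    exact h2.smul_measure_nnreal
  have h6 := (integrable_map_equiv e.toHomeomorph.toMeasurableEquiv _).1 h5
  refine h6.congr (Eventually.of_forall fun x => ?_)
  simp only [Function.comp, ← Finset.prod_inv_distrib]
  rfl

/-- The `L¹` norm of `∏_l (c - ∑_{μ ∈ S} (∂/∂x_l^μ)²)^N g` is bounded by a norm `‖g‖_{K,L}` in which
`K` and `L` do not depend on the number of arguments. -/
theorem exists_integral_ellipticOps_le (s n : ℕ) {c : ℝ} (hc : 0 ≤ c) (S : Finset (Fin (s + 1)))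
    (N : ℕ) : ∃ C : ℝ, 0 ≤ C ∧ ∀ g : TestFn s n,
      ∫ x, ‖ellipticOps c S N (List.finRange n) g x‖ ≤ C * schwartzNorm s n (2 * N) (s + 2) g := by
  have hw := integrable_prod_weight s n (le_refl (s + 2))
  have hwpos : ∀ x : MinkN s n, 0 < ∏ l, Real.sqrt (1 + ‖x l‖ ^ 2) ^ (s + 2) := fun x =>
    Finset.prod_pos fun l _ => pow_pos (Real.sqrt_pos.2 (by positivity)) _
  refine ⟨(c + S.card) ^ (N * n) * ∫ x : MinkN s n, (∏ l, Real.sqrt (1 + ‖x l‖ ^ 2) ^ (s + 2))⁻¹,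
    mul_nonneg (by positivity) (integral_nonneg fun x => (inv_pos.2 (hwpos x)).le), fun g => ?_⟩
  have h1 := (derivBound_schwartzNorm (2 * N) (s + 2) g).mono
    (u := fun i => 0 + 2 * N * (List.finRange n).count i) fun l => by
      rw [count_finRange]; omega
  have h2 := DerivBound.ellipticOps hc S N (List.finRange n) h1
  rw [List.length_finRange] at h2
  have h3 : ∀ x, ‖ellipticOps c S N (List.finRange n) g x‖ ≤
      (c + S.card) ^ (N * n) * schwartzNorm s n (2 * N) (s + 2) g
        * (∏ l, Real.sqrt (1 + ‖x l‖ ^ 2) ^ (s + 2))⁻¹ := fun x => by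
    have h4 := h2 0 Fin.elim0 (by simp) x
    rw [LineDeriv.iteratedLineDerivOp_fin_zero] at h4
    rw [← div_eq_mul_inv, le_div_iff₀ (hwpos x), mul_comm]
    exact h4
  refine (integral_mono_of_nonneg (Eventually.of_forall fun x => norm_nonneg _) (hw.const_mul _)
    (Eventually.of_forall h3)).trans (le_of_eq ?_)
  rw [integral_const_mul]
  ring

/-- `f = 𝓕 g` is represented by the integrable function `∏_l (c - ∑_{μ ∈ S} (∂/∂x_l^μ)²)^N g`. -/
theorem minkFourier_eq_integral (c : ℝ) (S : Finset (Fin (s + 1))) (N : ℕ) (g : TestFn s n)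
    (k : MinkN s n) (hk : ∀ l, 0 < ellipticSymbol c S (k l)) :
    minkFourier s n g k = fourierConst s n * (((∏ l, ellipticSymbol c S (k l) ^ N)⁻¹ : ℝ) : ℂ)
      * ∫ x : MinkN s n, Complex.exp (-Complex.I * ((∑ l, minkInner (x l) (k l) : ℝ) : ℂ))
        * ellipticOps c S N (List.finRange n) g x := by
  have h1 := minkFourier_ellipticOps c S N (List.finRange n) g k
  rw [minkFourier_apply, ← List.ofFn_eq_map, List.prod_ofFn] at h1
  have h2 : 0 < ∏ l, ellipticSymbol c S (k l) ^ N := Finset.prod_pos fun l _ => pow_pos (hk l) N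
  have h3 : ((∏ l, ellipticSymbol c S (k l) ^ N : ℝ) : ℂ) ≠ 0 := by exact_mod_cast h2.ne'
  rw [mul_assoc, mul_left_comm, h1, Complex.ofReal_inv, inv_mul_cancel_left₀ h3]

end EllipticOp

/-! ### Momentum configurations with all but one particle on the mass shell -/

section ShellGeometry

variable {s n : ℕ} {m : ℝ}

theorem minkInner_eq (x y : Mink s) : minkInner x y = x 0 * y 0 - ⟪spatial x, spatial y⟫_ℝ := by
  simp [minkInner, spatial, PiLp.inner_apply, mul_comm]

theorem minkSq_eq (k : Mink s) : minkSq k = k 0 ^ 2 - ‖spatial k‖ ^ 2 := by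
  rw [minkSq, minkInner_eq, real_inner_self_eq_norm_sq]; ring

theorem minkSq_sub_eq (k : Mink s) :
    minkSq k - m ^ 2 = (-k 0) ^ 2 - energy m (spatial k) ^ 2 := by
  rw [minkSq_eq, energy_sq]; ring

theorem spatial_shellPoint (σ : ℝ) (p : Momentum s) : spatial (shellPoint m σ p) = p := by
  ext i; simp [spatial, shellPoint]

theorem shellPoint_zero (σ : ℝ) (p : Momentum s) : shellPoint m σ p 0 = σ * energy m p := by
  simp [shellPoint]

theorem spatial_sum {ι : Type} (S : Finset ι) (f : ι → Mink s) :
    spatial (∑ i ∈ S, f i) = ∑ i ∈ S, spatial (f i) := by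
  ext i; simp [spatial]

theorem spatial_neg (k : Mink s) : spatial (-k) = -spatial k := by
  ext i; simp [spatial]

/-- The sign of the energy of the `l`-th particle. -/
def shellSign (j l : Fin n) : ℝ := if l < j then -1 else 1

theorem abs_shellSign (j l : Fin n) : |shellSign j l| = 1 := by
  unfold shellSign; split_ifs <;> simp

theorem shellConfig_of_ne (j : Fin n) (p : {l : Fin n // l ≠ j} → Momentum s)
    (i : {l : Fin n // l ≠ j}) : shellConfig m j p i = shellPoint m (shellSign j i) (p i) := by
  simp [shellConfig, i.2, shellSign]

theorem shellConfig_self (j : Fin n) (p : {l : Fin n // l ≠ j} → Momentum s) :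
    shellConfig m j p j = -∑ i, shellPoint m (shellSign j i.1) (p i) := by
  simp [shellConfig, shellSign]

theorem shellConfig_self_zero (j : Fin n) (p : {l : Fin n // l ≠ j} → Momentum s) :
    -(shellConfig m j p j 0) = ∑ i, shellSign j i.1 * energy m (p i) := by
  rw [shellConfig_self]
  simp [shellPoint_zero]

theorem spatial_shellConfig_self (j : Fin n) (p : {l : Fin n // l ≠ j} → Momentum s) :
    spatial (shellConfig m j p j) = -∑ i, p i := by
  rw [shellConfig_self, spatial_neg, spatial_sum]
  simp only [spatial_shellPoint]

theorem energy_shellConfig_self (j : Fin n) (p : {l : Fin n // l ≠ j} → Momentum s) :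
    energy m (spatial (shellConfig m j p j)) = energy m (∑ i, p i) := by
  rw [spatial_shellConfig_self, energy_neg]

theorem prod_eq_mul_prod_ne {M : Type} [CommMonoid M] (j : Fin n) (f : Fin n → M) :
    ∏ l, f l = f j * ∏ i : {l : Fin n // l ≠ j}, f i := by
  rw [← Finset.mul_prod_erase Finset.univ f (Finset.mem_univ j)]
  congr 1
  exact Finset.prod_subtype _ (by simp) f

theorem continuous_shellPoint (σ : ℝ) : Continuous (shellPoint m σ : Momentum s → Mink s) := by
  have hE := continuous_energy (s := s) m
  unfold shellPoint
  refine (PiLp.continuous_toLp 2 _).comp (continuous_pi fun μ => ?_)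
  refine Fin.cases ?_ (fun i => ?_) μ
  · simp only [Fin.cons_zero]; fun_prop
  · simp only [Fin.cons_succ]; fun_prop

theorem continuous_shellConfig (j : Fin n) :
    Continuous (shellConfig m j : ({l : Fin n // l ≠ j} → Momentum s) → MinkN s n) := by
  have hS := fun σ => continuous_shellPoint (s := s) (m := m) σ
  unfold shellConfig
  refine (PiLp.continuous_toLp 2 _).comp (continuous_pi fun l => ?_)
  split_ifs with h <;> fun_prop

/-- The spatial coordinates. -/
def spatialIndices (s : ℕ) : Finset (Fin (s + 1)) := Finset.univ.map (Fin.succEmb s)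

theorem ellipticSymbol_spatialIndices (k : Mink s) :
    ellipticSymbol (m ^ 2) (spatialIndices s) k = energy m (spatial k) ^ 2 := by
  rw [ellipticSymbol, spatialIndices, Finset.sum_map, energy_sq, EuclideanSpace.norm_sq_eq, add_comm]
  simp [spatial]

/-- The `j`-th term of the structure functional in which the propagator is replaced by an energy
kernel. -/
def kernelTerm (m : ℝ) (j : Fin n) (κ : ℝ → ℝ → ℂ) (f : TestFn s n) : ℂ :=
  ∫ p : {l : Fin n // l ≠ j} → Momentum s, ((∏ l, (2 * energy m (p l))⁻¹ : ℝ) : ℂ) *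
    κ (energy m (spatial (shellConfig m j p j))) (-(shellConfig m j p j 0)) * f (shellConfig m j p)

theorem exp_mul_eq_wave (M : ℕ) (σ : ℝ) (x : Mink s) (p : Momentum s) :
    (((energy m p ^ M)⁻¹ : ℝ) : ℂ)
      * Complex.exp (-Complex.I * (minkInner x (shellPoint m σ p) : ℝ)) = wave m M σ x 0 p := by
  rw [wave, minkInner_eq, spatial_shellPoint, shellPoint_zero, real_inner_comm]
  congr 2
  push_cast; ring

theorem exp_mul_eq_vertexKernel (L : ℕ) (κ : ℝ → ℝ → ℂ) (x k : Mink s) :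
    (((energy m (spatial k) ^ L)⁻¹ : ℝ) : ℂ) * κ (energy m (spatial k)) (-k 0)
      * Complex.exp (-Complex.I * (minkInner x k : ℝ))
      = vertexKernel m L κ x (-spatial k) (-k 0) := by
  rw [vertexKernel, minkInner_eq, energy_neg, inner_neg_left, real_inner_comm]
  congr 2
  push_cast; ring

/-- The integrand of `kernelTerm` for a plane wave as product of free waves. -/
theorem planeWave_eq (N : ℕ) (j : Fin n) (κ : ℝ → ℝ → ℂ)
    (p : {l : Fin n // l ≠ j} → Momentum s) (x : MinkN s n) :
    ((∏ l, (2 * energy m (p l))⁻¹ : ℝ) : ℂ) *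
      κ (energy m (spatial (shellConfig m j p j))) (-(shellConfig m j p j 0)) *
      ((((∏ l, ellipticSymbol (m ^ 2) (spatialIndices s) (shellConfig m j p l) ^ N)⁻¹ : ℝ) : ℂ)
        * Complex.exp (-Complex.I * ((∑ l, minkInner (x l) (shellConfig m j p l) : ℝ) : ℂ)))
      = ((2 : ℂ)⁻¹) ^ Fintype.card {l : Fin n // l ≠ j} *
        ((∏ i : {l : Fin n // l ≠ j}, wave m (2 * N + 1) (shellSign j i) (x i) 0 (p i)) *
          vertexKernel m (2 * N) κ (x j) (∑ i, p i) (∑ i, shellSign j i.1 * energy m (p i))) := by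
  have h1 : ∀ l, ellipticSymbol (m ^ 2) (spatialIndices s) (shellConfig m j p l) ^ N
      = energy m (spatial (shellConfig m j p l)) ^ (2 * N) := fun l => by
    rw [ellipticSymbol_spatialIndices, pow_mul]
  have h2 : vertexKernel m (2 * N) κ (x j) (∑ i, p i) (∑ i, shellSign j i.1 * energy m (p i))
      = vertexKernel m (2 * N) κ (x j) (-spatial (shellConfig m j p j))
        (-shellConfig m j p j 0) := by
    rw [spatial_shellConfig_self, neg_neg, shellConfig_self_zero]
  have h3 : ∀ i : {l : Fin n // l ≠ j}, wave m (2 * N + 1) (shellSign j i) (x i) 0 (p i)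
      = (((energy m (p i) ^ (2 * N + 1))⁻¹ : ℝ) : ℂ)
        * Complex.exp (-Complex.I * (minkInner (x i) (shellConfig m j p i) : ℝ)) := fun i => by
    rw [shellConfig_of_ne, exp_mul_eq_wave]
  have h4 : Complex.exp (-Complex.I * ((∑ l, minkInner (x l) (shellConfig m j p l) : ℝ) : ℂ))
      = ∏ l, Complex.exp (-Complex.I * (minkInner (x l) (shellConfig m j p l) : ℝ)) := by
    rw [← Complex.exp_sum]; push_cast; rw [Finset.mul_sum]
  have h5 : ∀ i : {l : Fin n // l ≠ j}, spatial (shellConfig m j p i) = p i := fun i => by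
    rw [shellConfig_of_ne, spatial_shellPoint]
  simp only [h1]
  rw [h2, ← exp_mul_eq_vertexKernel, h4, prod_eq_mul_prod_ne j, prod_eq_mul_prod_ne j]
  simp only [h3, h5]
  rw [Finset.prod_mul_distrib, ← Finset.card_univ, ← Finset.prod_const]
  have h6 : ∏ i : {l : Fin n // l ≠ j}, (((energy m (p i) ^ (2 * N + 1))⁻¹ : ℝ) : ℂ)
      = (∏ i : {l : Fin n // l ≠ j}, (((energy m (p i))⁻¹ : ℝ) : ℂ))
        * ∏ i : {l : Fin n // l ≠ j}, (((energy m (p i) ^ (2 * N))⁻¹ : ℝ) : ℂ) := by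
    rw [← Finset.prod_mul_distrib]
    refine Finset.prod_congr rfl fun i _ => ?_
    rw [pow_succ, mul_inv, mul_comm]; push_cast; rfl
  have h7 : ((∏ l, (2 * energy m (p l))⁻¹ : ℝ) : ℂ)
      = (∏ _i : {l : Fin n // l ≠ j}, (2 : ℂ)⁻¹) *
        ∏ i : {l : Fin n // l ≠ j}, (((energy m (p i))⁻¹ : ℝ) : ℂ) := by
    rw [← Finset.prod_mul_distrib, Complex.ofReal_prod]
    refine Finset.prod_congr rfl fun i _ => ?_
    rw [mul_inv]; push_cast; rfl
  rw [h6, h7, mul_inv, ← Finset.prod_inv_distrib, Complex.ofReal_mul, Complex.ofReal_prod]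
  ring

end ShellGeometry

section KernelTerm

variable {s n : ℕ} {m : ℝ}

/-- The position space function that represents `𝓕 g`. -/
def positionLift (m : ℝ) (g : TestFn s n) : TestFn s n :=
  ellipticOps (m ^ 2) (spatialIndices s) (s + 3) (List.finRange n) g

/-- Decay of `𝓕 g` on the configurations with all but one particle on the mass shell. -/
theorem exists_norm_shell_le (s n : ℕ) (hm : 0 < m) : ∃ C : ℝ, 0 ≤ C ∧
    ∀ (j : Fin n) (g : TestFn s n) (p : {l : Fin n // l ≠ j} → Momentum s),
      ‖((∏ l, (2 * energy m (p l))⁻¹ : ℝ) : ℂ) * minkFourier s n g (shellConfig m j p)‖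
        ≤ C * schwartzNorm s n (2 * (s + 3)) (s + 2) g
          * ∏ i, (energy m (p i) ^ (2 * (s + 3) + 1))⁻¹ := by
  obtain ⟨C, hC, h⟩ := exists_integral_ellipticOps_le s n (sq_nonneg m) (spatialIndices s) (s + 3)
  refine ⟨‖fourierConst s n‖ * (m ^ (2 * (s + 3)))⁻¹ * C, by positivity, fun j g p => ?_⟩
  have hpos : ∀ l, 0 < ellipticSymbol (m ^ 2) (spatialIndices s) (shellConfig m j p l) := fun l => by
    rw [ellipticSymbol_spatialIndices]
    have := energy_pos hm (spatial (shellConfig m j p l))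
    positivity
  have h1 := congrArg norm (planeWave_eq (m := m) (s + 3) j (fun _ _ => 1) p 0)
  have hI : (Complex.exp (-Complex.I * ((∑ l, minkInner ((0 : MinkN s n) l)
      (shellConfig m j p l) : ℝ) : ℂ))) = 1 := by
    simp [minkInner]
  rw [hI, mul_one, mul_one, norm_mul, norm_mul, norm_pow, norm_mul, norm_prod] at h1
  simp only [norm_wave hm] at h1
  have hv := norm_vertexKernel_le hm (2 * (s + 3)) (κ := fun _ _ => 1) (D := 1) (by simp)
    ((0 : MinkN s n) j) (∑ i, p i) (∑ i, shellSign j i.1 * energy m (p i))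
  have h2 : ‖(2 : ℂ)⁻¹‖ ^ Fintype.card {l : Fin n // l ≠ j} ≤ 1 :=
    pow_le_one₀ (norm_nonneg _) (by rw [norm_inv]; norm_num)
  have hP : 0 ≤ ∏ i, (energy m (p i) ^ (2 * (s + 3) + 1))⁻¹ := Finset.prod_nonneg fun i _ => by
    have := energy_nonneg m (p i); positivity
  have h3 : ‖((∏ l, (2 * energy m (p l))⁻¹ : ℝ) : ℂ)‖ *
      ‖(((∏ l, ellipticSymbol (m ^ 2) (spatialIndices s) (shellConfig m j p l) ^ (s + 3))⁻¹ : ℝ) : ℂ)‖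
      ≤ (m ^ (2 * (s + 3)))⁻¹ * ∏ i, (energy m (p i) ^ (2 * (s + 3) + 1))⁻¹ := by
    rw [h1]
    calc _ ≤ 1 * ((∏ i, (energy m (p i) ^ (2 * (s + 3) + 1))⁻¹) * ((m ^ (2 * (s + 3)))⁻¹ * 1)) := by
          gcongr
      _ = _ := by ring
  rw [minkFourier_eq_integral (m ^ 2) (spatialIndices s) (s + 3) g _ hpos, norm_mul, norm_mul, norm_mul]
  have h4 : ‖∫ x : MinkN s n, Complex.exp (-Complex.I * ((∑ l, minkInner (x l) (shellConfig m j p l) : ℝ) : ℂ))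
        * ellipticOps (m ^ 2) (spatialIndices s) (s + 3) (List.finRange n) g x‖
      ≤ C * schwartzNorm s n (2 * (s + 3)) (s + 2) g := by
    refine (norm_integral_le_integral_norm _).trans (le_trans (le_of_eq ?_) (h g))
    refine integral_congr_ae (Eventually.of_forall fun x => ?_)
    simp only
    rw [norm_mul, neg_mul, norm_exp_neg_I_mul, one_mul]
  have hS : 0 ≤ schwartzNorm s n (2 * (s + 3)) (s + 2) g := apply_nonneg _ _
  calc _ = ‖fourierConst s n‖ * (‖((∏ l, (2 * energy m (p l))⁻¹ : ℝ) : ℂ)‖ *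
      ‖(((∏ l, ellipticSymbol (m ^ 2) (spatialIndices s) (shellConfig m j p l) ^ (s + 3))⁻¹ : ℝ) : ℂ)‖)
      * ‖∫ x : MinkN s n, Complex.exp (-Complex.I * ((∑ l, minkInner (x l) (shellConfig m j p l) : ℝ) : ℂ))
        * ellipticOps (m ^ 2) (spatialIndices s) (s + 3) (List.finRange n) g x‖ := by ring
    _ ≤ ‖fourierConst s n‖ * ((m ^ (2 * (s + 3)))⁻¹ * ∏ i, (energy m (p i) ^ (2 * (s + 3) + 1))⁻¹)
      * (C * schwartzNorm s n (2 * (s + 3)) (s + 2) g) := by gcongr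
    _ = _ := by ring

theorem integrable_prod_energy (hm : 0 < m) {ι : Type} [Fintype ι] {M : ℕ} (hM : s + 1 ≤ M) :
    Integrable fun p : ι → Momentum s => ∏ i, (energy m (p i) ^ M)⁻¹ :=
  Integrable.fintype_prod fun _ => integrable_inv_energy_pow hm hM

/-- Integrals over the shell configurations with a bounded factor. -/
theorem exists_norm_integral_shell_le (s n : ℕ) (hm : 0 < m) : ∃ C : ℝ, 0 ≤ C ∧
    ∀ (j : Fin n) (g : TestFn s n) (K : ({l : Fin n // l ≠ j} → Momentum s) → ℂ) (D : ℝ),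
      Measurable K → (∀ p, ‖K p‖ ≤ D) →
      Integrable (fun p => ((∏ l, (2 * energy m (p l))⁻¹ : ℝ) : ℂ) * K p
        * minkFourier s n g (shellConfig m j p)) ∧
      ‖∫ p, ((∏ l, (2 * energy m (p l))⁻¹ : ℝ) : ℂ) * K p
        * minkFourier s n g (shellConfig m j p)‖
        ≤ C * D * schwartzNorm s n (2 * (s + 3)) (s + 2) g := by
  obtain ⟨C, hC, h⟩ := exists_norm_shell_le s n hm
  have hnn : ∀ (j : Fin n), 0 ≤ ∫ p : {l : Fin n // l ≠ j} → Momentum s,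
      ∏ i, (energy m (p i) ^ (2 * (s + 3) + 1))⁻¹ := fun j => integral_nonneg fun p =>
    Finset.prod_nonneg fun i _ => by have := energy_nonneg m (p i); positivity
  refine ⟨C * ∑ j : Fin n, ∫ p : {l : Fin n // l ≠ j} → Momentum s,
    ∏ i, (energy m (p i) ^ (2 * (s + 3) + 1))⁻¹,
    mul_nonneg hC (Finset.sum_nonneg fun j _ => hnn j), fun j g K D hK hD => ?_⟩
  have hS : 0 ≤ schwartzNorm s n (2 * (s + 3)) (s + 2) g := apply_nonneg _ _
  have hD0 : 0 ≤ D := (norm_nonneg _).trans (hD 0)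
  have hi := integrable_prod_energy (s := s) hm (ι := {l : Fin n // l ≠ j})
    (M := 2 * (s + 3) + 1) (by omega)
  have hb : ∀ p, ‖((∏ l, (2 * energy m (p l))⁻¹ : ℝ) : ℂ) * K p
        * minkFourier s n g (shellConfig m j p)‖ ≤
      D * (C * schwartzNorm s n (2 * (s + 3)) (s + 2) g)
        * ∏ i, (energy m (p i) ^ (2 * (s + 3) + 1))⁻¹ := fun p => by
    rw [mul_right_comm, norm_mul, mul_comm, mul_assoc D]
    exact mul_le_mul (hD p) (h j g p) (norm_nonneg _) hD0
  have hmeas : Measurable fun p => ((∏ l, (2 * energy m (p l))⁻¹ : ℝ) : ℂ) * K p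
        * minkFourier s n g (shellConfig m j p) := by
    have hE := (continuous_energy (s := s) m).measurable
    have h1 : Measurable fun p : {l : Fin n // l ≠ j} → Momentum s =>
        ((∏ l, (2 * energy m (p l))⁻¹ : ℝ) : ℂ) := by fun_prop
    have h2 : Measurable fun p : {l : Fin n // l ≠ j} → Momentum s =>
        minkFourier s n g (shellConfig m j p) :=
      ((minkFourier s n g).continuous.comp (continuous_shellConfig j)).measurable
    exact (h1.mul hK).mul h2
  refine ⟨(hi.const_mul _).mono' hmeas.aestronglyMeasurable (Eventually.of_forall hb),
    (norm_integral_le_of_norm_le (hi.const_mul _) (Eventually.of_forall hb)).trans ?_⟩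
  rw [integral_const_mul]
  have h5 := Finset.single_le_sum (fun i _ => hnn i) (Finset.mem_univ j)
  calc _ ≤ D * (C * schwartzNorm s n (2 * (s + 3)) (s + 2) g) *
        ∑ j : Fin n, ∫ p : {l : Fin n // l ≠ j} → Momentum s,
          ∏ i, (energy m (p i) ^ (2 * (s + 3) + 1))⁻¹ := by gcongr
    _ = _ := by ring

/-- In position space `kernelTerm` is a superposition of products of free waves. -/
theorem kernelTerm_minkFourier (hm : 0 < m) (j : Fin n) {B : ℝ} {κ : ℝ → ℝ → ℂ}
    (hκ : IsEnergyKernel m B κ) (g : TestFn s n) :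
    kernelTerm m j κ (minkFourier s n g)
      = fourierConst s n * ((2 : ℂ)⁻¹) ^ Fintype.card {l : Fin n // l ≠ j} *
        ∫ x : MinkN s n, positionLift m g x *
          multiWave m (2 * (s + 3) + 1) (fun i : {l : Fin n // l ≠ j} => shellSign j i)
            (fun i : {l : Fin n // l ≠ j} => x i) (vertexKernel m (2 * (s + 3)) κ (x j)) := by
  set N := s + 3 with hN
  set P : MinkN s n → ({l : Fin n // l ≠ j} → Momentum s) → ℂ := fun x p =>
    (∏ i : {l : Fin n // l ≠ j}, wave m (2 * N + 1) (shellSign j i) (x i) 0 (p i)) *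
          vertexKernel m (2 * N) κ (x j) (∑ i, p i) (∑ i, shellSign j i.1 * energy m (p i)) with hP
  obtain ⟨D, hD⟩ := hκ.bounded
  have hE := (continuous_energy (s := s) m).measurable
  have hE' := (continuous_inv_energy_pow (s := s) hm (2 * N + 1)).measurable
  have hPm : Measurable fun z : ({l : Fin n // l ≠ j} → Momentum s) × MinkN s n => P z.2 z.1 := by
    refine Measurable.mul (Finset.measurable_prod _ fun i _ => ?_) (measurable_vertexKernel hm _
      hκ.measurable (by fun_prop) (by fun_prop) (by fun_prop))
    have h2 : Measurable fun w : ({l : Fin n // l ≠ j} → Momentum s) × MinkN s n => w.1 i := by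
      fun_prop
    have h1 : Measurable fun w : ({l : Fin n // l ≠ j} → Momentum s) × MinkN s n => w.2 i := by
      fun_prop
    have h3 : Measurable fun w : ({l : Fin n // l ≠ j} → Momentum s) × MinkN s n =>
        spatial (w.2 i) := continuous_spatial.measurable.comp h1
    have h4 : Measurable fun w : ({l : Fin n // l ≠ j} → Momentum s) × MinkN s n =>
        ⟪w.1 i, spatial (w.2 i)⟫_ℝ := h2.inner h3
    have h5 : Measurable fun w : ({l : Fin n // l ≠ j} → Momentum s) × MinkN s n =>
        (energy m (w.1 i) ^ (2 * N + 1))⁻¹ := hE'.comp h2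
    have h6 : Measurable fun w : ({l : Fin n // l ≠ j} → Momentum s) × MinkN s n => w.2 i 0 := by
      fun_prop
    unfold wave
    fun_prop
  have hPb : ∀ x p, ‖P x p‖ ≤ (∏ i, (energy m (p i) ^ (2 * N + 1))⁻¹) * ((m ^ (2 * N))⁻¹ * D) :=
    fun x p => by
      simp only [hP]
      rw [norm_mul, norm_prod]
      simp only [norm_wave hm]
      refine mul_le_mul_of_nonneg_left (norm_vertexKernel_le hm _ hD _ _ _)
        (Finset.prod_nonneg fun i _ => ?_)
      have := energy_nonneg m (p i)
      positivity
  have hF : Integrable fun x : MinkN s n => positionLift m g x := SchwartzMap.integrable _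
  have hint : Integrable (fun z : ({l : Fin n // l ≠ j} → Momentum s) × MinkN s n =>
      positionLift m g z.2 * P z.2 z.1) (volume.prod volume) := by
    have h1 := ((integrable_prod_energy (s := s) hm (ι := {l : Fin n // l ≠ j})
      (M := 2 * N + 1) (by omega)).mul_const ((m ^ (2 * N))⁻¹ * D)).mul_prod hF.norm
    refine h1.mono' (hF.1.comp_snd.mul hPm.aestronglyMeasurable) (Eventually.of_forall fun z => ?_)
    rw [norm_mul, mul_comm]
    exact mul_le_mul_of_nonneg_right (hPb _ _) (norm_nonneg _)
  have hpos : ∀ (p : {l : Fin n // l ≠ j} → Momentum s) l,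
      0 < ellipticSymbol (m ^ 2) (spatialIndices s) (shellConfig m j p l) := fun p l => by
    rw [ellipticSymbol_spatialIndices]
    have := energy_pos hm (spatial (shellConfig m j p l))
    positivity
  calc kernelTerm m j κ (minkFourier s n g)
      = ∫ p : {l : Fin n // l ≠ j} → Momentum s, fourierConst s n
          * ((2 : ℂ)⁻¹) ^ Fintype.card {l : Fin n // l ≠ j} *
          ∫ x : MinkN s n, positionLift m g x * P x p := by
        refine integral_congr_ae (Eventually.of_forall fun p => ?_)
        simp only
        have h0 : ((2 : ℂ)⁻¹) ^ Fintype.card {l : Fin n // l ≠ j} *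
              ∫ x : MinkN s n, positionLift m g x * P x p
            = ((∏ l, (2 * energy m (p l))⁻¹ : ℝ) : ℂ) *
              κ (energy m (spatial (shellConfig m j p j))) (-(shellConfig m j p j 0)) *
              (((∏ l, ellipticSymbol (m ^ 2) (spatialIndices s) (shellConfig m j p l) ^ N)⁻¹ : ℝ)
                : ℂ) * ∫ x : MinkN s n,
              Complex.exp (-Complex.I * ((∑ l, minkInner (x l) (shellConfig m j p l) : ℝ) : ℂ))
              * ellipticOps (m ^ 2) (spatialIndices s) N (List.finRange n) g x := by
          rw [← integral_const_mul, ← integral_const_mul]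
          refine integral_congr_ae (Eventually.of_forall fun x => ?_)
          have h := planeWave_eq (m := m) N j κ p x
          simp only [hP]
          rw [positionLift]
          linear_combination -ellipticOps (m ^ 2) (spatialIndices s) N (List.finRange n) g x * h
        rw [minkFourier_eq_integral (m ^ 2) (spatialIndices s) N g _ (hpos p), mul_assoc
          (fourierConst s n), mul_assoc (fourierConst s n), h0]
        ring
    _ = fourierConst s n * ((2 : ℂ)⁻¹) ^ Fintype.card {l : Fin n // l ≠ j} *
          ∫ p : {l : Fin n // l ≠ j} → Momentum s, ∫ x : MinkN s n, positionLift m g x * P x p :=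
        integral_const_mul _ _
    _ = _ := by
        rw [integral_integral_swap (f := fun (p : {l : Fin n // l ≠ j} → Momentum s)
          (x : MinkN s n) => positionLift m g x * P x p) hint]
        congr 1
        refine integral_congr_ae (Eventually.of_forall fun x => ?_)
        simp only
        rw [integral_const_mul, multiWave]

/-- The dependence of `kernelTerm` on the energy kernel: it is a function of the Fourier transform
of the kernel, continuous along bounded pointwise limits, with a bound by a norm `‖g‖_{K,L}`. -/
theorem exists_kernelFunctional (hs : 2 ≤ s) (hm : 0 < m) (j : Fin n) (hn : 4 ≤ n) :
    ∃ C : ℝ, 0 ≤ C ∧ ∀ g : TestFn s n, ∃ Λ : (ℝ → ℝ → ℂ) → ℂ,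
      (∀ B κ, IsEnergyKernel m B κ →
        kernelTerm m j κ (minkFourier s n g) = Λ fun a t => timeFourier (κ a) t) ∧
      (∀ B v, IsTimeLimit m B v →
        ‖Λ v‖ ≤ C * B * schwartzNorm s n (2 * (s + 3)) (s + 2) g) ∧
      (∀ (c : ℂ) v, (Λ fun a t => c * v a t) = c * Λ v) ∧
      ∀ (B : ℝ) (J : Type) (l : Filter J) (v : J → ℝ → ℝ → ℂ) (v₀ : ℝ → ℝ → ℂ),
        l.IsCountablyGenerated → (∀ᶠ i in l, IsTimeLimit m B (v i)) →
        (∀ a t, m ≤ a → Tendsto (fun i => v i a t) l (𝓝 (v₀ a t))) →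
        Tendsto (fun i => Λ (v i)) l (𝓝 (Λ v₀)) := by
  have hcard : 3 ≤ Fintype.card {l : Fin n // l ≠ j} := by
    rw [Fintype.card_subtype_compl, Fintype.card_fin, Fintype.card_subtype_eq]; omega
  obtain ⟨C₁, hC₁, h1⟩ := hasSpectralRep_multiWave hs hm (M := 2 * (s + 3) + 1) (L := 2 * (s + 3))
    (by omega) (by omega) hcard
  obtain ⟨C₂, hC₂, h2⟩ := exists_integral_ellipticOps_le s n (sq_nonneg m) (spatialIndices s) (s + 3)
  set c : ℂ := fourierConst s n * ((2 : ℂ)⁻¹) ^ Fintype.card {l : Fin n // l ≠ j} with hc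
  refine ⟨‖c‖ * C₁ * C₂, by positivity, fun g => ?_⟩
  have hF : Integrable fun x : MinkN s n => positionLift m g x := SchwartzMap.integrable _
  obtain ⟨Λ, a1, a2, a4, a3⟩ := exists_timeFunctional hm
    (T := fun x : MinkN s n => multiWave m (2 * (s + 3) + 1)
      (fun i : {l : Fin n // l ≠ j} => shellSign j i) (fun i : {l : Fin n // l ≠ j} => x i))
    (y := fun x => x j) (fun x => h1 _ _ fun i => abs_shellSign j i)
    (fun B κ hκ => measurable_multiWave hm _ (fun i => by fun_prop) (by fun_prop) hκ.measurable) hF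
  refine ⟨fun v => c * Λ v, fun B κ hκ => ?_, fun B v hv => ?_, fun b v => ?_, fun B J l v v₀ hl hv hlim => ?_⟩
  · change _ = c * Λ fun a t => timeFourier (κ a) t
    rw [kernelTerm_minkFourier hm j hκ, ← a1 B κ hκ]
  · have hB : 0 ≤ B := (norm_nonneg _).trans (hv.norm_le (a := m) (t := 0) le_rfl)
    rw [norm_mul]
    calc ‖c‖ * ‖Λ v‖ ≤ ‖c‖ * (C₁ * B * (C₂ * schwartzNorm s n (2 * (s + 3)) (s + 2) g)) := by
          gcongr
          exact (a2 B v hv).trans (mul_le_mul_of_nonneg_left (h2 g) (by positivity))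
      _ = _ := by ring
  · simp only [a4]
    ring
  · exact (a3 B J l v v₀ hl hv hlim).const_mul _

end KernelTerm

/-! ### The regularized terms and their limits -/

section RegTerm

variable {s n : ℕ} {m ε : ℝ} {φ : ℝ → ℝ}

/-- The momentum of the off-shell particle, if there are two other particles, stays away from the
mass shell. -/
theorem sq_le_abs_of_three (j : Fin 3) (p : {l : Fin 3 // l ≠ j} → Momentum s) :
    m ^ 2 ≤ |(-(shellConfig m j p j 0)) ^ 2 - energy m (spatial (shellConfig m j p j)) ^ 2| := by
  have hcard : Fintype.card {l : Fin 3 // l ≠ j} = 2 := by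
    rw [Fintype.card_subtype_compl, Fintype.card_fin, Fintype.card_subtype_eq]
  set e := (Fintype.equivFinOfCardEq hcard).symm
  rw [shellConfig_self_zero, energy_shellConfig_self, ← e.sum_comp, ← e.sum_comp,
    Fin.sum_univ_two, Fin.sum_univ_two]
  set a := p (e 0)
  set b := p (e 1)
  have h1 := sq_add_norm_mul_le_energy_mul m a b
  have h2 := abs_le.1 (abs_real_inner_le_norm a b)
  have e1 : energy m (a + b) ^ 2 = ‖a‖ ^ 2 + 2 * ⟪a, b⟫_ℝ + ‖b‖ ^ 2 + m ^ 2 := by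
    rw [energy_sq, norm_add_sq_real]
  have ha := energy_sq m a
  have hb := energy_sq m b
  have hs : ∀ l : Fin 3, shellSign j l = 1 ∨ shellSign j l = -1 := fun l => by
    unfold shellSign; split_ifs <;> simp
  rw [e1]
  rcases hs (e 0).1 with h3 | h3 <;> rcases hs (e 1).1 with h4 | h4 <;> rw [h3, h4]
  · refine le_trans ?_ (le_abs_self _); nlinarith
  · refine le_trans ?_ (neg_le_abs _); nlinarith
  · refine le_trans ?_ (neg_le_abs _); nlinarith
  · refine le_trans ?_ (le_abs_self _); nlinarith

theorem isTimeLimit_nearLimit (hm : 0 < m) (hφ : IsCutoff m ε φ) {Φ : ℝ} (hΦ : ∀ x, |φ x| ≤ Φ)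
    (r : ℝ) : IsTimeLimit m ((16 + 32 * Φ) * m⁻¹) (nearLimit φ ε r) := by
  have hε := hφ.eps_pos
  have h1 : Tendsto (fun i : ℕ => ε / 4 * (1 / ((i : ℝ) + 1))) atTop (𝓝[>] 0) := by
    refine tendsto_nhdsWithin_iff.2 ⟨?_, Eventually.of_forall fun i => ?_⟩
    · simpa using tendsto_one_div_add_atTop_nhds_zero_nat.const_mul (ε / 4)
    · rw [mem_Ioi]; positivity
  refine ⟨fun i => nearKernel φ (ε / 4 * (1 / ((i : ℝ) + 1))) r, fun i => ?_, fun a t ha =>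
    (tendsto_timeFourier_nearKernel hm hφ r ha t).comp h1⟩
  refine isEnergyKernel_nearKernel hm hφ hΦ (by positivity) ?_ r
  refine mul_le_of_le_one_right (by positivity) ?_
  rw [div_le_one (by positivity)]
  have : (0 : ℝ) ≤ i := i.cast_nonneg
  linarith

theorem isTimeLimit_deltaLimit (hm : 0 < m) : IsTimeLimit m (2 * m⁻¹) deltaLimit := by
  have h1 : Tendsto (fun i : ℕ => 1 / ((i : ℝ) + 1)) atTop (𝓝[>] 0) := by
    refine tendsto_nhdsWithin_iff.2 ⟨tendsto_one_div_add_atTop_nhds_zero_nat,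
      Eventually.of_forall fun i => ?_⟩
    rw [mem_Ioi]; positivity
  exact ⟨fun i => deltaKernel (1 / ((i : ℝ) + 1)), fun i =>
    isEnergyKernel_deltaKernel hm (by positivity), fun a t ha =>
    (tendsto_timeFourier_deltaKernel (hm.trans_le ha) t).comp h1⟩

/-- The limits of the terms with the propagator near the mass shell, `ν(r)`, and with the
difference of the mass shells, `δ`. Removing the time cutoff turns the principal value into
`∓ iπ` times the difference of the mass shells. -/
theorem exists_kernelTerm_limits (hs : 2 ≤ s) (hm : 0 < m) (hφ : IsCutoff m ε φ) (hn : 3 ≤ n)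
    (j : Fin n) : ∃ C : ℝ, 0 ≤ C ∧ ∀ g : TestFn s n, ∃ (δ : ℂ) (ν : ℝ → ℂ),
      Tendsto (fun η => kernelTerm m j (deltaKernel η) (minkFourier s n g)) (𝓝[>] 0) (𝓝 δ) ∧
      (∀ r, Tendsto (fun η => kernelTerm m j (nearKernel φ η r) (minkFourier s n g)) (𝓝[>] 0)
        (𝓝 (ν r))) ∧
      Tendsto ν atTop (𝓝 (-(Complex.I * Real.pi) * δ)) ∧
      Tendsto ν atBot (𝓝 (Complex.I * Real.pi * δ)) ∧
      ‖δ‖ ≤ C * schwartzNorm s n (2 * (s + 3)) (s + 2) g ∧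
      ‖ν 0‖ ≤ C * schwartzNorm s n (2 * (s + 3)) (s + 2) g := by
  have hε := hφ.eps_pos
  rcases hn.eq_or_lt with rfl | hn4
  · refine ⟨0, le_rfl, fun g => ⟨0, fun _ => 0, ?_, fun r => ?_, by simp, by simp, by simp,
      by simp⟩⟩
    · refine tendsto_const_nhds.congr' ?_
      have hm2 : 0 < m ^ 2 := by positivity
      filter_upwards [nhdsWithin_le_nhds (eventually_le_nhds hm2)] with η hη
      refine ((integral_congr_ae (Eventually.of_forall fun p => ?_)).trans
        (integral_zero _ _)).symm
      simp only [deltaKernel]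
      rw [if_neg (not_lt.2 (hη.trans (sq_le_abs_of_three j p)))]
      simp
    · refine tendsto_const_nhds.congr fun η => ?_
      refine ((integral_congr_ae (Eventually.of_forall fun p => ?_)).trans
        (integral_zero _ _)).symm
      simp only [nearKernel]
      rw [hφ.propCut_eq_zero η (hφ.eps_lt.le.trans (sq_le_abs_of_three j p))]
      simp
  · obtain ⟨Φ, hΦ0, hΦ⟩ := hφ.exists_bound
    obtain ⟨C, hC, h⟩ := exists_kernelFunctional hs hm j hn4
    set B := (16 + 32 * Φ) * m⁻¹ + 2 * m⁻¹ with hB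
    have hB1 : (16 + 32 * Φ) * m⁻¹ ≤ B := by rw [hB]; linarith [inv_pos.2 hm]
    have hB2 : 2 * m⁻¹ ≤ B := by rw [hB]; linarith [show 0 ≤ (16 + 32 * Φ) * m⁻¹ by positivity]
    refine ⟨C * B, by positivity, fun g => ?_⟩
    obtain ⟨Λ, a1, a2, a4, a3⟩ := h g
    have hS : 0 ≤ schwartzNorm s n (2 * (s + 3)) (s + 2) g := apply_nonneg _ _
    have near_ok : ∀ r, ∀ᶠ η in 𝓝[>] (0 : ℝ),
        IsEnergyKernel m ((16 + 32 * Φ) * m⁻¹) (nearKernel φ η r) := fun r => by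
      filter_upwards [self_mem_nhdsWithin, nhdsWithin_le_nhds (eventually_le_nhds
        (show (0 : ℝ) < ε / 4 by linarith))] with η hη hηε
      exact isEnergyKernel_nearKernel hm hφ hΦ hη hηε r
    have delta_ok : ∀ᶠ η in 𝓝[>] (0 : ℝ), IsEnergyKernel m (2 * m⁻¹) (deltaKernel η) := by
      filter_upwards [self_mem_nhdsWithin] with η hη
      exact isEnergyKernel_deltaKernel hm hη
    refine ⟨Λ deltaLimit, fun r => Λ (nearLimit φ ε r), ?_, fun r => ?_, ?_, ?_, ?_, ?_⟩
    · refine (a3 _ _ (𝓝[>] (0 : ℝ)) (fun η a t => timeFourier (deltaKernel η a) t) deltaLimit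
        inferInstance (delta_ok.mono fun η h => h.isTimeLimit) fun a t ha =>
        tendsto_timeFourier_deltaKernel (hm.trans_le ha) t).congr' ?_
      filter_upwards [delta_ok] with η hη using (a1 _ _ hη).symm
    · refine (a3 _ _ (𝓝[>] (0 : ℝ)) (fun η a t => timeFourier (nearKernel φ η r a) t)
        (nearLimit φ ε r) inferInstance ((near_ok r).mono fun η h => h.isTimeLimit) fun a t ha =>
        tendsto_timeFourier_nearKernel hm hφ r ha t).congr' ?_
      filter_upwards [near_ok r] with η hη using (a1 _ _ hη).symm
    · rw [← a4]
      exact a3 _ _ atTop (fun r => nearLimit φ ε r) _ inferInstance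
        (Eventually.of_forall fun r => isTimeLimit_nearLimit hm hφ hΦ r) fun a t ha =>
        tendsto_nearLimit_atTop hφ (hm.trans_le ha) t
    · rw [← a4]
      exact a3 _ _ atBot (fun r => nearLimit φ ε r) _ inferInstance
        (Eventually.of_forall fun r => isTimeLimit_nearLimit hm hφ hΦ r) fun a t ha =>
        tendsto_nearLimit_atBot hφ (hm.trans_le ha) t
    · exact (a2 _ _ (isTimeLimit_deltaLimit hm)).trans (by gcongr)
    · exact (a2 _ _ (isTimeLimit_nearLimit hm hφ hΦ 0)).trans (by gcongr)

/-- The propagator away from the mass shell. -/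
def farFactor (m : ℝ) (φ : ℝ → ℝ) (k : Mink s) : ℂ :=
  (((minkSq k - m ^ 2)⁻¹ * (1 - φ (minkSq k - m ^ 2)) : ℝ) : ℂ)

theorem norm_farFactor_le (hφ : IsCutoff m ε φ) {Φ : ℝ} (hΦ : ∀ x, |φ x| ≤ Φ) (k : Mink s) :
    ‖farFactor m φ k‖ ≤ 2 * ε⁻¹ * (1 + Φ) := by
  have hε := hφ.eps_pos
  have hΦ0 : 0 ≤ Φ := (abs_nonneg _).trans (hΦ 0)
  rw [farFactor, Complex.norm_real, norm_mul, Real.norm_eq_abs, Real.norm_eq_abs, abs_inv]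
  rcases lt_or_ge |minkSq k - m ^ 2| (ε / 2) with h | h
  · have h1 := abs_lt.1 h
    rw [hφ.eq_one _ (by linarith) h1.2, sub_self, abs_zero, mul_zero]
    positivity
  · have h1 : |minkSq k - m ^ 2|⁻¹ ≤ 2 * ε⁻¹ := by
      rw [inv_le_comm₀ (by linarith) (by positivity), mul_inv, inv_inv]; linarith
    have h2 : |1 - φ (minkSq k - m ^ 2)| ≤ 1 + Φ := by
      refine (abs_sub _ _).trans ?_
      rw [abs_one]
      gcongr
      exact hΦ _
    gcongr

theorem continuous_minkSq : Continuous (minkSq : Mink s → ℝ) :=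
  (hasTemperateGrowth_minkSq s).1.continuous

theorem measurable_farFactor (hφ : IsCutoff m ε φ) :
    Measurable (farFactor m φ : Mink s → ℂ) := by
  have h1 := hφ.contDiff.continuous.measurable
  have h2 := (continuous_minkSq (s := s)).measurable
  unfold farFactor
  fun_prop

/-- The part of the `loc` term with the propagator away from the mass shell. -/
def farTerm (m : ℝ) (φ : ℝ → ℝ) (j : Fin n) (f : TestFn s n) : ℂ :=
  ∫ p : {l : Fin n // l ≠ j} → Momentum s, ((∏ l, (2 * energy m (p l))⁻¹ : ℝ) : ℂ) *
    farFactor m φ (shellConfig m j p j) * f (shellConfig m j p)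

theorem deltaReg_loc_eq (hφ : IsCutoff m ε φ) {η : ℝ} (hη : η < ε / 2) (k : Mink s) :
    deltaReg m Channel.loc η k
      = nearKernel φ η 0 (energy m (spatial k)) (-k 0) + farFactor m φ k := by
  rw [nearKernel, ← minkSq_sub_eq, farFactor, propCut, deltaReg]
  by_cases h : η < |minkSq k - m ^ 2|
  · simp only [if_pos h, mul_zero, Complex.ofReal_zero, Complex.exp_zero, mul_one]
    push_cast; ring
  · have h1 := abs_lt.1 ((not_lt.1 h).trans_lt hη)
    rw [if_neg h, if_neg h, hφ.eq_one _ (by linarith) h1.2]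
    simp

theorem sign_neg_real (x : ℝ) : (SignType.sign (-x) : ℝ) = -(SignType.sign x : ℝ) := by
  rcases lt_trichotomy x 0 with h | rfl | h
  · simp [h]
  · simp
  · simp [h]

theorem deltaReg_inn_eq (η : ℝ) (k : Mink s) : deltaReg m Channel.inn η k
    = -(Complex.I * Real.pi) * deltaKernel η (energy m (spatial k)) (-k 0) := by
  rw [deltaKernel, ← minkSq_sub_eq, deltaReg, sign_neg_real]
  split_ifs
  · push_cast; ring
  · simp

theorem deltaReg_out_eq (η : ℝ) (k : Mink s) : deltaReg m Channel.out η k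
    = Complex.I * Real.pi * deltaKernel η (energy m (spatial k)) (-k 0) := by
  rw [deltaKernel, ← minkSq_sub_eq, deltaReg, sign_neg_real]
  split_ifs
  · push_cast; ring
  · simp

theorem regTerm_inn (j : Fin n) (f : TestFn s n) (η : ℝ) : regTerm m j Channel.inn f η
    = -(Complex.I * Real.pi) * kernelTerm m j (deltaKernel η) f := by
  rw [regTerm, kernelTerm, ← integral_const_mul]
  refine integral_congr_ae (Eventually.of_forall fun p => ?_)
  simp only
  rw [deltaReg_inn_eq]; ring

theorem regTerm_out (j : Fin n) (f : TestFn s n) (η : ℝ) : regTerm m j Channel.out f η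
    = Complex.I * Real.pi * kernelTerm m j (deltaKernel η) f := by
  rw [regTerm, kernelTerm, ← integral_const_mul]
  refine integral_congr_ae (Eventually.of_forall fun p => ?_)
  simp only
  rw [deltaReg_out_eq]; ring

theorem measurable_kernel_shellConfig {κ : ℝ → ℝ → ℂ} (hκ : Measurable (Function.uncurry κ))
    (j : Fin n) : Measurable fun p : {l : Fin n // l ≠ j} → Momentum s =>
      κ (energy m (spatial (shellConfig m j p j))) (-(shellConfig m j p j 0)) := by
  have h1 : Measurable fun p : {l : Fin n // l ≠ j} → Momentum s => shellConfig m j p j :=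
    ((PiLp.continuous_apply 2 _ j).comp (continuous_shellConfig j)).measurable
  have h2 : Measurable fun p : {l : Fin n // l ≠ j} → Momentum s =>
      energy m (spatial (shellConfig m j p j)) :=
    ((continuous_energy m).comp continuous_spatial).measurable.comp h1
  exact hκ.comp (h2.prodMk (by fun_prop))

theorem regTerm_loc (hm : 0 < m) (hφ : IsCutoff m ε φ) (j : Fin n) (g : TestFn s n) {η : ℝ}
    (hη : 0 < η) (hηε : η < ε / 2) : regTerm m j Channel.loc (minkFourier s n g) η
      = kernelTerm m j (nearKernel φ η 0) (minkFourier s n g)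
        + farTerm m φ j (minkFourier s n g) := by
  obtain ⟨Φ, hΦ0, hΦ⟩ := hφ.exists_bound
  obtain ⟨C, hC, h⟩ := exists_norm_integral_shell_le s n hm
  have i1 := (h j g (fun p => nearKernel φ η 0 (energy m (spatial (shellConfig m j p j)))
    (-(shellConfig m j p j 0))) _ (measurable_kernel_shellConfig (measurable_nearKernel hφ η 0) j)
    fun p => norm_nearKernel_le hΦ hη _ _ _).1
  have i2 := (h j g (fun p => farFactor m φ (shellConfig m j p j)) _
    ((measurable_farFactor hφ).comp
      ((PiLp.continuous_apply 2 _ j).comp (continuous_shellConfig j)).measurable)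
    fun p => norm_farFactor_le hφ hΦ _).1
  rw [regTerm, kernelTerm, farTerm, ← integral_add i1 i2]
  refine integral_congr_ae (Eventually.of_forall fun p => ?_)
  simp only
  rw [deltaReg_loc_eq hφ hηε]; ring

theorem chi_shellPoint (hm : 0 < m) (hφ : IsCutoff m ε φ) (t : ℝ) (a : Channel) {σ : ℝ}
    (hσ : σ = 1 ∨ σ = -1) (p : Momentum s) : chi m φ t a (shellPoint m σ p) = 1 := by
  have hE := energy_pos hm p
  have hε := hφ.eps_pos
  have h0 : minkSq (shellPoint m σ p) - m ^ 2 = 0 := by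
    rw [minkSq_sub_eq, spatial_shellPoint, shellPoint_zero]
    rcases hσ with rfl | rfl <;> ring
  have h1 : φ 0 = 1 := hφ.eq_one 0 (by linarith) (by linarith)
  rcases hσ with rfl | rfl <;> cases a <;>
    simp [chi, chiPM, h0, h1, shellPoint_zero, spatial_shellPoint, hE, hE.le, not_lt]

theorem chiProd_shellConfig (hm : 0 < m) (hφ : IsCutoff m ε φ) (t : Fin n → ℝ)
    (a : Fin n → Channel) (j : Fin n) (p : {l : Fin n // l ≠ j} → Momentum s) :
    chiProd m φ t a (shellConfig m j p) = chi m φ (t j) (a j) (shellConfig m j p j) := by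
  rw [chiProd, prod_eq_mul_prod_ne j, Finset.prod_eq_one, mul_one]
  intro i _
  rw [shellConfig_of_ne]
  refine chi_shellPoint hm hφ _ _ ?_ _
  unfold shellSign; split_ifs <;> simp

theorem deltaReg_mul_chi_inn (hφ : IsCutoff m ε φ) (η t : ℝ) (k : Mink s) :
    deltaReg m Channel.loc η k * chi m φ t Channel.inn k
      = nearKernel φ η t (energy m (spatial k)) (-k 0) := by
  rw [nearKernel, ← minkSq_sub_eq, propCut, deltaReg, chi, chiPM, chiPM]
  by_cases h : η < |minkSq k - m ^ 2|
  swap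
  · simp [h]
  rw [if_pos h, if_pos h]
  rcases lt_trichotomy (k 0) 0 with h0 | h0 | h0
  · rw [if_neg (by linarith), if_pos (by linarith), if_pos (by linarith)]
    push_cast
    rw [zero_mul, zero_add, mul_assoc]
    congr 3
    ring
  · have h1 : φ (minkSq k - m ^ 2) = 0 := by
      apply hφ.eq_zero
      rw [minkSq_sub_eq, h0, energy_sq]
      refine le_trans ?_ (neg_le_abs _)
      nlinarith [hφ.eps_lt, sq_nonneg ‖spatial k‖]
    simp [h0, h1]
  · rw [if_pos (by linarith), if_neg (by linarith), if_neg (by linarith)]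
    push_cast
    rw [zero_mul, add_zero, mul_assoc]
    congr 3
    ring

theorem chi_out_eq (t : ℝ) (k : Mink s) :
    chi m φ t Channel.out k = chi m φ (-t) Channel.inn k := by
  simp only [chi]
  congr 3 <;> push_cast <;> ring

/-- The `loc` term after application of the wave operator, in the channel `a`. -/
theorem regTerm_chiProd (hm : 0 < m) (hφ : IsCutoff m ε φ) (j : Fin n) (t : Fin n → ℝ)
    (a : Fin n → Channel) (f f' : TestFn s n) (hf : ∀ k, f' k = chiProd m φ t a k * f k) (η : ℝ) :
    regTerm m j Channel.loc f' η = match a j with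
      | Channel.inn => kernelTerm m j (nearKernel φ η (t j)) f
      | Channel.loc => regTerm m j Channel.loc f η
      | Channel.out => kernelTerm m j (nearKernel φ η (-t j)) f := by
  have h1 : regTerm m j Channel.loc f' η =
      ∫ p : {l : Fin n // l ≠ j} → Momentum s, ((∏ l, (2 * energy m (p l))⁻¹ : ℝ) : ℂ) *
      (deltaReg m Channel.loc η (shellConfig m j p j) * chi m φ (t j) (a j) (shellConfig m j p j))
        * f (shellConfig m j p) := by
    refine integral_congr_ae (Eventually.of_forall fun p => ?_)
    simp only
    rw [hf, chiProd_shellConfig hm hφ]; ring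
  rw [h1]
  cases h : a j with
  | inn => simp only [deltaReg_mul_chi_inn hφ]; rfl
  | loc => simp only [chi, mul_one]; rfl
  | out => simp only [chi_out_eq, deltaReg_mul_chi_inn hφ]; rfl

/-- For `n ≥ 3` the terms of the form factor functional exist, are bounded by a norm `‖g‖_{K,L}`
with `K`, `L` independent of `n`, and are the limits of the terms of the structure functional in
which the wave operators have been inserted. -/
theorem exists_shellTerm_limits (hs : 2 ≤ s) (hm : 0 < m) (hφ : IsCutoff m ε φ) (hn : 3 ≤ n)
    (j : Fin n) : ∃ C : ℝ, 0 ≤ C ∧ ∀ g : TestFn s n,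
      (∀ a, Tendsto (regTerm m j a (minkFourier s n g)) (𝓝[>] 0)
        (𝓝 (shellTerm m j a (minkFourier s n g)))) ∧
      (∀ a, ‖shellTerm m j a (minkFourier s n g)‖
        ≤ C * schwartzNorm s n (2 * (s + 3)) (s + 2) g) ∧
      ∃ Rt : Channel → ℝ → ℂ,
        (∀ τ, Rt Channel.loc τ = shellTerm m j Channel.loc (minkFourier s n g)) ∧
        (∀ a, Tendsto (Rt a) atTop (𝓝 (shellTerm m j a (minkFourier s n g)))) ∧
        ∀ (t : Fin n → ℝ) (a : Fin n → Channel) (f' : TestFn s n),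
          (∀ k, f' k = chiProd m φ t a k * minkFourier s n g k) →
          Tendsto (regTerm m j Channel.loc f') (𝓝[>] 0) (𝓝 (Rt (a j) (t j))) := by
  obtain ⟨Φ, hΦ0, hΦ⟩ := hφ.exists_bound
  obtain ⟨C₁, hC₁, h1⟩ := exists_kernelTerm_limits hs hm hφ hn j
  obtain ⟨C₂, hC₂, h2⟩ := exists_norm_integral_shell_le s n hm
  have hε := hφ.eps_pos
  refine ⟨Real.pi * C₁ + (C₁ + C₂ * (2 * ε⁻¹ * (1 + Φ))), by positivity, fun g => ?_⟩
  obtain ⟨δ, ν, b1, b2, b3, b4, b5, b6⟩ := h1 g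
  have hS : 0 ≤ schwartzNorm s n (2 * (s + 3)) (s + 2) g := apply_nonneg _ _
  have hfar : ‖farTerm m φ j (minkFourier s n g)‖
      ≤ C₂ * (2 * ε⁻¹ * (1 + Φ)) * schwartzNorm s n (2 * (s + 3)) (s + 2) g :=
    (h2 j g (fun p => farFactor m φ (shellConfig m j p j)) _
    ((measurable_farFactor hφ).comp
      ((PiLp.continuous_apply 2 _ j).comp (continuous_shellConfig j)).measurable)
    fun p => norm_farFactor_le hφ hΦ _).2
  set S : Channel → ℂ := fun a => match a with
    | Channel.inn => -(Complex.I * Real.pi) * δ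
    | Channel.loc => ν 0 + farTerm m φ j (minkFourier s n g)
    | Channel.out => Complex.I * Real.pi * δ with hSdef
  have hlim : ∀ a, Tendsto (regTerm m j a (minkFourier s n g)) (𝓝[>] 0) (𝓝 (S a)) := by
    intro a
    cases a with
    | inn => exact (b1.const_mul _).congr fun η => (regTerm_inn j _ η).symm
    | loc =>
      refine ((b2 0).add_const _).congr' ?_
      filter_upwards [self_mem_nhdsWithin, nhdsWithin_le_nhds (eventually_lt_nhds
        (show (0 : ℝ) < ε / 2 by linarith))] with η hη hηε
      exact (regTerm_loc hm hφ j g hη hηε).symm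
    | out => exact (b1.const_mul _).congr fun η => (regTerm_out j _ η).symm
  have hval : ∀ a, shellTerm m j a (minkFourier s n g) = S a := fun a => (hlim a).limUnder_eq
  have hIpi : ‖Complex.I * (Real.pi : ℂ)‖ = Real.pi := by
    rw [norm_mul, Complex.norm_I, one_mul, Complex.norm_real, Real.norm_of_nonneg Real.pi_pos.le]
  have hπ := Real.pi_pos
  have hnn : 0 ≤ (C₁ + C₂ * (2 * ε⁻¹ * (1 + Φ))) * schwartzNorm s n (2 * (s + 3)) (s + 2) g := by
    positivity
  have hnn' : 0 ≤ Real.pi * C₁ * schwartzNorm s n (2 * (s + 3)) (s + 2) g := by positivity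
  have hδ : Real.pi * ‖δ‖ ≤ Real.pi * (C₁ * schwartzNorm s n (2 * (s + 3)) (s + 2) g) := by
    gcongr
  simp only [hval]
  refine ⟨hlim, fun a => ?_, fun a τ => match a with
    | Channel.inn => ν τ
    | Channel.loc => S Channel.loc
    | Channel.out => ν (-τ), fun τ => rfl, fun a => ?_, fun t a f' hf => ?_⟩
  · cases a with
    | inn => simp only [hSdef]; rw [norm_mul, norm_neg, hIpi]; linarith
    | loc => simp only [hSdef]; refine (norm_add_le _ _).trans ?_; linarith
    | out => simp only [hSdef]; rw [norm_mul, hIpi]; linarith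
  · cases a with
    | inn => exact b3
    | loc => exact tendsto_const_nhds
    | out => exact b4.comp tendsto_neg_atTop_atBot
  · have h3 := regTerm_chiProd hm hφ j t a _ f' hf
    cases h : a j with
    | inn =>
      refine (b2 (t j)).congr fun η => ?_
      rw [h3, h]
    | loc =>
      refine (hlim Channel.loc).congr fun η => ?_
      rw [h3, h]
    | out =>
      refine (b2 (-t j)).congr fun η => ?_
      rw [h3, h]

end RegTerm

/-! ### The two-point function -/

section TwoPoint

variable {s : ℕ} {m m₀ ε : ℝ} {φ ρ : ℝ → ℝ}

/-- The pair of momenta `(k, -k)` with `k` on the backward mass shell of mass `μ`. -/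
def pairPoint (μ : ℝ) (p : Momentum s) : MinkN s 2 :=
  WithLp.toLp 2 ![shellPoint μ (-1) p, -shellPoint μ (-1) p]

theorem continuous_energy_uncurry :
    Continuous fun z : ℝ × Momentum s => energy z.1 z.2 := by
  unfold energy; fun_prop

theorem continuous_pairPoint : Continuous fun z : ℝ × Momentum s => pairPoint z.1 z.2 := by
  have hE := continuous_energy_uncurry (s := s)
  have h1 : Continuous fun z : ℝ × Momentum s => shellPoint z.1 (-1) z.2 := by
    unfold shellPoint
    refine (PiLp.continuous_toLp 2 _).comp (continuous_pi fun μ => ?_)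
    refine Fin.cases ?_ (fun i => ?_) μ
    · simp only [Fin.cons_zero]; fun_prop
    · simp only [Fin.cons_succ]; fun_prop
  unfold pairPoint
  refine (PiLp.continuous_toLp 2 _).comp (continuous_pi fun i => ?_)
  fin_cases i
  · exact h1
  · exact h1.neg

/-- Decay of `𝓕 g` at the pairs `(k, -k)` in the mass and in the spatial momentum. -/
theorem exists_norm_pair_le (s N : ℕ) : ∃ C : ℝ, 0 ≤ C ∧ ∀ (g : TestFn s 2) (μ : ℝ)
    (p : Momentum s), 0 < μ → ‖minkFourier s 2 g (pairPoint μ p)‖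
      ≤ C * schwartzNorm s 2 (2 * N) (s + 2) g * (energy μ p ^ (2 * N))⁻¹ := by
  obtain ⟨C, hC, h⟩ := exists_integral_ellipticOps_le s 2 zero_le_one Finset.univ N
  refine ⟨‖fourierConst s 2‖ * C, by positivity, fun g μ p hμ => ?_⟩
  have hsym : ∀ k : Mink s, 1 + k 0 ^ 2 ≤ ellipticSymbol 1 Finset.univ k := fun k => by
    rw [ellipticSymbol]
    gcongr
    exact Finset.single_le_sum (f := fun μ => k μ ^ 2) (fun μ _ => sq_nonneg _) (Finset.mem_univ 0)
  have hpos : ∀ k : Mink s, 1 ≤ ellipticSymbol 1 Finset.univ k := fun k =>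
    le_trans (by linarith [sq_nonneg (k 0)]) (hsym k)
  have hE := energy_pos hμ p
  rw [minkFourier_eq_integral 1 Finset.univ N g _ fun l => zero_lt_one.trans_le (hpos _), norm_mul,
    norm_mul]
  have h4 : ‖∫ x : MinkN s 2, Complex.exp (-Complex.I * ((∑ l, minkInner (x l) (pairPoint μ p l) : ℝ) : ℂ))
        * ellipticOps 1 Finset.univ N (List.finRange 2) g x‖
      ≤ C * schwartzNorm s 2 (2 * N) (s + 2) g := by
    refine (norm_integral_le_integral_norm _).trans (le_trans (le_of_eq ?_) (h g))
    refine integral_congr_ae (Eventually.of_forall fun x => ?_)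
    simp only
    rw [norm_mul, neg_mul, norm_exp_neg_I_mul, one_mul]
  have h5 : ‖(((∏ l, ellipticSymbol 1 Finset.univ (pairPoint μ p l) ^ N)⁻¹ : ℝ) : ℂ)‖
      ≤ (energy μ p ^ (2 * N))⁻¹ := by
    have h6 : energy μ p ^ (2 * N) ≤ ∏ l, ellipticSymbol 1 Finset.univ (pairPoint μ p l) ^ N := by
      rw [Fin.prod_univ_two, pow_mul]
      have h7 : energy μ p ^ 2 ≤ ellipticSymbol 1 Finset.univ (pairPoint μ p 0) := by
        refine le_trans ?_ (hsym _)
        have : pairPoint μ p 0 0 = -1 * energy μ p := shellPoint_zero (-1) p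
        rw [this]; nlinarith
      calc (energy μ p ^ 2) ^ N ≤ ellipticSymbol 1 Finset.univ (pairPoint μ p 0) ^ N := by gcongr
        _ ≤ _ := le_mul_of_one_le_right (pow_nonneg (zero_le_one.trans (hpos _)) _)
              (one_le_pow₀ (hpos _))
    have h8 : 0 < energy μ p ^ (2 * N) := by positivity
    rw [Complex.norm_real, Real.norm_of_nonneg (inv_nonneg.2 (h8.le.trans h6))]
    exact inv_anti₀ h8 h6
  have hS : 0 ≤ schwartzNorm s 2 (2 * N) (s + 2) g := apply_nonneg _ _
  calc _ ≤ ‖fourierConst s 2‖ * (energy μ p ^ (2 * N))⁻¹ *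
        (C * schwartzNorm s 2 (2 * N) (s + 2) g) := by gcongr
    _ = _ := by ring

theorem energy_mono {μ ν : ℝ} (hμ : 0 ≤ μ) (h : μ ≤ ν) (p : Momentum s) :
    energy μ p ≤ energy ν p := by
  unfold energy
  gcongr

theorem twoPoint_eq (μ : ℝ) (f : TestFn s 2) :
    twoPoint μ f = ∫ p : Momentum s, (((2 * energy μ p)⁻¹ : ℝ) : ℂ) * f (pairPoint μ p) := rfl

theorem exists_norm_twoPoint_le (s : ℕ) (hm : 0 < m) : ∃ C : ℝ, 0 ≤ C ∧ ∀ g : TestFn s 2,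
    ‖twoPoint m (minkFourier s 2 g)‖ ≤ C * schwartzNorm s 2 (2 * (s + 3)) (s + 2) g := by
  obtain ⟨C, hC, h⟩ := exists_norm_pair_le s (s + 3)
  have hi := integrable_inv_energy_pow (s := s) hm (k := 2 * (s + 3)) (by omega)
  refine ⟨(2 * m)⁻¹ * C * ∫ p : Momentum s, (energy m p ^ (2 * (s + 3)))⁻¹,
    mul_nonneg (by positivity) (integral_nonneg fun p => by
      have := energy_nonneg m p; positivity), fun g => ?_⟩
  rw [twoPoint_eq]
  refine (norm_integral_le_of_norm_le (hi.const_mul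
    ((2 * m)⁻¹ * (C * schwartzNorm s 2 (2 * (s + 3)) (s + 2) g)))
    (Eventually.of_forall fun p => ?_)).trans (le_of_eq ?_)
  · have hE := energy_pos hm p
    rw [norm_mul, Complex.norm_real, Real.norm_of_nonneg (by positivity), mul_assoc]
    gcongr
    · exact le_energy m p
    · exact h g m p hm
  · rw [integral_const_mul]; ring

/-- Integrability and bounds for the integrand of the two-point function, as a function of the mass
and of the momentum. -/
theorem exists_spectral_bound (s : ℕ) (hm₀ : 0 < m₀) (hρ : IsSpectralDensity m₀ ρ) :
    ∃ (N : ℕ) (w : ℝ × Momentum s → ℝ) (C : ℝ), s + 3 ≤ N ∧ 0 ≤ C ∧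
      Integrable w ((volume.restrict (Ioi m₀)).prod volume) ∧
      (∀ z, 0 ≤ w z) ∧
      (∀ (g : TestFn s 2) (μ : ℝ) (p : Momentum s), m₀ < μ →
        ‖(ρ μ : ℂ) * ((((2 * energy μ p)⁻¹ : ℝ) : ℂ) * minkFourier s 2 g (pairPoint μ p))‖
        ≤ C * schwartzNorm s 2 (2 * N) (s + 2) g * w (μ, p)) := by
  obtain ⟨Cρ, Nρ, hCρ⟩ := hρ.polynomially_bounded
  set N := s + 3 + Nρ with hN
  obtain ⟨C, hC, h⟩ := exists_norm_pair_le s N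
  have hCρ0 : 0 ≤ Cρ := by
    have h1 := (hρ.nonneg m₀ le_rfl).trans (hCρ m₀ le_rfl)
    by_contra hneg
    have : 0 < (1 + m₀) ^ Nρ := by positivity
    nlinarith
  have hi1 : Integrable (fun μ : ℝ => μ ^ (-2 : ℝ)) (volume.restrict (Ioi m₀)) :=
    integrableOn_Ioi_rpow_of_lt (by norm_num) hm₀
  have hi2 := integrable_inv_energy_pow (s := s) hm₀ (k := s + 1) le_rfl
  -- negative powers of `ω_μ ≥ μ ≥ m₀` that are not needed for integrability are bounded by constants
  have hkey : ∀ (μ : ℝ) (p : Momentum s), m₀ < μ →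
      ρ μ * ((2 * energy μ p)⁻¹ * (energy μ p ^ (2 * N))⁻¹) ≤
        Cρ * (1 + m₀⁻¹) ^ Nρ * ((2 * m₀)⁻¹ * (m₀ ^ (s + 3 + Nρ))⁻¹)
          * (μ ^ (-2 : ℝ) * (energy m₀ p ^ (s + 1))⁻¹) := fun μ p hμ => by
    have hμ0 : 0 < μ := hm₀.trans hμ
    have hE := energy_pos hμ0 p
    have hE0 := energy_pos hm₀ p
    have e1 : μ ≤ energy μ p := le_energy μ p
    have e2 : energy m₀ p ≤ energy μ p := energy_mono hm₀.le hμ.le p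
    have e3 : ρ μ ≤ Cρ * ((1 + m₀⁻¹) ^ Nρ * μ ^ Nρ) := by
      refine (hCρ μ hμ.le).trans (mul_le_mul_of_nonneg_left ?_ hCρ0)
      rw [← mul_pow]
      gcongr
      have : 1 ≤ m₀⁻¹ * μ := by rw [inv_mul_eq_div, le_div_iff₀ hm₀]; linarith
      linarith
    have e4 : (energy μ p ^ (2 * N))⁻¹ ≤ (m₀ ^ (s + 3 + Nρ))⁻¹ * (μ ^ Nρ)⁻¹ * (μ ^ 2)⁻¹
        * (energy m₀ p ^ (s + 1))⁻¹ := by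
      rw [← mul_inv, ← mul_inv, ← mul_inv]
      refine inv_anti₀ (by positivity) ?_
      have : energy μ p ^ (2 * N) = energy μ p ^ (s + 3 + Nρ) * energy μ p ^ Nρ * energy μ p ^ 2
          * energy μ p ^ (s + 1) := by
        rw [← pow_add, ← pow_add, ← pow_add]; congr 1; omega
      rw [this]
      have : m₀ ≤ energy μ p := hμ.le.trans e1
      gcongr
    have e5 : (2 * energy μ p)⁻¹ ≤ (2 * m₀)⁻¹ := by
      have : m₀ ≤ energy μ p := hμ.le.trans e1
      gcongr
    have e6 : μ ^ (-2 : ℝ) = (μ ^ 2)⁻¹ := by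
      rw [Real.rpow_neg hμ0.le]; norm_cast
    rw [e6]
    calc _ ≤ Cρ * ((1 + m₀⁻¹) ^ Nρ * μ ^ Nρ) * ((2 * m₀)⁻¹ * ((m₀ ^ (s + 3 + Nρ))⁻¹ * (μ ^ Nρ)⁻¹
          * (μ ^ 2)⁻¹ * (energy m₀ p ^ (s + 1))⁻¹)) := by
          have := hρ.nonneg μ hμ.le
          gcongr
      _ = Cρ * (1 + m₀⁻¹) ^ Nρ * ((2 * m₀)⁻¹ * (m₀ ^ (s + 3 + Nρ))⁻¹)
          * ((μ ^ 2)⁻¹ * (energy m₀ p ^ (s + 1))⁻¹) * (μ ^ Nρ * (μ ^ Nρ)⁻¹) := by ring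
      _ = _ := by rw [mul_inv_cancel₀ (by positivity), mul_one]
  refine ⟨N, fun z => |z.1 ^ (-2 : ℝ)| * (energy m₀ z.2 ^ (s + 1))⁻¹,
    C * (Cρ * (1 + m₀⁻¹) ^ Nρ * ((2 * m₀)⁻¹ * (m₀ ^ (s + 3 + Nρ))⁻¹)), by omega, by positivity,
    hi1.abs.mul_prod hi2, fun z => ?_, fun g μ p hμ => ?_⟩
  · have := energy_nonneg m₀ z.2
    positivity
  · have hμ0 : 0 < μ := hm₀.trans hμ
    have hE := energy_pos hμ0 p
    have hρ0 := hρ.nonneg μ hμ.le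
    have hS : 0 ≤ schwartzNorm s 2 (2 * N) (s + 2) g := apply_nonneg _ _
    rw [norm_mul, norm_mul, Complex.norm_real, Complex.norm_real, Real.norm_of_nonneg hρ0,
      Real.norm_of_nonneg (by positivity)]
    simp only
    rw [abs_of_nonneg (by positivity)]
    calc _ ≤ ρ μ * ((2 * energy μ p)⁻¹ * (C * schwartzNorm s 2 (2 * N) (s + 2) g
          * (energy μ p ^ (2 * N))⁻¹)) := by
          gcongr
          exact h g μ p hμ0
      _ = C * schwartzNorm s 2 (2 * N) (s + 2) g
          * (ρ μ * ((2 * energy μ p)⁻¹ * (energy μ p ^ (2 * N))⁻¹)) := by ring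
      _ ≤ C * schwartzNorm s 2 (2 * N) (s + 2) g * (Cρ * (1 + m₀⁻¹) ^ Nρ *
          ((2 * m₀)⁻¹ * (m₀ ^ (s + 3 + Nρ))⁻¹) * (μ ^ (-2 : ℝ) * (energy m₀ p ^ (s + 1))⁻¹)) := by
          exact mul_le_mul_of_nonneg_left (hkey μ p hμ) (mul_nonneg hC hS)
      _ = _ := by ring

theorem aestronglyMeasurable_spectralDensity (hρ : IsSpectralDensity m₀ ρ) :
    AEStronglyMeasurable ρ (volume.restrict (Ioi m₀)) :=
  (hρ.locallyIntegrable.aestronglyMeasurable).mono_measure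
    (Measure.restrict_mono Ioi_subset_Ici_self le_rfl)

/-- The part of the two-point function with masses above `m₀`, with a time dependent phase. -/
def spectralPart (m m₀ : ℝ) (ρ A : ℝ → ℝ) (T : ℝ) (f : TestFn s 2) : ℂ :=
  ∫ μ in Ioi m₀, ∫ p : Momentum s, (A μ * Complex.exp (Complex.I * ((energy μ p - energy m p) * T : ℝ)))
    * ((ρ μ : ℂ) * ((((2 * energy μ p)⁻¹ : ℝ) : ℂ) * f (pairPoint μ p)))

theorem integrable_spectral (hm₀ : 0 < m₀) (hρ : IsSpectralDensity m₀ ρ) (g : TestFn s 2) :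
    Integrable (fun z : ℝ × Momentum s => (ρ z.1 : ℂ) * ((((2 * energy z.1 z.2)⁻¹ : ℝ) : ℂ)
      * minkFourier s 2 g (pairPoint z.1 z.2))) ((volume.restrict (Ioi m₀)).prod volume) := by
  obtain ⟨N, w, C, -, -, hw, -, h⟩ := exists_spectral_bound s hm₀ hρ
  have hE := (continuous_energy_uncurry (s := s)).measurable
  have hf : Measurable fun z : ℝ × Momentum s => minkFourier s 2 g (pairPoint z.1 z.2) :=
    ((minkFourier s 2 g).continuous.comp continuous_pairPoint).measurable
  refine (hw.const_mul (C * schwartzNorm s 2 (2 * N) (s + 2) g)).mono' ?_ ?_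
  · refine (Complex.continuous_ofReal.comp_aestronglyMeasurable
      (aestronglyMeasurable_spectralDensity hρ).comp_fst).mul (Measurable.aestronglyMeasurable ?_)
    fun_prop
  · have h1 : ∀ᵐ z : ℝ × Momentum s ∂((volume.restrict (Ioi m₀)).prod volume), z.1 ∈ Ioi m₀ :=
      (Measure.quasiMeasurePreserving_fst).ae (ae_restrict_mem measurableSet_Ioi)
    filter_upwards [h1] with z hz
    exact h g z.1 z.2 hz

theorem integrable_spectral_phase (hm₀ : 0 < m₀) (hρ : IsSpectralDensity m₀ ρ) {A : ℝ → ℝ}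
    (hA : Measurable A) {D : ℝ} (hD : ∀ μ, |A μ| ≤ D) (T : ℝ) (g : TestFn s 2) :
    Integrable (fun z : ℝ × Momentum s =>
      (A z.1 * Complex.exp (Complex.I * ((energy z.1 z.2 - energy m z.2) * T : ℝ)))
      * ((ρ z.1 : ℂ) * ((((2 * energy z.1 z.2)⁻¹ : ℝ) : ℂ)
      * minkFourier s 2 g (pairPoint z.1 z.2)))) ((volume.restrict (Ioi m₀)).prod volume) := by
  have hE := (continuous_energy_uncurry (s := s)).measurable
  have hE' := (continuous_energy (s := s) m).measurable
  refine (integrable_spectral hm₀ hρ g).bdd_mul (c := D) (Measurable.aestronglyMeasurable ?_)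
    (Eventually.of_forall fun z => ?_)
  · have h1 : Measurable fun z : ℝ × Momentum s => A z.1 := hA.comp measurable_fst
    fun_prop
  · rw [norm_mul, norm_exp_I_mul, mul_one, Complex.norm_real]
    exact hD _

/-- A Riemann-Lebesgue lemma for the phase `e^{iω_μ T}` as a function of the mass `μ`. -/
theorem tendsto_integral_mass_phase (hm₀ : 0 < m₀) (p : Momentum s) (G : ℝ → ℂ) :
    Tendsto (fun T : ℝ => ∫ μ in Ioi m₀, G μ * Complex.exp (Complex.I * (T * energy μ p : ℝ)))
      (cocompact ℝ) (𝓝 0) := by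
  -- the substitution `u = ω_μ`, with inverse `μ = (u² - |p|²)^{1/2}`
  have hder : ∀ μ ∈ Ioi m₀, HasDerivWithinAt (fun μ => energy μ p) (μ / energy μ p) (Ioi m₀) μ :=
    fun μ hμ => by
      have hμ0 : 0 < μ := hm₀.trans hμ
      have h1 : HasDerivAt (fun μ : ℝ => ‖p‖ ^ 2 + μ ^ 2) (2 * μ) μ := by
        simpa using ((hasDerivAt_id μ).pow 2).const_add (‖p‖ ^ 2)
      have h2 := h1.sqrt (by positivity)
      refine (h2.congr_deriv ?_).hasDerivWithinAt
      rw [energy, mul_div_mul_left _ _ two_ne_zero]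
  have hinv : ∀ μ ∈ Ioi m₀, √(energy μ p ^ 2 - ‖p‖ ^ 2) = μ := fun μ hμ => by
    rw [energy_sq, add_sub_cancel_left, Real.sqrt_sq (hm₀.trans hμ).le]
  have hinj : InjOn (fun μ => energy μ p) (Ioi m₀) := fun μ hμ ν hν h => by
    rw [← hinv μ hμ, ← hinv ν hν]
    simp only at h
    rw [h]
  set H : ℝ → ℂ := ((fun μ => energy μ p) '' Ioi m₀).indicator fun u =>
    ((u / √(u ^ 2 - ‖p‖ ^ 2) : ℝ) : ℂ) * G √(u ^ 2 - ‖p‖ ^ 2) with hH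
  have himg : MeasurableSet ((fun μ => energy μ p) '' Ioi m₀) :=
    measurableSet_Ioi.image_of_continuousOn_injOn (by unfold energy; fun_prop) hinj
  refine (tendsto_integral_mul_exp H).congr fun T => ?_
  have h1 : ∀ u, H u * Complex.exp (Complex.I * (T * u : ℝ))
      = ((fun μ => energy μ p) '' Ioi m₀).indicator (fun u =>
        ((u / √(u ^ 2 - ‖p‖ ^ 2) : ℝ) : ℂ) * G √(u ^ 2 - ‖p‖ ^ 2)
          * Complex.exp (Complex.I * (T * u : ℝ))) u := fun u => by
    by_cases hu : u ∈ (fun μ => energy μ p) '' Ioi m₀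
    · rw [hH, indicator_of_mem hu, indicator_of_mem hu]
    · rw [hH, indicator_of_notMem hu, indicator_of_notMem hu, zero_mul]
  simp only [h1]
  rw [integral_indicator himg, integral_image_eq_integral_abs_deriv_smul measurableSet_Ioi hder hinj]
  refine setIntegral_congr_fun measurableSet_Ioi fun μ hμ => ?_
  have hμ0 : 0 < μ := hm₀.trans hμ
  have hE := energy_pos hμ0 p
  simp only [hinv μ hμ]
  rw [abs_of_pos (by positivity), Complex.real_smul, ← mul_assoc, ← mul_assoc, ← Complex.ofReal_mul,
    div_mul_div_cancel₀ hE.ne', div_self hμ0.ne', Complex.ofReal_one, one_mul]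

theorem tendsto_spectralPart (hm₀ : 0 < m₀) (hρ : IsSpectralDensity m₀ ρ) {A : ℝ → ℝ}
    (hA : Measurable A) {D : ℝ} (hD : ∀ μ, |A μ| ≤ D) (g : TestFn s 2) :
    Tendsto (fun T => spectralPart m m₀ ρ A T (minkFourier s 2 g)) (cocompact ℝ) (𝓝 0) := by
  have hi := fun T => integrable_spectral_phase (m := m) hm₀ hρ hA hD T g
  have hswap : ∀ T, spectralPart m m₀ ρ A T (minkFourier s 2 g) = ∫ p : Momentum s, ∫ μ in Ioi m₀,
      (A μ * Complex.exp (Complex.I * ((energy μ p - energy m p) * T : ℝ)))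
      * ((ρ μ : ℂ) * ((((2 * energy μ p)⁻¹ : ℝ) : ℂ) * minkFourier s 2 g (pairPoint μ p))) :=
    fun T => integral_integral_swap (hi T)
  simp only [hswap]
  have h0 := (integrable_spectral hm₀ hρ g).norm.const_mul D
  have hp : ∀ p : Momentum s, Tendsto (fun T : ℝ => ∫ μ in Ioi m₀,
      (A μ * Complex.exp (Complex.I * ((energy μ p - energy m p) * T : ℝ)))
      * ((ρ μ : ℂ) * ((((2 * energy μ p)⁻¹ : ℝ) : ℂ) * minkFourier s 2 g (pairPoint μ p))))
      (cocompact ℝ) (𝓝 0) := fun p => by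
    have h1 := tendsto_integral_mass_phase hm₀ p fun μ =>
      A μ * ((ρ μ : ℂ) * ((((2 * energy μ p)⁻¹ : ℝ) : ℂ) * minkFourier s 2 g (pairPoint μ p)))
    refine squeeze_zero_norm (fun T => le_of_eq ?_) (tendsto_zero_iff_norm_tendsto_zero.1 h1)
    have e : ∀ μ, (A μ * Complex.exp (Complex.I * ((energy μ p - energy m p) * T : ℝ)))
        * ((ρ μ : ℂ) * ((((2 * energy μ p)⁻¹ : ℝ) : ℂ) * minkFourier s 2 g (pairPoint μ p)))
        = Complex.exp (-(Complex.I * (energy m p * T : ℝ))) *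
          (A μ * ((ρ μ : ℂ) * ((((2 * energy μ p)⁻¹ : ℝ) : ℂ) * minkFourier s 2 g (pairPoint μ p)))
          * Complex.exp (Complex.I * (T * energy μ p : ℝ))) := fun μ => by
      have : Complex.exp (Complex.I * ((energy μ p - energy m p) * T : ℝ))
          = Complex.exp (-(Complex.I * (energy m p * T : ℝ)))
            * Complex.exp (Complex.I * (T * energy μ p : ℝ)) := by
        rw [← Complex.exp_add]; congr 1; push_cast; ring
      rw [this]; ring
    simp only [e]
    rw [integral_const_mul, norm_mul, norm_exp_neg_I_mul, one_mul]
  have hcg : (cocompact ℝ).IsCountablyGenerated := by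
    rw [cocompact_eq_atBot_atTop]; infer_instance
  have h2 := tendsto_integral_filter_of_dominated_convergence (μ := (volume : Measure (Momentum s)))
    (F := fun (T : ℝ) (p : Momentum s) => ∫ μ in Ioi m₀,
      (A μ * Complex.exp (Complex.I * ((energy μ p - energy m p) * T : ℝ)))
      * ((ρ μ : ℂ) * ((((2 * energy μ p)⁻¹ : ℝ) : ℂ) * minkFourier s 2 g (pairPoint μ p))))
    (f := fun _ => 0) (l := cocompact ℝ)
    (fun p => ∫ μ in Ioi m₀, D * ‖(ρ μ : ℂ) * ((((2 * energy μ p)⁻¹ : ℝ) : ℂ)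
      * minkFourier s 2 g (pairPoint μ p))‖)
    (Eventually.of_forall fun T => ((hi T).integral_prod_right).1)
    (Eventually.of_forall fun T => ?_) h0.integral_prod_right (Eventually.of_forall hp)
  · simpa using h2
  · filter_upwards [h0.prod_left_ae] with p hip
    refine norm_integral_le_of_norm_le hip (Eventually.of_forall fun μ => ?_)
    rw [norm_mul, norm_mul, norm_exp_I_mul, mul_one, Complex.norm_real]
    exact mul_le_mul_of_nonneg_right (hD μ) (norm_nonneg _)

end TwoPoint

section TwoPointTime

variable {s : ℕ} {m m₀ ε : ℝ} {φ ρ : ℝ → ℝ}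

/-- The two-point structure function in terms of `spectralPart` at time zero. -/
theorem structHat_two_eq (f : TestFn s 2) :
    structHat m m₀ ρ 2 f = twoPoint m f + spectralPart m m₀ ρ 1 0 f := by
  simp only [structHat, spectralPart, twoPoint_eq]
  congr 2
  funext μ
  rw [← integral_const_mul]
  simp

theorem norm_spectralPart_le (hm₀ : 0 < m₀) (hρ : IsSpectralDensity m₀ ρ) :
    ∃ (N : ℕ) (C : ℝ), s + 3 ≤ N ∧ 0 ≤ C ∧ ∀ g : TestFn s 2,
      ‖spectralPart m m₀ ρ 1 0 (minkFourier s 2 g)‖ ≤ C * schwartzNorm s 2 (2 * N) (s + 2) g := by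
  obtain ⟨N, w, C, hN, hC, hw, hw0, h⟩ := exists_spectral_bound s hm₀ hρ
  refine ⟨N, C * ∫ z, w z ∂((volume.restrict (Ioi m₀)).prod volume), hN,
    mul_nonneg hC (integral_nonneg hw0), fun g => ?_⟩
  have hi := integrable_spectral_phase (m := m) hm₀ hρ (A := 1) measurable_const (D := 1)
    (fun μ => by simp) 0 g
  have h1 : ∀ᵐ z : ℝ × Momentum s ∂((volume.restrict (Ioi m₀)).prod volume), z.1 ∈ Ioi m₀ :=
    (Measure.quasiMeasurePreserving_fst).ae (ae_restrict_mem measurableSet_Ioi)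
  rw [spectralPart, ← integral_prod _ hi]
  refine (norm_integral_le_of_norm_le (hw.const_mul (C * schwartzNorm s 2 (2 * N) (s + 2) g))
    ?_).trans (le_of_eq (by rw [integral_const_mul]; ring))
  filter_upwards [h1] with z hz
  refine le_trans (le_of_eq ?_) (h g z.1 z.2 hz)
  simp

/-- The momentum space bound for the two-point function. -/
theorem exists_norm_structHat_two_le (hm : 0 < m) (hm₀ : 0 < m₀) (hρ : IsSpectralDensity m₀ ρ) :
    ∃ (N : ℕ) (C : ℝ), s + 3 ≤ N ∧ 0 ≤ C ∧ ∀ g : TestFn s 2,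
      ‖structHat m m₀ ρ 2 (minkFourier s 2 g)‖ ≤ C * (schwartzNorm s 2 (2 * (s + 3)) (s + 2) g +
        schwartzNorm s 2 (2 * N) (s + 2) g) := by
  obtain ⟨C1, hC1, h1⟩ := exists_norm_twoPoint_le s hm
  obtain ⟨N, C2, hN, hC2, h2⟩ := norm_spectralPart_le (s := s) (m := m) hm₀ hρ
  refine ⟨N, C1 + C2, hN, by positivity, fun g => ?_⟩
  rw [structHat_two_eq]
  have p1 : 0 ≤ schwartzNorm s 2 (2 * (s + 3)) (s + 2) g := apply_nonneg _ _
  have p2 : 0 ≤ schwartzNorm s 2 (2 * N) (s + 2) g := apply_nonneg _ _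
  refine (norm_add_le _ _).trans ((add_le_add (h1 g) (h2 g)).trans ?_)
  nlinarith

theorem integrable_twoPoint (hm : 0 < m) (g : TestFn s 2) : Integrable fun p : Momentum s =>
    (((2 * energy m p)⁻¹ : ℝ) : ℂ) * minkFourier s 2 g (pairPoint m p) := by
  obtain ⟨C, hC, h⟩ := exists_norm_pair_le s (s + 3)
  have hi := integrable_inv_energy_pow (s := s) hm (k := 2 * (s + 3)) (by omega)
  have hE := (continuous_energy (s := s) m).measurable
  have hf : Measurable fun p : Momentum s => minkFourier s 2 g (pairPoint m p) :=
    ((minkFourier s 2 g).continuous.comp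
      (continuous_pairPoint.comp (Continuous.prodMk_right m))).measurable
  refine (hi.const_mul ((2 * m)⁻¹ * (C * schwartzNorm s 2 (2 * (s + 3)) (s + 2) g))).mono'
    (Measurable.aestronglyMeasurable (by fun_prop)) (Eventually.of_forall fun p => ?_)
  have hE := energy_pos hm p
  rw [norm_mul, Complex.norm_real, Real.norm_of_nonneg (by positivity), mul_assoc]
  gcongr
  · exact le_energy m p
  · exact h g m p hm

/-- The sign of the time in the phase of `χ_t(a, ·)`, and zero for `loc`, where there is no phase. -/
def channelSign : Channel → ℝ
  | Channel.inn => 1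
  | Channel.loc => 0
  | Channel.out => -1

/-- The real factor in front of the phase of `χ_t(a, ·)` on the mass shell of mass `μ`. -/
def channelCut (m : ℝ) (φ : ℝ → ℝ) : Channel → ℝ → ℝ
  | Channel.loc, _ => 1
  | _, μ => φ (μ ^ 2 - m ^ 2)

theorem minkSq_shellPoint_mass (μ : ℝ) {σ : ℝ} (hσ : σ = 1 ∨ σ = -1) (p : Momentum s) :
    minkSq (shellPoint μ σ p) = μ ^ 2 := by
  have h1 : (shellPoint μ σ p) 0 ^ 2 = energy μ p ^ 2 := by
    rw [shellPoint_zero]; rcases hσ with rfl | rfl <;> ring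
  rw [minkSq_eq, spatial_shellPoint, h1, energy_sq]; ring

theorem chi_shellPoint_mass {μ : ℝ} (hμ : 0 < μ) (t : ℝ) (a : Channel) {σ : ℝ}
    (hσ : σ = 1 ∨ σ = -1) (p : Momentum s) :
    chi m φ t a (shellPoint μ σ p) = (channelCut m φ a μ : ℂ) * Complex.exp (Complex.I *
      (-(channelSign a * σ * (energy μ p - energy m p) * t) : ℝ)) := by
  have hE := energy_pos hμ p
  have h0 := shellPoint_zero (m := μ) σ p
  have h1 := minkSq_shellPoint_mass μ hσ p
  have h2 := spatial_shellPoint (m := μ) σ p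
  rcases hσ with rfl | rfl <;> cases a <;>
    simp [chi, chiPM, h0, h1, h2, channelCut, channelSign, hE, hE.le] <;> ring_nf <;>
    simp [hE.not_gt]

theorem pairPoint_zero (μ : ℝ) (p : Momentum s) : pairPoint μ p 0 = shellPoint μ (-1) p := rfl

theorem pairPoint_one (μ : ℝ) (p : Momentum s) : pairPoint μ p 1 = shellPoint μ 1 (-p) := by
  change -shellPoint μ (-1) p = _
  ext i
  refine Fin.cases ?_ (fun i => ?_) i <;> simp [shellPoint, energy_neg]

theorem chiProd_pairPoint {μ : ℝ} (hμ : 0 < μ) (t : Fin 2 → ℝ) (a : Fin 2 → Channel)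
    (p : Momentum s) :
    chiProd m φ t a (pairPoint μ p) = ((channelCut m φ (a 0) μ * channelCut m φ (a 1) μ : ℝ) : ℂ)
      * Complex.exp (Complex.I * ((energy μ p - energy m p) *
        (channelSign (a 0) * t 0 - channelSign (a 1) * t 1) : ℝ)) := by
  rw [chiProd, Fin.prod_univ_two, pairPoint_zero, pairPoint_one,
    chi_shellPoint_mass hμ _ _ (Or.inr rfl), chi_shellPoint_mass hμ _ _ (Or.inl rfl), energy_neg,
    energy_neg, Complex.ofReal_mul, mul_mul_mul_comm, ← Complex.exp_add]
  congr 2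
  push_cast; ring

/-- The finite time two-point function: only the spectral part depends on the times. -/
theorem structHat_two_chiProd (hm : 0 < m) (hm₀ : 0 < m₀) (hφ : IsCutoff m ε φ) (t : Fin 2 → ℝ)
    (a : Fin 2 → Channel) (f f' : TestFn s 2) (hf : ∀ k, f' k = chiProd m φ t a k * f k) :
    structHat m m₀ ρ 2 f' = twoPoint m f + spectralPart m m₀ ρ
      (fun μ => channelCut m φ (a 0) μ * channelCut m φ (a 1) μ)
      (channelSign (a 0) * t 0 - channelSign (a 1) * t 1) f := by
  have hc : ∀ b, channelCut m φ b m = 1 := fun b => by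
    have := hφ.eps_pos
    cases b <;> simp [channelCut, hφ.eq_one 0 (by linarith) (by linarith)]
  rw [structHat_two_eq]
  congr 1
  · rw [twoPoint_eq, twoPoint_eq]
    congr 1
    funext p
    rw [hf, chiProd_pairPoint hm, hc, hc]
    simp
  · unfold spectralPart
    refine setIntegral_congr_fun measurableSet_Ioi fun μ hμ => ?_
    simp only
    congr 1
    funext p
    rw [hf, chiProd_pairPoint (hm₀.trans hμ)]
    simp only [Pi.one_apply, mul_zero, Complex.ofReal_zero, Complex.exp_zero, Complex.ofReal_one]
    ring

theorem measurable_channelCut (hφ : IsCutoff m ε φ) (b : Channel) :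
    Measurable (channelCut m φ b) := by
  have := hφ.contDiff.continuous.measurable
  cases b <;> unfold channelCut <;> fun_prop

theorem exists_abs_channelCut_le (hφ : IsCutoff m ε φ) :
    ∃ D : ℝ, ∀ b μ, |channelCut m φ b μ| ≤ D := by
  obtain ⟨Φ, hΦ, h⟩ := hφ.exists_bound
  refine ⟨max 1 Φ, fun b μ => ?_⟩
  cases b
  · exact (h _).trans (le_max_right _ _)
  · simp [channelCut]
  · exact (h _).trans (le_max_right _ _)

/-- The limits of the finite time two-point function in one time parameter. -/
theorem structHat_two_limits (hm : 0 < m) (hm₀ : 0 < m₀) (hφ : IsCutoff m ε φ)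
    (hρ : IsSpectralDensity m₀ ρ) (a : Fin 2 → Channel) (g : TestFn s 2)
    (f' : (Fin 2 → ℝ) → TestFn s 2)
    (hf : ∀ t k, f' t k = chiProd m φ t a k * minkFourier s 2 g k) (i : Fin 2) :
    (a i = Channel.loc ∧
      ∀ t τ, structHat m m₀ ρ 2 (f' (Function.update t i τ)) = structHat m m₀ ρ 2 (f' t)) ∨
    (a i ≠ Channel.loc ∧
      ∀ t, Tendsto (fun τ => structHat m m₀ ρ 2 (f' (Function.update t i τ))) atTop
        (𝓝 (formFactorHat m m₀ ρ 2 a (minkFourier s 2 g)))) := by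
  have e := fun t => structHat_two_chiProd (ρ := ρ) hm hm₀ hφ t a _ _ (hf t)
  obtain ⟨D, hD⟩ := exists_abs_channelCut_le hφ
  by_cases hi : a i = Channel.loc
  · refine Or.inl ⟨hi, fun t τ => ?_⟩
    rw [e, e]
    congr 2
    fin_cases i
    · simp only [Fin.zero_eta] at hi
      simp [hi, channelSign]
    · simp only [Fin.mk_one] at hi
      simp [hi, channelSign]
  · refine Or.inr ⟨hi, fun t => ?_⟩
    have hne : ¬(a 0 = Channel.loc ∧ a 1 = Channel.loc) := by
      rintro ⟨h0, h1⟩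
      fin_cases i
      · exact hi h0
      · exact hi h1
    have hff : formFactorHat m m₀ ρ 2 a (minkFourier s 2 g) = twoPoint m (minkFourier s 2 g) := by
      simp only [formFactorHat]; rw [if_neg hne]
    rw [hff]
    simp only [e]
    have hsign : channelSign (a i) ≠ 0 := by
      cases h : a i <;> simp_all [channelSign]
    have hlin : ∀ c d : ℝ, c ≠ 0 → Tendsto (fun τ => c * τ + d) atTop (cocompact ℝ) := fun c d hc => by
      rcases hc.lt_or_gt with h | h
      · exact (tendsto_atBot_add_const_right _ _
          (tendsto_id.const_mul_atTop_of_neg h)).mono_right atBot_le_cocompact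
      · exact (tendsto_atTop_add_const_right _ _
          (tendsto_id.const_mul_atTop h)).mono_right atTop_le_cocompact
    have hT : Tendsto (fun τ => channelSign (a 0) * Function.update t i τ 0
        - channelSign (a 1) * Function.update t i τ 1) atTop (cocompact ℝ) := by
      fin_cases i
      · refine (hlin (channelSign (a 0)) (-(channelSign (a 1) * t 1)) hsign).congr fun τ => ?_
        simp [sub_eq_add_neg]
      · refine (hlin (-channelSign (a 1)) (channelSign (a 0) * t 0) (neg_ne_zero.2 hsign)).congr
          fun τ => ?_
        simp; ring
    have h1 := (tendsto_spectralPart (m := m) hm₀ hρ (A := fun μ => channelCut m φ (a 0) μ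
        * channelCut m φ (a 1) μ) ((measurable_channelCut hφ _).mul (measurable_channelCut hφ _))
        (D := D * D) (fun μ => by
          rw [abs_mul]
          exact mul_le_mul (hD _ _) (hD _ _) (abs_nonneg _) ((abs_nonneg _).trans (hD (a 0) μ)))
        g).comp hT
    simpa using h1.const_add (twoPoint m (minkFourier s 2 g))

/-- When both channels are `loc`, the finite time two-point function is independent of time. -/
theorem structHat_two_of_loc {a : Fin 2 → Channel} (ha : a 0 = Channel.loc ∧ a 1 = Channel.loc) (t : Fin 2 → ℝ)
    (f f' : TestFn s 2) (hf : ∀ k, f' k = chiProd m φ t a k * f k) :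
    structHat m m₀ ρ 2 f' = formFactorHat m m₀ ρ 2 a f := by
  have : f' = f := by
    ext k
    rw [hf, chiProd, Fin.prod_univ_two, ha.1, ha.2]
    simp [chi]
  simp only [formFactorHat]
  rw [if_pos ha, this]

end TwoPointTime

/-! ### Inversion of the Fourier transform -/

section Inversion

variable {s n : ℕ}

/-- The map `k ↦ (k⁰, -𝐤)` on tuples is an isometry. -/
def reflIso (s n : ℕ) : MinkN s n ≃ₗᵢ[ℝ] MinkN s n where
  toLinearEquiv := (diagEquiv n (spaceReflLin s).toContinuousLinearEquiv).toLinearEquiv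
  norm_map' x := by
    have h : ∀ l, ‖(diagEquiv n (spaceReflLin s).toContinuousLinearEquiv x) l‖ = ‖x l‖ := fun l => by
      rw [diagEquiv_apply, EuclideanSpace.norm_eq, EuclideanSpace.norm_eq]
      congr 1
      refine Finset.sum_congr rfl fun i _ => ?_
      refine Fin.cases ?_ (fun i => ?_) i <;> simp [spaceReflLin]
    change ‖diagEquiv n (spaceReflLin s).toContinuousLinearEquiv x‖ = ‖x‖
    rw [PiLp.norm_eq_of_L2, PiLp.norm_eq_of_L2]
    simp only [h]

theorem fourierScale_eq (k : MinkN s n) :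
    fourierScale s n k = (2 * Real.pi)⁻¹ • reflIso s n k := rfl

theorem reflIso_reflIso (k : MinkN s n) : reflIso s n (reflIso s n k) = k := by
  change diagEquiv n (spaceReflLin s).toContinuousLinearEquiv
    (diagEquiv n (spaceReflLin s).toContinuousLinearEquiv k) = k
  ext l i
  rw [diagEquiv_apply, diagEquiv_apply]
  refine Fin.cases ?_ (fun i => ?_) i <;> simp [spaceReflLin]

theorem fourierConst_sq : fourierConst s n * fourierConst s n
    * (((2 * Real.pi) ^ (Module.finrank ℝ (MinkN s n)) : ℝ) : ℂ) = 1 := by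
  have hf : Module.finrank ℝ (MinkN s n) = (s + 1) * n := by
    rw [(WithLp.linearEquiv 2 ℝ (∀ _ : Fin n, Mink s)).finrank_eq, Module.finrank_pi_fintype]
    simp [mul_comm]
  rw [hf, fourierConst, ← Complex.ofReal_mul, ← Complex.ofReal_mul,
    ← Real.rpow_add (by positivity), ← Real.rpow_natCast, ← Real.rpow_add (by positivity)]
  rw [show -(((s + 1) * n : ℕ) : ℝ) / 2 + -(((s + 1) * n : ℕ) : ℝ) / 2 + (((s + 1) * n : ℕ) : ℝ) = 0
    by ring]
  simp

theorem minkFourier_minkFourierInv (f : TestFn s n) :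
    minkFourier s n (minkFourierInv s n f) = f := by
  ext k
  have hpi : (2 * Real.pi) ≠ 0 := by positivity
  have e1 : minkFourier s n (minkFourierInv s n f) k = fourierConst s n *
      (𝓕 (minkFourierInv s n f : MinkN s n → ℂ)) (fourierScale s n k) := rfl
  rw [e1, Real.fourier_eq']
  set G : MinkN s n → ℂ := fun y => fourierConst s n *
    (Complex.exp ((-2 * Real.pi * inner ℝ y k : ℝ) * Complex.I) • (𝓕⁻ f) y) with hG
  have hR : (fun x => Complex.exp ((-2 * Real.pi * inner ℝ x (fourierScale s n k) : ℝ) * Complex.I)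
      • minkFourierInv s n f x) = fun x => G (fourierScale s n x) := by
    funext x
    have e2 : minkFourierInv s n f x = fourierConst s n * (𝓕⁻ f) (fourierScale s n x) := rfl
    have e3 : inner ℝ x (fourierScale s n k) = inner ℝ (fourierScale s n x) k := by
      rw [fourierScale_eq, fourierScale_eq, inner_smul_left, inner_smul_right]
      congr 1
      rw [← (reflIso s n).inner_map_map x, reflIso_reflIso]
    rw [e2, e3]
    simp only [hG, smul_eq_mul]
    ring
  rw [hR]
  have e4 : ∀ G : MinkN s n → ℂ, ∫ x, G (fourierScale s n x)
      = (((2 * Real.pi) ^ (Module.finrank ℝ (MinkN s n)) : ℝ) : ℂ) * ∫ x, G x := fun G => by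
    have h1 := (reflIso s n).measurePreserving.integral_comp
      (reflIso s n).toHomeomorph.measurableEmbedding (fun x => G ((2 * Real.pi)⁻¹ • x))
    have h2 := Measure.integral_comp_smul (μ := (volume : Measure (MinkN s n))) G (2 * Real.pi)⁻¹
    simp only [fourierScale_eq]
    rw [h1, h2, inv_pow, inv_inv, abs_of_nonneg (by positivity), Complex.real_smul]
  rw [e4 G, hG, integral_const_mul]
  have e5 : ∫ y : MinkN s n, Complex.exp ((-2 * Real.pi * inner ℝ y k : ℝ) * Complex.I) • (𝓕⁻ f) y
      = f k := by
    rw [← Real.fourier_eq']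
    have : 𝓕 (𝓕⁻ f) = f := FourierTransform.fourier_fourierInv_eq f
    conv_rhs => rw [← this]
    rfl
  rw [e5]
  have := fourierConst_sq (s := s) (n := n)
  calc _ = f k * (fourierConst s n * fourierConst s n
    * (((2 * Real.pi) ^ (Module.finrank ℝ (MinkN s n)) : ℝ) : ℂ)) := by ring
    _ = f k := by rw [this, mul_one]

/-- In momentum space the finite time wave operators are multiplication operators. -/
theorem minkFourier_omegaN {m ε : ℝ} {φ : ℝ → ℝ} (hm : 0 < m) (hφ : IsCutoff m ε φ)
    (t : Fin n → ℝ) (f : TestFnExt s n) (a : Fin n → Channel) (k : MinkN s n) :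
    minkFourier s n (omegaN m φ n t f a) k = chiProd m φ t a k * minkFourier s n (f a) k := by
  have : omegaN m φ n t f a = minkFourierInv s n
      (SchwartzMap.smulLeftCLM ℂ (chiProd m φ t a) (minkFourier s n (f a))) := rfl
  rw [this, minkFourier_minkFourierInv,
    SchwartzMap.smulLeftCLM_apply_apply (hasTemperateGrowth_chiProd hm hφ t a), smul_eq_mul]

end Inversion

/-! ### Lorentz invariance of the measure on the mass shell -/

section PiDensity

theorem lmarginal_prod_eq {ι : Type*} [DecidableEq ι] {α : ι → Type*}
    [∀ i, MeasurableSpace (α i)] (μ : ∀ i, Measure (α i)) [∀ i, SigmaFinite (μ i)]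
    {f : ∀ i, α i → ℝ≥0∞} (hf : ∀ i, Measurable (f i)) (S : Finset ι) (x : ∀ i, α i) :
    (lmarginal μ S fun x => ∏ i ∈ S, f i (x i)) x = ∏ i ∈ S, ∫⁻ y, f i y ∂μ i := by
  have hm : ∀ S : Finset ι, Measurable fun x : ∀ i, α i => ∏ i ∈ S, f i (x i) := fun S =>
    Finset.measurable_prod _ fun i _ => (hf i).comp (measurable_pi_apply i)
  induction S using Finset.induction_on generalizing x with
  | empty => simp
  | insert i S hi ih =>
    rw [lmarginal_insert _ (hm _) hi, Finset.prod_insert hi, ← lintegral_mul_const _ (hf i)]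
    refine lintegral_congr fun y => ?_
    rw [← ih (Function.update x i y)]
    simp only [lmarginal]
    rw [← lintegral_const_mul]
    · refine lintegral_congr fun z => ?_
      rw [Finset.prod_insert hi]
      simp [Function.updateFinset, hi]
    · exact (hm S).comp measurable_updateFinset

theorem pi_withDensity {ι : Type*} [Fintype ι] {α : ι → Type*}
    [∀ i, MeasurableSpace (α i)] (μ : ∀ i, Measure (α i)) [∀ i, SigmaFinite (μ i)]
    {f : ∀ i, α i → ℝ≥0∞} (hf : ∀ i, Measurable (f i))
    [∀ i, SigmaFinite ((μ i).withDensity (f i))] :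
    Measure.pi (fun i => (μ i).withDensity (f i))
      = (Measure.pi μ).withDensity fun x => ∏ i, f i (x i) := by
  classical
  refine Measure.pi_eq (μ := fun i => (μ i).withDensity (f i)) fun S hS => ?_
  rw [withDensity_apply _ (MeasurableSet.univ_pi hS),
    ← lintegral_indicator (MeasurableSet.univ_pi hS)]
  have h1 : ∀ x, (univ.pi S).indicator (fun x => ∏ i, f i (x i)) x
      = ∏ i, (S i).indicator (f i) (x i) := fun x => by
    by_cases hx : x ∈ univ.pi S
    · rw [indicator_of_mem hx]
      exact Finset.prod_congr rfl fun i _ => (indicator_of_mem (hx i (mem_univ i)) _).symm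
    · rw [indicator_of_notMem hx]
      obtain ⟨i, hi⟩ : ∃ i, x i ∉ S i := by simpa [Set.mem_pi] using hx
      exact (Finset.prod_eq_zero (Finset.mem_univ i) (indicator_of_notMem hi _)).symm
  simp only [h1]
  rcases isEmpty_or_nonempty (∀ i, α i) with he | ⟨⟨x0⟩⟩
  · obtain ⟨i, hi⟩ : ∃ i, IsEmpty (α i) := by
      by_contra h
      push Not at h
      exact he.false fun i => (h i).some
    rw [lintegral_of_isEmpty, Finset.prod_eq_zero (Finset.mem_univ i)]
    rw [Measure.eq_zero_of_isEmpty ((μ i).withDensity (f i))]; rfl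
  · have h2 := lmarginal_prod_eq μ (fun i => (hf i).indicator (hS i)) Finset.univ x0
    rw [lmarginal_univ] at h2
    refine h2.trans (Finset.prod_congr rfl fun i _ => ?_)
    rw [lintegral_indicator (hS i), withDensity_apply _ (hS i)]

end PiDensity

section ShellMeasure

variable {s n : ℕ} {m : ℝ}

/-- The point of Minkowski space with energy `e` and spatial part `p`. -/
def minkMk (z : ℝ × Momentum s) : Mink s := WithLp.toLp 2 (Fin.cons z.1 fun i : Fin s => z.2 i)

theorem minkMk_zero (z : ℝ × Momentum s) : minkMk z 0 = z.1 := rfl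

theorem spatial_minkMk (z : ℝ × Momentum s) : spatial (minkMk z) = z.2 := by
  ext i; simp [spatial, minkMk]

theorem shellPoint_eq_minkMk (σ : ℝ) (p : Momentum s) :
    shellPoint m σ p = minkMk (σ * energy m p, p) := rfl

theorem minkMk_spatial (k : Mink s) : minkMk (k 0, spatial k) = k := by
  ext i; refine Fin.cases ?_ (fun i => ?_) i <;> simp [spatial, minkMk]

theorem measurePreserving_minkMk :
    MeasurePreserving (minkMk : ℝ × Momentum s → Mink s) := by
  have h1 := (volume_preserving_piFinSuccAbove (fun _ : Fin (s + 1) => ℝ) 0).symm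
  have h2 := (MeasurePreserving.id (volume : Measure ℝ)).prod (PiLp.volume_preserving_ofLp (Fin s))
  have h3 := ((PiLp.volume_preserving_toLp (Fin (s + 1))).comp h1).comp h2
  have : (minkMk : ℝ × Momentum s → Mink s) = (WithLp.toLp 2 ∘
      ⇑(MeasurableEquiv.piFinSuccAbove (fun _ : Fin (s + 1) => ℝ) 0).symm) ∘
      Prod.map id (WithLp.ofLp (p := 2)) := by
    funext z
    simp [minkMk, MeasurableEquiv.piFinSuccAbove_symm_apply]
    rfl
  rw [this]
  exact h3

theorem continuous_energy_swap : Continuous fun z : Momentum s × ℝ => energy z.2 z.1 := by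
  unfold energy; fun_prop

theorem continuous_shellPoint_swap :
    Continuous fun z : Momentum s × ℝ => shellPoint z.2 1 z.1 := by
  have hE := continuous_energy_swap (s := s)
  unfold shellPoint
  refine (PiLp.continuous_toLp 2 _).comp (continuous_pi fun μ => ?_)
  refine Fin.cases ?_ (fun i => ?_) μ
  · simp only [Fin.cons_zero]; fun_prop
  · simp only [Fin.cons_succ]; fun_prop

theorem lintegral_mink (H : Mink s → ℝ≥0∞) (hH : Measurable H) :
    ∫⁻ k, H k = ∫⁻ p : Momentum s, ∫⁻ e : ℝ, H (minkMk (e, p)) := by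
  rw [← measurePreserving_minkMk.lintegral_comp hH, Measure.volume_eq_prod,
    lintegral_prod_symm' (fun z => H (minkMk z)) (hH.comp measurePreserving_minkMk.measurable)]

theorem energy_smul {μ : ℝ} (hm : 0 < m) (hμ : 0 < μ) (q : Momentum s) :
    energy μ ((μ / m) • q) = μ / m * energy m q := by
  have h : 0 ≤ μ / m := by positivity
  rw [energy, energy, norm_smul, Real.norm_of_nonneg h,
    show (μ / m * ‖q‖) ^ 2 + μ ^ 2 = (μ / m) ^ 2 * (‖q‖ ^ 2 + m ^ 2) by field_simp,
    Real.sqrt_mul (sq_nonneg _), Real.sqrt_sq h]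

/-- The weight in the mass that normalizes the integral of `coneFun`. -/
def coneWeight (s : ℕ) (m : ℝ) : ℝ → ℝ≥0∞ :=
  (Ioo (1 : ℝ) 2).indicator fun μ => (ENNReal.ofReal ((μ / m) ^ s))⁻¹

theorem measurable_coneWeight : Measurable (coneWeight s m) :=
  Measurable.indicator (by fun_prop) measurableSet_Ioo

/-- The function on Minkowski space that is homogeneous of degree zero in the open forward light
cone and is given by `G` on the mass shell, times a weight in the mass. -/
def coneFun (m : ℝ) (G : Mink s → ℝ≥0∞) (k : Mink s) : ℝ≥0∞ :=
  {k : Mink s | 0 < k 0 ∧ 0 < minkSq k}.indicator (fun k =>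
    coneWeight s m √(minkSq k) * G ((m / √(minkSq k)) • k)) k

theorem measurable_coneFun {G : Mink s → ℝ≥0∞} (hG : Measurable G) : Measurable (coneFun m G) := by
  have h1 := (continuous_minkSq (s := s)).measurable
  have h2 : Measurable fun k : Mink s => k 0 := by fun_prop
  refine Measurable.indicator (Measurable.mul ?_ ?_)
    ((measurableSet_lt measurable_const h2).inter (measurableSet_lt measurable_const h1))
  · exact measurable_coneWeight.comp h1.sqrt
  · refine hG.comp ?_
    have := h1.sqrt
    fun_prop

theorem lintegral_coneFun_energy (G : Mink s → ℝ≥0∞) (p : Momentum s) :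
    ∫⁻ e : ℝ, coneFun m G (minkMk (e, p))
    = ∫⁻ μ in Ioi (0 : ℝ), ENNReal.ofReal (μ / energy μ p)
      * (coneWeight s m μ * G ((m / μ) • shellPoint μ 1 p)) := by
  -- for fixed spatial momentum, substitute the energy by the mass
  have hder : ∀ μ ∈ Ioi (0 : ℝ), HasDerivWithinAt (fun μ => energy μ p) (μ / energy μ p)
      (Ioi 0) μ := fun μ hμ => by
    have hμ0 : 0 < μ := hμ
    have h1 : HasDerivAt (fun μ : ℝ => ‖p‖ ^ 2 + μ ^ 2) (2 * μ) μ := by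
      simpa using ((hasDerivAt_id μ).pow 2).const_add (‖p‖ ^ 2)
    have h2 := h1.sqrt (by positivity)
    refine (h2.congr_deriv ?_).hasDerivWithinAt
    rw [energy, mul_div_mul_left _ _ two_ne_zero]
  have hsq : ∀ μ ∈ Ioi (0 : ℝ), √(energy μ p ^ 2 - ‖p‖ ^ 2) = μ := fun μ hμ => by
    rw [energy_sq, add_sub_cancel_left, Real.sqrt_sq (le_of_lt hμ)]
  have hinj : InjOn (fun μ => energy μ p) (Ioi 0) := fun μ hμ ν hν h => by
    rw [← hsq μ hμ, ← hsq ν hν]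
    simp only at h
    rw [h]
  have himg : (fun μ => energy μ p) '' Ioi 0 = {e | 0 < e ∧ 0 < e ^ 2 - ‖p‖ ^ 2} := by
    ext e
    constructor
    · rintro ⟨μ, hμ, rfl⟩
      have hμ0 : 0 < μ := hμ
      refine ⟨energy_pos hμ0 p, ?_⟩
      simp only
      rw [energy_sq, add_sub_cancel_left]; positivity
    · rintro ⟨he, h⟩
      refine ⟨√(e ^ 2 - ‖p‖ ^ 2), Real.sqrt_pos.2 h, ?_⟩
      simp only [energy]
      rw [Real.sq_sqrt h.le, add_sub_cancel, Real.sqrt_sq he.le]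
  have hset : MeasurableSet {e : ℝ | 0 < e ∧ 0 < e ^ 2 - ‖p‖ ^ 2} :=
    (measurableSet_lt measurable_const measurable_id).inter
      (measurableSet_lt measurable_const
        (show Measurable fun e : ℝ => e ^ 2 - ‖p‖ ^ 2 by fun_prop))
  have h1 : ∀ e, coneFun m G (minkMk (e, p)) = {e : ℝ | 0 < e ∧ 0 < e ^ 2 - ‖p‖ ^ 2}.indicator
      (fun e => coneWeight s m √(e ^ 2 - ‖p‖ ^ 2) * G ((m / √(e ^ 2 - ‖p‖ ^ 2)) • minkMk (e, p))) e := fun e => by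
    have hk : minkSq (minkMk (e, p)) = e ^ 2 - ‖p‖ ^ 2 := by
      rw [minkSq_eq, minkMk_zero, spatial_minkMk]
    simp only [coneFun, indicator, mem_ofPred_eq, hk, minkMk_zero]
  simp only [h1]
  rw [lintegral_indicator hset, ← himg,
    lintegral_image_eq_lintegral_abs_deriv_mul measurableSet_Ioi hder hinj]
  refine setLIntegral_congr_fun measurableSet_Ioi fun μ hμ => ?_
  have hμ0 : 0 < μ := hμ
  have hE := energy_pos hμ0 p
  simp only [hsq μ hμ]
  rw [abs_of_pos (by positivity), shellPoint_eq_minkMk, one_mul]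

theorem lintegral_shell_scale (hm : 0 < m) {G : Mink s → ℝ≥0∞} (hG : Measurable G) {μ : ℝ}
    (hμ : μ ∈ Ioi (0 : ℝ)) : ∫⁻ p : Momentum s, ENNReal.ofReal (μ / energy μ p)
      * (coneWeight s m μ * G ((m / μ) • shellPoint μ 1 p)) = (ENNReal.ofReal ((μ / m) ^ s) * coneWeight s m μ) *
      ∫⁻ q : Momentum s, ENNReal.ofReal (m / energy m q) * G (shellPoint m 1 q) := by
  -- for fixed mass, substitute `p = (μ / m) q`
  have hμ0 : 0 < μ := hμ
  have hr : 0 < μ / m := by positivity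
  have hS : Measurable (shellPoint μ 1 : Momentum s → Mink s) :=
    (continuous_shellPoint 1).measurable
  have hE := (continuous_energy (s := s) μ).measurable
  have hK : Measurable fun p : Momentum s => ENNReal.ofReal (μ / energy μ p)
      * (coneWeight s m μ * G ((m / μ) • shellPoint μ 1 p)) := by
    have h3 := hG.comp (show Measurable fun p : Momentum s => (m / μ) • shellPoint μ 1 p by fun_prop)
    simp only [Function.comp_def] at h3
    fun_prop
  have h1 := lintegral_map (μ := (volume : Measure (Momentum s))) hK
    (measurable_const_smul (μ / m))
  rw [Measure.map_addHaar_smul _ hr.ne', lintegral_smul_measure, finrank_euclideanSpace,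
    Fintype.card_fin, smul_eq_mul, abs_of_pos (by positivity),
    ENNReal.ofReal_inv_of_pos (by positivity)] at h1
  have h2 : ∀ q : Momentum s, ENNReal.ofReal (μ / energy μ ((μ / m) • q))
      * (coneWeight s m μ * G ((m / μ) • shellPoint μ 1 ((μ / m) • q)))
      = coneWeight s m μ * (ENNReal.ofReal (m / energy m q) * G (shellPoint m 1 q)) := fun q => by
    have e1 : (m / μ) • shellPoint μ 1 ((μ / m) • q) = shellPoint m 1 q := by
      ext i
      refine Fin.cases ?_ (fun i => ?_) i
      · simp [shellPoint, energy_smul hm hμ0]; field_simp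
      · simp [shellPoint]; field_simp
    have e2 : μ / (μ / m * energy m q) = m / energy m q := by
      have := energy_pos hm q
      field_simp
    rw [e1, energy_smul hm hμ0, e2]; ring
  simp only [h2] at h1
  have hE0 := (continuous_energy (s := s) m).measurable
  have hS0 : Measurable (shellPoint m 1 : Momentum s → Mink s) :=
    (continuous_shellPoint 1).measurable
  rw [lintegral_const_mul _ (by fun_prop)] at h1
  rw [mul_assoc, ← h1, ← mul_assoc, ENNReal.mul_inv_cancel, one_mul]
  · exact (ENNReal.ofReal_pos.2 (by positivity)).ne'
  · exact ENNReal.ofReal_ne_top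

/-- Integration in hyperbolic polar coordinates: the mass and a point of the mass shell. -/
theorem lintegral_coneFun (hm : 0 < m) {G : Mink s → ℝ≥0∞} (hG : Measurable G) :
    ∫⁻ k, coneFun m G k
      = ∫⁻ q : Momentum s, ENNReal.ofReal (m / energy m q) * G (shellPoint m 1 q) := by
  rw [lintegral_mink _ (measurable_coneFun hG)]
  have hwm := measurable_coneWeight (s := s) (m := m)
  simp only [lintegral_coneFun_energy]
  rw [lintegral_lintegral_swap]
  swap
  · have hE' := (continuous_energy_swap (s := s)).measurable
    have h1 := (continuous_shellPoint_swap (s := s)).measurable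
    have h4 : Measurable fun z : Momentum s × ℝ => ENNReal.ofReal (z.2 / energy z.2 z.1)
        * (coneWeight s m z.2 * G ((m / z.2) • shellPoint z.2 1 z.1)) := by fun_prop
    exact h4.aemeasurable
  rw [setLIntegral_congr_fun measurableSet_Ioi fun μ hμ => lintegral_shell_scale hm hG hμ,
    lintegral_mul_const _ (by fun_prop)]
  have hc : ∫⁻ μ in Ioi (0 : ℝ), ENNReal.ofReal ((μ / m) ^ s) * coneWeight s m μ = 1 := by
    have h1 : ∀ μ, ENNReal.ofReal ((μ / m) ^ s) * coneWeight s m μ =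
        (Ioo (1 : ℝ) 2).indicator 1 μ := fun μ => by
      by_cases hμ : μ ∈ Ioo (1 : ℝ) 2
      · have : 0 < μ := by linarith [hμ.1]
        rw [coneWeight, indicator_of_mem hμ, indicator_of_mem hμ, ENNReal.mul_inv_cancel]
        · rfl
        · exact (ENNReal.ofReal_pos.2 (by positivity)).ne'
        · exact ENNReal.ofReal_ne_top
      · rw [coneWeight, indicator_of_notMem hμ, indicator_of_notMem hμ, mul_zero]
    simp only [h1]
    rw [lintegral_indicator_one measurableSet_Ioo, Measure.restrict_apply measurableSet_Ioo,
      inter_eq_left.2 fun x hx => by exact lt_trans one_pos hx.1, Real.volume_Ioo]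
    norm_num
  rw [hc, one_mul]

end ShellMeasure

/-! ### Lorentz transformations of the mass shell -/

section LorentzShell

variable {s n : ℕ} {m μ : ℝ} {Λ : Mink s ≃L[ℝ] Mink s}

theorem IsRestrictedLorentz.minkSq_eq (h : IsRestrictedLorentz Λ) (k : Mink s) :
    minkSq (Λ k) = minkSq k := h.inner_eq k k

theorem IsRestrictedLorentz.inner_symm (h : IsRestrictedLorentz Λ) (x y : Mink s) :
    minkInner (Λ x) y = minkInner x (Λ.symm y) := by
  rw [← h.inner_eq x, Λ.apply_symm_apply]

theorem minkInner_single (k : Mink s) : minkInner (EuclideanSpace.single 0 1) k = k 0 := by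
  simp [minkInner]

theorem minkInner_comm (x y : Mink s) : minkInner x y = minkInner y x := by
  simp [minkInner, mul_comm]

theorem IsRestrictedLorentz.symm (h : IsRestrictedLorentz Λ) : IsRestrictedLorentz Λ.symm where
  inner_eq x y := by
    rw [← h.inner_eq, Λ.apply_symm_apply, Λ.apply_symm_apply]
  det_eq := by
    have h1 := (Λ.toLinearEquiv).det_symm_mul_det
    have h2 : LinearMap.det (Λ.toLinearEquiv : Mink s →ₗ[ℝ] Mink s) = 1 := h.det_eq
    rw [h2, mul_one] at h1
    exact h1
  orthochronous := by
    rw [← minkInner_single (Λ.symm _), ← h.inner_symm, minkInner_comm, minkInner_single]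
    exact h.orthochronous

/-- Two points in the open forward light cone have a positive Minkowski inner product. -/
theorem minkInner_pos {x y : Mink s} (hx : 0 < minkSq x) (hx0 : 0 < x 0) (hy : 0 < minkSq y)
    (hy0 : 0 < y 0) : 0 < minkInner x y := by
  rw [minkSq_eq] at hx hy
  have h1 : ‖spatial x‖ < x 0 := lt_of_pow_lt_pow_left₀ 2 hx0.le (by linarith)
  have h2 : ‖spatial y‖ < y 0 := lt_of_pow_lt_pow_left₀ 2 hy0.le (by linarith)
  rw [minkInner_eq]
  have h3 := real_inner_le_norm (spatial x) (spatial y)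
  have h4 : ‖spatial x‖ * ‖spatial y‖ < x 0 * y 0 :=
    mul_lt_mul'' h1 h2 (norm_nonneg _) (norm_nonneg _)
  linarith

theorem IsRestrictedLorentz.pos (h : IsRestrictedLorentz Λ) {k : Mink s} (hk : 0 < minkSq k)
    (hk0 : 0 < k 0) : 0 < Λ k 0 := by
  rw [← minkInner_single (Λ k), minkInner_comm, h.inner_symm]
  refine minkInner_pos hk hk0 ?_ h.symm.orthochronous
  rw [h.symm.minkSq_eq]
  simp [minkSq, minkInner]

/-- The sign of the energy of a timelike vector is Lorentz invariant. -/
theorem IsRestrictedLorentz.sign_eq (h : IsRestrictedLorentz Λ) {k : Mink s} (hk : 0 < minkSq k) :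
    SignType.sign (Λ k 0) = SignType.sign (k 0) := by
  rcases lt_trichotomy (k 0) 0 with h0 | h0 | h0
  · have h1 : 0 < Λ (-k) 0 := h.pos (by simpa [minkSq, minkInner] using hk) (by simpa using h0)
    have h2 : Λ k 0 < 0 := by simpa using h1
    rw [sign_neg h0, sign_neg h2]
  · rw [IndefMetricQFT.minkSq_eq, h0] at hk
    nlinarith [sq_nonneg ‖spatial k‖]
  · rw [sign_pos h0, sign_pos (h.pos hk h0)]

theorem IsRestrictedLorentz.deltaReg_eq (h : IsRestrictedLorentz Λ) (a : Channel) {η : ℝ}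
    (hη : η < m ^ 2) (k : Mink s) : deltaReg m a η (Λ k) = deltaReg m a η k := by
  have h1 : |minkSq k - m ^ 2| < η → SignType.sign (Λ k 0) = SignType.sign (k 0) := fun hk =>
    h.sign_eq (by linarith [(abs_lt.1 hk).1])
  cases a <;> simp only [deltaReg, h.minkSq_eq]
  · split_ifs with hk
    · rw [h1 hk]
    · rfl
  · split_ifs with hk
    · rw [h1 hk]
    · rfl

/-- The action of a Lorentz transformation on the spatial momenta of the points of a mass shell. -/
def shellAct (μ σ : ℝ) (Λ : Mink s ≃L[ℝ] Mink s) (p : Momentum s) : Momentum s :=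
  spatial (Λ (shellPoint μ σ p))

theorem continuous_shellAct (μ σ : ℝ) (Λ : Mink s ≃L[ℝ] Mink s) :
    Continuous (shellAct μ σ Λ) :=
  continuous_spatial.comp (Λ.continuous.comp (continuous_shellPoint σ))

theorem shellPoint_neg (σ : ℝ) (p : Momentum s) :
    shellPoint μ (-σ) p = -shellPoint μ σ (-p) := by
  ext i
  refine Fin.cases ?_ (fun i => ?_) i <;> simp [shellPoint, energy_neg]

theorem IsRestrictedLorentz.shellPoint_one (h : IsRestrictedLorentz Λ) (hμ : 0 < μ)
    (p : Momentum s) : Λ (shellPoint μ 1 p) = shellPoint μ 1 (shellAct μ 1 Λ p) := by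
  have h1 : minkSq (shellPoint μ 1 p) = μ ^ 2 := minkSq_shellPoint_mass μ (Or.inl rfl) p
  have h2 := h.minkSq_eq (shellPoint μ 1 p)
  have h0 : 0 < Λ (shellPoint μ 1 p) 0 := h.pos (by rw [h1]; positivity) (by
    rw [shellPoint_zero, one_mul]; exact energy_pos hμ p)
  rw [h1, IndefMetricQFT.minkSq_eq] at h2
  rw [shellPoint_eq_minkMk 1 (shellAct μ 1 Λ p), ← minkMk_spatial (Λ _)]
  congr 1
  rw [one_mul, shellAct, Prod.mk.injEq]
  refine ⟨?_, rfl⟩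
  rw [energy, ← h2, add_sub_cancel, Real.sqrt_sq h0.le]

theorem shellAct_neg (σ : ℝ) (p : Momentum s) :
    shellAct μ (-σ) Λ p = -shellAct μ σ Λ (-p) := by
  rw [shellAct, shellAct, shellPoint_neg, map_neg, spatial_neg]

theorem IsRestrictedLorentz.shellPoint_eq (h : IsRestrictedLorentz Λ) (hμ : 0 < μ) {σ : ℝ}
    (hσ : σ = 1 ∨ σ = -1) (p : Momentum s) :
    Λ (shellPoint μ σ p) = shellPoint μ σ (shellAct μ σ Λ p) := by
  rcases hσ with rfl | rfl
  · exact h.shellPoint_one hμ p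
  · rw [shellPoint_neg, map_neg, h.shellPoint_one hμ, shellPoint_neg, shellAct_neg, neg_neg]

/-- The measure `d𝐩 / (2ω)` on the mass shell. -/
def shellMeasure (s : ℕ) (μ : ℝ) : Measure (Momentum s) :=
  volume.withDensity fun p => ENNReal.ofReal (2 * energy μ p)⁻¹

theorem measurable_shellDensity (μ : ℝ) :
    Measurable fun p : Momentum s => ENNReal.ofReal (2 * energy μ p)⁻¹ := by
  have := (continuous_energy (s := s) μ).measurable
  fun_prop

instance (μ : ℝ) : SigmaFinite (shellMeasure s μ) :=
  SigmaFinite.withDensity_of_ne_top' fun _ => ENNReal.ofReal_ne_top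

theorem IsRestrictedLorentz.measurePreserving (h : IsRestrictedLorentz Λ) :
    MeasurePreserving Λ := by
  refine ⟨Λ.continuous.measurable, ?_⟩
  have hd : LinearMap.det ((Λ : Mink s →L[ℝ] Mink s) : Mink s →ₗ[ℝ] Mink s) ≠ 0 := by
    rw [h.det_eq]; exact one_ne_zero
  have := Measure.map_linearMap_addHaar_eq_smul_addHaar (volume : Measure (Mink s)) hd
  rw [h.det_eq] at this
  simpa using this

/-- Up to a constant, an integral over the mass shell is an integral over the light cone of a function
whose construction commutes with Lorentz transformations. -/
theorem lintegral_shellMeasure (hm : 0 < m) {G : Mink s → ℝ≥0∞} (hG : Measurable G) :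
    ENNReal.ofReal (2 * m) * ∫⁻ p, G (shellPoint m 1 p) ∂(shellMeasure s m)
      = ∫⁻ k, coneFun m G k := by
  have hS : Measurable (shellPoint m 1 : Momentum s → Mink s) :=
    (continuous_shellPoint 1).measurable
  have hGS : Measurable fun p : Momentum s => G (shellPoint m 1 p) := hG.comp hS
  rw [lintegral_coneFun hm hG, shellMeasure, lintegral_withDensity_eq_lintegral_mul _
    (measurable_shellDensity m) hGS, ← lintegral_const_mul _
    ((measurable_shellDensity m).mul hGS)]
  refine lintegral_congr fun p => ?_
  have hE := energy_pos hm p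
  rw [Pi.mul_apply, ← mul_assoc, ← ENNReal.ofReal_mul (by positivity)]
  congr 2
  field_simp

theorem IsRestrictedLorentz.measurePreserving_shellAct_one (h : IsRestrictedLorentz Λ)
    (hm : 0 < m) : MeasurePreserving (shellAct m 1 Λ) (shellMeasure s m) (shellMeasure s m) := by
  refine ⟨(continuous_shellAct m 1 Λ).measurable, ?_⟩
  refine Measure.ext_of_lintegral _ fun g hg => ?_
  rw [lintegral_map hg (continuous_shellAct m 1 Λ).measurable]
  have hG : Measurable fun k : Mink s => g (spatial k) := hg.comp continuous_spatial.measurable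
  have h1 := lintegral_shellMeasure hm hG
  have h2 := lintegral_shellMeasure hm (hG.comp Λ.continuous.measurable)
  have h3 : ∫⁻ k, coneFun m ((fun k : Mink s => g (spatial k)) ∘ Λ) k
      = ∫⁻ k, coneFun m (fun k : Mink s => g (spatial k)) k := by
    rw [← h.measurePreserving.lintegral_comp (measurable_coneFun hG)]
    refine lintegral_congr fun k => ?_
    have hiff : (0 < Λ k 0 ∧ 0 < minkSq k) ↔ (0 < k 0 ∧ 0 < minkSq k) := by
      refine and_congr_left fun hk => ⟨fun h0 => ?_, fun h0 => h.pos hk h0⟩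
      have := h.symm.pos (k := Λ k) (by rwa [h.minkSq_eq]) h0
      rwa [Λ.symm_apply_apply] at this
    simp only [coneFun, indicator, mem_ofPred_eq, h.minkSq_eq, hiff, Function.comp_apply, map_smul]
  have hc : ENNReal.ofReal (2 * m) ≠ 0 := (ENNReal.ofReal_pos.2 (by positivity)).ne'
  have h4 := h2.trans (h3.trans h1.symm)
  rw [ENNReal.mul_right_inj hc ENNReal.ofReal_ne_top] at h4
  simp only [spatial_shellPoint] at h4
  exact h4

theorem measurePreserving_neg_shellMeasure (μ : ℝ) :
    MeasurePreserving (fun p : Momentum s => -p) (shellMeasure s μ) (shellMeasure s μ) := by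
  refine ⟨measurable_neg, Measure.ext_of_lintegral _ fun g hg => ?_⟩
  have hD := measurable_shellDensity (s := s) μ
  have hg' : Measurable fun p => g (-p) := hg.comp measurable_neg
  rw [lintegral_map hg measurable_neg, shellMeasure,
    lintegral_withDensity_eq_lintegral_mul _ hD hg,
    lintegral_withDensity_eq_lintegral_mul _ hD hg',
    ← lintegral_neg_eq_self]
  refine lintegral_congr fun p => ?_
  simp [energy_neg]

/-- The measure `d𝐩 / (2ω)` is Lorentz invariant. The backward mass shell is reduced to the forward
one by the reflection `k ↦ -k`. -/
theorem IsRestrictedLorentz.measurePreserving_shellAct (h : IsRestrictedLorentz Λ) (hm : 0 < m)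
    {σ : ℝ} (hσ : σ = 1 ∨ σ = -1) :
    MeasurePreserving (shellAct m σ Λ) (shellMeasure s m) (shellMeasure s m) := by
  rcases hσ with rfl | rfl
  · exact h.measurePreserving_shellAct_one hm
  · have h1 := measurePreserving_neg_shellMeasure (s := s) m
    have h2 := h1.comp ((h.measurePreserving_shellAct_one hm).comp h1)
    have : shellAct m (-1) Λ = (fun p => -p) ∘ shellAct m 1 Λ ∘ fun p => -p := by
      funext p
      rw [shellAct_neg]; rfl
    rw [this]
    exact h2

theorem integral_shellMeasure (hm : 0 < m) (R : Momentum s → ℂ) :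
    ∫ p : Momentum s, (((2 * energy m p)⁻¹ : ℝ) : ℂ) * R p = ∫ p, R p ∂(shellMeasure s m) := by
  rw [shellMeasure, integral_withDensity_eq_integral_toReal_smul (measurable_shellDensity m)
    (Eventually.of_forall fun _ => ENNReal.ofReal_lt_top)]
  refine integral_congr_ae (Eventually.of_forall fun p => ?_)
  have hE := energy_pos hm p
  simp only
  rw [ENNReal.toReal_ofReal (by positivity), Complex.real_smul]

theorem integral_pi_shellMeasure (hm : 0 < m) {ι : Type} [Fintype ι] (R : (ι → Momentum s) → ℂ) :
    ∫ p : ι → Momentum s, ((∏ l, (2 * energy m (p l))⁻¹ : ℝ) : ℂ) * R p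
      = ∫ p, R p ∂(Measure.pi fun _ : ι => shellMeasure s m) := by
  have hD := measurable_shellDensity (s := s) m
  have h1 : Measure.pi (fun _ : ι => shellMeasure s m) = (volume : Measure (ι → Momentum s)).withDensity
      fun p => ∏ l, ENNReal.ofReal (2 * energy m (p l))⁻¹ := by
    have : ∀ i : ι, SigmaFinite ((volume : Measure (Momentum s)).withDensity
      fun p => ENNReal.ofReal (2 * energy m p)⁻¹) :=
      fun _ => inferInstanceAs (SigmaFinite (shellMeasure s m))
    exact pi_withDensity (fun _ : ι => (volume : Measure (Momentum s))) fun _ => hD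
  have hpm : Measurable fun p : ι → Momentum s => ∏ l, ENNReal.ofReal (2 * energy m (p l))⁻¹ :=
    Finset.measurable_prod _ fun i _ => hD.comp (measurable_pi_apply i)
  rw [h1, integral_withDensity_eq_integral_toReal_smul hpm
    (Eventually.of_forall fun _ => ENNReal.prod_lt_top fun _ _ => ENNReal.ofReal_lt_top)]
  refine integral_congr_ae (Eventually.of_forall fun p => ?_)
  simp only
  rw [ENNReal.toReal_prod, Complex.real_smul]
  congr 2
  refine Finset.prod_congr rfl fun l _ => ?_
  have hE := energy_pos hm (p l)
  rw [ENNReal.toReal_ofReal (by positivity)]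

end LorentzShell

/-! ### Poincaré invariance of the momentum space functionals -/

section Poincare

variable {s n : ℕ} {m μ : ℝ} {Λ : Mink s ≃L[ℝ] Mink s}

theorem IsRestrictedLorentz.measurePreserving_diagEquiv (h : IsRestrictedLorentz Λ) (n : ℕ) :
    MeasurePreserving (diagEquiv n Λ) := by
  refine ⟨(diagEquiv n Λ).continuous.measurable, ?_⟩
  have hd : LinearMap.det (((diagEquiv n Λ : MinkN s n ≃L[ℝ] MinkN s n) :
      MinkN s n →L[ℝ] MinkN s n) : MinkN s n →ₗ[ℝ] MinkN s n) = 1 := by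
    have h1 : (((diagEquiv n Λ : MinkN s n ≃L[ℝ] MinkN s n) :
      MinkN s n →L[ℝ] MinkN s n) : MinkN s n →ₗ[ℝ] MinkN s n)
      = ((WithLp.linearEquiv 2 ℝ (Fin n → Mink s)).symm : (Fin n → Mink s) →ₗ[ℝ] MinkN s n) ∘ₗ
        (LinearMap.pi fun i => ((Λ : Mink s →L[ℝ] Mink s) : Mink s →ₗ[ℝ] Mink s) ∘ₗ LinearMap.proj i)
        ∘ₗ ((WithLp.linearEquiv 2 ℝ (Fin n → Mink s)).symm.symm :
          MinkN s n →ₗ[ℝ] (Fin n → Mink s)) := rfl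
    rw [h1, LinearMap.det_conj, LinearMap.det_pi, Finset.prod_eq_one fun _ _ => h.det_eq]
  have := Measure.map_linearMap_addHaar_eq_smul_addHaar (volume : Measure (MinkN s n))
    (hd ▸ one_ne_zero)
  rw [hd] at this
  simpa using this

theorem spatial_add (x y : Mink s) : spatial (x + y) = spatial x + spatial y := by
  ext i; simp [spatial]

/-- Covariance of the Fourier transform. -/
theorem minkFourier_poincareAct (h : IsRestrictedLorentz Λ) (a : Mink s) (f : TestFn s n)
    (k : MinkN s n) : minkFourier s n (poincareAct n Λ a f) k
      = Complex.exp (-Complex.I * (minkInner a (∑ l, k l) : ℝ))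
        * minkFourier s n f (diagEquiv n Λ.symm k) := by
  set G : MinkN s n → ℂ := fun y =>
    Complex.exp (-Complex.I * ((∑ l, minkInner (Λ (y l) + a) (k l) : ℝ) : ℂ)) * f y with hG
  have h1 : ∀ x : MinkN s n,
      Complex.exp (-Complex.I * ((∑ l, minkInner (x l) (k l) : ℝ) : ℂ)) * poincareAct n Λ a f x
      = (fun x => G (diagEquiv n Λ.symm x)) (x - WithLp.toLp 2 fun _ => a) := fun x => by
    rw [poincareAct_apply]
    have e1 : diagEquiv n Λ.symm (x - WithLp.toLp 2 fun _ => a)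
        = WithLp.toLp 2 fun l => Λ.symm (x l - a) := rfl
    simp only [hG, e1]
    congr 4
    refine Finset.sum_congr rfl fun l _ => ?_
    rw [Λ.apply_symm_apply, sub_add_cancel]
  have h2 : ∀ y : MinkN s n, G y = Complex.exp (-Complex.I * (minkInner a (∑ l, k l) : ℝ)) *
      (Complex.exp (-Complex.I * ((∑ l, minkInner (y l) (diagEquiv n Λ.symm k l) : ℝ) : ℂ))
        * f y) := fun y => by
    have e2 : ∑ l, minkInner (Λ (y l) + a) (k l)
        = minkInner a (∑ l, k l) + ∑ l, minkInner (y l) (diagEquiv n Λ.symm k l) := by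
      have e3 : ∀ l, minkInner (Λ (y l) + a) (k l)
          = minkInner a (k l) + minkInner (y l) (diagEquiv n Λ.symm k l) := fun l => by
        rw [diagEquiv_apply, ← h.inner_symm]
        simp only [minkInner_eq, spatial_add, inner_add_left, PiLp.add_apply]
        ring
      have e4 : minkInner a (∑ l, k l) = ∑ l, minkInner a (k l) := by
        simp only [minkInner_eq, spatial_sum, inner_sum, Finset.sum_sub_distrib]
        simp [Finset.mul_sum]
      rw [e4, ← Finset.sum_add_distrib]
      exact Finset.sum_congr rfl fun l _ => e3 l
    rw [hG]
    simp only
    rw [e2, ← mul_assoc, ← Complex.exp_add]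
    congr 2
    push_cast; ring
  rw [minkFourier_apply, minkFourier_apply]
  simp only [h1]
  rw [integral_sub_right_eq_self (fun x => G (diagEquiv n Λ.symm x)),
    (h.symm.measurePreserving_diagEquiv n).integral_comp
      (diagEquiv n Λ.symm).toHomeomorph.measurableEmbedding G]
  simp only [h2]
  rw [integral_const_mul]; ring

theorem sum_shellConfig (j : Fin n) (p : {l : Fin n // l ≠ j} → Momentum s) :
    ∑ l, shellConfig m j p l = 0 := by
  have h1 : ∑ l ∈ Finset.univ.erase j, shellConfig m j p l
      = ∑ i : {l : Fin n // l ≠ j}, shellConfig m j p i :=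
    Finset.sum_subtype _ (by simp) fun l => shellConfig m j p l
  rw [← Finset.add_sum_erase Finset.univ _ (Finset.mem_univ j), h1, shellConfig_self]
  simp [shellConfig_of_ne]

theorem shellSign_eq (j l : Fin n) : shellSign j l = 1 ∨ shellSign j l = -1 := by
  unfold shellSign; split_ifs <;> simp

theorem diagEquiv_shellConfig (h : IsRestrictedLorentz Λ) (hm : 0 < m) (j : Fin n)
    (p : {l : Fin n // l ≠ j} → Momentum s) : diagEquiv n Λ (shellConfig m j p)
      = shellConfig m j fun i => shellAct m (shellSign j i) Λ (p i) := by
  have h1 : ∀ i : {l : Fin n // l ≠ j}, Λ (shellPoint m (shellSign j i) (p i))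
      = shellPoint m (shellSign j i) (shellAct m (shellSign j i) Λ (p i)) := fun i =>
    h.shellPoint_eq hm (shellSign_eq j i) (p i)
  refine PiLp.ext fun l => ?_
  rw [diagEquiv_apply]
  by_cases hl : l = j
  · subst hl
    rw [shellConfig_self, shellConfig_self, map_neg, map_sum]
    simp only [h1]
  · rw [shellConfig_of_ne j p ⟨l, hl⟩, shellConfig_of_ne j _ ⟨l, hl⟩, h1 ⟨l, hl⟩]

theorem measurable_deltaReg (a : Channel) (η : ℝ) : Measurable (deltaReg (s := s) m a η) := by
  have h1 := (continuous_minkSq (s := s)).measurable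
  have h2 : Measurable fun k : Mink s => k 0 := by fun_prop
  have h3 : Measurable fun k : Mink s => |minkSq k - m ^ 2| := by fun_prop
  have h4 : (fun k : Mink s => ((SignType.sign (k 0) : ℝ) : ℂ))
      = fun k => if 0 < k 0 then 1 else if k 0 < 0 then -1 else 0 := by
    funext k
    rw [sign_apply]
    split_ifs <;> simp
  have h5 : Measurable fun k : Mink s => ((SignType.sign (k 0) : ℝ) : ℂ) := by
    rw [h4]
    exact Measurable.ite (measurableSet_lt measurable_const h2) measurable_const
      (Measurable.ite (measurableSet_lt h2 measurable_const) measurable_const measurable_const)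
  cases a <;> unfold deltaReg
  · exact Measurable.ite (measurableSet_lt h3 measurable_const) (by fun_prop) measurable_const
  · exact Measurable.ite (measurableSet_lt measurable_const h3) (by fun_prop) measurable_const
  · exact Measurable.ite (measurableSet_lt h3 measurable_const) (by fun_prop) measurable_const

/-- The translation phase drops out, since the momenta of a configuration add up to zero. For
`η < m²` the regularized propagator only sees timelike momenta, where the sign of the energy is
Lorentz invariant. -/
theorem regTerm_poincareAct (h : IsRestrictedLorentz Λ) (hm : 0 < m) (a : Mink s) (j : Fin n)
    (b : Channel) (f : TestFn s n) {η : ℝ} (hη : η < m ^ 2) :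
    regTerm m j b (minkFourier s n (poincareAct n Λ a f)) η
      = regTerm m j b (minkFourier s n f) η := by
  have h1 : ∀ f : TestFn s n, regTerm m j b f η
      = ∫ p, deltaReg m b η (shellConfig m j p j) * f (shellConfig m j p)
        ∂(Measure.pi fun _ : {l : Fin n // l ≠ j} => shellMeasure s m) := fun f => by
    rw [← integral_pi_shellMeasure hm]
    simp only [regTerm, mul_assoc]
  have hP := measurePreserving_pi (fun _ : {l : Fin n // l ≠ j} => shellMeasure s m)
    (fun _ => shellMeasure s m) (f := fun i => shellAct m (shellSign j i) Λ.symm)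
    fun i => h.symm.measurePreserving_shellAct hm (shellSign_eq j i)
  have hmeas : Measurable fun p : {l : Fin n // l ≠ j} → Momentum s =>
      deltaReg m b η (shellConfig m j p j) * minkFourier s n f (shellConfig m j p) :=
    ((measurable_deltaReg b η).comp
      ((PiLp.continuous_apply 2 _ j).comp (continuous_shellConfig j)).measurable).mul
      ((minkFourier s n f).continuous.comp (continuous_shellConfig j)).measurable
  rw [h1, h1]
  conv_rhs => rw [← hP.map_eq]
  rw [integral_map hP.measurable.aemeasurable hmeas.aestronglyMeasurable]
  refine integral_congr_ae (Eventually.of_forall fun p => ?_)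
  simp only
  rw [minkFourier_poincareAct h, sum_shellConfig, ← diagEquiv_shellConfig h.symm hm,
    diagEquiv_apply, h.symm.deltaReg_eq b hη]
  simp [minkInner]

theorem shellTerm_poincareAct (h : IsRestrictedLorentz Λ) (hm : 0 < m) (a : Mink s) (j : Fin n)
    (b : Channel) (f : TestFn s n) : shellTerm m j b (minkFourier s n (poincareAct n Λ a f))
      = shellTerm m j b (minkFourier s n f) := by
  have h1 : regTerm m j b (minkFourier s n (poincareAct n Λ a f)) =ᶠ[𝓝[>] 0]
      regTerm m j b (minkFourier s n f) := by
    filter_upwards [Ioo_mem_nhdsGT (show (0 : ℝ) < m ^ 2 by positivity)] with η hη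
    exact regTerm_poincareAct h hm a j b f hη.2
  rw [shellTerm, shellTerm, limUnder, limUnder, Filter.map_congr h1]

theorem twoPoint_poincareAct (h : IsRestrictedLorentz Λ) (hμ : 0 < μ) (a : Mink s)
    (f : TestFn s 2) : twoPoint μ (minkFourier s 2 (poincareAct 2 Λ a f))
      = twoPoint μ (minkFourier s 2 f) := by
  have hP := h.symm.measurePreserving_shellAct hμ (Or.inr rfl)
  have hmeas : Measurable fun p : Momentum s => minkFourier s 2 f (pairPoint μ p) :=
    ((minkFourier s 2 f).continuous.comp
      (continuous_pairPoint.comp (Continuous.prodMk_right μ))).measurable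
  rw [twoPoint_eq, twoPoint_eq, integral_shellMeasure hμ, integral_shellMeasure hμ]
  conv_rhs => rw [← hP.map_eq]
  rw [integral_map hP.measurable.aemeasurable hmeas.aestronglyMeasurable]
  refine integral_congr_ae (Eventually.of_forall fun p => ?_)
  simp only
  have h1 : diagEquiv 2 Λ.symm (pairPoint μ p) = pairPoint μ (shellAct μ (-1) Λ.symm p) := by
    refine PiLp.ext fun l => ?_
    rw [diagEquiv_apply]
    fin_cases l
    · exact h.symm.shellPoint_eq hμ (Or.inr rfl) p
    · change Λ.symm (-shellPoint μ (-1) p) = -shellPoint μ (-1) (shellAct μ (-1) Λ.symm p)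
      rw [map_neg, h.symm.shellPoint_eq hμ (Or.inr rfl) p]
  have h2 : ∑ l, pairPoint μ p l = 0 := by
    rw [Fin.sum_univ_two]
    exact add_neg_cancel _
  rw [minkFourier_poincareAct h, h2, h1]
  simp [minkInner]

theorem formFactorHat_poincareAct (h : IsRestrictedLorentz Λ) (hm : 0 < m) {m₀ : ℝ}
    (hm₀ : 0 < m₀) (ρ : ℝ → ℝ) (a : Mink s) (n : ℕ) (b : Fin n → Channel) (f : TestFn s n) :
    formFactorHat m m₀ ρ n b (minkFourier s n (poincareAct n Λ a f))
      = formFactorHat m m₀ ρ n b (minkFourier s n f) := by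
  match n with
  | 0 => rfl
  | 1 => rfl
  | 2 =>
    simp only [formFactorHat, structHat]
    rw [twoPoint_poincareAct h hm]
    congr 2
    refine setIntegral_congr_fun measurableSet_Ioi fun μ hμ => ?_
    rw [twoPoint_poincareAct h (hm₀.trans hμ)]
  | n + 3 =>
    exact Finset.sum_congr rfl fun j _ => shellTerm_poincareAct h hm a j (b j) f

end Poincare

/-! ### Linearity and norm bounds in each degree -/

section Linear

variable {s n : ℕ} {m m₀ ε : ℝ} {φ ρ : ℝ → ℝ}

theorem norm_deltaReg_le (a : Channel) {η : ℝ} (hη : 0 < η) (k : Mink s) :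
    ‖deltaReg m a η k‖ ≤ Real.pi * η⁻¹ := by
  have hpi := Real.pi_gt_three
  have hη' : 0 < η⁻¹ := inv_pos.2 hη
  have hsign : ∀ x : ℝ, |((SignType.sign x : SignType) : ℝ)| ≤ 1 := fun x => by
    rw [sign_apply]; split_ifs <;> simp
  have h1 : Real.pi * |((SignType.sign (k 0) : SignType) : ℝ)| * (2 * η)⁻¹ ≤ Real.pi * η⁻¹ := by
    calc _ ≤ Real.pi * 1 * η⁻¹ := by
          gcongr
          · exact hsign _
          · linarith
      _ = _ := by ring
  have h2 : |2 * η| = 2 * η := abs_of_pos (by positivity)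
  cases a <;> simp only [deltaReg] <;> split_ifs with h
  · rw [norm_neg]
    simpa [abs_of_pos Real.pi_pos, h2, abs_of_pos hη] using h1
  · simp only [norm_zero]; positivity
  · rw [Complex.norm_real, norm_inv, Real.norm_eq_abs]
    calc _ ≤ η⁻¹ := inv_anti₀ hη h.le
      _ ≤ _ := by nlinarith
  · simp only [norm_zero]; positivity
  · simpa [abs_of_pos Real.pi_pos, h2, abs_of_pos hη] using h1
  · simp only [norm_zero]; positivity

theorem integrable_regTerm (hm : 0 < m) (j : Fin n) (a : Channel) (g : TestFn s n) {η : ℝ}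
    (hη : 0 < η) : Integrable fun p : {l : Fin n // l ≠ j} → Momentum s =>
      ((∏ l, (2 * energy m (p l))⁻¹ : ℝ) : ℂ) * deltaReg m a η (shellConfig m j p j)
        * minkFourier s n g (shellConfig m j p) := by
  obtain ⟨C, -, h⟩ := exists_norm_integral_shell_le s n hm
  exact (h j g (fun p => deltaReg m a η (shellConfig m j p j)) _ ((measurable_deltaReg a η).comp
    ((PiLp.continuous_apply 2 _ j).comp (continuous_shellConfig j)).measurable)
    fun p => norm_deltaReg_le a hη _).1

/-- The regularized terms are linear for each `η > 0`, and so are their limits. -/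
theorem isLinearMap_shellTerm (hs : 2 ≤ s) (hm : 0 < m) (hφ : IsCutoff m ε φ) (hn : 3 ≤ n)
    (j : Fin n) (a : Channel) :
    IsLinearMap ℂ fun g : TestFn s n => shellTerm m j a (minkFourier s n g) := by
  obtain ⟨C, -, h⟩ := exists_shellTerm_limits hs hm hφ hn j
  have hlim := fun g => (h g).1 a
  constructor
  · intro f g
    refine tendsto_nhds_unique (hlim (f + g)) (((hlim f).add (hlim g)).congr' ?_)
    filter_upwards [self_mem_nhdsWithin] with η hη
    rw [regTerm, regTerm, regTerm, ← integral_add (integrable_regTerm hm j a f hη)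
      (integrable_regTerm hm j a g hη)]
    refine integral_congr_ae (Eventually.of_forall fun p => ?_)
    simp only [map_add, add_apply]
    ring
  · intro c g
    refine tendsto_nhds_unique (hlim (c • g)) (((hlim g).const_smul c).congr fun η => ?_)
    rw [regTerm, regTerm, ← integral_smul]
    refine integral_congr_ae (Eventually.of_forall fun p => ?_)
    simp only [map_smul, smul_apply, smul_eq_mul]
    ring

theorem isLinearMap_twoPoint (hm : 0 < m) :
    IsLinearMap ℂ fun g : TestFn s 2 => twoPoint m (minkFourier s 2 g) := by
  constructor
  · intro f g
    rw [twoPoint_eq, twoPoint_eq, twoPoint_eq, ← integral_add (integrable_twoPoint hm f)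
      (integrable_twoPoint hm g)]
    refine integral_congr_ae (Eventually.of_forall fun p => ?_)
    simp only [map_add, add_apply]
    ring
  · intro c g
    rw [twoPoint_eq, twoPoint_eq, ← integral_smul]
    refine integral_congr_ae (Eventually.of_forall fun p => ?_)
    simp only [map_smul, smul_apply, smul_eq_mul]
    ring

theorem isLinearMap_structHat_two (hm : 0 < m) (hm₀ : 0 < m₀) (hρ : IsSpectralDensity m₀ ρ) :
    IsLinearMap ℂ fun g : TestFn s 2 => structHat m m₀ ρ 2 (minkFourier s 2 g) := by
  have hi := fun g => integrable_spectral_phase (s := s) (m := m) hm₀ hρ (A := 1) measurable_const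
    (D := 1) (fun μ => by simp) 0 g
  have h2 : IsLinearMap ℂ fun g : TestFn s 2 => spectralPart m m₀ ρ 1 0 (minkFourier s 2 g) := by
    constructor
    · intro f g
      rw [spectralPart, spectralPart, spectralPart, ← integral_prod _ (hi _), ← integral_prod _ (hi _),
        ← integral_prod _ (hi _), ← integral_add (hi _) (hi _)]
      refine integral_congr_ae (Eventually.of_forall fun p => ?_)
      simp only [map_add, add_apply]
      ring
    · intro c g
      rw [spectralPart, spectralPart, ← integral_prod _ (hi _), ← integral_prod _ (hi _),
        ← integral_smul]
      refine integral_congr_ae (Eventually.of_forall fun p => ?_)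
      simp only [map_smul, smul_apply, smul_eq_mul]
      ring
  have h1 := isLinearMap_twoPoint (s := s) hm
  constructor
  · intro f g
    simp only [structHat_two_eq]
    rw [h1.map_add, h2.map_add]; ring
  · intro c g
    simp only [structHat_two_eq]
    rw [h1.map_smul, h2.map_smul, smul_add]

theorem isLinearMap_formFactorHat (hs : 2 ≤ s) (hm : 0 < m) (hm₀ : 0 < m₀)
    (hφ : IsCutoff m ε φ) (hρ : IsSpectralDensity m₀ ρ) (n : ℕ) (a : Fin n → Channel) :
    IsLinearMap ℂ fun g : TestFn s n => formFactorHat m m₀ ρ n a (minkFourier s n g) := by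
  match n with
  | 0 => exact ⟨fun f g => (add_zero (0 : ℂ)).symm, fun c g => (smul_zero c).symm⟩
  | 1 => exact ⟨fun f g => (add_zero (0 : ℂ)).symm, fun c g => (smul_zero c).symm⟩
  | 2 =>
    simp only [formFactorHat]
    split_ifs
    · exact isLinearMap_structHat_two hm hm₀ hρ
    · exact isLinearMap_twoPoint hm
  | n + 3 =>
    have h := fun j => isLinearMap_shellTerm hs hm hφ (n := n + 3) (by omega) j (a j)
    constructor
    · intro f g
      simp only [formFactorHat, (h _).map_add, Finset.sum_add_distrib]
    · intro c g
      simp only [formFactorHat, (h _).map_smul, Finset.smul_sum]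

theorem structHat_eq_formFactorHat (n : ℕ) (f : TestFn s n) :
    structHat m m₀ ρ n f = formFactorHat m m₀ ρ n (fun _ => Channel.loc) f := by
  match n with
  | 0 => rfl
  | 1 => rfl
  | 2 => simp only [formFactorHat]; simp
  | n + 3 => rfl

theorem schwartzNorm_le_of_forall {K L : ℕ} (f : TestFn s n) {C : ℝ}
    (h : ∀ (w : Derivs s n K) (x : MinkN s n), weightedDeriv L f w x ≤ C) :
    schwartzNorm s n K L f ≤ C := by
  have : Nonempty (Derivs s n K) := ⟨⟨⟨0, Fin.elim0⟩, by simp⟩⟩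
  exact ciSup_le fun p => h p.1 p.2

theorem schwartzNorm_mono {K K' : ℕ} (hK : K ≤ K') (L : ℕ) (f : TestFn s n) :
    schwartzNorm s n K L f ≤ schwartzNorm s n K' L f :=
  schwartzNorm_le_of_forall f fun w x =>
    le_ciSup (weightedDeriv_bdd K' L f) (⟨w.1, fun l => (w.2 l).trans hK⟩, x)

/-- The norms `‖·‖_{K,L}` are continuous in the Schwartz topology. -/
theorem schwartzNorm_le (K L : ℕ) (f : TestFn s n) : schwartzNorm s n K L f ≤
    2 ^ (n * L) * ((Finset.Iic (n * L, n * K)).sup (schwartzSeminormFamily ℝ (MinkN s n) ℂ)) f := by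
  refine schwartzNorm_le_of_forall f fun w x => ?_
  have h1 := SchwartzMap.one_add_le_sup_seminorm_apply (𝕜 := ℝ) (m := (n * L, n * K))
    (k := n * L) (n := w.1.1) le_rfl (card_le_of_derivs w) f x
  refine le_trans ?_ h1
  simp only [weightedDeriv]
  have h2 : ∏ l, Real.sqrt (1 + ‖x l‖ ^ 2) ^ L ≤ (1 + ‖x‖) ^ (n * L) := by
    calc ∏ l, Real.sqrt (1 + ‖x l‖ ^ 2) ^ L ≤ ∏ _l : Fin n, (1 + ‖x‖) ^ L := by
          refine Finset.prod_le_prod (fun _ _ => by positivity) fun l _ => ?_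
          gcongr
          rw [Real.sqrt_le_left (by positivity)]
          have := PiLp.norm_apply_le x l
          nlinarith [norm_nonneg (x l), norm_nonneg x]
      _ = (1 + ‖x‖) ^ (n * L) := by simp [← pow_mul, mul_comm]
  have h3 : ‖iteratedFDeriv ℝ w.1.1 f x (fun i =>
      PiLp.single 2 (w.1.2 i).1 (EuclideanSpace.single (w.1.2 i).2 (1 : ℝ)))‖
      ≤ ‖iteratedFDeriv ℝ w.1.1 f x‖ := by
    refine le_trans (ContinuousMultilinearMap.le_opNorm _ _) ?_
    simp
  gcongr

/-- A bound for `F^G` in each degree by a norm `‖·‖_{K,L}` with `K`, `L` independent of the degree. -/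
theorem exists_norm_formFactorHat_le (hs : 2 ≤ s) (hm : 0 < m) (hm₀ : 0 < m₀)
    (hφ : IsCutoff m ε φ) (hρ : IsSpectralDensity m₀ ρ) : ∃ K : ℕ, ∀ n, ∃ C : ℝ, 0 ≤ C ∧
      ∀ (a : Fin n → Channel) (g : TestFn s n),
        ‖formFactorHat m m₀ ρ n a (minkFourier s n g)‖ ≤ C * schwartzNorm s n K (s + 2) g := by
  obtain ⟨N, C₂, hN, hC₂, h2⟩ := exists_norm_structHat_two_le (s := s) hm hm₀ hρ
  obtain ⟨C₁, hC₁, h1⟩ := exists_norm_twoPoint_le s hm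
  have hmono : ∀ {n} (g : TestFn s n), schwartzNorm s n (2 * (s + 3)) (s + 2) g
      ≤ schwartzNorm s n (2 * N) (s + 2) g := fun g => schwartzNorm_mono (by omega) _ g
  refine ⟨2 * N, fun n => ?_⟩
  match n with
  | 0 => exact ⟨0, le_rfl, fun a g => by simp [formFactorHat]⟩
  | 1 => exact ⟨0, le_rfl, fun a g => by simp [formFactorHat]⟩
  | 2 =>
    refine ⟨C₁ + 2 * C₂, by positivity, fun a g => ?_⟩
    have h0 := hmono g
    have hnn : 0 ≤ schwartzNorm s 2 (2 * (s + 3)) (s + 2) g := apply_nonneg _ _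
    simp only [formFactorHat]
    split_ifs
    · refine (h2 g).trans ?_
      nlinarith
    · refine (h1 g).trans ?_
      nlinarith
  | n + 3 =>
    choose C hC h using fun j => exists_shellTerm_limits hs hm hφ (n := n + 3) (by omega) j
    refine ⟨∑ j, C j, Finset.sum_nonneg fun j _ => hC j, fun a g => ?_⟩
    simp only [formFactorHat]
    refine (norm_sum_le _ _).trans ?_
    rw [Finset.sum_mul]
    refine Finset.sum_le_sum fun j _ => ((h j g).2.1 (a j)).trans ?_
    exact mul_le_mul_of_nonneg_left (hmono g) (hC j)

end Linear

/-! ### Continuity for the direct sum topologies -/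

section Topologies

/-- A linear functional that is continuous on each summand is continuous: the topology induced by the
functional is one of those of which the direct sum topology is the infimum. -/
theorem continuous_directSumTopology {X : ℕ → Type} [∀ n, AddCommGroup (X n)]
    [∀ n, Module ℝ (X n)] (τ : ∀ n, TopologicalSpace (X n)) (L : (⨁ n, X n) →ₗ[ℝ] ℂ)
    (h : ∀ n, @Continuous (X n) ℂ (τ n) _ fun x => L (DirectSum.of X n x)) :
    @Continuous (⨁ n, X n) ℂ (directSumTopology X τ) _ L := by
  rw [continuous_iff_le_induced]
  refine sInf_le ⟨fun n => ?_, ?_, ?_, ?_⟩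
  · let _ := τ n
    exact continuous_induced_rng.2 (h n)
  · exact topologicalAddGroup_induced L
  · exact continuousSMul_induced L
  · exact LocallyConvexSpace.induced L

theorem continuous_sum_apply {ι Y : Type} [Fintype ι] (t : TopologicalSpace Y) {T : ι → Y → ℂ}
    (h : ∀ i, @Continuous Y ℂ t _ (T i)) :
    @Continuous (ι → Y) ℂ (@Pi.topologicalSpace ι (fun _ => Y) fun _ => t) _
      fun f => ∑ i, T i (f i) :=
  continuous_finsetSum _ fun i _ => (h i).comp (continuous_apply i)

variable {s n : ℕ}

theorem continuous_normTopology {K L : ℕ} {T : TestFn s n → ℂ} (hT : IsLinearMap ℂ T) {C : ℝ}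
    (hC : ∀ g, ‖T g‖ ≤ C * schwartzNorm s n K L g) :
    @Continuous (TestFn s n) ℂ (normTopology s n K L) _ T := by
  let _ := (schwartzNorm s n K L).toSeminormedAddCommGroup
  exact AddMonoidHomClass.continuous_of_bound (hT.mk' T).toAddMonoidHom C hC

theorem continuous_schwartz {K L : ℕ} {T : TestFn s n → ℂ} (hT : IsLinearMap ℂ T) {C : ℝ}
    (hC0 : 0 ≤ C) (hC : ∀ g, ‖T g‖ ≤ C * schwartzNorm s n K L g) : Continuous T := by
  refine (SchwartzMap.mkCLMtoNormedSpace (𝕜 := ℝ) (σ := RingHom.id ℝ) T hT.map_add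
    (fun c f => ?_) ⟨Finset.Iic (n * L, n * K), C * 2 ^ (n * L), by positivity, fun f => ?_⟩).continuous
  · have := hT.map_smul (c : ℂ) f
    rw [RingHom.id_apply, Complex.real_smul, ← smul_eq_mul, ← this]
    congr 1
  · rw [mul_assoc]
    exact (hC f).trans (mul_le_mul_of_nonneg_left (schwartzNorm_le K L f) hC0)

end Topologies

/-! ### Iterated limits -/

section Iterated

variable {ι : Type} [DecidableEq ι]

theorem iteratedLim_of_eq (order : List ι) {Φ : (ι → ℝ) → ℂ} {c : ℂ} (h : ∀ t, Φ t = c) :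
    IteratedLim order Φ c := by
  induction order generalizing Φ with
  | nil => exact h
  | cons i is ih =>
    refine ⟨fun _ => c, fun t => ?_, ih fun _ => rfl⟩
    simp only [h]
    exact tendsto_const_nhds

theorem IteratedLim.add {order : List ι} {Φ Ψ : (ι → ℝ) → ℂ} {c d : ℂ}
    (h : IteratedLim order Φ c) (h' : IteratedLim order Ψ d) :
    IteratedLim order (fun t => Φ t + Ψ t) (c + d) := by
  induction order generalizing Φ Ψ with
  | nil => exact fun t => congrArg₂ (· + ·) (h t) (h' t)
  | cons i is ih =>
    obtain ⟨Φ', h1, h2⟩ := h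
    obtain ⟨Ψ', h1', h2'⟩ := h'
    exact ⟨fun t => Φ' t + Ψ' t, fun t => (h1 t).add (h1' t), ih h2 h2'⟩

theorem iteratedLim_sum {κ : Type} (S : Finset κ) {order : List ι} {Φ : κ → (ι → ℝ) → ℂ}
    {c : κ → ℂ} (h : ∀ x ∈ S, IteratedLim order (Φ x) (c x)) :
    IteratedLim order (fun t => ∑ x ∈ S, Φ x t) (∑ x ∈ S, c x) := by
  classical
  induction S using Finset.induction_on with
  | empty => simpa using iteratedLim_of_eq order fun _ => rfl
  | insert x S hx ih =>
    simp only [Finset.sum_insert hx]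
    exact (h x (Finset.mem_insert_self x S)).add
      (ih fun y hy => h y (Finset.mem_insert_of_mem hy))

/-- If, for each parameter, the function either does not depend on the parameter or converges
to `c` as this single parameter tends to infinity, the first parameter of the second kind already
gives the value `c`. -/
theorem iteratedLim_of_single {order : List ι} {Φ : (ι → ℝ) → ℂ} {c : ℂ}
    (h : ∀ i, (∀ t τ, Φ (Function.update t i τ) = Φ t) ∨
      ∀ t, Tendsto (fun τ => Φ (Function.update t i τ)) atTop (𝓝 c))
    (h' : ∃ i ∈ order, ∀ t, Tendsto (fun τ => Φ (Function.update t i τ)) atTop (𝓝 c)) :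
    IteratedLim order Φ c := by
  induction order with
  | nil => simp at h'
  | cons i is ih =>
    by_cases hi : ∀ t, Tendsto (fun τ => Φ (Function.update t i τ)) atTop (𝓝 c)
    · exact ⟨fun _ => c, hi, iteratedLim_of_eq is fun _ => rfl⟩
    · have h1 := (h i).resolve_right hi
      refine ⟨Φ, fun t => ?_, ih ?_⟩
      · simp only [h1]
        exact tendsto_const_nhds
      · obtain ⟨k, hk, hk'⟩ := h'
        rcases List.mem_cons.1 hk with rfl | hk
        · exact absurd hk' hi
        · exact ⟨k, hk, hk'⟩

end Iterated

/-! ### The time limits in each degree -/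

section Assembly

variable {s : ℕ} {m m₀ ε : ℝ} {φ ρ : ℝ → ℝ} [DecidableEq (Σ n : ℕ, Fin n)]

theorem update_slice_of_ne {n : ℕ} (t : TimeParam) {i : Σ n : ℕ, Fin n} (hi : i.1 ≠ n) (τ : ℝ) :
    (fun l : Fin n => Function.update t i τ ⟨n, l⟩) = fun l => t ⟨n, l⟩ := by
  funext l
  exact Function.update_of_ne (fun h => hi (congrArg Sigma.fst h).symm) _ _

theorem update_slice {n : ℕ} (t : TimeParam) (l₀ : Fin n) (τ : ℝ) :
    (fun l : Fin n => Function.update t ⟨n, l₀⟩ τ ⟨n, l⟩)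
      = Function.update (fun l => t ⟨n, l⟩) l₀ τ := by
  funext l
  by_cases h : l = l₀
  · subst h; simp
  · rw [Function.update_of_ne h, Function.update_of_ne]
    simpa using h

/-- The iterated limits in a single degree and for a single choice of channels. -/
theorem iteratedLim_structHat (hs : 2 ≤ s) (hm : 0 < m) (hm₀ : 0 < m₀)
    (hφ : IsCutoff m ε φ) (hρ : IsSpectralDensity m₀ ρ) {order : List (Σ n : ℕ, Fin n)} (n : ℕ)
    (hn : ∀ l : Fin n, (⟨n, l⟩ : Σ n : ℕ, Fin n) ∈ order) (f : TestFnExt s n)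
    (a : Fin n → Channel) :
    IteratedLim order (fun t : TimeParam => structHat m m₀ ρ n
      (minkFourier s n (omegaN m φ n (fun l => t ⟨n, l⟩) f a)))
      (formFactorHat m m₀ ρ n a (minkFourier s n (f a))) := by
  match n with
  | 0 => exact iteratedLim_of_eq order fun t => rfl
  | 1 => exact iteratedLim_of_eq order fun t => rfl
  | 2 =>
    have hf := fun t k => minkFourier_omegaN hm hφ t f a k
    by_cases ha : a 0 = Channel.loc ∧ a 1 = Channel.loc
    · exact iteratedLim_of_eq order fun t => structHat_two_of_loc ha _ _ _ (hf _)
    · have hlim := structHat_two_limits hm hm₀ hφ hρ a (f a)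
        (fun t => minkFourier s 2 (omegaN m φ 2 t f a)) hf
      have hex : ∃ i : Fin 2, a i ≠ Channel.loc := by
        by_contra! h
        exact ha ⟨h 0, h 1⟩
      refine iteratedLim_of_single (fun i => ?_) ?_
      · obtain ⟨n', l⟩ := i
        by_cases hn' : n' = 2
        · subst hn'
          simp only [update_slice]
          rcases hlim l with h | h
          · exact Or.inl fun t τ => h.2 _ τ
          · exact Or.inr fun t => h.2 _
        · left
          intro t τ
          rw [update_slice_of_ne t hn']
      · obtain ⟨i, hi⟩ := hex
        refine ⟨⟨2, i⟩, hn i, fun t => ?_⟩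
        simp only [update_slice]
        rcases hlim i with h | h
        · exact absurd h.1 hi
        · exact h.2 _
  | n + 3 =>
    refine iteratedLim_sum Finset.univ fun j _ => ?_
    obtain ⟨C, -, h⟩ := exists_shellTerm_limits hs hm hφ (n := n + 3) (by omega) j
    obtain ⟨-, -, Rt, -, hRt, hlim⟩ := h (f a)
    have hterm : ∀ t : TimeParam, shellTerm m j Channel.loc
        (minkFourier s (n + 3) (omegaN m φ (n + 3) (fun l => t ⟨n + 3, l⟩) f a))
        = Rt (a j) (t ⟨n + 3, j⟩) := fun t =>
      (hlim _ a _ fun k => minkFourier_omegaN hm hφ _ f a k).limUnder_eq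
    simp only [hterm]
    have hj : ∀ t : TimeParam, Tendsto (fun τ => Rt (a j) (Function.update t ⟨n + 3, j⟩ τ ⟨n + 3, j⟩))
        atTop (𝓝 (shellTerm m j (a j) (minkFourier s (n + 3) (f a)))) := fun t => by
      simpa using hRt (a j)
    refine iteratedLim_of_single (fun i => ?_) ⟨_, hn j, hj⟩
    by_cases hi : i = ⟨n + 3, j⟩
    · subst hi
      exact Or.inr hj
    · left
      intro t τ
      rw [Function.update_of_ne (Ne.symm hi)]

end Assembly

/-! ### The functionals on the direct sums -/

section Functionals

variable {s : ℕ} {m m₀ ε : ℝ} {φ ρ : ℝ → ℝ}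

theorem isLinearMap_structHat (hs : 2 ≤ s) (hm : 0 < m) (hm₀ : 0 < m₀)
    (hφ : IsCutoff m ε φ) (hρ : IsSpectralDensity m₀ ρ) (n : ℕ) :
    IsLinearMap ℂ fun g : TestFn s n => structHat m m₀ ρ n (minkFourier s n g) := by
  simp only [structHat_eq_formFactorHat]
  exact isLinearMap_formFactorHat hs hm hm₀ hφ hρ n _

theorem isLinearMap_formFactorSum (hs : 2 ≤ s) (hm : 0 < m) (hm₀ : 0 < m₀)
    (hφ : IsCutoff m ε φ) (hρ : IsSpectralDensity m₀ ρ) (n : ℕ) :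
    IsLinearMap ℂ fun f : TestFnExt s n => ∑ a, formFactorHat m m₀ ρ n a (minkFourier s n (f a)) := by
  have h := isLinearMap_formFactorHat (s := s) hs hm hm₀ hφ hρ n
  constructor
  · intro f g
    simp only [Pi.add_apply, (h _).map_add, Finset.sum_add_distrib]
  · intro c f
    simp only [Pi.smul_apply, (h _).map_smul, Finset.smul_sum]

open Classical in
/-- A functional on the direct sum that is given by linear functionals in each degree. -/
theorem toModule_eq_sum {X : ℕ → Type} [∀ n, AddCommGroup (X n)] [∀ n, Module ℂ (X n)]
    {T : ∀ n, X n → ℂ} (hT : ∀ n, IsLinearMap ℂ (T n)) (f : ⨁ n, X n) :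
    DirectSum.toModule ℂ ℕ ℂ (fun n => (hT n).mk' (T n)) f
      = ∑ n ∈ DFinsupp.support f, T n (f n) :=
  DFinsupp.sumAddHom_apply (fun n => ((hT n).mk' (T n)).toAddMonoidHom) f

open Classical in
theorem structFunctional_eq_of_subset (hs : 2 ≤ s) (hm : 0 < m) (hm₀ : 0 < m₀)
    (hφ : IsCutoff m ε φ) (hρ : IsSpectralDensity m₀ ρ) (f : Borchers s) {S : Finset ℕ}
    (hS : ∀ n, f n ≠ 0 → n ∈ S) : structFunctional m m₀ ρ f
      = ∑ n ∈ S, structHat m m₀ ρ n (minkFourier s n (f n)) := by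
  refine Finset.sum_subset (fun n hn => hS n (DFinsupp.mem_support_iff.1 hn)) fun n _ hn => ?_
  rw [DFinsupp.notMem_support_iff.1 hn]
  exact (isLinearMap_structHat hs hm hm₀ hφ hρ n).map_zero

open Classical in
theorem formFactor_eq_of_subset (hs : 2 ≤ s) (hm : 0 < m) (hm₀ : 0 < m₀)
    (hφ : IsCutoff m ε φ) (hρ : IsSpectralDensity m₀ ρ) (f : BorchersExt s) {S : Finset ℕ}
    (hS : ∀ n, f n ≠ 0 → n ∈ S) : formFactor m m₀ ρ f
      = ∑ n ∈ S, ∑ a, formFactorHat m m₀ ρ n a (minkFourier s n (f n a)) := by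
  refine Finset.sum_subset (fun n hn => hS n (DFinsupp.mem_support_iff.1 hn)) fun n _ hn => ?_
  rw [DFinsupp.notMem_support_iff.1 hn]
  exact (isLinearMap_formFactorSum hs hm hm₀ hφ hρ n).map_zero

theorem waveOp_apply (t : TimeParam) (f : BorchersExt s) (n : ℕ) :
    waveOp m φ t f n = ∑ a, omegaN m φ n (fun l => t ⟨n, l⟩) (f n) a := by
  have : waveOp m φ t f n = projN s n (omegaN m φ n (fun l => t ⟨n, l⟩) (f n)) := rfl
  rw [this, projN, LinearMap.sum_apply]
  rfl

open Classical in
theorem structFunctional_waveOp (hs : 2 ≤ s) (hm : 0 < m) (hm₀ : 0 < m₀)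
    (hφ : IsCutoff m ε φ) (hρ : IsSpectralDensity m₀ ρ) (t : TimeParam) (f : BorchersExt s) :
    structFunctional m m₀ ρ (waveOp m φ t f) = ∑ n ∈ DFinsupp.support f, ∑ a,
      structHat m m₀ ρ n (minkFourier s n (omegaN m φ n (fun l => t ⟨n, l⟩) (f n) a)) := by
  rw [structFunctional_eq_of_subset hs hm hm₀ hφ hρ _ (S := DFinsupp.support f)]
  · refine Finset.sum_congr rfl fun n _ => ?_
    rw [waveOp_apply]
    exact map_sum ((isLinearMap_structHat hs hm hm₀ hφ hρ n).mk' _) _ _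
  · intro n hn
    rw [DFinsupp.mem_support_iff]
    intro h0
    refine hn ?_
    rw [waveOp_apply, h0]
    simp

theorem isContinuousFunctional_structFunctional (hs : 2 ≤ s) (hm : 0 < m) (hm₀ : 0 < m₀)
    (hφ : IsCutoff m ε φ) (hρ : IsSpectralDensity m₀ ρ) :
    IsContinuousFunctional (structFunctional (s := s) m m₀ ρ) := by
  have hT := fun n => isLinearMap_structHat (s := s) hs hm hm₀ hφ hρ n
  have heq : structFunctional (s := s) m m₀ ρ
      = DirectSum.toModule ℂ ℕ ℂ (fun n => (hT n).mk' _) := by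
    funext f
    exact (toModule_eq_sum hT f).symm
  rw [heq]
  refine ⟨LinearMap.isLinear _, ?_⟩
  refine continuous_directSumTopology _ ((DirectSum.toModule ℂ ℕ ℂ
    (fun n => (hT n).mk' _)).restrictScalars ℝ) fun n => ?_
  obtain ⟨K, hK⟩ := exists_norm_formFactorHat_le (s := s) hs hm hm₀ hφ hρ
  obtain ⟨C, hC0, hC⟩ := hK n
  have h1 : Continuous fun g : TestFn s n => structHat m m₀ ρ n (minkFourier s n g) :=
    continuous_schwartz (hT n) hC0 fun g => by
      rw [structHat_eq_formFactorHat]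
      exact hC _ g
  refine h1.congr fun g => ?_
  exact (DirectSum.toModule_lof (φ := fun n => (hT n).mk' _) ℂ n g).symm

theorem isLinearMap_formFactor (hs : 2 ≤ s) (hm : 0 < m) (hm₀ : 0 < m₀)
    (hφ : IsCutoff m ε φ) (hρ : IsSpectralDensity m₀ ρ) : ∃ L : BorchersExt s →ₗ[ℂ] ℂ,
      formFactor m m₀ ρ = L ∧ ∀ n f, L (DirectSum.of (fun n => TestFnExt s n) n f)
        = ∑ a, formFactorHat m m₀ ρ n a (minkFourier s n (f a)) := by
  have hT := fun n => isLinearMap_formFactorSum (s := s) hs hm hm₀ hφ hρ n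
  refine ⟨DirectSum.toModule ℂ ℕ ℂ (fun n => (hT n).mk' _), ?_, fun n f => ?_⟩
  · funext f
    refine Eq.trans ?_ (toModule_eq_sum hT f).symm
    unfold formFactor
    congr!
  · exact DirectSum.toModule_lof (φ := fun n => (hT n).mk' _) ℂ n f

theorem isContinuousFunctional_formFactor (hs : 2 ≤ s) (hm : 0 < m) (hm₀ : 0 < m₀)
    (hφ : IsCutoff m ε φ) (hρ : IsSpectralDensity m₀ ρ) :
    IsContinuousFunctional (formFactor (s := s) m m₀ ρ) := by
  obtain ⟨L, hL, hLn⟩ := isLinearMap_formFactor (s := s) hs hm hm₀ hφ hρ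
  rw [hL]
  refine ⟨L.isLinear, continuous_directSumTopology _ (L.restrictScalars ℝ) fun n => ?_⟩
  obtain ⟨K, hK⟩ := exists_norm_formFactorHat_le (s := s) hs hm hm₀ hφ hρ
  obtain ⟨C, hC0, hC⟩ := hK n
  refine (continuous_sum_apply inferInstance (T := fun (a : Fin n → Channel) (g : TestFn s n) =>
    formFactorHat m m₀ ρ n a (minkFourier s n g)) fun a => ?_).congr fun f => (hLn n f).symm
  exact continuous_schwartz (isLinearMap_formFactorHat hs hm hm₀ hφ hρ n a) hC0 (hC a)

theorem continuous_gamma_formFactor (hs : 2 ≤ s) (hm : 0 < m) (hm₀ : 0 < m₀)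
    (hφ : IsCutoff m ε φ) (hρ : IsSpectralDensity m₀ ρ) :
    @Continuous (BorchersExt s) ℂ (gammaTopology s) _ (formFactor m m₀ ρ) := by
  obtain ⟨L, hL, hLn⟩ := isLinearMap_formFactor (s := s) hs hm hm₀ hφ hρ
  obtain ⟨K, hK⟩ := exists_norm_formFactorHat_le (s := s) hs hm hm₀ hφ hρ
  rw [hL]
  refine continuous_le_dom ((iInf_le _ K).trans (iInf_le _ (s + 2))) ?_
  refine continuous_directSumTopology _ (L.restrictScalars ℝ) fun n => ?_
  obtain ⟨C, hC0, hC⟩ := hK n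
  have h1 := continuous_sum_apply (normTopology s n K (s + 2))
    (T := fun (a : Fin n → Channel) (g : TestFn s n) =>
      formFactorHat m m₀ ρ n a (minkFourier s n g)) fun a =>
    continuous_normTopology (isLinearMap_formFactorHat hs hm hm₀ hφ hρ n a) (hC a)
  have h2 : (fun f : TestFnExt s n => (L.restrictScalars ℝ) (DirectSum.of (fun n => TestFnExt s n) n f))
      = fun f => ∑ a, formFactorHat m m₀ ρ n a (minkFourier s n (f a)) := funext (hLn n)
  rw [h2]
  exact h1

theorem isPoincareInvariant_formFactor (hs : 2 ≤ s) (hm : 0 < m) (hm₀ : 0 < m₀)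
    (hφ : IsCutoff m ε φ) (hρ : IsSpectralDensity m₀ ρ) :
    IsPoincareInvariant (formFactor (s := s) m m₀ ρ) := by
  classical
  intro Λ a f hΛ
  have h1 : ∀ n b, poincareActExt Λ a f n b = poincareAct n Λ a (f n b) := fun n b => rfl
  rw [formFactor_eq_of_subset hs hm hm₀ hφ hρ (poincareActExt Λ a f) (S := DFinsupp.support f),
    formFactor_eq_of_subset hs hm hm₀ hφ hρ f (S := DFinsupp.support f)]
  · refine Finset.sum_congr rfl fun n _ => Finset.sum_congr rfl fun b _ => ?_
    rw [h1, formFactorHat_poincareAct hΛ hm hm₀]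
  · exact fun n hn => DFinsupp.mem_support_iff.2 hn
  · intro n hn
    rw [DFinsupp.mem_support_iff]
    intro h0
    refine hn (funext fun b => ?_)
    rw [h1, h0]
    simp

theorem isFormFactorFunctional (hs : 2 ≤ s) (hm : 0 < m) (hm₀ : 0 < m₀)
    (hφ : IsCutoff m ε φ) (hρ : IsSpectralDensity m₀ ρ) :
    IsFormFactorFunctional m φ (structFunctional (s := s) m m₀ ρ) (formFactor m m₀ ρ) := by
  refine ⟨isContinuousFunctional_structFunctional hs hm hm₀ hφ hρ,
    isContinuousFunctional_formFactor hs hm hm₀ hφ hρ, fun f order _ horder => ?_⟩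
  simp only [structFunctional_waveOp hs hm hm₀ hφ hρ]
  refine iteratedLim_sum _ fun n hn => iteratedLim_sum _ fun a _ => ?_
  exact iteratedLim_structHat hs hm hm₀ hφ hρ n (horder n hn) (f n) a

theorem exists_tendsto_regTerm (hs : 2 ≤ s) (hm : 0 < m) (hφ : IsCutoff m ε φ) {n : ℕ}
    (hn : 3 ≤ n) (j : Fin n) (a : Channel) (f : TestFn s n) :
    ∃ c : ℂ, Tendsto (regTerm m j a f) (𝓝[>] 0) (𝓝 c) := by
  obtain ⟨C, -, h⟩ := exists_shellTerm_limits hs hm hφ hn j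
  have := (h (minkFourierInv s n f)).1 a
  rw [minkFourier_minkFourierInv] at this
  exact ⟨_, this⟩

end Functionals

end IndefMetricQFT

open IndefMetricQFT in
theorem proposition4p7 {s : ℕ} (hs : 2 ≤ s) {m m₀ ε : ℝ} (hm : 0 < m) (hm₀ : 0 < m₀)
    {φ : ℝ → ℝ} (hφ : IsCutoff m ε φ) {ρ : ℝ → ℝ} (hρ : IsSpectralDensity m₀ ρ) :
    (∀ (n : ℕ) (j : Fin n) (a : Channel) (f : TestFn s n), 3 ≤ n →
      ∃ c : ℂ, Filter.Tendsto (regTerm m j a f) (𝓝[>] (0 : ℝ)) (𝓝 c)) ∧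
    IsFormFactorFunctional m φ (structFunctional (s := s) m m₀ ρ) (formFactor m m₀ ρ) ∧
    IsPoincareInvariant (formFactor (s := s) m m₀ ρ) ∧
    @Continuous (BorchersExt s) ℂ (gammaTopology s) _ (formFactor m m₀ ρ) := by
  exact ⟨fun n j a f hn => exists_tendsto_regTerm hs hm hφ hn j a f,
    isFormFactorFunctional hs hm hm₀ hφ hρ, isPoincareInvariant_formFactor hs hm hm₀ hφ hρ,
    continuous_gamma_formFactor hs hm hm₀ hφ hρ⟩
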